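/- **Conventions.** All inverse semigroups carry the natural partial order ($s\le t$ iff $s=te$ with $e$ idempotent), $s^\dagger$ is the inverse of $s$ and $\mathcal E(S)$ the set of idempotents; $s,t$ are orthogonal if $s^\dagger t=0=ts^\dagger$. A *Cartan inverse monoid* is an inverse monoid $S$ with $0$ such that: $\mathcal E(S)$ is a Boolean algebra in the natural order; any two elements of $S$ have a meet; every pairwise orthogonal family (in particular every orthogonal pair) has a join; $S$ is fundamental, i.e. $ses^\dagger=tet^\dagger$ for all $e\in\mathcal E(S)$ implies $s=t$; and the character (Stone) space $X_S$ of the Boolean algebra $\mathcal E(S)$ is hyperstonean (compact Hausdorff, extremally disconnected, with sufficiently many positive normal functionals on $C(X_S,\mathbb R)$). Put $\mathcal D=C(X_S)$, let $\mathcal P$ be the inverse monoid of partial isometries of $\mathcal D$, and let $\chi_e\in\mathcal P$ be the indicator function of $\{\rho:\rho(e)=1\}$ for $e\in\mathcal E(S)$. For $s\in S$ and $p\in\mathcal P$ let $s^\dagger p s\in\mathcal P$ be the function with $(s^\dagger ps)(\rho)=p(\beta_s(\rho))$, $\beta_s(\rho)(e)=\rho(s^\dagger es)$, if $\rho(s^\dagger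 s)=1$, and $(s^\dagger ps)(\rho)=0$ otherwise. An *extension* $\mathcal P\overset{\iota}{\hookrightarrow}\mathcal G\overset{q}{\to}S$ of a Cartan inverse monoid $S$ consists of an inverse semigroup $\mathcal G$, an injective homomorphism $\iota$ and a surjective homomorphism $q$ such that: $q(g)$ is idempotent iff $g\in\iota(\mathcal P)$; $q\circ\iota$ is injective on $\mathcal E(\mathcal P)$ and is the natural identification of $\mathcal E(\mathcal P)$ with $\mathcal E(S)$, $q(\iota(\chi_e))=e$; and conjugation in $\mathcal G$ induces the natural action of $S$ on $\mathcal P$, i.e. $g^\dagger\iota(p)g=\iota\big(q(g)^\dagger\,p\,q(g)\big)$ for $g\in\mathcal G$, $p\in\mathcal P$. Extensions $(\iota_1,\mathcal G_1,q_1)$ of $S_1$ and $(\iota_2,\mathcal G_2,q_2)$ of $S_2$ are *equivalent* if there are isomorphisms $\theta:S_1\to S_2$ and $\alpha:\mathcal G_1\to\mathcal G_2$ with $q_2\circ\alpha=\theta\circ q_1$ and $\iota_2\circ\underline\theta=\alpha\circ\iota_1$, where $\underline\theta:\mathcal P_1\to\mathcal P_2$ is induced by $\theta$. An *order preserving section*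 is a map $j:S\to\mathcal G$ with $q\circ j=\mathrm{id}$, $j(1)=1$, and $j(s)\le j(t)$ whenever $s\le t$. A *Cartan pair* $(\mathcal M,\mathcal D)$ is a von Neumann algebra $\mathcal M$ with a maximal abelian von Neumann subalgebra $\mathcal D$ such that there is a faithful normal conditional expectation $\mathcal M\to\mathcal D$ and such that the set $\mathcal{GN}(\mathcal M,\mathcal D)$ of *groupoid normalizers* (partial isometries $v\in\mathcal M$ with $v\mathcal Dv^*\subseteq\mathcal D$ and $v^*\mathcal Dv\subseteq\mathcal D$) has weak-$*$ dense span in $\mathcal M$. An isomorphism of Cartan pairs is a $*$-isomorphism $\mathcal M_1\to\mathcal M_2$ that takes $\mathcal D_1$ onto $\mathcal D_2$. The *extension for* $(\mathcal M,\mathcal D)$ is $\mathcal P\hookrightarrow\mathcal G\overset{q}{\to}S$ with $\mathcal G=\mathcal{GN}(\mathcal M,\mathcal D)$, $q$ the quotient map onto $S=\mathcal G/R_M$, where $(v,w)\in R_M$ iff $vev^*=wew^*$ for all projections $e\in\mathcal D$, and $\mathcal P$ the partial isometries of $\mathcal D$, where $\mathcal D$ is identified with $C(X_S)$ by the $*$-isomorphism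 that takes each projection $e\in\mathcal D$ to $\chi_{q(e)}$. **Construction.** Let $\mathcal P\overset{\iota}{\hookrightarrow}\mathcal G\overset{q}{\to}S$ be an extension of a Cartan inverse monoid, $j$ an order preserving section, and $\pi$ a faithful normal unital representation of $\mathcal D=C(X_S)$ on a Hilbert space $\mathcal H$. Put $K(t,s)=\chi_{s^\dagger t\wedge1}$, let $\mathfrak A$ be the reproducing kernel right Hilbert $\mathcal D$-module of $K$, with kernel functions $k_s$ ($s\in S$), and let $\mathfrak A\otimes_\pi\mathcal H$ be the interior tensor product; it is the Hilbert space densely spanned by the $k_s\otimes\xi$, with $\langle k_s\otimes\xi,k_t\otimes\eta\rangle=\langle\xi,\pi(K(s,t))\eta\rangle$ (inner products linear in the second variable). For $v\in\mathcal G$ and $s\in S$ let $\sigma(v,s)\in\mathcal P$ be given by $\iota(\sigma(v,s))=j(q(v)s)^\dagger\,v\,j(s)$, and let $\lambda_\pi(v)$ be the partial isometry of $\mathfrak A\otimes_\pi\mathcal H$ with $\lambda_\pi(v)(k_s\otimes\xi)=k_{q(v)s}\otimes\pi(\sigma(v,s))\xi$. Put $\mathcal M_q=\lambda_\pi(\mathcal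 G)''$ and $\mathcal D_q=\lambda_\pi(\mathcal E(\mathcal G))''$. **Theorem.** (a) $(\mathcal M_q,\mathcal D_q)$ is a Cartan pair; $\lambda_\pi(\mathcal G)=\mathcal{GN}(\mathcal M_q,\mathcal D_q)$; the quotient of $\mathcal{GN}(\mathcal M_q,\mathcal D_q)$ by $R_M$ is a Cartan inverse monoid; and the extension for $(\mathcal M_q,\mathcal D_q)$ is equivalent to $\mathcal P\hookrightarrow\mathcal G\overset{q}{\to}S$. (b) If two extensions of Cartan inverse monoids are equivalent, then the Cartan pairs constructed from them are isomorphic, for all choices of the representations $\pi$ and of the order preserving sections $j$. In particular, the isomorphism class of $(\mathcal M_q,\mathcal D_q)$ depends only on the equivalence class of the extension, and not on $\pi$ or $j$. (c) For every Cartan pair, the extension for it exists and is an extension of a Cartan inverse monoid; for every extension of a Cartan inverse monoid $S$ there are an order preserving section $j$ and a faithful normal representation $\pi$ of $C(X_S)$. Sending a Cartan pair to the extension for it induces a bijection from the isomorphism classes of Cartan pairs onto the equivalence classes of extensions of Cartan inverse monoids, and the inverse of this bijection sends the class of an extension to the class of $(\mathcal M_q,\mathcal D_q)$, for all $j$ and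 $\pi$. -/

import Mathlib

namespace CartanExt

/-- An inverse semigroup: every `s` has a unique `t` with `s t s = s` and `t s t = t`. -/
class IsInverseSemigroup (S : Type*) [Semigroup S] : Prop where
  existsUnique_inverse : ∀ s : S, ∃! t : S, s * t * s = s ∧ t * s * t = t

section
variable {S : Type*} [Semigroup S]

theorem isInverseSemigroup_of_commute
    (h₁ : ∀ s : S, ∃ t, s * t * s = s ∧ t * s * t = t)
    (h₂ : ∀ e f : S, IsIdempotentElem e → IsIdempotentElem f → e * f = f * e) :
    IsInverseSemigroup S := by
  refine ⟨fun s => ?_⟩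
  obtain ⟨t, ht, ht'⟩ := h₁ s
  refine ⟨t, ⟨ht, ht'⟩, ?_⟩
  rintro x ⟨hx, hx'⟩
  have a1 : IsIdempotentElem (s * t) := by unfold IsIdempotentElem; grind
  have a2 : IsIdempotentElem (t * s) := by unfold IsIdempotentElem; grind
  have b1 : IsIdempotentElem (s * x) := by unfold IsIdempotentElem; grind
  have b2 : IsIdempotentElem (x * s) := by unfold IsIdempotentElem; grind
  have c1 := h₂ _ _ a1 b1
  have c2 := h₂ _ _ a2 b2
  have : x = t * s * x := by grind
  grind

variable [IsInverseSemigroup S]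

/-- The inverse `s†` of an element of an inverse semigroup. -/
noncomputable def dag (s : S) : S :=
  (IsInverseSemigroup.existsUnique_inverse s).choose

theorem mul_dag_mul (s : S) : s * dag s * s = s :=
  (IsInverseSemigroup.existsUnique_inverse s).choose_spec.1.1

theorem dag_mul_dag (s : S) : dag s * s * dag s = dag s :=
  (IsInverseSemigroup.existsUnique_inverse s).choose_spec.1.2

theorem dag_eq {s t : S} (h₁ : s * t * s = s) (h₂ : t * s * t = t) : dag s = t :=
  ((IsInverseSemigroup.existsUnique_inverse s).choose_spec.2 t ⟨h₁, h₂⟩).symm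

theorem dag_dag (s : S) : dag (dag s) = s := dag_eq (dag_mul_dag s) (mul_dag_mul s)

theorem dag_idem {e : S} (he : IsIdempotentElem e) : dag e = e :=
  dag_eq (by rw [he.eq, he.eq]) (by rw [he.eq, he.eq])

theorem idem_mul_aux {e f : S} (he : IsIdempotentElem e) (hf : IsIdempotentElem f) :
    IsIdempotentElem (e * f) := by
  have h1 := mul_dag_mul (e * f)
  have h2 := dag_mul_dag (e * f)
  unfold IsIdempotentElem at he hf
  have h3 : dag (e * f) = f * dag (e * f) * e := by
    apply dag_eq
    · grind
    · grind
  have h4 : IsIdempotentElem (dag (e * f)) := by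
    unfold IsIdempotentElem
    grind
  have h5 := dag_idem h4
  rw [dag_dag] at h5
  rwa [← h5] at h4

theorem idem_comm {e f : S} (he : IsIdempotentElem e) (hf : IsIdempotentElem f) :
    e * f = f * e := by
  have h1 := idem_mul_aux he hf
  have h2 := idem_mul_aux hf he
  rw [← dag_idem h1]
  unfold IsIdempotentElem at *
  apply dag_eq <;> grind

theorem idem_dag_mul (s : S) : IsIdempotentElem (dag s * s) := by
  have := mul_dag_mul s
  unfold IsIdempotentElem; grind

theorem idem_mul_dag (s : S) : IsIdempotentElem (s * dag s) := by
  have := mul_dag_mul s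
  unfold IsIdempotentElem; grind

theorem dag_mul (s t : S) : dag (s * t) = dag t * dag s := by
  have h := idem_comm (idem_dag_mul s) (idem_mul_dag t)
  have := mul_dag_mul s
  have := mul_dag_mul t
  have := dag_mul_dag s
  have := dag_mul_dag t
  apply dag_eq <;> grind

theorem idem_conj (s : S) {e : S} (he : IsIdempotentElem e) :
    IsIdempotentElem (s * e * dag s) := by
  have h := idem_comm (idem_dag_mul s) he
  have := mul_dag_mul s
  unfold IsIdempotentElem at *
  grind
end

/-- The Munn congruence `v ∼ w` iff `v e v† = w e w†` for all idempotents `e`. -/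
def munnCon (G : Type*) [Semigroup G] [IsInverseSemigroup G] : Con G where
  r v w := ∀ e : G, IsIdempotentElem e → v * e * dag v = w * e * dag w
  iseqv := ⟨fun _ _ _ => rfl, fun h e he => (h e he).symm,
    fun h₁ h₂ e he => (h₁ e he).trans (h₂ e he)⟩
  mul' := by
    intro a b c d h₁ h₂ e he
    have h3 := h₂ e he
    have h4 := h₁ _ (idem_conj c he)
    rw [dag_mul, dag_mul]
    grind

/-- The quotient of `G` by the Munn congruence. -/
abbrev MunnQuotient (G : Type*) [Semigroup G] [IsInverseSemigroup G] : Type _ :=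
  (munnCon G).Quotient

instance (G : Type*) [Semigroup G] [IsInverseSemigroup G] :
    IsInverseSemigroup (MunnQuotient G) := by
  refine isInverseSemigroup_of_commute ?_ ?_
  · intro s
    induction s using Con.induction_on with
    | H v =>
      refine ⟨((dag v : G) : MunnQuotient G), ?_, ?_⟩
      · rw [← Con.coe_mul, ← Con.coe_mul, mul_dag_mul]
      · rw [← Con.coe_mul, ← Con.coe_mul, dag_mul_dag]
  · have key : ∀ x : MunnQuotient G, IsIdempotentElem x →
        ∃ e : G, IsIdempotentElem e ∧ (e : MunnQuotient G) = x := by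
      intro x hx
      induction x using Con.induction_on with
      | H a =>
        have h1 := mul_dag_mul (a * a)
        have h2 := dag_mul_dag (a * a)
        refine ⟨a * dag (a * a) * a, ?_, ?_⟩
        · unfold IsIdempotentElem; grind
        · have h3 : (a : MunnQuotient G) * a = a := hx
          have h4 : ((a * a * dag (a * a) * (a * a) : G) : MunnQuotient G) = ((a * a : G) : MunnQuotient G) := by rw [h1]
          simp only [Con.coe_mul] at h4 ⊢
          grind
    intro x y hx hy
    obtain ⟨e, he, rfl⟩ := key x hx
    obtain ⟨f, hf, rfl⟩ := key y hy
    rw [← Con.coe_mul, ← Con.coe_mul, idem_comm he hf]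

instance (G : Type*) [MonoidWithZero G] [IsInverseSemigroup G] :
    MonoidWithZero (MunnQuotient G) :=
  { (inferInstance : Monoid (MunnQuotient G)) with
    zero := ((0 : G) : MunnQuotient G)
    zero_mul := fun x => by
      induction x using Con.induction_on with
      | H v => exact congrArg _ (zero_mul v)
    mul_zero := fun x => by
      induction x using Con.induction_on with
      | H v => exact congrArg _ (mul_zero v) }

/-- The natural partial order: `s ≤ t` iff `s = t e` for some idempotent `e`. -/
def NatLE {S : Type*} [Mul S] (s t : S) : Prop := ∃ e : S, IsIdempotentElem e ∧ s = t * e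

/-- `m` is the greatest lower bound of `s` and `t` in the natural partial order. -/
def IsMeet {S : Type*} [Mul S] (s t m : S) : Prop :=
  NatLE m s ∧ NatLE m t ∧ ∀ r : S, NatLE r s → NatLE r t → NatLE r m

/-- `m` is the least upper bound of `A` in the natural partial order. -/
def IsJoin {S : Type*} [Mul S] (A : Set S) (m : S) : Prop :=
  (∀ a ∈ A, NatLE a m) ∧ ∀ r : S, (∀ a ∈ A, NatLE a r) → NatLE m r

/-- The set `E(S)` of idempotents. -/
abbrev Idem (S : Type*) [Mul S] : Type _ := {e : S // IsIdempotentElem e}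

/-- Orthogonality `s† t = 0 = t s†`. -/
def Orthogonal {S : Type*} [MonoidWithZero S] [IsInverseSemigroup S] (s t : S) : Prop :=
  dag s * t = 0 ∧ t * dag s = 0

/-- Boolean inverse monoid: an inverse monoid with zero whose idempotents form a Boolean algebra in
the natural partial order, which is a meet semilattice, and in which orthogonal pairs have joins. -/
class IsBooleanInverseMonoid (S : Type*) [MonoidWithZero S] : Prop
    extends IsInverseSemigroup S where
  booleanAlgebra : ∃ B : BooleanAlgebra (Idem S), ∀ e f : Idem S, B.le e f ↔ NatLE (e : S) f
  exists_meet : ∀ s t : S, ∃ m, IsMeet s t m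
  exists_join : ∀ s t : S, Orthogonal s t → ∃ m, IsJoin {s, t} m

/-- Complete Boolean inverse monoid: every family of pairwise orthogonal elements has a join. -/
class IsCompleteBooleanInverseMonoid (S : Type*) [MonoidWithZero S] : Prop
    extends IsBooleanInverseMonoid S where
  exists_join_of_pairwise : ∀ A : Set S, A.Pairwise Orthogonal → ∃ m, IsJoin A m

/-- Fundamental: the Munn congruence is trivial. -/
def IsFundamental (S : Type*) [Semigroup S] [IsInverseSemigroup S] : Prop :=
  ∀ s t : S, (∀ e : S, IsIdempotentElem e → s * e * dag s = t * e * dag t) → s = t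

/-- A character of the Boolean algebra `E(S)`: a lattice homomorphism onto `{0, 1}` preserving
`0` and `1`. -/
def IsCharacter {S : Type*} [MonoidWithZero S] (ρ : Idem S → Bool) : Prop :=
  (∀ e : Idem S, (e : S) = 0 → ρ e = false) ∧
  (∀ e : Idem S, (e : S) = 1 → ρ e = true) ∧
  (∀ e f g : Idem S, (g : S) = e * f → ρ g = (ρ e && ρ f)) ∧
  (∀ e f g : Idem S, IsJoin {(e : S), (f : S)} (g : S) → ρ g = (ρ e || ρ f))

/-- The character space of the Boolean algebra `E(S)`, i.e. its Stone space. Its topology is that of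
pointwise convergence, whose basis is formed by the sets `{ρ | ρ e = 1}`. -/
def Character (S : Type*) [MonoidWithZero S] : Type _ := {ρ : Idem S → Bool // IsCharacter ρ}

instance (S : Type*) [MonoidWithZero S] : CoeFun (Character S) (fun _ => Idem S → Bool) :=
  ⟨fun ρ => ρ.1⟩

instance (S : Type*) [MonoidWithZero S] : TopologicalSpace (Character S) :=
  inferInstanceAs (TopologicalSpace {ρ : Idem S → Bool // IsCharacter ρ})

/-- A hyperstonean space: compact Hausdorff, extremally disconnected, with sufficiently many
positive normal functionals on its continuous functions. -/
def IsHyperstonean (X : Type*) [TopologicalSpace X] : Prop :=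
  CompactSpace X ∧ T2Space X ∧ ExtremallyDisconnected X ∧
  ∀ f : C(X, ℝ), 0 ≤ f → f ≠ 0 →
    ∃ μ : C(X, ℝ) →ₗ[ℝ] ℝ, (∀ g, 0 ≤ g → 0 ≤ μ g) ∧
      (∀ (F : Set C(X, ℝ)) (g : C(X, ℝ)), F.Nonempty → DirectedOn (· ≤ ·) F → IsLUB F g →
        IsLUB (μ '' F) (μ g)) ∧
      μ f ≠ 0

/-- A Cartan inverse monoid: a fundamental complete Boolean inverse monoid such that the character
space of its idempotents is hyperstonean. -/
class IsCartanInverseMonoid (S : Type*) [MonoidWithZero S] : Prop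
    extends IsCompleteBooleanInverseMonoid S where
  fundamental : IsFundamental S
  hyperstonean : IsHyperstonean (Character S)

/-- The algebra `C(X)`, `X` being the character space of `E(S)`. -/
abbrev CharAlg (S : Type*) [MonoidWithZero S] : Type _ := C(Character S, ℂ)

/-- The characteristic function of `{ρ | ρ e = 1}`. -/
noncomputable def chi {S : Type*} [MonoidWithZero S] (e : Idem S) : CharAlg S where
  toFun ρ := if ρ e then 1 else 0
  continuous_toFun :=
    (continuous_of_discreteTopology (f := fun b : Bool => if b then (1 : ℂ) else 0)).comp
      ((continuous_apply e).comp continuous_subtype_val)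

/-- The inverse monoid of all partial isometries of `C(X)`. -/
def partialIsometries (S : Type*) [MonoidWithZero S] : Submonoid (CharAlg S) where
  carrier := {p | p * star p * p = p}
  one_mem' := by simp
  mul_mem' := by
    intro a b ha hb
    simp only [Set.mem_ofPred_eq, star_mul] at *
    linear_combination (b * star b * b) * ha + a * hb

theorem star_chi {S : Type*} [MonoidWithZero S] (e : Idem S) : star (chi e) = chi e := by
  ext ρ; simp only [chi, ContinuousMap.star_apply, ContinuousMap.coe_mk]; split_ifs <;> simp

theorem chi_mul_self {S : Type*} [MonoidWithZero S] (e : Idem S) : chi e * chi e = chi e := by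
  ext ρ; simp [chi]

theorem chi_mul {S : Type*} [MonoidWithZero S] (e f g : Idem S) (h : (g : S) = e * f) :
    chi e * chi f = chi g := by
  ext ρ
  have := ρ.2.2.2.1 e f g h
  cases h1 : ρ e <;> cases h2 : ρ f <;> simp_all [chi]

/-- The projection `chi e` as a partial isometry. -/
noncomputable def chiP {S : Type*} [MonoidWithZero S] (e : Idem S) : partialIsometries S :=
  ⟨chi e, by
    change _ * _ * _ = _
    rw [star_chi, chi_mul_self, chi_mul_self]⟩

section order
variable {S : Type*} [MonoidWithZero S]

theorem natLE_iff_left [IsInverseSemigroup S] {s t : S} :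
    NatLE s t ↔ ∃ f : S, IsIdempotentElem f ∧ s = f * t := by
  constructor
  · rintro ⟨e, he, rfl⟩
    refine ⟨t * e * dag t, idem_conj t he, ?_⟩
    have := idem_comm he (idem_dag_mul t)
    have := mul_dag_mul t
    have := he.eq
    grind
  · rintro ⟨f, hf, rfl⟩
    refine ⟨dag t * f * t, ?_, ?_⟩
    · have := idem_conj (dag t) hf
      rwa [dag_dag] at this
    · have := idem_comm hf (idem_mul_dag t)
      have := mul_dag_mul t
      have := hf.eq
      grind

theorem mul_eq_of_natLE [IsInverseSemigroup S] {e w : S} (he : IsIdempotentElem e)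
    (h : NatLE e w) : w * e = e := by
  obtain ⟨x, hx, h⟩ := h
  have h1 : x * e = e := by rw [← idem_comm he hx, h, mul_assoc, hx.eq]
  calc w * e = w * x * e := by rw [mul_assoc, h1]
    _ = e := by rw [← h, he.eq]

variable [IsBooleanInverseMonoid S]

/-- The idempotent `w ∧ 1`. -/
noncomputable def meetOne (w : S) : Idem S :=
  ⟨(IsBooleanInverseMonoid.exists_meet w 1).choose, by
    obtain ⟨-, ⟨e, he, h⟩, -⟩ := (IsBooleanInverseMonoid.exists_meet w 1).choose_spec
    rw [h, one_mul]
    exact he⟩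

/-- The idempotent `s† t ∧ 1`. -/
noncomputable def fixIdem (s t : S) : Idem S := meetOne (dag s * t)

theorem fixIdem_isMeet (s t : S) : IsMeet (dag s * t) 1 (fixIdem s t : S) :=
  (IsBooleanInverseMonoid.exists_meet (dag s * t) 1).choose_spec

theorem natLE_fixIdem {s t : S} (e : Idem S) (h : NatLE (e : S) (dag s * t)) :
    (e : S) = fixIdem s t * e := by
  have := (fixIdem_isMeet s t).2.2 e h ⟨e, e.2, (one_mul _).symm⟩
  exact (mul_eq_of_natLE e.2 this).symm

theorem fixIdem_comm (s t : S) : fixIdem s t = fixIdem t s := by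
  have key : ∀ s t : S, (fixIdem s t : S) = fixIdem t s * fixIdem s t := by
    intro s t
    apply natLE_fixIdem
    obtain ⟨x, hx, h⟩ := (fixIdem_isMeet s t).1
    rw [natLE_iff_left]
    refine ⟨x, hx, ?_⟩
    rw [← dag_idem (fixIdem s t).2, h, dag_mul, dag_mul, dag_dag, dag_idem hx]
  apply Subtype.ext
  rw [key s t, idem_comm (fixIdem t s).2 (fixIdem s t).2, ← key t s]

theorem fixIdem_trans (r s t : S) :
    (fixIdem r s * fixIdem s t : S) = fixIdem r t * (fixIdem r s * fixIdem s t) := by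
  have h1 := mul_eq_of_natLE (fixIdem r s).2 (fixIdem_isMeet r s).1
  have h2 := mul_eq_of_natLE (fixIdem s t).2 (fixIdem_isMeet s t).1
  have h3 := idem_comm (fixIdem r s).2 (fixIdem s t).2
  have h4 := idem_mul_aux (fixIdem r s).2 (fixIdem s t).2
  refine natLE_fixIdem ⟨_, h4⟩ ?_
  have h5 : IsIdempotentElem (dag t * (s * dag s) * t) := by
    have := idem_conj (dag t) (idem_mul_dag s)
    rwa [dag_dag] at this
  refine ⟨_, idem_mul_aux h5 h4, ?_⟩
  have h6 := idem_comm (idem_mul_dag t) (idem_mul_dag s)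
  have h7 := mul_dag_mul t
  simp only
  generalize (fixIdem r s : S) = e at *
  generalize (fixIdem s t : S) = f at *
  calc e * f = dag r * s * e * f := by rw [h1]
    _ = dag r * s * (f * e) := by rw [mul_assoc, h3]
    _ = dag r * s * (dag s * t * f * e) := by rw [h2]
    _ = dag r * (s * dag s) * t * (e * f) := by rw [h3]; simp only [mul_assoc]
    _ = dag r * (s * dag s) * (t * dag t * t) * (e * f) := by rw [h7]
    _ = dag r * ((s * dag s) * (t * dag t)) * t * (e * f) := by simp only [mul_assoc]
    _ = dag r * t * (dag t * (s * dag s) * t * (e * f)) := by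
      rw [← h6]; simp only [mul_assoc]
end order

section kernel
variable {S : Type*} [MonoidWithZero S] [IsBooleanInverseMonoid S]

/-- The kernel `K(t, s)`: the characteristic function of the idempotent `s† t ∧ 1`. -/
noncomputable def kern (t s : S) : CharAlg S := chi (fixIdem s t)

theorem kern_comm (s t : S) : kern s t = kern t s := by
  unfold kern; rw [fixIdem_comm]

theorem kern_trans (r s t : S) : kern r s * kern s t * kern r t = kern r s * kern s t := by
  have h : IsIdempotentElem (fixIdem r s * fixIdem s t : S) :=
    idem_mul_aux (fixIdem r s).2 (fixIdem s t).2
  rw [kern_comm r s, kern_comm s t, kern_comm r t]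
  unfold kern
  rw [chi_mul (fixIdem r s) (fixIdem s t) ⟨_, h⟩ rfl, mul_comm,
    chi_mul (fixIdem r t) ⟨_, h⟩ ⟨_, h⟩ (fixIdem_trans r s t)]

variable {H : Type*} [NormedAddCommGroup H] [InnerProductSpace ℂ H] [CompleteSpace H]

theorem re_sum_nonneg {X ι : Type*} [TopologicalSpace X]
    (π : C(X, ℂ) →⋆ₐ[ℂ] (H →L[ℂ] H)) (ξ : ι → H) (A : Finset ι) :
    ∀ k : ι → ι → C(X, ℂ), (∀ i j, star (k i j) = k i j) → (∀ i j, k i j * k i j = k i j) →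
      (∀ i j, k i j = k j i) → (∀ i j l, k i j * k j l * k i l = k i j * k j l) →
      0 ≤ (∑ i ∈ A, ∑ j ∈ A, inner ℂ (ξ i) (π (k i j) (ξ j))).re := by
  classical
  induction A using Finset.induction_on with
  | empty => intros; simp
  | insert m A hm ih =>
    intro k h1 h2 h3 h4
    have e1 : ∀ i j, k i j * k m i = k m i * k m j := by
      intro i j
      have := h4 m i j
      have := h4 i j m
      have := h4 i m j
      rw [h3 i m, h3 j m] at *
      grind
    have hd : ∀ i, k m i * k m m = k m i := by
      intro i
      have := h4 m i m
      rw [h3 i m, h2] at this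
      exact this
    set k' : ι → ι → C(X, ℂ) := fun i j => k i j - k m i * k m j with hk'
    have hsum : ∀ i j, inner ℂ (ξ i) (π (k i j) (ξ j)) =
        inner ℂ (π (k m i) (ξ i)) (π (k m j) (ξ j)) + inner ℂ (ξ i) (π (k' i j) (ξ j)) := by
      intro i j
      have e : k i j = star (k m i) * k m j + k' i j := by rw [h1, hk']; ring
      conv_lhs => rw [e, map_add, map_mul, map_star]
      rw [add_apply, inner_add_right, mul_apply_eq_comp,
        ContinuousLinearMap.star_eq_adjoint, ContinuousLinearMap.adjoint_inner_right]
    have hz : ∀ j, k' m j = 0 := by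
      intro j
      simp only [hk']
      rw [mul_comm, hd, sub_self]
    have hz' : ∀ j, k' j m = 0 := by
      intro j
      simp only [hk']
      rw [hd, h3, sub_self]
    have ih' := ih k' ?_ ?_ ?_ ?_
    · simp only [hsum, Finset.sum_add_distrib, Complex.add_re]
      refine add_nonneg ?_ ?_
      · have : ∑ i ∈ insert m A, ∑ j ∈ insert m A,
            inner ℂ (π (k m i) (ξ i)) (π (k m j) (ξ j)) =
            inner ℂ (∑ i ∈ insert m A, π (k m i) (ξ i)) (∑ i ∈ insert m A, π (k m i) (ξ i)) := by
          rw [sum_inner]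
          simp only [inner_sum]
        rw [this]
        exact inner_self_nonneg (𝕜 := ℂ)
      · rw [Finset.sum_insert hm]
        simp only [Finset.sum_insert hm, hz, hz', map_zero, zero_apply,
          inner_zero_right, Finset.sum_const_zero, zero_add]
        exact ih'
    · intro i j
      simp only [hk', star_sub, star_mul, h1]; ring
    · intro i j
      have := e1 i j
      have := h2 i j
      have := h2 m i
      have := h2 m j
      simp only [hk']
      grind
    · intro i j
      simp only [hk', h3 i j]; ring
    · intro i j l
      have a1 := e1 i j
      have a2 := e1 j l
      have a3 := e1 i l
      have a4 := h2 m j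
      have a5 := h4 i j l
      have a6 := h3 i j
      have a7 := e1 j i
      have a8 := h2 m i
      have a9 := h2 m l
      simp only [hk']
      grind

theorem star_kern (s t : S) : star (kern s t) = kern s t := star_chi _

variable (π : CharAlg S →⋆ₐ[ℂ] (H →L[ℂ] H))

/-- The vector space of finite formal sums `∑ k_s ⊗ ξ_s` with `s ∈ S`, `ξ_s ∈ H`. -/
def PreTensor (_ : CharAlg S →⋆ₐ[ℂ] (H →L[ℂ] H)) : Type _ := S →₀ H

noncomputable instance : AddCommGroup (PreTensor π) := inferInstanceAs (AddCommGroup (S →₀ H))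

noncomputable instance : Module ℂ (PreTensor π) := inferInstanceAs (Module ℂ (S →₀ H))

/-- The sesquilinear form with `⟨k_s ⊗ ξ, k_t ⊗ η⟩ = ⟨ξ, π(K(s,t)) η⟩`. -/
noncomputable def preInner (f g : S →₀ H) : ℂ :=
  f.sum fun s ξ => g.sum fun t η => inner ℂ ξ (π (kern s t) η)

theorem preInner_add_left (f f' g : S →₀ H) :
    preInner π (f + f') g = preInner π f g + preInner π f' g := by
  classical
  unfold preInner
  rw [Finsupp.sum_add_index']
  · simp
  · intro s ξ ξ'
    simp [Finsupp.sum_add]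

theorem preInner_conj (f g : S →₀ H) :
    (starRingEnd ℂ) (preInner π g f) = preInner π f g := by
  unfold preInner
  rw [Finsupp.sum_comm]
  simp only [map_finsuppSum]
  refine Finsupp.sum_congr fun s _ => Finsupp.sum_congr fun t _ => ?_
  rw [inner_conj_symm, ← ContinuousLinearMap.adjoint_inner_right,
    ← ContinuousLinearMap.star_eq_adjoint, ← map_star, star_kern, kern_comm]

theorem preInner_smul_left (f g : S →₀ H) (c : ℂ) :
    preInner π (c • f) g = (starRingEnd ℂ) c * preInner π f g := by
  unfold preInner
  rw [Finsupp.sum_smul_index']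
  · simp only [inner_smul_left]
    simp only [Finsupp.sum, Finset.mul_sum]
  · simp

noncomputable instance preCore : PreInnerProductSpace.Core ℂ (PreTensor π) where
  inner f g := preInner π f g
  conj_inner_symm f g := preInner_conj π f g
  add_left f g h := preInner_add_left π f g h
  smul_left f g c := preInner_smul_left π f g c
  re_inner_nonneg f := by
    change 0 ≤ (preInner π f f).re
    unfold preInner Finsupp.sum
    exact re_sum_nonneg π _ _ (fun s t => kern s t) (fun s t => star_kern s t)
      (fun s t => chi_mul_self _) (fun s t => kern_comm s t) (fun r s t => kern_trans r s t)

noncomputable instance : SeminormedAddCommGroup (PreTensor π) :=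
  InnerProductSpace.Core.toSeminormedAddCommGroup (𝕜 := ℂ)

noncomputable instance : InnerProductSpace ℂ (PreTensor π) := .ofCore _

/-- The Hilbert space `𝔄 ⊗_π H`. Here `𝔄` is the reproducing kernel Hilbert module over `C(X)` of the
kernel `K`: it is densely spanned over `C(X)` by the kernel functions `k_s`, with
`⟨k_s, k_t⟩ = K(s,t)`. Hence its interior tensor product with `H` is the separation and completion
of the span of the `k_s ⊗ ξ` in the form `⟨k_s ⊗ ξ, k_t ⊗ η⟩ = ⟨ξ, π(K(s,t)) η⟩`. -/
abbrev InteriorTensor : Type _ := UniformSpace.Completion (PreTensor π)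

noncomputable def preTmul (s : S) (ξ : H) : PreTensor π := Finsupp.single s ξ

/-- The elementary tensor `k_s ⊗ ξ`. -/
noncomputable def tmul (s : S) (ξ : H) : InteriorTensor π :=
  ((preTmul π s ξ : PreTensor π) : InteriorTensor π)

theorem inner_preTmul (s t : S) (ξ η : H) :
    inner ℂ (preTmul π s ξ) (preTmul π t η) = inner ℂ ξ (π (kern s t) η) := by
  change preInner π (Finsupp.single s ξ) (Finsupp.single t η) = _
  simp [preInner]

theorem inner_tmul (s t : S) (ξ η : H) :
    inner ℂ (tmul π s ξ) (tmul π t η) = inner ℂ ξ (π (kern s t) η) := by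
  unfold tmul
  rw [UniformSpace.Completion.inner_coe, inner_preTmul]


theorem preTensor_induction {p : PreTensor π → Prop} (f : PreTensor π) (h0 : p 0)
    (hadd : ∀ f g, p f → p g → p (f + g)) (hs : ∀ s ξ, p (preTmul π s ξ)) : p f :=
  Finsupp.induction_linear (motive := p) f h0 hadd hs

/-- The linear map `k_s ⊗ ξ ↦ k_{r(s)} ⊗ π(a(s)) ξ`. -/
noncomputable def preMap (r : S → S) (a : S → CharAlg S) : PreTensor π →ₗ[ℂ] PreTensor π :=
  Finsupp.lsum ℂ fun s => Finsupp.lsingle (r s) ∘ₗ (π (a s)).toLinearMap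

theorem preMap_preTmul (r : S → S) (a : S → CharAlg S) (s : S) (ξ : H) :
    preMap π r a (preTmul π s ξ) = preTmul π (r s) (π (a s) ξ) := by
  unfold preMap preTmul
  exact Finsupp.lsum_single _ _ _ _

theorem norm_preMap_le (r r' : S → S) (a : S → CharAlg S)
    (h₁ : ∀ s t, star (a s) * kern (r s) (r t) * a t = kern (r' s) t)
    (h₂ : ∀ s t, kern (r' s) (r' t) = kern (r' s) t) (f : PreTensor π) :
    ‖preMap π r a f‖ ≤ ‖f‖ := by
  set T := preMap π r a
  set E := preMap π r' (fun _ => 1)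
  have e1 : ∀ f g, inner ℂ (T f) (T g) = inner ℂ (E f) g := by
    intro f g
    induction f using preTensor_induction with
    | h0 => simp
    | hadd f f' hf hf' => simp only [map_add, inner_add_left, hf, hf']
    | hs s ξ =>
      induction g using preTensor_induction with
      | h0 => simp
      | hadd f f' hf hf' => simp only [map_add, inner_add_right, hf, hf']
      | hs t η =>
        simp only [T, E, preMap_preTmul, inner_preTmul]
        rw [← h₁, map_one, map_mul, map_mul, map_star, ContinuousLinearMap.star_eq_adjoint]
        simp only [mul_apply_eq_comp, ContinuousLinearMap.adjoint_inner_right]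
        rfl
  have e2 : ∀ f g, inner ℂ (E f) (E g) = inner ℂ (E f) g := by
    intro f g
    induction f using preTensor_induction with
    | h0 => simp
    | hadd f f' hf hf' => simp only [map_add, inner_add_left, hf, hf']
    | hs s ξ =>
      induction g using preTensor_induction with
      | h0 => simp
      | hadd f f' hf hf' => simp only [map_add, inner_add_right, hf, hf']
      | hs t η =>
        simp only [E, preMap_preTmul, inner_preTmul]
        rw [h₂, map_one]
        simp
  have e3 : ‖E f‖ ^ 2 ≤ ‖E f‖ * ‖f‖ := by
    rw [← inner_self_eq_norm_sq (𝕜 := ℂ), e2]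
    exact re_inner_le_norm _ _
  have e4 : ‖T f‖ ^ 2 ≤ ‖E f‖ * ‖f‖ := by
    rw [← inner_self_eq_norm_sq (𝕜 := ℂ), e1]
    exact re_inner_le_norm _ _
  have n1 := norm_nonneg (E f)
  have n2 := norm_nonneg f
  have e5 : ‖E f‖ ≤ ‖f‖ := by
    by_contra h
    push Not at h
    nlinarith
  exact abs_le_of_sq_le_sq' (by nlinarith) n2 |>.2
end kernel

/-- An extension `P → G → S` of `S` by the partial isometries `P` of `C(X)`, `X` the character space
of `E(S)`: `ι` is an injective and `q` a surjective homomorphism, `q g` is idempotent exactly when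
`g ∈ ι(P)`, `q ∘ ι` is injective on the idempotents of `P` and it is the natural identification
`chi e ↦ e` of `E(P)` with `E(S)`; moreover conjugation in `G` induces the natural action of `S` on
`P`: if `g† ι(p) g = ι(p')` then `p'(ρ) = p(τ)`, whenever the function
`τ : e ↦ ρ(q(g)† e q(g))` is a character (that is, whenever `ρ(q(g)† q(g)) = 1`). -/
structure Extension (S G : Type*) [MonoidWithZero S] [IsInverseSemigroup S]
    [Semigroup G] [IsInverseSemigroup G] where
  ι : partialIsometries S →ₙ* G
  q : G →ₙ* S
  ι_injective : Function.Injective ι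
  q_surjective : Function.Surjective q
  isIdempotentElem_q_iff : ∀ g : G, IsIdempotentElem (q g) ↔ ∃ p, ι p = g
  q_ι_chiP : ∀ e : Idem S, q (ι (chiP e)) = e
  q_ι_injOn : ∀ p p' : partialIsometries S, IsIdempotentElem p → IsIdempotentElem p' →
    q (ι p) = q (ι p') → p = p'
  conj_ι : ∀ (g : G) (p p' : partialIsometries S), dag g * ι p * g = ι p' →
    ∀ ρ τ : Character S,
      (∀ e f : Idem S, (f : S) = dag (q g) * e * q g → τ e = ρ f) →
      (p' : CharAlg S) ρ = (p : CharAlg S) τ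

/-- An order preserving section `j : S → G` of `q` with `j 1 = 1`. -/
structure OrderSection {S G : Type*} [MonoidWithZero S] [IsInverseSemigroup S]
    [Semigroup G] [IsInverseSemigroup G] (X : Extension S G) where
  j : S → G
  q_j : ∀ s, X.q (j s) = s
  j_one : ∀ g : G, j 1 * g = g ∧ g * j 1 = g
  mono : ∀ s t : S, NatLE s t → NatLE (j s) (j t)

theorem map_dag {G S : Type*} [Semigroup S] [IsInverseSemigroup S]
    [Semigroup G] [IsInverseSemigroup G] (q : G →ₙ* S) (g : G) : q (dag g) = dag (q g) := by
  symm
  apply dag_eq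
  · rw [← map_mul, ← map_mul, mul_dag_mul]
  · rw [← map_mul, ← map_mul, dag_mul_dag]

section lambda
variable {S G : Type*} [MonoidWithZero S] [IsBooleanInverseMonoid S]
  [Semigroup G] [IsInverseSemigroup G] {X : Extension S G}

theorem idem_q_sigma (j : OrderSection X) (v : G) (s : S) :
    IsIdempotentElem (X.q (dag (j.j (X.q v * s)) * v * j.j s)) := by
  rw [map_mul, map_mul, map_dag, j.q_j, j.q_j, mul_assoc]
  exact idem_dag_mul _

/-- The cocycle function `σ(v, s) = j(q(v) s)† v j(s)`, as an element of `P`. -/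
noncomputable def sigma (j : OrderSection X) (v : G) (s : S) : partialIsometries S :=
  ((X.isIdempotentElem_q_iff _).1 (idem_q_sigma j v s)).choose

theorem ι_sigma (j : OrderSection X) (v : G) (s : S) :
    X.ι (sigma j v s) = dag (j.j (X.q v * s)) * v * j.j s :=
  ((X.isIdempotentElem_q_iff _).1 (idem_q_sigma j v s)).choose_spec

theorem q_injOn (X : Extension S G) {g g' : G} (hg : IsIdempotentElem g)
    (hg' : IsIdempotentElem g') (h : X.q g = X.q g') : g = g' := by
  obtain ⟨p, rfl⟩ := (X.isIdempotentElem_q_iff g).1 (by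
    unfold IsIdempotentElem; rw [← map_mul, hg.eq])
  obtain ⟨p', rfl⟩ := (X.isIdempotentElem_q_iff g').1 (by
    unfold IsIdempotentElem; rw [← map_mul, hg'.eq])
  refine congrArg _ (X.q_ι_injOn p p' ?_ ?_ h)
  · apply X.ι_injective; rw [map_mul]; exact hg
  · apply X.ι_injective; rw [map_mul]; exact hg'

theorem j_idem (j : OrderSection X) {e : S} (he : IsIdempotentElem e) :
    IsIdempotentElem (j.j e) := by
  obtain ⟨x, hx, h⟩ := j.mono e 1 ⟨e, he, (one_mul e).symm⟩
  rw [h, (j.j_one x).1]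
  exact hx

theorem j_source (j : OrderSection X) (s : S) : dag (j.j s) * j.j s = j.j (dag s * s) := by
  apply q_injOn X (idem_dag_mul _) (j_idem j (idem_dag_mul s))
  rw [map_mul, map_dag, j.q_j, j.q_j]

theorem j_range (j : OrderSection X) (s : S) : j.j s * dag (j.j s) = j.j (s * dag s) := by
  apply q_injOn X (idem_mul_dag _) (j_idem j (idem_mul_dag s))
  rw [map_mul, map_dag, j.q_j, j.q_j]

theorem j_mul_idem (j : OrderSection X) (s : S) {e : S} (he : IsIdempotentElem e) :
    j.j (s * e) = j.j s * j.j e := by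
  obtain ⟨x, hx, h⟩ := j.mono (s * e) s ⟨e, he, rfl⟩
  have h1 : j.j (s * e) = j.j s * (dag (j.j (s * e)) * j.j (s * e)) := by
    have h2 := mul_dag_mul (j.j (s * e))
    have h3 : j.j (s * e) * x = j.j (s * e) := by rw [h, mul_assoc, hx.eq]
    have h4 := idem_comm hx (idem_dag_mul (j.j (s * e)))
    calc j.j (s * e) = j.j (s * e) * (dag (j.j (s * e)) * j.j (s * e)) := by
          rw [← mul_assoc, h2]
      _ = j.j s * (x * (dag (j.j (s * e)) * j.j (s * e))) := by
          rw [← mul_assoc (j.j s), ← h]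
      _ = j.j s * (dag (j.j (s * e)) * (j.j (s * e) * x)) := by rw [h4, mul_assoc]
      _ = _ := by rw [h3]
  rw [h1]
  have h5 : dag (j.j (s * e)) * j.j (s * e) = dag (j.j s) * j.j s * j.j e := by
    apply q_injOn X (idem_dag_mul _) (idem_mul_aux (idem_dag_mul _) (j_idem j he))
    simp only [map_mul, map_dag, j.q_j]
    have := idem_comm he (idem_dag_mul s)
    have := he.eq
    rw [dag_mul, dag_idem he]
    grind
  rw [h5, ← mul_assoc, ← mul_assoc, mul_dag_mul]

theorem j_idem_mul (j : OrderSection X) (s : S) {e : S} (he : IsIdempotentElem e) :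
    j.j (e * s) = j.j e * j.j s := by
  have h1 : IsIdempotentElem (dag s * e * s) := by
    have := idem_conj (dag s) he
    rwa [dag_dag] at this
  have h2 : e * s = s * (dag s * e * s) := by
    have := idem_comm he (idem_mul_dag s)
    have := mul_dag_mul s
    grind
  rw [h2, j_mul_idem j s h1]
  have h3 : j.j (dag s * e * s) = dag (j.j s) * j.j e * j.j s := by
    refine q_injOn X (j_idem j h1) ?_ ?_
    · have := idem_conj (dag (j.j s)) (j_idem j he)
      rwa [dag_dag] at this
    · simp only [map_mul, map_dag, j.q_j]
  rw [h3]
  have := idem_comm (j_idem j he) (idem_mul_dag (j.j s))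
  have := mul_dag_mul (j.j s)
  grind

theorem ι_comm (X : Extension S G) (p p' : partialIsometries S) :
    X.ι p * X.ι p' = X.ι p' * X.ι p := by
  rw [← map_mul, ← map_mul, mul_comm]

theorem ι_chiP (j : OrderSection X) (e : Idem S) : X.ι (chiP e) = j.j e := by
  refine q_injOn X ?_ (j_idem j e.2) ?_
  · unfold IsIdempotentElem
    rw [← map_mul]
    refine congrArg _ (Subtype.ext (chi_mul_self e))
  · rw [X.q_ι_chiP, j.q_j]

theorem star_mem_partialIsometries {p : CharAlg S} (hp : p ∈ partialIsometries S) :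
    star p ∈ partialIsometries S := by
  have h : p * star p * p = p := hp
  change star p * star (star p) * star p = star p
  conv_rhs => rw [← h]
  simp only [star_mul, star_star]
  ring

theorem ι_star (X : Extension S G) (p : partialIsometries S) :
    X.ι ⟨star (p : CharAlg S), star_mem_partialIsometries p.2⟩ = dag (X.ι p) := by
  symm
  have h : (p : CharAlg S) * star (p : CharAlg S) * p = p := p.2
  have h' : star (p : CharAlg S) * p * star (p : CharAlg S) = star (p : CharAlg S) := by
    have := star_mem_partialIsometries p.2
    change _ * star (star _) * _ = _ at this
    rwa [star_star] at this
  apply dag_eq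
  · rw [← map_mul, ← map_mul]
    exact congrArg _ (Subtype.ext h)
  · rw [← map_mul, ← map_mul]
    exact congrArg _ (Subtype.ext h')

theorem kern_mul_left (r s t : S) : kern (r * s) (r * t) = kern (dag r * r * s) t := by
  rw [kern_comm, kern_comm _ t]
  unfold kern fixIdem
  rw [dag_mul, dag_mul, dag_idem (idem_dag_mul r)]
  simp only [mul_assoc]

theorem mul_fixIdem (c d : S) : c * (fixIdem c d : S) = d * fixIdem c d := by
  have h1 := mul_eq_of_natLE (fixIdem c d).2 (fixIdem_isMeet c d).1
  have h2 := mul_eq_of_natLE (fixIdem d c).2 (fixIdem_isMeet d c).1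
  rw [fixIdem_comm d c] at h2
  generalize (fixIdem c d : S) = f at *
  have h3 := idem_comm (idem_mul_dag c) (idem_mul_dag d)
  have h4 := mul_dag_mul d
  calc c * f = c * (dag c * d * f) := by rw [h1]
    _ = c * dag c * (d * dag d * d) * f := by rw [h4]; simp only [mul_assoc]
    _ = (c * dag c) * (d * dag d) * d * f := by simp only [mul_assoc]
    _ = d * dag d * (c * (dag c * d * f)) := by rw [h3]; simp only [mul_assoc]
    _ = d * (dag d * c * f) := by rw [h1]; simp only [mul_assoc]
    _ = d * f := by rw [h2]

theorem sigma_kern (j : OrderSection X) (v : G) (s t : S) :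
    star (sigma j v s : CharAlg S) * kern (X.q v * s) (X.q v * t) * sigma j v t =
      kern (dag (X.q v) * X.q v * s) t := by
  rw [← kern_mul_left, kern_comm]
  have hv : dag v * v = j.j (dag (X.q v) * X.q v) := by
    apply q_injOn X (idem_dag_mul _) (j_idem j (idem_dag_mul _))
    rw [map_mul, map_dag, j.q_j]
  have hq : X.q (X.ι (sigma j v s)) = dag (X.q v * s) * (X.q v * s) := by
    rw [ι_sigma]
    simp only [map_mul, map_dag, j.q_j, mul_assoc]
  have hs := ι_sigma j v s
  have ht := ι_sigma j v t
  set r := X.q v with hr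
  set f := fixIdem (r * s) (r * t) with hf
  have hrf : r * s * (f : S) = r * t * f := mul_fixIdem _ _
  have hcf : dag (r * s) * (r * t) * (f : S) = f :=
    mul_eq_of_natLE f.2 (fixIdem_isMeet _ _).1
  have hF : X.ι (chiP f) = j.j f := ι_chiP j f
  have hFi : j.j (f : S) * j.j f = j.j f := j_idem j f.2
  have aux : ∀ s : S, X.ι (sigma j v s) = dag (j.j (r * s)) * v * j.j s →
      X.ι (sigma j v s) * j.j f = dag (j.j (r * s * f)) * v * j.j (dag r * (r * s * f)) := by
    intro s hs
    have h1 : X.ι (sigma j v s) * j.j f = j.j f * X.ι (sigma j v s) * j.j f := by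
      rw [← hF, ι_comm X (chiP f), mul_assoc, hF, hFi]
    rw [h1, hs, j_mul_idem j _ f.2, dag_mul, dag_idem (j_idem j f.2)]
    have h2 : dag r * (r * s * (f : S)) = dag r * r * (s * f) := by simp only [mul_assoc]
    rw [h2, j_idem_mul j _ (idem_dag_mul r), ← hv, j_mul_idem j s f.2]
    have h3 := mul_dag_mul v
    calc j.j f * (dag (j.j (r * s)) * v * j.j s) * j.j f
        = j.j f * dag (j.j (r * s)) * v * (j.j s * j.j f) := by simp only [mul_assoc]
      _ = j.j f * dag (j.j (r * s)) * (v * dag v * v) * (j.j s * j.j f) := by rw [h3]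
      _ = _ := by simp only [mul_assoc]
  have h1 : X.ι (sigma j v s) * j.j f = X.ι (sigma j v t) * j.j f := by
    rw [aux s hs, aux t ht, hrf]
  have h2 : dag (X.ι (sigma j v s)) * X.ι (sigma j v s) * j.j f = j.j f := by
    apply q_injOn X (idem_mul_aux (idem_dag_mul _) (j_idem j f.2)) (j_idem j f.2)
    simp only [map_mul, map_dag, j.q_j]
    rw [hq, dag_idem (idem_dag_mul _), (idem_dag_mul _).eq]
    have h3 := dag_mul_dag (r * s)
    calc dag (r * s) * (r * s) * (f : S)
        = dag (r * s) * (r * s) * (dag (r * s) * (r * t) * f) := by rw [hcf]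
      _ = dag (r * s) * (r * s) * dag (r * s) * (r * t) * f := by simp only [mul_assoc]
      _ = f := by rw [h3, hcf]
  have h3 : X.ι (⟨star (sigma j v s : CharAlg S), star_mem_partialIsometries (sigma j v s).2⟩ *
      chiP f * sigma j v t) = X.ι (chiP f) := by
    rw [map_mul, map_mul, ι_star, mul_assoc, ι_comm, hF, ← h1, ← mul_assoc, h2]
  exact congrArg Subtype.val (X.ι_injective h3)

variable {H : Type*} [NormedAddCommGroup H] [InnerProductSpace ℂ H] [CompleteSpace H]

/-- The operator `λ_π(v)` on `𝔄 ⊗_π H`, determined by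
`k_s ⊗ ξ ↦ k_{q(v) s} ⊗ π(σ(v, s)) ξ`. -/
noncomputable def lam (j : OrderSection X) (π : CharAlg S →⋆ₐ[ℂ] (H →L[ℂ] H)) (v : G) :
    InteriorTensor π →L[ℂ] InteriorTensor π :=
  ((preMap π (fun s => X.q v * s) (fun s => (sigma j v s : CharAlg S))).mkContinuous 1
    (fun f => by
      rw [one_mul]
      refine norm_preMap_le π _ (fun s => dag (X.q v) * X.q v * s) _
        (fun s t => sigma_kern j v s t) (fun s t => ?_) f
      rw [kern_mul_left, dag_idem (idem_dag_mul _), ← mul_assoc (dag _ * _),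
        dag_mul_dag])).completion

theorem lam_tmul (j : OrderSection X) (π : CharAlg S →⋆ₐ[ℂ] (H →L[ℂ] H)) (v : G) (s : S) (ξ : H) :
    lam j π v (tmul π s ξ) = tmul π (X.q v * s) (π (sigma j v s) ξ) := by
  unfold lam tmul
  rw [ContinuousLinearMap.completion_apply_coe, LinearMap.mkContinuous_apply, preMap_preTmul]
end lambda

section pairs
variable {H : Type*} [NormedAddCommGroup H] [InnerProductSpace ℂ H] [CompleteSpace H]

/-- The von Neumann algebra generated by `T`, i.e. the double commutant of `T ∪ T*`; for self-adjoint
`T` this is the double commutant of `T`. -/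
noncomputable def bicommutant (T : Set (H →L[ℂ] H)) : VonNeumannAlgebra H where
  toStarSubalgebra := StarSubalgebra.centralizer ℂ
    (StarSubalgebra.centralizer ℂ T : Set (H →L[ℂ] H))
  centralizer_centralizer' := by
    change Set.centralizer (Set.centralizer (StarSubalgebra.centralizer ℂ
      (StarSubalgebra.centralizer ℂ T : Set (H →L[ℂ] H)) : Set (H →L[ℂ] H))) =
      (StarSubalgebra.centralizer ℂ
      (StarSubalgebra.centralizer ℂ T : Set (H →L[ℂ] H)) : Set (H →L[ℂ] H))
    rw [StarSubalgebra.coe_centralizer]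
    exact Set.centralizer_centralizer_centralizer _

/-- The `σ`-weak (weak-*) topology of `B(H)`: the coarsest one that makes all functionals
`x ↦ ∑ ⟨ζ_n, x η_n⟩`, with `ζ`, `η` square summable, continuous. -/
@[reducible] noncomputable def sigmaWeakTopology (H : Type*) [NormedAddCommGroup H] [InnerProductSpace ℂ H]
    [CompleteSpace H] : TopologicalSpace (H →L[ℂ] H) :=
  ⨅ ζ : lp (fun _ : ℕ => H) 2 × lp (fun _ : ℕ => H) 2,
    TopologicalSpace.induced (fun x : H →L[ℂ] H => ∑' n, inner ℂ (ζ.1 n) (x (ζ.2 n))) inferInstance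

/-- `v` is a groupoid normalizer of `D` in `M`: a partial isometry of `M` with `v D v* ⊆ D` and
`v* D v ⊆ D`. -/
def IsGroupoidNormalizer (M D : VonNeumannAlgebra H) (v : H →L[ℂ] H) : Prop :=
  v ∈ M ∧ v * star v * v = v ∧ ∀ d ∈ D, v * d * star v ∈ D ∧ star v * d * v ∈ D

/-- A normal conditional expectation of `M` onto `D`. -/
structure IsNormalExpectation (M D : VonNeumannAlgebra H)
    (E : M.toStarSubalgebra →ₗ[ℂ] D.toStarSubalgebra) : Prop where
  map_mem : ∀ (x : M.toStarSubalgebra) (d : D.toStarSubalgebra),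
    (x : H →L[ℂ] H) = d → E x = d
  nonneg : ∀ x : M.toStarSubalgebra, 0 ≤ (x : H →L[ℂ] H) → 0 ≤ (E x : H →L[ℂ] H)
  bimodule : ∀ (x y : M.toStarSubalgebra) (d d' : D.toStarSubalgebra),
    (y : H →L[ℂ] H) = d * x * d' → E y = d * E x * d'
  normal : ∀ (F : Set M.toStarSubalgebra) (x : M.toStarSubalgebra), F.Nonempty →
    DirectedOn (fun y z : M.toStarSubalgebra => (y : H →L[ℂ] H) ≤ z) F →
    IsLUB ((fun y : M.toStarSubalgebra => (y : H →L[ℂ] H)) '' F) x →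
    IsLUB ((fun y : M.toStarSubalgebra => (E y : H →L[ℂ] H)) '' F) (E x)

/-- `(M, D)` is a Cartan pair: `D` is a maximal abelian subalgebra of `M` (equivalently,
`D = D' ∩ M`), there is a faithful normal conditional expectation of `M` onto `D`, and the linear
span of the groupoid normalizers is weak-* dense in `M`. -/
structure IsCartanPair (M D : VonNeumannAlgebra H) : Prop where
  le : D ≤ M
  masa : ∀ x ∈ M, x ∈ D ↔ ∀ d ∈ D, d * x = x * d
  exists_expectation : ∃ E : M.toStarSubalgebra →ₗ[ℂ] D.toStarSubalgebra,
    IsNormalExpectation M D E ∧ ∀ x : M.toStarSubalgebra, E (star x * x) = 0 → x = 0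
  regular : (M : Set (H →L[ℂ] H)) ⊆
    @closure _ (sigmaWeakTopology H)
      (Submodule.span ℂ {v | IsGroupoidNormalizer M D v} : Set (H →L[ℂ] H))

variable {M D : VonNeumannAlgebra H}

theorem IsCartanPair.comm (h : IsCartanPair M D) {x y : H →L[ℂ] H} (hx : x ∈ D) (hy : y ∈ D) :
    x * y = y * x := (h.masa y (h.le hy)).1 hy x hx

theorem IsGroupoidNormalizer.star_mul_mem {v : H →L[ℂ] H} (hv : IsGroupoidNormalizer M D v) :
    star v * v ∈ D := by
  simpa using (hv.2.2 1 (one_mem D)).2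

theorem IsGroupoidNormalizer.mul_star_mem {v : H →L[ℂ] H} (hv : IsGroupoidNormalizer M D v) :
    v * star v ∈ D := by
  simpa using (hv.2.2 1 (one_mem D)).1

theorem IsGroupoidNormalizer.adjoint {v : H →L[ℂ] H} (hv : IsGroupoidNormalizer M D v) :
    IsGroupoidNormalizer M D (star v) := by
  refine ⟨star_mem hv.1, ?_, fun d hd => ?_⟩
  · have := congrArg star hv.2.1
    simpa [mul_assoc] using this
  · rw [star_star]
    exact (hv.2.2 d hd).symm

/-- The inverse monoid of groupoid normalizers of a Cartan pair. -/
def groupoidNormalizers (h : IsCartanPair M D) : Submonoid (H →L[ℂ] H) where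
  carrier := {v | IsGroupoidNormalizer M D v}
  one_mem' := ⟨one_mem M, by simp, fun d hd => by simpa using hd⟩
  mul_mem' := by
    intro v w hv hw
    refine ⟨mul_mem hv.1 hw.1, ?_, fun d hd => ⟨?_, ?_⟩⟩
    · have h1 := h.comm hv.star_mul_mem hw.mul_star_mem
      have h2 := hv.2.1
      have h3 := hw.2.1
      rw [star_mul]
      grind
    · have := (hv.2.2 _ (hw.2.2 d hd).1).1
      simpa [mul_assoc] using this
    · have := (hw.2.2 _ (hv.2.2 d hd).2).2
      simpa [mul_assoc] using this

abbrev GN (h : IsCartanPair M D) : Type _ := groupoidNormalizers h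

theorem zero_mem_groupoidNormalizers (h : IsCartanPair M D) :
    (0 : H →L[ℂ] H) ∈ groupoidNormalizers h :=
  ⟨zero_mem M, by simp, fun d _ => by simp [zero_mem D]⟩

noncomputable instance (h : IsCartanPair M D) : MonoidWithZero (GN h) :=
  { (inferInstance : Monoid (groupoidNormalizers h)) with
    zero := ⟨0, zero_mem_groupoidNormalizers h⟩
    zero_mul := fun _ => Subtype.ext (zero_mul _)
    mul_zero := fun _ => Subtype.ext (mul_zero _) }

theorem idem_GN (h : IsCartanPair M D) {e : GN h} (he : IsIdempotentElem e) :
    (e : H →L[ℂ] H) ∈ D := by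
  have h0 : (e : H →L[ℂ] H) * e = e := congrArg Subtype.val he
  have h1 := h.comm e.2.star_mul_mem e.2.mul_star_mem
  have h2 : (e : H →L[ℂ] H) * star (e : H →L[ℂ] H) * e = e := e.2.2.1
  have h3 := congrArg star h2
  have h4 := congrArg star h0
  simp only [star_mul, star_star] at h3 h4
  have h5 : star (e : H →L[ℂ] H) = e := by
    calc star (e : H →L[ℂ] H) = star (e : H →L[ℂ] H) * (e * e) * star (e : H →L[ℂ] H) := by
          rw [h0, mul_assoc, h3]
      _ = (star (e : H →L[ℂ] H) * e) * (e * star (e : H →L[ℂ] H)) := by simp only [mul_assoc]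
      _ = e * (star (e : H →L[ℂ] H) * star (e : H →L[ℂ] H)) * e := by
          rw [h1]; simp only [mul_assoc]
      _ = e := by rw [h4, h2]
  have h6 := e.2.star_mul_mem
  rwa [h5, h0] at h6

instance (h : IsCartanPair M D) : IsInverseSemigroup (GN h) := by
  refine isInverseSemigroup_of_commute (fun v => ?_) (fun e f he hf => ?_)
  · refine ⟨⟨star (v : H →L[ℂ] H), v.2.adjoint⟩, Subtype.ext v.2.2.1, Subtype.ext ?_⟩
    have := v.2.adjoint.2.1
    rwa [star_star] at this
  · exact Subtype.ext (h.comm (idem_GN h he) (idem_GN h hf))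

theorem idem_mk {G : Type*} [Semigroup G] [IsInverseSemigroup G] (e : Idem G) :
    IsIdempotentElem ((e : G) : MunnQuotient G) := by
  unfold IsIdempotentElem
  rw [← Con.coe_mul, e.2.eq]

/-- `Y` is the extension associated with the Cartan pair `(M, D)`. Its quotient map is the one onto
the Munn quotient `S` of the groupoid normalizers, and `ι` is the inclusion of the partial
isometries of `D`, where `D` is identified with `C(X)`, `X` the character space of `E(S)`, through
the isomorphism `Φ` that takes `chi [e]` to `e` for all projections `e` of `D`. -/
def IsExtensionOf (h : IsCartanPair M D) (Y : Extension (MunnQuotient (GN h)) (GN h)) : Prop :=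
  (∀ v : GN h, Y.q v = (v : MunnQuotient (GN h))) ∧
  ∃ Φ : CharAlg (MunnQuotient (GN h)) ≃⋆ₐ[ℂ] D.toStarSubalgebra,
    (∀ e : Idem (GN h),
      (Φ (chi ⟨((e : GN h) : MunnQuotient (GN h)), idem_mk e⟩) : H →L[ℂ] H) = (e : GN h)) ∧
    ∀ p : partialIsometries (MunnQuotient (GN h)),
      (Y.ι p : H →L[ℂ] H) = Φ (p : CharAlg (MunnQuotient (GN h)))

/-- `(M₁, D₁)` and `(M₂, D₂)` are isomorphic: a star isomorphism of `M₁` onto `M₂` takes `D₁` onto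
`D₂`. -/
def CartanPairIso {H₁ H₂ : Type*} [NormedAddCommGroup H₁] [InnerProductSpace ℂ H₁]
    [CompleteSpace H₁] [NormedAddCommGroup H₂] [InnerProductSpace ℂ H₂] [CompleteSpace H₂]
    (M₁ D₁ : VonNeumannAlgebra H₁) (M₂ D₂ : VonNeumannAlgebra H₂) : Prop :=
  ∃ θ : M₁.toStarSubalgebra ≃⋆ₐ[ℂ] M₂.toStarSubalgebra,
    ∀ x : M₁.toStarSubalgebra, (θ x : H₂ →L[ℂ] H₂) ∈ D₂ ↔ (x : H₁ →L[ℂ] H₁) ∈ D₁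

end pairs

section equivalence
variable {S₁ S₂ S₃ : Type*} [MonoidWithZero S₁] [MonoidWithZero S₂] [MonoidWithZero S₃]

/-- The bijection of idempotents induced by an isomorphism. -/
def idemMap (θ : S₁ ≃* S₂) (e : Idem S₁) : Idem S₂ :=
  ⟨θ e, by unfold IsIdempotentElem; rw [← map_mul, e.2.eq]⟩

theorem natLE_map (θ : S₁ ≃* S₂) {s t : S₁} (h : NatLE s t) : NatLE (θ s) (θ t) := by
  obtain ⟨e, he, rfl⟩ := h
  exact ⟨θ e, (idemMap θ ⟨e, he⟩).2, map_mul θ t e⟩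

theorem isJoin_map (θ : S₁ ≃* S₂) {A : Set S₁} {m : S₁} (h : IsJoin A m) :
    IsJoin (θ '' A) (θ m) := by
  refine ⟨?_, fun r hr => ?_⟩
  · rintro _ ⟨a, ha, rfl⟩
    exact natLE_map θ (h.1 a ha)
  · have := h.2 (θ.symm r) fun a ha => by
      have := natLE_map θ.symm (hr _ ⟨a, ha, rfl⟩)
      rwa [θ.symm_apply_apply] at this
    have := natLE_map θ this
    rwa [θ.apply_symm_apply] at this

/-- The map of character spaces induced by an isomorphism. -/
def characterMap (θ : S₁ ≃* S₂) : C(Character S₂, Character S₁) where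
  toFun ρ := ⟨fun e => ρ (idemMap θ e), by
    refine ⟨fun e he => ρ.2.1 _ ?_, fun e he => ρ.2.2.1 _ ?_, fun e f g h => ρ.2.2.2.1 _ _ _ ?_,
      fun e f g h => ρ.2.2.2.2 _ _ _ ?_⟩
    · change θ e = 0
      rw [he, map_zero]
    · change θ e = 1
      rw [he, map_one]
    · change θ g = θ e * θ f
      rw [h, map_mul]
    · have := isJoin_map θ h
      rwa [Set.image_pair] at this⟩
  continuous_toFun := by
    refine Continuous.subtype_mk (continuous_pi fun e => ?_) _
    exact (continuous_apply (idemMap θ e)).comp continuous_subtype_val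

/-- The isomorphism between the monoids of partial isometries that is induced by `θ : S₁ ≃* S₂`. -/
noncomputable def pullback (θ : S₁ ≃* S₂) (p : partialIsometries S₁) : partialIsometries S₂ :=
  ⟨(p : CharAlg S₁).comp (characterMap θ), by
    have h : (p : CharAlg S₁) * star (p : CharAlg S₁) * p = p := p.2
    change _ * star _ * _ = _
    ext ρ
    exact congrArg (fun f : CharAlg S₁ => f (characterMap θ ρ)) h⟩

variable [IsInverseSemigroup S₁] [IsInverseSemigroup S₂] [IsInverseSemigroup S₃]
  {G₁ G₂ G₃ : Type*} [Semigroup G₁] [IsInverseSemigroup G₁] [Semigroup G₂] [IsInverseSemigroup G₂]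
  [Semigroup G₃] [IsInverseSemigroup G₃]

/-- Equivalence of extensions: isomorphisms `θ : S₁ ≃* S₂` and `α : G₁ ≃* G₂` that commute with the
quotient maps and, together with the isomorphism induced by `θ`, with the inclusions. -/
def ExtEquiv (X₁ : Extension S₁ G₁) (X₂ : Extension S₂ G₂) : Prop :=
  ∃ (θ : S₁ ≃* S₂) (α : G₁ ≃* G₂), (∀ g, X₂.q (α g) = θ (X₁.q g)) ∧
    ∀ p, X₂.ι (pullback θ p) = α (X₁.ι p)

theorem ExtEquiv.refl (X : Extension S₁ G₁) : ExtEquiv X X :=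
  ⟨MulEquiv.refl _, MulEquiv.refl _, fun _ => rfl, fun _ => congrArg X.ι (Subtype.ext rfl)⟩

theorem ExtEquiv.trans {X₁ : Extension S₁ G₁} {X₂ : Extension S₂ G₂} {X₃ : Extension S₃ G₃}
    (h : ExtEquiv X₁ X₂) (h' : ExtEquiv X₂ X₃) : ExtEquiv X₁ X₃ := by
  obtain ⟨θ, α, h1, h2⟩ := h
  obtain ⟨θ', α', h1', h2'⟩ := h'
  refine ⟨θ.trans θ', α.trans α', fun g => ?_, fun p => ?_⟩
  · change X₃.q (α' (α g)) = θ' (θ (X₁.q g))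
    rw [h1', h1]
  · have h3 : pullback (θ.trans θ') p = pullback θ' (pullback θ p) := Subtype.ext rfl
    rw [h3, h2', h2]
    rfl

theorem ExtEquiv.symm {X₁ : Extension S₁ G₁} {X₂ : Extension S₂ G₂}
    (h : ExtEquiv X₁ X₂) : ExtEquiv X₂ X₁ := by
  obtain ⟨θ, α, h1, h2⟩ := h
  refine ⟨θ.symm, α.symm, fun g => ?_, fun p => ?_⟩
  · rw [θ.eq_symm_apply, ← h1, α.apply_symm_apply]
  · rw [α.eq_symm_apply, ← h2]
    congr 1
    apply Subtype.ext
    ext ρ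
    change (p : CharAlg S₂) _ = (p : CharAlg S₂) ρ
    congr 1
    apply Subtype.ext
    funext e
    exact congrArg (ρ : Idem S₂ → Bool) (Subtype.ext (θ.apply_symm_apply e))

end equivalence

noncomputable def complexify {X : Type*} [TopologicalSpace X] (f : C(X, ℝ)) : C(X, ℂ) :=
  (⟨Complex.ofReal, Complex.continuous_ofReal⟩ : C(ℝ, ℂ)).comp f

/-- A faithful normal unital representation of `C(X)` on a Hilbert space `H`; normal means that it
preserves suprema of bounded increasing nets of real functions. -/
structure FaithfulNormalRep (S H : Type*) [MonoidWithZero S] [NormedAddCommGroup H]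
    [InnerProductSpace ℂ H] [CompleteSpace H] where
  toHom : CharAlg S →⋆ₐ[ℂ] (H →L[ℂ] H)
  injective : Function.Injective toHom
  normal : ∀ (F : Set C(Character S, ℝ)) (f : C(Character S, ℝ)), F.Nonempty →
    DirectedOn (· ≤ ·) F → IsLUB F f → IsLUB ((fun g => toHom (complexify g)) '' F)
      (toHom (complexify f))

section
variable {S G H : Type*} [MonoidWithZero S] [IsBooleanInverseMonoid S]
  [Semigroup G] [IsInverseSemigroup G] [NormedAddCommGroup H] [InnerProductSpace ℂ H]
  [CompleteSpace H] {X : Extension S G}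

/-- The von Neumann algebra `M_q`: the double commutant of `λ_π(G)`. -/
noncomputable def algM (j : OrderSection X) (π : FaithfulNormalRep S H) :
    VonNeumannAlgebra (InteriorTensor π.toHom) :=
  bicommutant (Set.range (lam j π.toHom))

/-- The von Neumann algebra `D_q`: the double commutant of `λ_π(E(G))`. -/
noncomputable def algD (j : OrderSection X) (π : FaithfulNormalRep S H) :
    VonNeumannAlgebra (InteriorTensor π.toHom) :=
  bicommutant (lam j π.toHom '' {g : G | IsIdempotentElem g})
end

universe u

/-- Cartan pairs, bundled. -/
structure CartanPair : Type (u + 1) where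
  H : Type u
  [normedAddCommGroup : NormedAddCommGroup H]
  [innerProductSpace : InnerProductSpace ℂ H]
  [completeSpace : CompleteSpace H]
  M : VonNeumannAlgebra H
  D : VonNeumannAlgebra H
  isCartanPair : IsCartanPair M D

attribute [instance] CartanPair.normedAddCommGroup CartanPair.innerProductSpace
  CartanPair.completeSpace

/-- Extensions of Cartan inverse monoids, bundled. -/
structure CartanExtension : Type (u + 1) where
  S : Type u
  G : Type u
  [monoidWithZero : MonoidWithZero S]
  [isCartanInverseMonoid : IsCartanInverseMonoid S]
  [semigroup : Semigroup G]
  [isInverseSemigroup : IsInverseSemigroup G]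
  X : Extension S G

attribute [instance] CartanExtension.monoidWithZero CartanExtension.isCartanInverseMonoid
  CartanExtension.semigroup CartanExtension.isInverseSemigroup

/-- Isomorphism of Cartan pairs. -/
instance cartanPairSetoid : Setoid CartanPair.{u} where
  r P Q := CartanPairIso P.M P.D Q.M Q.D
  iseqv := by
    refine ⟨fun P => ⟨StarAlgEquiv.refl ℂ _, fun x => Iff.rfl⟩, ?_, ?_⟩
    · rintro P Q ⟨θ, hθ⟩
      refine ⟨θ.symm, fun x => ?_⟩
      rw [← hθ, θ.apply_symm_apply]
    · rintro P Q R ⟨θ, hθ⟩ ⟨θ', hθ'⟩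
      exact ⟨θ.trans θ', fun x => (hθ' (θ x)).trans (hθ x)⟩

/-- Equivalence of extensions. -/
instance cartanExtensionSetoid : Setoid CartanExtension.{u} where
  r 𝒳 𝒴 := ExtEquiv 𝒳.X 𝒴.X
  iseqv := ⟨fun 𝒳 => ExtEquiv.refl 𝒳.X, fun h => h.symm, fun h h' => h.trans h'⟩

end CartanExt

open CartanExt
universe u

namespace CartanExt

open Filter Topology
open scoped ComplexOrder

set_option linter.unusedSectionVars false

/-! Shortcuts for instance resolution. -/

noncomputable local instance {H : Type*} [NormedAddCommGroup H] [InnerProductSpace ℂ H] :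
    NormedRing (H →L[ℂ] H) := inferInstance

noncomputable local instance {H : Type*} [NormedAddCommGroup H] [InnerProductSpace ℂ H] :
    Ring (H →L[ℂ] H) := inferInstance

noncomputable local instance {H : Type*} [NormedAddCommGroup H] [InnerProductSpace ℂ H] :
    Semiring (H →L[ℂ] H) := inferInstance

noncomputable local instance {H : Type*} [NormedAddCommGroup H] [InnerProductSpace ℂ H] :
    NonUnitalNonAssocSemiring (H →L[ℂ] H) := inferInstance

noncomputable local instance {H : Type*} [NormedAddCommGroup H] [InnerProductSpace ℂ H] :
    SeminormedAddCommGroup (H →L[ℂ] H) := inferInstance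

noncomputable local instance {H : Type*} [NormedAddCommGroup H] [InnerProductSpace ℂ H] :
    Algebra ℂ (H →L[ℂ] H) := inferInstance

noncomputable local instance {H : Type*} [NormedAddCommGroup H] [InnerProductSpace ℂ H] :
    Module ℂ (H →L[ℂ] H) := inferInstance

local instance {H : Type*} [NormedAddCommGroup H] [InnerProductSpace ℂ H] [CompleteSpace H] :
    MulMemClass (VonNeumannAlgebra H) (H →L[ℂ] H) := inferInstance

noncomputable local instance {H : Type*} [NormedAddCommGroup H] [InnerProductSpace ℂ H] [CompleteSpace H]
    (A : StarSubalgebra ℂ (H →L[ℂ] H)) : NormedRing A := inferInstance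

noncomputable local instance {H : Type*} [NormedAddCommGroup H] [InnerProductSpace ℂ H] [CompleteSpace H]
    (A : StarSubalgebra ℂ (H →L[ℂ] H)) : Ring A := inferInstance

noncomputable local instance {H : Type*} [NormedAddCommGroup H] [InnerProductSpace ℂ H] [CompleteSpace H]
    (A : StarSubalgebra ℂ (H →L[ℂ] H)) : Semiring A := inferInstance

noncomputable local instance {H : Type*} [NormedAddCommGroup H] [InnerProductSpace ℂ H] [CompleteSpace H]
    (A : StarSubalgebra ℂ (H →L[ℂ] H)) : NonUnitalNonAssocSemiring A := inferInstance

noncomputable local instance {H : Type*} [NormedAddCommGroup H] [InnerProductSpace ℂ H] [CompleteSpace H]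
    (A : StarSubalgebra ℂ (H →L[ℂ] H)) : SeminormedAddCommGroup A := inferInstance

noncomputable local instance {H : Type*} [NormedAddCommGroup H] [InnerProductSpace ℂ H] [CompleteSpace H]
    (A : StarSubalgebra ℂ (H →L[ℂ] H)) : Algebra ℂ A := inferInstance

noncomputable local instance {H : Type*} [NormedAddCommGroup H] [InnerProductSpace ℂ H] [CompleteSpace H]
    (A : StarSubalgebra ℂ (H →L[ℂ] H)) : Module ℂ A := inferInstance

section weakLimits
variable {H : Type*} [NormedAddCommGroup H] [InnerProductSpace ℂ H] [CompleteSpace H]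

/-- Convergence in the weak operator topology. -/
def WTendsto {ι : Type*} (F : ι → H →L[ℂ] H) (l : Filter ι) (x : H →L[ℂ] H) : Prop :=
  ∀ ξ η : H, Tendsto (fun i => inner ℂ ξ (F i η)) l (𝓝 (inner ℂ ξ (x η)))

theorem ext_inner_op {x y : H →L[ℂ] H} (h : ∀ ξ η : H, inner ℂ ξ (x η) = inner ℂ ξ (y η)) :
    x = y := by
  ext η
  exact ext_inner_left ℂ fun ξ => h ξ η

theorem inner_star_left (x : H →L[ℂ] H) (ξ η : H) :
    inner ℂ (star x ξ) η = inner ℂ ξ (x η) := by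
  rw [ContinuousLinearMap.star_eq_adjoint, ContinuousLinearMap.adjoint_inner_left]

theorem inner_star_right (x : H →L[ℂ] H) (ξ η : H) :
    inner ℂ ξ (star x η) = inner ℂ (x ξ) η := by
  rw [ContinuousLinearMap.star_eq_adjoint, ContinuousLinearMap.adjoint_inner_right]

variable {ι : Type*} {l : Filter ι} {F F' : ι → H →L[ℂ] H} {x x' : H →L[ℂ] H}

theorem wTendsto_const (x : H →L[ℂ] H) : WTendsto (fun _ : ι => x) l x :=
  fun _ _ => tendsto_const_nhds

theorem WTendsto.unique [l.NeBot] (h : WTendsto F l x) (h' : WTendsto F l x') : x = x' :=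
  ext_inner_op fun ξ η => tendsto_nhds_unique (h ξ η) (h' ξ η)

theorem WTendsto.sub (h : WTendsto F l x) (h' : WTendsto F' l x') :
    WTendsto (fun i => F i - F' i) l (x - x') := fun ξ η => by
  simpa [inner_sub_right] using (h ξ η).sub (h' ξ η)

theorem WTendsto.mul_left (h : WTendsto F l x) (t : H →L[ℂ] H) :
    WTendsto (fun i => t * F i) l (t * x) := fun ξ η => by
  simpa [inner_star_left] using h (star t ξ) η

theorem WTendsto.mul_right (h : WTendsto F l x) (t : H →L[ℂ] H) :
    WTendsto (fun i => F i * t) l (x * t) := fun ξ η => by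
  simpa using h ξ (t η)

theorem WTendsto.star (h : WTendsto F l x) : WTendsto (fun i => star (F i)) l (star x) :=
  fun ξ η => by
  have := (Complex.continuous_conj.tendsto _).comp (h η ξ)
  simp only [Function.comp_def, inner_conj_symm] at this
  simpa [inner_star_right] using this

theorem WTendsto.congr' (h : WTendsto F l x) (h' : F =ᶠ[l] F') : WTendsto F' l x :=
  fun ξ η => (h ξ η).congr' (h'.mono fun i hi => by simp only [hi])

theorem WTendsto.mem [l.NeBot] (M : VonNeumannAlgebra H) (h : WTendsto F l x)
    (hF : ∀ᶠ i in l, F i ∈ M) : x ∈ M := by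
  rw [← VonNeumannAlgebra.commutant_commutant M, VonNeumannAlgebra.mem_commutant_iff]
  intro t ht
  rw [VonNeumannAlgebra.mem_commutant_iff] at ht
  refine WTendsto.unique (h.mul_left t) ((h.mul_right t).congr' ?_)
  filter_upwards [hF] with i hi
  exact ht _ hi

theorem le_iff_inner {x y : H →L[ℂ] H} :
    x ≤ y ↔ ∀ ξ, 0 ≤ inner ℂ ξ ((y - x) ξ) := by
  rw [ContinuousLinearMap.le_def, ContinuousLinearMap.isPositive_iff_complex]
  refine forall_congr' fun ξ => ?_
  rw [← inner_conj_symm, Complex.le_def, Complex.ext_iff]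
  generalize inner ℂ ξ ((y - x) ξ) = z
  simp only [RCLike.re_to_complex, Complex.conj_re, Complex.conj_im, Complex.ofReal_re,
    Complex.ofReal_im, Complex.zero_re, Complex.zero_im, true_and]
  constructor
  · rintro ⟨h1, h2⟩; exact ⟨h2, by linarith⟩
  · rintro ⟨h1, h2⟩; exact ⟨by linarith, h1⟩

theorem WTendsto.le [l.NeBot] (h : WTendsto F l x) {y : H →L[ℂ] H} (hF : ∀ᶠ i in l, F i ≤ y) :
    x ≤ y := by
  rw [le_iff_inner]
  intro ξ
  refine ge_of_tendsto (((wTendsto_const y).sub h) ξ ξ) ?_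
  filter_upwards [hF] with i hi
  exact le_iff_inner.1 hi ξ

theorem WTendsto.ge [l.NeBot] (h : WTendsto F l x) {y : H →L[ℂ] H} (hF : ∀ᶠ i in l, y ≤ F i) :
    y ≤ x := by
  rw [le_iff_inner]
  intro ξ
  refine ge_of_tendsto ((h.sub (wTendsto_const y)) ξ ξ) ?_
  filter_upwards [hF] with i hi
  exact le_iff_inner.1 hi ξ

/-- The closed balls of `B(H)` are compact in the weak operator topology. -/
theorem exists_wTendsto (𝒰 : Ultrafilter ι) (F : ι → H →L[ℂ] H) (C : ℝ)
    (hF : ∀ᶠ i in (𝒰 : Filter ι), ‖F i‖ ≤ C) : ∃ x, WTendsto F 𝒰 x := by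
  have key : ∀ ξ η : H, ∃ z : ℂ, ‖z‖ ≤ C * ‖ξ‖ * ‖η‖ ∧
      Tendsto (fun i => inner ℂ ξ (F i η)) (𝒰 : Filter ι) (𝓝 z) := by
    intro ξ η
    have hc := isCompact_closedBall (0 : ℂ) (C * ‖ξ‖ * ‖η‖)
    obtain ⟨z, hz, h⟩ := hc.ultrafilter_le_nhds (𝒰.map fun i => inner ℂ ξ (F i η)) (by
      rw [le_principal_iff]
      change ∀ᶠ i in (𝒰 : Filter ι), _
      filter_upwards [hF] with i hi
      rw [mem_closedBall_zero_iff]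
      calc ‖inner ℂ ξ (F i η)‖ ≤ ‖ξ‖ * ‖F i η‖ := norm_inner_le_norm _ _
        _ ≤ ‖ξ‖ * (C * ‖η‖) := by
          gcongr
          exact (F i).le_of_opNorm_le hi η
        _ = _ := by ring)
    exact ⟨z, by simpa using hz, h⟩
  choose B hB1 hB2 using key
  have uniq : ∀ {f : ι → ℂ} {a b : ℂ}, Tendsto f (𝒰 : Filter ι) (𝓝 a) →
      Tendsto f (𝒰 : Filter ι) (𝓝 b) → a = b := fun h h' => tendsto_nhds_unique h h'
  let L : H →ₗ⋆[ℂ] H →ₗ[ℂ] ℂ := LinearMap.mk₂'ₛₗ (starRingEnd ℂ) (RingHom.id ℂ) B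
    (fun ξ ξ' η => uniq (hB2 _ _) (by
      simpa [inner_add_left] using (hB2 ξ η).add (hB2 ξ' η)))
    (fun c ξ η => uniq (hB2 _ _) (by
      simpa [inner_smul_left, mul_comm] using (hB2 ξ η).const_mul ((starRingEnd ℂ) c)))
    (fun ξ η η' => uniq (hB2 _ _) (by
      simpa [inner_add_right] using (hB2 ξ η).add (hB2 ξ η')))
    (fun c ξ η => uniq (hB2 _ _) (by
      simpa [inner_smul_right] using (hB2 ξ η).const_mul c))
  let L' : H →L⋆[ℂ] H →L[ℂ] ℂ := L.mkContinuous₂ C hB1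
  refine ⟨star (InnerProductSpace.continuousLinearMapOfBilin L'), fun ξ η => ?_⟩
  rw [inner_star_right, InnerProductSpace.continuousLinearMapOfBilin_apply]
  exact hB2 ξ η

theorem inner_sq_le {T : H →L[ℂ] H} (hT : 0 ≤ T) (ξ η : H) :
    ‖inner ℂ ξ (T η)‖ ^ 2 ≤ (inner ℂ ξ (T ξ)).re * (inner ℂ η (T η)).re := by
  obtain ⟨a, rfl⟩ := CStarAlgebra.nonneg_iff_eq_star_mul_self.1 hT
  have h : ∀ ξ η : H, inner ℂ ξ ((star a * a) η) = inner ℂ (a ξ) (a η) := fun ξ η => by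
    rw [mul_apply_eq_comp, inner_star_right]
  rw [h, h, h]
  have h1 : ∀ ξ : H, (inner ℂ (a ξ) (a ξ)).re = ‖a ξ‖ ^ 2 := fun ξ =>
    inner_self_eq_norm_sq (𝕜 := ℂ) (a ξ)
  rw [h1, h1, ← mul_pow]
  gcongr
  exact norm_inner_le_norm _ _

theorem isLUB_of_inner {F : Set (H →L[ℂ] H)} {x : H →L[ℂ] H} (h1 : ∀ y ∈ F, y ≤ x)
    (h2 : ∀ ξ, ∀ ε > 0, ∃ y ∈ F, (inner ℂ ξ ((x - y) ξ)).re < ε) : IsLUB F x := by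
  refine ⟨h1, fun z hz => le_iff_inner.2 fun ξ => ?_⟩
  rw [Complex.le_def]
  constructor
  · refine le_of_forall_pos_lt_add fun ε hε => ?_
    obtain ⟨y, hy, h⟩ := h2 ξ ε hε
    have h3 := (Complex.le_def.1 (le_iff_inner.1 (hz hy) ξ)).1
    have h4 : z - x = (z - y) - (x - y) := by abel
    rw [h4, sub_apply (z - y), inner_sub_right, Complex.sub_re]
    simp only [Complex.zero_re] at *
    linarith
  · obtain ⟨y, hy, h⟩ := h2 ξ 1 one_pos
    have h3 := (Complex.le_def.1 (le_iff_inner.1 (hz hy) ξ)).2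
    have h5 := (Complex.le_def.1 (le_iff_inner.1 (h1 y hy) ξ)).2
    have h4 : z - x = (z - y) - (x - y) := by abel
    rw [h4, sub_apply (z - y), inner_sub_right, Complex.sub_im, ← h3, ← h5]
    simp

/-- Bounded increasing nets converge weakly; hence suprema are weak limits. -/
theorem exists_wTendsto_of_directed {F : Set (H →L[ℂ] H)} (hF : F.Nonempty)
    (hd : DirectedOn (· ≤ ·) F) {z : H →L[ℂ] H} (hz : ∀ y ∈ F, y ≤ z) :
    ∃ x, IsLUB F x ∧ ∃ 𝒰 : Ultrafilter F, (∀ y : F, ∀ᶠ i in (𝒰 : Filter F), y ≤ i) ∧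
      WTendsto (fun i : F => (i : H →L[ℂ] H)) 𝒰 x := by
  have : Nonempty F := hF.to_subtype
  have : IsDirectedOrder F := directedOn_iff_isDirectedOrder.1 hd
  set 𝒰 : Ultrafilter F := Ultrafilter.of atTop
  have hu : (𝒰 : Filter F) ≤ atTop := Ultrafilter.of_le atTop
  have hge : ∀ y : F, ∀ᶠ i in (𝒰 : Filter F), y ≤ i := fun y => hu (eventually_ge_atTop y)
  obtain ⟨y0, hy0⟩ := hF
  have hb : ∀ᶠ i : F in (𝒰 : Filter F), ‖(i : H →L[ℂ] H)‖ ≤ ‖z - y0‖ + ‖y0‖ := by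
    filter_upwards [hge ⟨y0, hy0⟩] with i hi
    have h1 : (0 : H →L[ℂ] H) ≤ i - y0 := sub_nonneg.2 hi
    have h2 : (i : H →L[ℂ] H) - y0 ≤ z - y0 := sub_le_sub_right (hz i i.2) _
    have h3 := CStarAlgebra.norm_le_norm_of_nonneg_of_le h1 h2
    calc ‖(i : H →L[ℂ] H)‖ = ‖(i - y0) + y0‖ := by rw [sub_add_cancel]
      _ ≤ _ := (norm_add_le _ _).trans (by gcongr)
  obtain ⟨x, hx⟩ := exists_wTendsto 𝒰 (fun i : F => (i : H →L[ℂ] H)) _ hb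
  refine ⟨x, ⟨fun y hy => hx.ge (hge ⟨y, hy⟩), fun w hw => hx.le ?_⟩, 𝒰, hge, hx⟩
  exact Eventually.of_forall fun i => hw i.2

theorem isLUB_iff_inner {F : Set (H →L[ℂ] H)} (hF : F.Nonempty) (hd : DirectedOn (· ≤ ·) F)
    {x : H →L[ℂ] H} : IsLUB F x ↔ (∀ y ∈ F, y ≤ x) ∧
      ∀ ξ, ∀ ε > 0, ∃ y ∈ F, (inner ℂ ξ ((x - y) ξ)).re < ε := by
  refine ⟨fun h => ⟨fun y hy => h.1 hy, fun ξ ε hε => ?_⟩, fun h => isLUB_of_inner h.1 h.2⟩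
  obtain ⟨x', hx', 𝒰, -, h2⟩ := exists_wTendsto_of_directed hF hd (fun y hy => h.1 hy)
  obtain rfl := h.unique hx'
  have h3 := ((wTendsto_const x).sub h2) ξ ξ
  rw [sub_self, zero_apply, inner_zero_right] at h3
  have h4 := (Complex.continuous_re.tendsto _).comp h3
  rw [Complex.zero_re] at h4
  obtain ⟨i, hi⟩ := (h4.eventually (gt_mem_nhds hε)).exists
  exact ⟨i, i.2, hi⟩

theorem IsLUB.mem_vN (M : VonNeumannAlgebra H) {F : Set (H →L[ℂ] H)} (hF : F.Nonempty)
    (hd : DirectedOn (· ≤ ·) F) {x : H →L[ℂ] H} (h : IsLUB F x) (hM : ∀ y ∈ F, y ∈ M) : x ∈ M := by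
  obtain ⟨x', hx', 𝒰, -, h2⟩ := exists_wTendsto_of_directed hF hd (fun y hy => h.1 hy)
  obtain rfl := h.unique hx'
  exact h2.mem M (Eventually.of_forall fun i => hM i i.2)

end weakLimits

section projections
variable {H : Type*} [NormedAddCommGroup H] [InnerProductSpace ℂ H] [CompleteSpace H]

theorem mem_vN_iff (M : VonNeumannAlgebra H) {x : H →L[ℂ] H} :
    x ∈ M ↔ ∀ t ∈ M.commutant, t * x = x * t := by
  conv_lhs => rw [← VonNeumannAlgebra.commutant_commutant M]
  exact VonNeumannAlgebra.mem_commutant_iff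

/-- The projection onto the closed subspace `K` belongs to `M` if `M'` leaves `K` invariant. -/
theorem starProjection_mem (M : VonNeumannAlgebra H) (K : Submodule ℂ H) [K.HasOrthogonalProjection]
    (hK : ∀ t ∈ M.commutant, ∀ ξ ∈ K, t ξ ∈ K) : K.starProjection ∈ M := by
  rw [mem_vN_iff]
  have h1 : ∀ t ∈ M.commutant, K.starProjection * t * K.starProjection = t * K.starProjection := by
    intro t ht
    ext ξ
    exact Submodule.starProjection_eq_self_iff.2 (hK t ht _ (Submodule.starProjection_apply_mem K ξ))
  intro t ht
  have h2 := h1 t ht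
  have h3 := congrArg star (h1 _ (star_mem ht))
  have h4 : star K.starProjection = K.starProjection :=
    (isSelfAdjoint_starProjection K).star_eq
  simp only [star_mul, h4, star_star] at h3
  rw [← h2, ← h3, mul_assoc]
  simp only [mul_assoc, (isStarProjection_starProjection (U := K)).isIdempotentElem.eq]

/-- Suprema of projections in a von Neumann algebra. -/
theorem exists_sup_projection (M : VonNeumannAlgebra H) (P : Set (H →L[ℂ] H)) (hP : ∀ p ∈ P, p ∈ M) :
    ∃ e ∈ M, IsStarProjection e ∧ (∀ p ∈ P, e * p = p) ∧
      ∀ y : H →L[ℂ] H, (∀ p ∈ P, y * p = 0) → y * e = 0 := by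
  set K : Submodule ℂ H := (Submodule.span ℂ {ξ | ∃ p ∈ P, ∃ η, ξ = p η}).topologicalClosure
  have : CompleteSpace K :=
    (Submodule.isClosed_topologicalClosure _).completeSpace_coe
  have hsub : ∀ p ∈ P, ∀ η, p η ∈ K := fun p hp η =>
    Submodule.le_topologicalClosure _ (Submodule.subset_span ⟨p, hp, η, rfl⟩)
  have hind : ∀ (t : H →L[ℂ] H) (L : Submodule ℂ H), IsClosed (L : Set H) →
      (∀ p ∈ P, ∀ η, t (p η) ∈ L) → ∀ ξ ∈ K, t ξ ∈ L := by
    intro t L hL h ξ hξ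
    have : K ≤ L.comap (t : H →ₗ[ℂ] H) := by
      refine Submodule.topologicalClosure_minimal _ (Submodule.span_le.2 ?_) (hL.preimage t.continuous)
      rintro _ ⟨p, hp, η, rfl⟩
      exact h p hp η
    exact this hξ
  refine ⟨K.starProjection, starProjection_mem M K fun t ht ξ hξ => ?_,
    isStarProjection_starProjection, fun p hp => ?_, fun y hy => ?_⟩
  · refine hind t K (Submodule.isClosed_topologicalClosure _) (fun p hp η => ?_) ξ hξ
    have := VonNeumannAlgebra.mem_commutant_iff.1 ht p (hP p hp)
    have h2 : t (p η) = p (t η) := (congrArg (fun z : H →L[ℂ] H => z η) this).symm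
    rw [h2]
    exact hsub p hp _
  · ext η
    exact Submodule.starProjection_eq_self_iff.2 (hsub p hp η)
  · ext η
    refine (Submodule.mem_bot ℂ).1 (hind y ⊥ isClosed_singleton (fun p hp η => ?_) _
      (Submodule.starProjection_apply_mem K η))
    exact congrArg (fun z : H →L[ℂ] H => z η) (hy p hp)

end projections

section diagonal
variable {ι : Type*} {E : ι → Type*} [∀ i, NormedAddCommGroup (E i)]
  [∀ i, InnerProductSpace ℂ (E i)]

theorem sum_sq_le_norm_sq (f : lp E 2) (s : Finset ι) : ∑ i ∈ s, ‖f i‖ ^ 2 ≤ ‖f‖ ^ 2 := by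
  have := lp.sum_rpow_le_norm_rpow (p := 2) (by norm_num) f s
  simpa using this

theorem norm_sq_le_of_sum (f : lp E 2) {C : ℝ} (hC : 0 ≤ C)
    (h : ∀ s : Finset ι, ∑ i ∈ s, ‖f i‖ ^ 2 ≤ C ^ 2) : ‖f‖ ≤ C := by
  refine lp.norm_le_of_forall_sum_le (p := 2) (by norm_num) hC fun s => ?_
  simpa using h s

/-- The diagonal operator on a Hilbert sum with uniformly bounded entries. -/
noncomputable def diagOp (T : ∀ i, E i →L[ℂ] E i) (C : ℝ) (hT : ∀ i, ‖T i‖ ≤ C) :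
    lp E 2 →L[ℂ] lp E 2 :=
  have hb : ∀ (f : lp E 2) (s : Finset ι), ∑ i ∈ s, ‖T i (f i)‖ ^ 2 ≤ (|C| * ‖f‖) ^ 2 := by
    intro f s
    calc ∑ i ∈ s, ‖T i (f i)‖ ^ 2 ≤ ∑ i ∈ s, |C| ^ 2 * ‖f i‖ ^ 2 := by
          refine Finset.sum_le_sum fun i _ => ?_
          rw [← mul_pow]
          gcongr
          exact (T i).le_of_opNorm_le ((hT i).trans (le_abs_self C)) _
      _ = |C| ^ 2 * ∑ i ∈ s, ‖f i‖ ^ 2 := by rw [Finset.mul_sum]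
      _ ≤ _ := by
        rw [mul_pow]
        gcongr
        exact sum_sq_le_norm_sq f s
  LinearMap.mkContinuous
    { toFun := fun f => (⟨fun i => T i (f i), by
        refine memℓp_gen' (p := 2) (C := (|C| * ‖f‖) ^ 2) fun s => ?_
        simpa using hb f s⟩ : lp E 2)
      map_add' := fun f g => by ext i; exact map_add (T i) _ _
      map_smul' := fun c f => by ext i; exact map_smul (T i) c _ } |C| fun f =>
    norm_sq_le_of_sum _ (by positivity) fun s => hb f s

end diagonal

section density
variable {H : Type*} [NormedAddCommGroup H] [InnerProductSpace ℂ H] [CompleteSpace H]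

/-- The amplification of an operator to `ℓ²(ι, H)`. -/
noncomputable def amp (ι : Type*) (x : H →L[ℂ] H) :
    lp (fun _ : ι => H) 2 →L[ℂ] lp (fun _ : ι => H) 2 :=
  diagOp (fun _ => x) ‖x‖ fun _ => le_rfl

theorem amp_apply {ι : Type*} (x : H →L[ℂ] H) (f : lp (fun _ : ι => H) 2) (i : ι) :
    amp ι x f i = x (f i) := rfl

theorem star_amp {ι : Type*} (x : H →L[ℂ] H) : star (amp ι x) = amp ι (star x) := by
  symm
  rw [ContinuousLinearMap.star_eq_adjoint (amp ι x), ContinuousLinearMap.eq_adjoint_iff]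
  intro f g
  rw [lp.inner_eq_tsum, lp.inner_eq_tsum]
  refine tsum_congr fun i => ?_
  rw [amp_apply, amp_apply, inner_star_left]

/-- The coordinate map of `ℓ²(ι, H)`. -/
noncomputable def coord {ι : Type*} (i : ι) : lp (fun _ : ι => H) 2 →L[ℂ] H :=
  LinearMap.mkContinuous
    { toFun := fun f => f i
      map_add' := fun f g => rfl
      map_smul' := fun c f => rfl } 1 fun f => by
    rw [one_mul]
    exact lp.norm_apply_le_norm (by norm_num) f i

/-- The inclusion of a coordinate into `ℓ²(ι, H)`. -/
noncomputable def incl {ι : Type*} [DecidableEq ι] (i : ι) : H →L[ℂ] lp (fun _ : ι => H) 2 :=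
  LinearMap.mkContinuous
    { toFun := fun ξ => lp.single (E := fun _ : ι => H) 2 i ξ
      map_add' := fun f g => lp.single_add (E := fun _ : ι => H) 2 i f g
      map_smul' := fun c f => lp.single_smul (E := fun _ : ι => H) 2 i c f } 1 fun f => by
    rw [one_mul]
    exact (lp.norm_single (E := fun _ : ι => H) (p := 2) (by norm_num) i f).le

theorem incl_apply {ι : Type*} [DecidableEq ι] (i k : ι) (ξ : H) :
    incl i ξ k = if k = i then ξ else 0 := by
  change lp.single (E := fun _ : ι => H) 2 i ξ k = _
  rw [lp.single_apply, Pi.single_apply]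

theorem hasSum_incl {ι : Type*} [DecidableEq ι] (f : lp (fun _ : ι => H) 2) :
    HasSum (fun k => incl k (f k)) f :=
  lp.hasSum_single (E := fun _ : ι => H) (p := 2) (by norm_num) f

theorem amp_incl {ι : Type*} [DecidableEq ι] (x : H →L[ℂ] H) (i : ι) (ξ : H) :
    amp ι x (incl i ξ) = incl i (x ξ) := by
  ext k
  rw [amp_apply, incl_apply, incl_apply]
  split_ifs <;> simp

/-- The von Neumann density theorem, for the `σ`-strong topology. -/
theorem exists_amp_sub_lt {ι : Type*} (A : StarSubalgebra ℂ (H →L[ℂ] H)) {x : H →L[ℂ] H}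
    (hx : ∀ t, (∀ a ∈ A, a * t = t * a) → x * t = t * x) (f : lp (fun _ : ι => H) 2) {ε : ℝ}
    (hε : 0 < ε) : ∃ a ∈ A, ‖amp ι x f - amp ι a f‖ < ε := by
  classical
  let L : (H →L[ℂ] H) →ₗ[ℂ] lp (fun _ : ι => H) 2 :=
    { toFun := fun a => amp ι a f
      map_add' := fun a b => by ext i; rfl
      map_smul' := fun c a => by ext i; rfl }
  set K : Submodule ℂ (lp (fun _ : ι => H) 2) :=
    (A.toSubalgebra.toSubmodule.map L).topologicalClosure
  have : CompleteSpace K := (Submodule.isClosed_topologicalClosure _).completeSpace_coe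
  have hK : ∀ a ∈ A, ∀ g ∈ K, amp ι a g ∈ K := by
    intro a ha g hg
    have : K ≤ K.comap (amp ι a : lp (fun _ : ι => H) 2 →ₗ[ℂ] lp (fun _ : ι => H) 2) := by
      refine Submodule.topologicalClosure_minimal _ ?_
        ((Submodule.isClosed_topologicalClosure _).preimage (amp ι a).continuous)
      rintro _ ⟨b, hb, rfl⟩
      refine Submodule.le_topologicalClosure _ ⟨a * b, A.mul_mem ha hb, ?_⟩
      ext i
      rfl
    exact this hg
  set P := K.starProjection
  have hP : star P = P := (isSelfAdjoint_starProjection K).star_eq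
  have h1 : ∀ a ∈ A, P * amp ι a * P = amp ι a * P := by
    intro a ha
    refine ContinuousLinearMap.ext fun g => ?_
    exact Submodule.starProjection_eq_self_iff.2 (hK a ha _ (Submodule.starProjection_apply_mem K g))
  have h2 : ∀ a ∈ A, amp ι a * P = P * amp ι a := by
    intro a ha
    have h3 := congrArg star (h1 (star a) (star_mem ha))
    simp only [star_mul, hP, star_amp, star_star] at h3
    rw [← h1 a ha, mul_assoc, ← h3]
  have h3 : ∀ i k : ι, x * (coord i ∘L P ∘L incl k) = (coord i ∘L P ∘L incl k) * x := by
    intro i k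
    refine hx _ fun a ha => ?_
    ext ξ
    have h4 := congrArg (fun z : lp (fun _ : ι => H) 2 →L[ℂ] lp (fun _ : ι => H) 2 =>
      coord i (z (incl k ξ))) (h2 a ha)
    simp only [mul_apply_eq_comp, amp_incl] at h4
    exact h4
  have hfK : P f = f := by
    refine Submodule.starProjection_eq_self_iff.2 (Submodule.le_topologicalClosure _ ⟨1, A.one_mem, ?_⟩)
    ext i
    rfl
  have h5 : P (amp ι x f) = amp ι x f := by
    ext i
    have s2 := (x ∘L coord i ∘L P).hasSum (hasSum_incl f)
    have s4 := (coord i ∘L P).hasSum (hasSum_incl (amp ι x f))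
    have h6 : ∀ k, (x ∘L coord i ∘L P) (incl k (f k)) = (coord i ∘L P) (incl k (amp ι x f k)) :=
      fun k => congrArg (fun z : H →L[ℂ] H => z (f k)) (h3 i k)
    simp only [h6] at s2
    have h7 := s4.unique s2
    rw [ContinuousLinearMap.comp_apply, ContinuousLinearMap.comp_apply,
      ContinuousLinearMap.comp_apply, hfK] at h7
    exact h7
  have h8 : amp ι x f ∈ K := Submodule.starProjection_eq_self_iff.1 h5
  obtain ⟨_, ⟨a, ha, rfl⟩, h⟩ := Metric.mem_closure_iff.1 h8 ε hε
  exact ⟨a, ha, by rwa [dist_eq_norm] at h⟩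

theorem exists_forall_amp_sub_lt {ι κ : Type*} [Finite κ] (A : StarSubalgebra ℂ (H →L[ℂ] H))
    {x : H →L[ℂ] H} (hx : ∀ t, (∀ a ∈ A, a * t = t * a) → x * t = t * x)
    (f : κ → lp (fun _ : ι => H) 2) {ε : ℝ} (hε : 0 < ε) :
    ∃ a ∈ A, ∀ k, ‖amp ι x (f k) - amp ι a (f k)‖ < ε := by
  classical
  cases nonempty_fintype κ
  let g : lp (fun _ : κ × ι => H) 2 := ⟨fun p => f p.1 p.2, by
    refine memℓp_gen' (p := 2) (C := ∑ k, ‖f k‖ ^ 2) fun s => ?_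
    have h1 : ∑ p ∈ s, ‖f p.1 p.2‖ ^ 2 ≤ ∑ p ∈ Finset.univ ×ˢ s.image Prod.snd, ‖f p.1 p.2‖ ^ 2 := by
      refine Finset.sum_le_sum_of_subset_of_nonneg (fun p hp => ?_) fun _ _ _ => by positivity
      exact Finset.mem_product.2 ⟨Finset.mem_univ _, Finset.mem_image_of_mem _ hp⟩
    rw [Finset.sum_product] at h1
    have h2 := h1.trans (Finset.sum_le_sum fun k _ => sum_sq_le_norm_sq (f k) _)
    simpa using h2⟩
  obtain ⟨a, ha, h⟩ := exists_amp_sub_lt A hx g hε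
  refine ⟨a, ha, fun k => lt_of_le_of_lt ?_ h⟩
  refine norm_sq_le_of_sum _ (norm_nonneg _) fun s => ?_
  have := sum_sq_le_norm_sq (amp (κ × ι) x g - amp (κ × ι) a g)
    (s.map ⟨fun i => (k, i), fun i j hij => congrArg Prod.snd hij⟩)
  rw [Finset.sum_map] at this
  exact this

/-- The double commutant lies in the `σ`-weak closure. -/
theorem mem_sigmaWeak_closure (A : StarSubalgebra ℂ (H →L[ℂ] H)) {x : H →L[ℂ] H}
    (hx : ∀ t, (∀ a ∈ A, a * t = t * a) → x * t = t * x) :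
    x ∈ @closure _ (sigmaWeakTopology H) (A : Set (H →L[ℂ] H)) := by
  letI := sigmaWeakTopology H
  rw [mem_closure_iff_nhds]
  intro t ht
  rw [nhds_iInf, Filter.mem_iInf] at ht
  obtain ⟨I, hI, V, hV, rfl⟩ := ht
  have hfin : Finite I := hI
  simp only [nhds_induced, Filter.mem_comap] at hV
  choose W hW hWV using hV
  choose ε hε hεW using fun i => Metric.mem_nhds_iff.1 (hW i)
  obtain ⟨C, hC⟩ : ∃ C, ∀ i : I, ‖i.1.1‖ ≤ C := by
    obtain ⟨C, hC⟩ := (Set.finite_range fun i : I => ‖i.1.1‖).bddAbove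
    exact ⟨C, fun i => hC ⟨i, rfl⟩⟩
  obtain ⟨δ, hδ, hδε⟩ : ∃ δ > 0, ∀ i : I, δ ≤ ε i := by
    obtain h | h := isEmpty_or_nonempty I
    · exact ⟨1, one_pos, fun i => h.elim i⟩
    · obtain ⟨i, hi⟩ := Finite.exists_min ε
      exact ⟨ε i, hε i, hi⟩
  obtain ⟨a, ha, h⟩ := exists_forall_amp_sub_lt A hx (fun i : I => i.1.2)
    (ε := δ / (|C| + 1)) (by positivity)
  refine ⟨a, Set.mem_iInter.2 fun i => hWV i (hεW i ?_), ha⟩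
  have e : ∀ y : H →L[ℂ] H, ∑' n, inner ℂ (i.1.1 n) (y (i.1.2 n)) = inner ℂ i.1.1 (amp ℕ y i.1.2) :=
    fun y => (lp.inner_eq_tsum (G := fun _ : ℕ => H) (𝕜 := ℂ) i.1.1 (amp ℕ y i.1.2)).symm
  rw [Metric.mem_ball]
  beta_reduce
  rw [e, e, dist_eq_norm, norm_sub_rev, ← inner_sub_right]
  calc ‖inner ℂ i.1.1 (amp ℕ x i.1.2 - amp ℕ a i.1.2)‖ ≤ ‖i.1.1‖ * ‖amp ℕ x i.1.2 - amp ℕ a i.1.2‖ :=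
        norm_inner_le_norm _ _
    _ ≤ |C| * (δ / (|C| + 1)) := by
      gcongr
      · exact (hC i).trans (le_abs_self C)
      · exact (h i).le
    _ < (|C| + 1) * (δ / (|C| + 1)) := by
      have : 0 < δ / (|C| + 1) := by positivity
      nlinarith
    _ = δ := by field_simp
    _ ≤ ε i := hδε i

end density

section spectral
variable {H : Type*} [NormedAddCommGroup H] [InnerProductSpace ℂ H] [CompleteSpace H]

theorem conj_nonneg {x : H →L[ℂ] H} (hx : 0 ≤ x) (y : H →L[ℂ] H) : 0 ≤ star y * x * y :=
  star_left_conjugate_nonneg hx y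

theorem mul_eq_zero_of_conj {x y : H →L[ℂ] H} (hx : 0 ≤ x) (h : star y * x * y = 0) : x * y = 0 := by
  obtain ⟨a, rfl⟩ := CStarAlgebra.nonneg_iff_eq_star_mul_self.1 hx
  have h1 : star (a * y) * (a * y) = 0 := by rw [star_mul, ← h]; simp only [mul_assoc]
  rw [CStarRing.star_mul_self_eq_zero_iff] at h1
  rw [mul_assoc, h1, mul_zero]

theorem mul_eq_zero_of_le {x z y : H →L[ℂ] H} (hx : 0 ≤ x) (hxz : x ≤ z) (h : star y * z * y = 0) :
    x * y = 0 := by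
  refine mul_eq_zero_of_conj hx (le_antisymm ?_ (conj_nonneg hx y))
  rw [← h]
  exact star_left_conjugate_le_conjugate hxz y

theorem proj_nonneg {p : H →L[ℂ] H} (hp : IsStarProjection p) : 0 ≤ p := by
  have := star_mul_self_nonneg p
  rwa [hp.isSelfAdjoint.star_eq, hp.isIdempotentElem.eq] at this

theorem one_sub_proj {p : H →L[ℂ] H} (hp : IsStarProjection p) : IsStarProjection (1 - p) :=
  hp.one_sub

theorem proj_le_one {p : H →L[ℂ] H} (hp : IsStarProjection p) : p ≤ 1 :=
  sub_nonneg.1 (proj_nonneg (one_sub_proj hp))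

theorem proj_le_iff {p q : H →L[ℂ] H} (hp : IsStarProjection p) (hq : IsStarProjection q) :
    p ≤ q ↔ q * p = p := by
  constructor
  · intro h
    have h1 : p * (1 - q) = 0 := by
      refine mul_eq_zero_of_le (proj_nonneg hp) h ?_
      rw [mul_assoc, mul_sub, mul_one, hq.isIdempotentElem.eq, sub_self, mul_zero]
    rw [mul_sub, mul_one, sub_eq_zero] at h1
    have := congrArg star h1
    rw [star_mul, hp.isSelfAdjoint.star_eq, hq.isSelfAdjoint.star_eq] at this
    exact this.symm
  · intro h
    have h2 : p * q = p := by
      have := congrArg star h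
      rwa [star_mul, hp.isSelfAdjoint.star_eq, hq.isSelfAdjoint.star_eq] at this
    have h3 : IsStarProjection (q - p) := by
      refine ⟨?_, hq.isSelfAdjoint.sub hp.isSelfAdjoint⟩
      unfold IsIdempotentElem
      rw [mul_sub, sub_mul, sub_mul, hq.isIdempotentElem.eq, hp.isIdempotentElem.eq, h, h2]
      abel
    exact sub_nonneg.1 (proj_nonneg h3)

theorem norm_le_of_nonneg_of_le {x : H →L[ℂ] H} {c : ℝ} (hc : 0 ≤ c) (hx : 0 ≤ x)
    (h : x ≤ algebraMap ℝ _ c) : ‖x‖ ≤ c := by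
  refine (CStarAlgebra.norm_le_norm_of_nonneg_of_le hx h).trans ?_
  refine (norm_algebraMap _ c).le.trans ?_
  rw [Real.norm_of_nonneg hc]
  calc c * ‖(1 : H →L[ℂ] H)‖ ≤ c * 1 := by
        gcongr
        exact ContinuousLinearMap.norm_id_le
    _ = c := mul_one c

/-- If `0 ≤ x ≤ c` then `0 ≤ x - (c/2) p ≤ c/2` for a spectral projection `p` of `x`. -/
theorem exists_dyadic_projection (M : VonNeumannAlgebra H) {x : H →L[ℂ] H} (hxM : x ∈ M) {c : ℝ}
    (hc : 0 < c) (h0 : 0 ≤ x) (h1 : x ≤ algebraMap ℝ _ c) :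
    ∃ p ∈ M, IsStarProjection p ∧ 0 ≤ x - (c / 2) • p ∧ x - (c / 2) • p ≤ algebraMap ℝ _ (c / 2) ∧
      ∀ y, star y * x * y = 0 → p * y = 0 := by
  have hsa : IsSelfAdjoint x := h0.isSelfAdjoint
  have hs0 : ∀ t ∈ spectrum ℝ x, 0 ≤ t := fun t ht => spectrum_nonneg_of_nonneg h0 ht
  have hs1 : ∀ t ∈ spectrum ℝ x, t ≤ c := (le_algebraMap_iff_spectrum_le (a := x)).1 h1
  set h : H →L[ℂ] H := cfc (fun t : ℝ => max (t - c / 2) 0) x with hh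
  set k : H →L[ℂ] H := cfc (fun t : ℝ => max (c / 2 - t) 0) x with hk
  have hh0 : 0 ≤ h := cfc_nonneg fun t _ => le_max_right _ _
  have hk0 : 0 ≤ k := cfc_nonneg fun t _ => le_max_right _ _
  have hh1 : h ≤ algebraMap ℝ _ (c / 2) := cfc_le_algebraMap _ _ _ fun t ht => by
    have := hs1 t ht; rw [max_le_iff]; constructor <;> linarith
  have hk1 : k ≤ algebraMap ℝ _ (c / 2) := cfc_le_algebraMap _ _ _ fun t ht => by
    have := hs0 t ht; rw [max_le_iff]; constructor <;> linarith
  have hhx : h ≤ x := by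
    conv_rhs => rw [← cfc_id ℝ x]
    refine cfc_mono fun t ht => ?_
    have := hs0 t ht
    simp only [id]
    rw [max_le_iff]; constructor <;> linarith
  have hkh : k * h = 0 := by
    rw [hk, hh, ← cfc_mul _ _ x, ← cfc_zero ℝ x]
    congr 1
    ext t
    obtain h | h := le_total t (c / 2)
    · simp [max_eq_right (sub_nonpos.2 h)]
    · simp [max_eq_right (sub_nonpos.2 h)]
  have hsum : x = h - k + algebraMap ℝ _ (c / 2) := by
    rw [hk, hh, ← cfc_sub _ _ x, ← cfc_const (R := ℝ) (c / 2) x, ← cfc_add x (fun t : ℝ => max (t - c / 2) 0 - max (c / 2 - t) 0)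
      (fun _ => c / 2) (by fun_prop) (by fun_prop)]
    conv_lhs => rw [← cfc_id ℝ x]
    congr 1
    ext t
    obtain h | h := le_total t (c / 2)
    · simp [max_eq_right (sub_nonpos.2 h), max_eq_left (sub_nonneg.2 h)]
    · simp [max_eq_right (sub_nonpos.2 h), max_eq_left (sub_nonneg.2 h)]
  have hhM : h ∈ M := by
    rw [mem_vN_iff]
    intro t ht
    have h2 : Commute x t := (VonNeumannAlgebra.mem_commutant_iff.1 ht) x hxM
    exact ((h2.cfc_real _).eq).symm
  obtain ⟨p, hpM, hp, hph, hp0⟩ := exists_sup_projection M {h} (by simpa using hhM)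
  have hph : p * h = h := hph h rfl
  have hp0 : ∀ y : H →L[ℂ] H, y * h = 0 → y * p = 0 := fun y hy => hp0 y (by simpa using hy)
  have hkp : k * p = 0 := hp0 k hkh
  have hpk : p * k = 0 := by
    have := congrArg star hkp
    rwa [star_mul, hp.isSelfAdjoint.star_eq, hk0.isSelfAdjoint.star_eq, star_zero] at this
  have hhp : h * p = h := by
    have := congrArg star hph
    rwa [star_mul, hp.isSelfAdjoint.star_eq, hh0.isSelfAdjoint.star_eq] at this
  have e1 : k ≤ (c / 2) • (1 - p) := by
    have := star_left_conjugate_le_conjugate hk1 (1 - p)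
    rw [(one_sub_proj hp).isSelfAdjoint.star_eq, ← Algebra.commutes, mul_assoc (algebraMap _ _ _),
      (one_sub_proj hp).isIdempotentElem.eq, ← Algebra.smul_def, sub_mul, one_mul, hpk, sub_zero,
      mul_sub, mul_one, hkp, sub_zero] at this
    exact this
  have e2 : h ≤ (c / 2) • p := by
    have := star_left_conjugate_le_conjugate hh1 p
    rw [hp.isSelfAdjoint.star_eq, ← Algebra.commutes, mul_assoc (algebraMap _ _ _),
      hp.isIdempotentElem.eq, ← Algebra.smul_def, hph, hhp] at this
    exact this
  rw [Algebra.algebraMap_eq_smul_one] at hsum ⊢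
  refine ⟨p, hpM, hp, ?_, ?_, fun y hy => ?_⟩
  · have : x - (c / 2) • p = h + ((c / 2) • (1 - p) - k) := by rw [hsum, smul_sub]; abel
    rw [this]
    exact add_nonneg hh0 (sub_nonneg.2 e1)
  · have : x - (c / 2) • p = (c / 2) • (1 : H →L[ℂ] H) - k - ((c / 2) • p - h) := by
      rw [hsum]; abel
    rw [this]
    exact (sub_le_self _ (sub_nonneg.2 e2)).trans (sub_le_self _ hk0)
  · have h3 : h * y = 0 := mul_eq_zero_of_le hh0 hhx hy
    have h4 : star y * h = 0 := by
      have := congrArg star h3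
      rwa [star_mul, hh0.isSelfAdjoint.star_eq, star_zero] at this
    have := congrArg star (hp0 _ h4)
    rwa [star_mul, star_star, hp.isSelfAdjoint.star_eq, star_zero] at this

/-- A closed convex cone contains every `x` with a dyadic expansion in terms of its elements. -/
theorem mem_of_dyadic {E : Type*} [NormedAddCommGroup E] [NormedSpace ℝ E] {Q : ℝ → E → Prop}
    {C : Set E} (hC : IsClosed C) (hC0 : (0 : E) ∈ C) (hCa : ∀ x ∈ C, ∀ y ∈ C, x + y ∈ C)
    (hQ : ∀ c > 0, ∀ x, Q c x → ∃ p, (c / 2) • p ∈ C ∧ Q (c / 2) (x - (c / 2) • p))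
    (hQn : ∀ c > 0, ∀ x, Q c x → ‖x‖ ≤ c) {c : ℝ} (hc : 0 < c) {x : E} (hx : Q c x) : x ∈ C := by
  have key : ∀ n : ℕ, ∃ y ∈ C, Q (c / 2 ^ n) (x - y) := by
    intro n
    induction n with
    | zero => exact ⟨0, hC0, by simpa using hx⟩
    | succ n ih =>
      obtain ⟨y, hy, h⟩ := ih
      obtain ⟨p, hp, h'⟩ := hQ _ (by positivity) _ h
      refine ⟨y + (c / 2 ^ n / 2) • p, hCa _ hy _ hp, ?_⟩
      rw [← sub_sub, pow_succ, ← div_div]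
      exact h'
  rw [← hC.closure_eq, Metric.mem_closure_iff]
  intro ε hε
  obtain ⟨n, hn⟩ := exists_pow_lt_of_lt_one (div_pos hε hc) (one_half_lt_one (α := ℝ))
  obtain ⟨y, hy, h⟩ := key n
  refine ⟨y, hy, ?_⟩
  rw [dist_eq_norm]
  refine (hQn _ (by positivity) _ h).trans_lt ?_
  rw [lt_div_iff₀ hc, one_div, inv_pow] at hn
  rwa [div_eq_mul_inv, mul_comm]

end spectral

section kaplansky
variable {H : Type*} [NormedAddCommGroup H] [InnerProductSpace ℂ H] [CompleteSpace H]

theorem exists_selfAdjoint_norm_sub_lt {ι : Type*} [Finite ι] (A : StarSubalgebra ℂ (H →L[ℂ] H))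
    {y : H →L[ℂ] H} (hy : ∀ t, (∀ a ∈ A, a * t = t * a) → y * t = t * y) (hsa : IsSelfAdjoint y)
    (f : ι → H) {ε : ℝ} (hε : 0 < ε) :
    ∃ a ∈ A, IsSelfAdjoint a ∧ ∀ i, ‖y (f i) - a (f i)‖ < ε := by
  let g : lp (fun _ : ι => H) 2 := ⟨f, Memℓp.all f⟩
  set W : Set (lp (fun _ : ι => H) 2) := {w | ∃ a ∈ A, IsSelfAdjoint a ∧ amp ι a g = w}
  have amp_add : ∀ a b : H →L[ℂ] H, amp ι (a + b) g = amp ι a g + amp ι b g := fun a b => by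
    ext i; rfl
  have amp_smul : ∀ (c : ℂ) (a : H →L[ℂ] H) (g), amp ι (c • a) g = c • amp ι a g := fun c a g => by
    ext i; rfl
  have amp_add' : ∀ (a b : H →L[ℂ] H) (g), amp ι (a + b) g = amp ι a g + amp ι b g := fun a b g => by
    ext i; rfl
  have hWs : ∀ (r : ℝ) (w) (_ : w ∈ W), (r : ℂ) • w ∈ W := by
    rintro r _ ⟨a, ha, ha', rfl⟩
    refine ⟨(r : ℂ) • a, A.smul_mem ha _, ?_, amp_smul _ _ _⟩
    unfold IsSelfAdjoint
    rw [star_smul, ha'.star_eq]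
    simp
  have hWc : Convex ℝ W := by
    rintro _ ⟨a, ha, ha', rfl⟩ _ ⟨b, hb, hb', rfl⟩ s t - - -
    obtain ⟨a1, h1, h2, h3⟩ := hWs s _ ⟨a, ha, ha', rfl⟩
    obtain ⟨b1, h4, h5, h6⟩ := hWs t _ ⟨b, hb, hb', rfl⟩
    exact ⟨a1 + b1, A.add_mem h1 h4, h2.add h5, by rw [amp_add, h3, h6]; rfl⟩
  have hmem : amp ι y g ∈ closure W := by
    by_contra hn
    obtain ⟨φ, u, h1, h2⟩ := RCLike.geometric_hahn_banach_closed_point (𝕜 := ℂ) hWc.closure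
      isClosed_closure hn
    set h := (InnerProductSpace.toDual ℂ _).symm φ
    have hφ : ∀ w, φ w = inner ℂ h w := fun w => by
      rw [InnerProductSpace.toDual_symm_apply]
    simp only [hφ, RCLike.re_to_complex] at h1 h2
    have hz : ∀ w ∈ W, (inner ℂ h w).re ≤ 0 := by
      intro w hw
      by_contra hpos
      push Not at hpos
      have := h1 _ (subset_closure (hWs (|u| / (inner ℂ h w).re) w hw))
      rw [inner_smul_right, Complex.re_ofReal_mul, div_mul_cancel₀ _ hpos.ne'] at this
      exact absurd (le_abs_self u) (not_le.2 this)
    have hu : 0 < u := by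
      have := h1 0 (subset_closure ⟨0, A.zero_mem, IsSelfAdjoint.zero _, by ext i; rfl⟩)
      simpa using this
    set N := ‖g‖ + ‖h‖ + 1
    have hN : 0 < N := by positivity
    obtain ⟨a, ha, hab⟩ := exists_forall_amp_sub_lt A hy (fun b : Bool => if b then g else h)
      (ε := u / N) (by positivity)
    have hg : ‖amp ι y g - amp ι a g‖ < u / N := hab true
    have hh : ‖amp ι y h - amp ι a h‖ < u / N := hab false
    have hb := hz _ ⟨(2⁻¹ : ℂ) • (a + star a), A.smul_mem (A.add_mem ha (star_mem (s := A) ha)) _, by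
      unfold IsSelfAdjoint
      rw [star_smul, star_add, star_star, add_comm]
      simp, rfl⟩
    rw [amp_smul, amp_add', inner_smul_right, inner_add_right] at hb
    have h3 : inner ℂ h (amp ι (star a) g) = inner ℂ (amp ι a h) g := by
      rw [← star_amp, inner_star_right]
    have h4 : inner ℂ h (amp ι y g) = inner ℂ (amp ι y h) g := by
      rw [← inner_star_right, star_amp, hsa.star_eq]
    have h5 : |(inner ℂ h (amp ι y g - amp ι a g)).re| ≤ ‖h‖ * (u / N) :=
      (Complex.abs_re_le_norm _).trans ((norm_inner_le_norm _ _).trans (by gcongr))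
    have h6 : |(inner ℂ (amp ι y h - amp ι a h) g).re| ≤ u / N * ‖g‖ :=
      (Complex.abs_re_le_norm _).trans ((norm_inner_le_norm _ _).trans (by gcongr))
    rw [inner_sub_right, Complex.sub_re] at h5
    rw [inner_sub_left, ← h4, Complex.sub_re, ← h3] at h6
    have h7 : (2⁻¹ : ℂ) = ((2⁻¹ : ℝ) : ℂ) := by push_cast; rfl
    rw [h7, Complex.re_ofReal_mul, Complex.add_re] at hb
    have h8 : ‖h‖ * (u / N) + u / N * ‖g‖ ≤ u := by
      have : ‖h‖ * (u / N) + u / N * ‖g‖ = u * ((‖h‖ + ‖g‖) / N) := by ring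
      rw [this]
      refine mul_le_of_le_one_right hu.le ((div_le_one hN).2 ?_)
      simp only [N]; linarith
    have h9 := (abs_le.1 h5).2
    have h10 := (abs_le.1 h6).2
    linarith
  obtain ⟨_, ⟨a, ha, ha', rfl⟩, h⟩ := Metric.mem_closure_iff.1 hmem ε hε
  rw [dist_eq_norm] at h
  exact ⟨a, ha, ha', fun i => (lp.norm_apply_le_norm (E := fun _ : ι => H) (p := 2) (by norm_num)
    (amp ι y g - amp ι a g) i).trans_lt h⟩

/-- The resolvent `(1 + a²)⁻¹` of a self-adjoint operator. -/
noncomputable def resolv (a : H →L[ℂ] H) : H →L[ℂ] H := cfc (fun t : ℝ => (1 + t ^ 2)⁻¹) a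

theorem continuous_resolv : Continuous fun t : ℝ => (1 + t ^ 2)⁻¹ :=
  Continuous.inv₀ (by fun_prop) fun t => by positivity

theorem one_add_sq_eq_cfc {a : H →L[ℂ] H} (ha : IsSelfAdjoint a) :
    1 + a * a = cfc (fun t : ℝ => 1 + t ^ 2) a := by
  rw [cfc_const_add _ _ a, cfc_pow_id a 2, map_one, sq]

theorem resolv_mul {a : H →L[ℂ] H} (ha : IsSelfAdjoint a) : resolv a * (1 + a * a) = 1 := by
  rw [one_add_sq_eq_cfc ha, resolv, ← cfc_mul _ _ a continuous_resolv.continuousOn, ← cfc_one ℝ a]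
  refine cfc_congr fun t _ => inv_mul_cancel₀ ?_
  positivity

theorem mul_resolv {a : H →L[ℂ] H} (ha : IsSelfAdjoint a) : (1 + a * a) * resolv a = 1 := by
  rw [one_add_sq_eq_cfc ha, resolv, ← cfc_mul _ _ a (by fun_prop) continuous_resolv.continuousOn,
    ← cfc_one ℝ a]
  refine cfc_congr fun t _ => mul_inv_cancel₀ ?_
  positivity

theorem resolv_comm (a : H →L[ℂ] H) : a * resolv a = resolv a * a := by
  have h1 : Commute a a := rfl
  exact ((h1.cfc_real _).eq).symm

theorem norm_two_resolv_mul_le {a : H →L[ℂ] H} (ha : IsSelfAdjoint a) :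
    ‖(2 : ℝ) • (resolv a * a)‖ ≤ 1 := by
  have : (2 : ℝ) • (resolv a * a) = cfc (fun t : ℝ => 2 * ((1 + t ^ 2)⁻¹ * t)) a := by
    have hc : ContinuousOn (fun t : ℝ => (1 + t ^ 2)⁻¹ * t) (spectrum ℝ a) :=
      (continuous_resolv.mul continuous_id').continuousOn
    rw [cfc_const_mul _ _ a hc,
      cfc_mul _ _ a continuous_resolv.continuousOn, cfc_id' ℝ a]
    rfl
  rw [this]
  refine norm_cfc_le zero_le_one fun t _ => ?_
  rw [Real.norm_eq_abs, abs_mul, abs_mul, abs_inv, abs_two, abs_of_pos (by positivity : 0 < 1 + t ^ 2),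
    mul_comm _ |t|, ← mul_assoc, ← div_eq_mul_inv, div_le_one (by positivity), ← sq_abs t]
  nlinarith [sq_nonneg (|t| - 1)]

theorem norm_resolv_le (a : H →L[ℂ] H) : ‖resolv a‖ ≤ 1 := by
  refine norm_cfc_le zero_le_one fun t _ => ?_
  rw [Real.norm_eq_abs, abs_of_nonneg (by positivity)]
  exact inv_le_one_of_one_le₀ (by nlinarith [sq_nonneg t])

theorem exists_two_resolv_mul_eq {x : H →L[ℂ] H} (hx : IsSelfAdjoint x) (hn : ‖x‖ ≤ 1) :
    ∃ y : H →L[ℂ] H, IsSelfAdjoint y ∧ (∀ t, x * t = t * x → y * t = t * y) ∧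
      x = (2 : ℝ) • (resolv y * y) := by
  have hspec : ∀ t ∈ spectrum ℝ x, t ^ 2 ≤ 1 := fun t ht => by
    have := (spectrum.norm_le_norm_mul_of_mem ht).trans (mul_le_of_le_one_right (norm_nonneg _)
      (ContinuousLinearMap.norm_id_le : ‖(1 : H →L[ℂ] H)‖ ≤ 1))
    rw [sq_le_one_iff_abs_le_one]
    exact this.trans hn
  set g : ℝ → ℝ := fun t => t / (1 + √(1 - t ^ 2)) with hg
  have hcont : Continuous g := by
    refine Continuous.div (by fun_prop) (by fun_prop) fun t => ?_
    have := Real.sqrt_nonneg (1 - t ^ 2)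
    linarith
  have hysa : IsSelfAdjoint (cfc g x) := cfc_predicate _ _
  refine ⟨cfc g x, hysa, fun t ht => ((show Commute x t from ht).cfc_real _).eq, ?_⟩
  have h1 : (1 + cfc g x * cfc g x) * x = (2 : ℝ) • cfc g x := by
    have e1 : 1 + cfc g x * cfc g x = cfc (fun t : ℝ => 1 + g t ^ 2) x := by
      have hc : ContinuousOn (fun t : ℝ => g t ^ 2) (spectrum ℝ x) := (hcont.pow 2).continuousOn
      rw [cfc_const_add _ _ x hc, cfc_pow _ 2 x hcont.continuousOn, map_one, sq]
    have e2 : (1 + cfc g x * cfc g x) * x = cfc (fun t : ℝ => (1 + g t ^ 2) * t) x := by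
      have hc : ContinuousOn (fun t : ℝ => 1 + g t ^ 2) (spectrum ℝ x) :=
        (continuous_const.add (hcont.pow 2)).continuousOn
      rw [e1, cfc_mul _ _ x hc
        continuous_id'.continuousOn, cfc_id' ℝ x]
    rw [e2, ← cfc_const_mul _ _ x hcont.continuousOn]
    refine cfc_congr fun t ht => ?_
    have h2 := hspec t ht
    have h3 := Real.sq_sqrt (sub_nonneg.2 h2)
    have h4 := Real.sqrt_nonneg (1 - t ^ 2)
    have h5 : 1 + √(1 - t ^ 2) ≠ 0 := by linarith
    simp only [hg]
    generalize √(1 - t ^ 2) = r at *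
    field_simp
    have h6 : t ^ 2 = 1 - r ^ 2 := by linarith
    rw [h6]
    ring
  calc x = resolv (cfc g x) * (1 + cfc g x * cfc g x) * x := by rw [resolv_mul hysa, one_mul]
    _ = _ := by rw [mul_assoc, h1, mul_smul_comm]

theorem resolv_sub_identity {R : Type*} [Ring R] {a y r s : R} (h1 : r * (1 + a * a) = 1)
    (h2 : (1 + y * y) * s = 1) (h3 : y * s = s * y) :
    s * y - r * a = r * ((y - a) * s) - r * a * ((y - a) * (y * s)) := by
  have l1 : r * a = r * (a * (1 + y * y)) * s := by
    rw [mul_assoc, mul_assoc, h2, mul_one]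
  have l2 : s * y = r * ((1 + a * a) * y) * s := by
    rw [← mul_assoc r, h1, one_mul, h3]
  rw [l2]
  conv_lhs => rw [l1]
  noncomm_ring

theorem resolv_mem_closure (A : StarSubalgebra ℂ (H →L[ℂ] H)) {a : H →L[ℂ] H} (ha : a ∈ A)
    (hsa : IsSelfAdjoint a) (c : ℂ) : c • (resolv a * a) ∈ closure (A : Set (H →L[ℂ] H)) := by
  have h1 : resolv a ∈ A.topologicalClosure := by
    have h2 : resolv a = cfc (fun z : ℂ => (((1 + z.re ^ 2)⁻¹ : ℝ) : ℂ)) a :=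
      cfc_real_eq_complex _ (ha := hsa)
    rw [h2]
    exact StarAlgebra.elemental.le_of_mem (StarSubalgebra.isClosed_topologicalClosure A)
      (StarSubalgebra.le_topologicalClosure A ha) (cfc_mem_elemental _ a)
  have h2 : resolv a * a ∈ A.topologicalClosure :=
    mul_mem h1 (StarSubalgebra.le_topologicalClosure A ha)
  exact SMulMemClass.smul_mem (s := A.topologicalClosure) _ h2

/-- The Kaplansky density theorem for self-adjoint operators (with a slightly worse bound). -/
theorem kaplansky {ι : Type*} [Finite ι] (A : StarSubalgebra ℂ (H →L[ℂ] H))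
    {x : H →L[ℂ] H} (hx : ∀ t, (∀ a ∈ A, a * t = t * a) → x * t = t * x) (hsa : IsSelfAdjoint x)
    (f : ι → H) {ε : ℝ} (hε : 0 < ε) :
    ∃ a ∈ A, ‖a‖ ≤ ‖x‖ + 2 ∧ ∀ i, ‖x (f i) - a (f i)‖ < ε := by
  set N := ‖x‖ + 1 with hNdef
  have hN : 0 < N := by positivity
  obtain ⟨y, hysa, hyc, hxy⟩ := exists_two_resolv_mul_eq (x := N⁻¹ • x)
    ((IsSelfAdjoint.all N⁻¹).smul hsa) (by
      rw [norm_smul, norm_inv, Real.norm_of_nonneg hN.le, inv_mul_le_iff₀ hN]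
      linarith)
  have hyA : ∀ t, (∀ a ∈ A, a * t = t * a) → y * t = t * y := fun t ht => hyc t (by
    rw [smul_mul_assoc, mul_smul_comm, hx t ht])
  obtain ⟨a, haA, hasa, ha⟩ := exists_selfAdjoint_norm_sub_lt A hyA hysa
    (fun p : ι × Bool => if p.2 then (resolv y) (f p.1) else y (resolv y (f p.1)))
    (ε := ε / (6 * N)) (by positivity)
  set b : H →L[ℂ] H := N • (2 : ℝ) • (resolv a * a) with hb
  have hbn : ‖b‖ ≤ N := by
    rw [hb, norm_smul, Real.norm_of_nonneg hN.le]
    exact mul_le_of_le_one_right hN.le (norm_two_resolv_mul_le hasa)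
  have hbx : ∀ i, ‖x (f i) - b (f i)‖ < ε / 2 := by
    intro i
    have e1 : x = N • (2 : ℝ) • (resolv y * y) := by
      rw [← hxy, smul_smul, mul_inv_cancel₀ hN.ne', one_smul]
    have e2 : x - b = (2 * N) • (resolv a * ((y - a) * resolv y)) -
        N • (((2 : ℝ) • (resolv a * a)) * ((y - a) * (y * resolv y))) := by
      rw [hb]
      conv_lhs => rw [e1]
      rw [← smul_sub, ← smul_sub, resolv_sub_identity (resolv_mul hasa) (mul_resolv hysa)
        (resolv_comm y), smul_mul_assoc, mul_comm 2 N, mul_smul, ← smul_sub, ← smul_sub]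
    have e3 : x (f i) - b (f i) = (2 * N) • (resolv a ((y - a) (resolv y (f i)))) -
        N • (((2 : ℝ) • (resolv a * a)) ((y - a) (y (resolv y (f i))))) :=
      congrArg (fun z : H →L[ℂ] H => z (f i)) e2
    have e4 : ‖(y - a) (resolv y (f i))‖ < ε / (6 * N) := ha (i, true)
    have e5 : ‖(y - a) (y (resolv y (f i)))‖ < ε / (6 * N) := ha (i, false)
    have e6 := (resolv a).le_of_opNorm_le (norm_resolv_le a) ((y - a) (resolv y (f i)))
    have e7 := ContinuousLinearMap.le_of_opNorm_le _ (norm_two_resolv_mul_le hasa)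
      ((y - a) (y (resolv y (f i))))
    rw [e3]
    refine (norm_sub_le _ _).trans_lt ?_
    rw [norm_smul, norm_smul, Real.norm_of_nonneg hN.le, Real.norm_of_nonneg (by positivity)]
    have e8 : ε / 2 = 2 * N * (ε / (6 * N)) + N * (ε / (6 * N)) := by field_simp; norm_num
    rw [e8]
    have e6' := e6.trans_lt ((one_mul _).trans_lt e4)
    have e7' := e7.trans_lt ((one_mul _).trans_lt e5)
    gcongr
  have hbA : b ∈ closure (A : Set (H →L[ℂ] H)) := by
    have h3 : b = ((N * 2 : ℝ) : ℂ) • (resolv a * a) := by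
      rw [hb, smul_smul]
      rfl
    rw [h3]
    exact resolv_mem_closure A haA hasa _
  obtain ⟨F, hF⟩ : ∃ F, ∀ i, ‖f i‖ ≤ F := by
    obtain ⟨C, hC⟩ := (Set.finite_range fun i => ‖f i‖).bddAbove
    exact ⟨C, fun i => hC ⟨i, rfl⟩⟩
  obtain ⟨d, hdA, hd⟩ := Metric.mem_closure_iff.1 hbA (min 1 (ε / 2 / (|F| + 1)))
    (lt_min one_pos (by positivity))
  rw [dist_eq_norm, lt_min_iff] at hd
  refine ⟨d, hdA, ?_, fun i => ?_⟩
  · calc ‖d‖ = ‖b - (b - d)‖ := by rw [sub_sub_cancel]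
      _ ≤ ‖b‖ + ‖b - d‖ := norm_sub_le _ _
      _ ≤ N + 1 := by gcongr; exact hd.1.le
      _ = _ := by rw [hNdef]; ring
  · have h1 : ‖b (f i) - d (f i)‖ ≤ ε / 2 := by
      refine ((b - d).le_of_opNorm_le hd.2.le (f i)).trans ?_
      rw [div_mul_eq_mul_div, div_le_iff₀ (by positivity)]
      have := (hF i).trans (le_abs_self F)
      gcongr
      linarith
    calc ‖x (f i) - d (f i)‖ = ‖(x (f i) - b (f i)) + (b (f i) - d (f i))‖ := by congr 1; abel
      _ ≤ _ := norm_add_le _ _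
      _ < ε / 2 + ε / 2 := add_lt_add_of_lt_of_le (hbx i) h1
      _ = ε := by ring

end kaplansky

section normal
variable {H : Type*} [NormedAddCommGroup H] [InnerProductSpace ℂ H] [CompleteSpace H]

/-- A functional on `M` in the norm closure of the span of the vector functionals. -/
def IsNormalFunctional (M : VonNeumannAlgebra H) (φ : M.toStarSubalgebra → ℂ) : Prop :=
  ∀ ε > 0, ∃ L : List (H × H), ∀ x : M.toStarSubalgebra,
    ‖φ x - (L.map fun p => inner ℂ p.1 ((x : H →L[ℂ] H) p.2)).sum‖ ≤ ε * ‖(x : H →L[ℂ] H)‖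

variable {M : VonNeumannAlgebra H} {φ ψ : M.toStarSubalgebra → ℂ}

theorem isNormalFunctional_inner (M : VonNeumannAlgebra H) (ζ η : H) :
    IsNormalFunctional M fun x => inner ℂ ζ ((x : H →L[ℂ] H) η) :=
  fun ε hε => ⟨[(ζ, η)], fun x => by simp; positivity⟩

theorem IsNormalFunctional.add (h : IsNormalFunctional M φ) (h' : IsNormalFunctional M ψ) :
    IsNormalFunctional M fun x => φ x + ψ x := fun ε hε => by
  obtain ⟨L, hL⟩ := h (ε / 2) (half_pos hε)
  obtain ⟨L', hL'⟩ := h' (ε / 2) (half_pos hε)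
  refine ⟨L ++ L', fun x => ?_⟩
  rw [List.map_append, List.sum_append, add_sub_add_comm]
  refine (norm_add_le _ _).trans ((add_le_add (hL x) (hL' x)).trans (le_of_eq ?_))
  ring

theorem IsNormalFunctional.congr (h : IsNormalFunctional M φ) (h' : ∀ x, φ x = ψ x) :
    IsNormalFunctional M ψ := by
  rwa [show ψ = φ from funext fun x => (h' x).symm]

theorem IsNormalFunctional.of_close
    (h : ∀ ε > 0, ∃ ψ, IsNormalFunctional M ψ ∧ ∀ x, ‖φ x - ψ x‖ ≤ ε * ‖(x : H →L[ℂ] H)‖) :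
    IsNormalFunctional M φ := fun ε hε => by
  obtain ⟨ψ, hψ, h1⟩ := h (ε / 2) (half_pos hε)
  obtain ⟨L, hL⟩ := hψ (ε / 2) (half_pos hε)
  refine ⟨L, fun x => ?_⟩
  rw [← sub_add_sub_cancel (φ x) (ψ x)]
  refine (norm_add_le _ _).trans ((add_le_add (h1 x) (hL x)).trans (le_of_eq ?_))
  ring

/-- Normal functionals are weakly continuous on bounded sets. -/
theorem IsNormalFunctional.tendsto (h : IsNormalFunctional M φ) {ι : Type*} {l : Filter ι}
    {F : ι → M.toStarSubalgebra} {x : M.toStarSubalgebra} {C : ℝ}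
    (hb : ∀ᶠ i in l, ‖(F i : H →L[ℂ] H)‖ ≤ C)
    (hF : WTendsto (fun i => (F i : H →L[ℂ] H)) l x) :
    Tendsto (fun i => φ (F i)) l (𝓝 (φ x)) := by
  rw [Metric.tendsto_nhds]
  intro ε hε
  set K := |C| + ‖(x : H →L[ℂ] H)‖ + 1
  have hK : 0 < K := by positivity
  obtain ⟨L, hL⟩ := h (ε / (3 * K)) (by positivity)
  have ht : Tendsto (fun i => (L.map fun p => inner ℂ p.1 ((F i : H →L[ℂ] H) p.2)).sum) l
      (𝓝 (L.map fun p => inner ℂ p.1 ((x : H →L[ℂ] H) p.2)).sum) :=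
    tendsto_list_sum L fun p _ => hF p.1 p.2
  filter_upwards [hb, Metric.tendsto_nhds.1 ht (ε / 3) (by positivity)] with i h1 h2
  have b1 : ‖(F i : H →L[ℂ] H)‖ ≤ K := by
    have := h1.trans (le_abs_self C); have := norm_nonneg (x : H →L[ℂ] H); simp only [K]; linarith
  have b2 : ‖(x : H →L[ℂ] H)‖ ≤ K := by have := abs_nonneg C; simp only [K]; linarith
  have e : ∀ y : M.toStarSubalgebra, ‖(y : H →L[ℂ] H)‖ ≤ K → ε / (3 * K) * ‖(y : H →L[ℂ] H)‖ ≤ ε / 3 := by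
    intro y hy
    calc _ ≤ ε / (3 * K) * K := by gcongr
      _ = ε / 3 := by field_simp
  have c1 := (hL (F i)).trans (e _ b1)
  have c2 := (hL x).trans (e _ b2)
  rw [dist_eq_norm] at h2 ⊢
  set S1 := (L.map fun p => inner ℂ p.1 ((F i : H →L[ℂ] H) p.2)).sum
  set S2 := (L.map fun p => inner ℂ p.1 ((x : H →L[ℂ] H) p.2)).sum
  rw [show φ (F i) - φ x = (φ (F i) - S1) + (S1 - S2) - (φ x - S2) by ring]
  have := norm_sub_le ((φ (F i) - S1) + (S1 - S2)) (φ x - S2)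
  have := norm_add_le (φ (F i) - S1) (S1 - S2)
  linarith

/-- A bounded functional factoring through a linear map into a Hilbert space. -/
theorem exists_inner_eq_of_norm_le {V : Type*} [AddCommGroup V] [Module ℂ V] (φ : V →ₗ[ℂ] ℂ)
    (T : V →ₗ[ℂ] H) (C : ℝ) (h : ∀ v, ‖φ v‖ ≤ C * ‖T v‖) : ∃ ζ, ∀ v, φ v = inner ℂ ζ (T v) := by
  have hker : LinearMap.ker T.rangeRestrict ≤ LinearMap.ker φ := by
    intro v hv
    rw [LinearMap.ker_rangeRestrict, LinearMap.mem_ker] at hv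
    have := h v
    rw [hv, norm_zero, mul_zero] at this
    exact norm_le_zero_iff.1 this
  obtain ⟨σ, hσ⟩ := T.rangeRestrict.exists_rightInverse_of_surjective
    (LinearMap.range_eq_top.2 T.surjective_rangeRestrict)
  have hs : ∀ v, φ (σ (T.rangeRestrict v)) = φ v := by
    intro v
    have h1 : σ (T.rangeRestrict v) - v ∈ LinearMap.ker T.rangeRestrict := by
      rw [LinearMap.mem_ker, map_sub, sub_eq_zero]
      exact congrArg (fun f : LinearMap.range T →ₗ[ℂ] LinearMap.range T => f (T.rangeRestrict v)) hσ
    have := hker h1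
    rwa [LinearMap.mem_ker, map_sub, sub_eq_zero] at this
  let g : LinearMap.range T →L[ℂ] ℂ := (φ ∘ₗ σ).mkContinuous C fun w => by
    obtain ⟨v, rfl⟩ := T.surjective_rangeRestrict w
    rw [LinearMap.comp_apply, hs]
    exact h v
  obtain ⟨G, hG, -⟩ := exists_extension_norm_eq (LinearMap.range T) g
  refine ⟨(InnerProductSpace.toDual ℂ H).symm G, fun v => ?_⟩
  rw [InnerProductSpace.toDual_symm_apply]
  have := hG (T.rangeRestrict v)
  rw [← hs v]
  exact this.symm

/-- The supremum of an increasing family of projections. -/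
theorem exists_isLUB_projection (M : VonNeumannAlgebra H) {P : Set (H →L[ℂ] H)} (hne : P.Nonempty)
    (hd : DirectedOn (· ≤ ·) P) (hP : ∀ p ∈ P, p ∈ M ∧ IsStarProjection p) :
    ∃ e ∈ M, IsStarProjection e ∧ IsLUB P e := by
  obtain ⟨e, heM, he, h1, h2⟩ := exists_sup_projection M P fun p hp => (hP p hp).1
  have hub : ∀ p ∈ P, p ≤ e := fun p hp => (proj_le_iff (hP p hp).2 he).2 (h1 p hp)
  obtain ⟨x, hx, -⟩ := exists_wTendsto_of_directed hne hd hub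
  have hxe : x ≤ e := hx.2 hub
  obtain ⟨p0, hp0⟩ := hne
  have hx0 : 0 ≤ x := (proj_nonneg (hP p0 hp0).2).trans (hx.1 hp0)
  have e1 : (1 - x) * e = 0 := h2 _ fun p hp => by
    have hp' := (hP p hp).2
    have h3 : star p * (1 - x) * p ≤ 0 := by
      refine (star_left_conjugate_le_conjugate (sub_le_sub_left (hx.1 hp) 1) p).trans (le_of_eq ?_)
      rw [hp'.isSelfAdjoint.star_eq, mul_sub p, mul_one, hp'.isIdempotentElem.eq, sub_self, zero_mul]
    have h4 : 0 ≤ 1 - x := sub_nonneg.2 (hxe.trans (proj_le_one he))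
    exact mul_eq_zero_of_conj h4 (le_antisymm h3 (conj_nonneg h4 p))
  have e2 : x * (1 - e) = 0 := mul_eq_zero_of_le hx0 hxe (by
    rw [mul_assoc, mul_sub, mul_one, he.isIdempotentElem.eq, sub_self, mul_zero])
  have : x = e := by
    rw [mul_sub, mul_one, sub_eq_zero] at e2
    rw [sub_mul, one_mul, sub_eq_zero] at e1
    exact e2.trans e1.symm
  exact ⟨e, heM, he, this ▸ hx⟩

end normal

section positive
variable {H : Type*} [NormedAddCommGroup H] [InnerProductSpace ℂ H] [CompleteSpace H]
  {M : VonNeumannAlgebra H}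

/-- A positive functional preserving suprema of increasing nets. -/
structure IsOrderNormal (φ : M.toStarSubalgebra →ₗ[ℂ] ℂ) : Prop where
  nonneg : ∀ x : M.toStarSubalgebra, 0 ≤ (x : H →L[ℂ] H) → 0 ≤ φ x
  normal : ∀ (F : Set M.toStarSubalgebra) (x : M.toStarSubalgebra), F.Nonempty →
    DirectedOn (fun y z : M.toStarSubalgebra => (y : H →L[ℂ] H) ≤ z) F →
    IsLUB ((fun y : M.toStarSubalgebra => (y : H →L[ℂ] H)) '' F) x →
    ∀ ε > 0, ∃ y ∈ F, (φ (x - y)).re < ε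

variable {φ : M.toStarSubalgebra →ₗ[ℂ] ℂ}

theorem IsOrderNormal.mono (h : IsOrderNormal φ) {x y : M.toStarSubalgebra}
    (hxy : (x : H →L[ℂ] H) ≤ y) : (φ x).re ≤ (φ y).re := by
  have := (Complex.le_def.1 (h.nonneg (y - x) (sub_nonneg.2 hxy))).1
  rw [map_sub, Complex.sub_re, Complex.zero_re] at this
  linarith

theorem IsOrderNormal.re_nonneg (h : IsOrderNormal φ) {x : M.toStarSubalgebra}
    (hx : 0 ≤ (x : H →L[ℂ] H)) : 0 ≤ (φ x).re := (Complex.le_def.1 (h.nonneg x hx)).1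

theorem IsOrderNormal.map_star_aux (h : IsOrderNormal φ) {x : M.toStarSubalgebra}
    (hx : star x = x) : (φ x).im = 0 := by
  have h1 : (0 : H →L[ℂ] H) ≤ algebraMap ℝ _ ‖(x : H →L[ℂ] H)‖ - x :=
    sub_nonneg.2 (IsSelfAdjoint.le_algebraMap_norm_self (a := (x : H →L[ℂ] H))
      (congrArg Subtype.val hx))
  have h2 : algebraMap ℝ (H →L[ℂ] H) ‖(x : H →L[ℂ] H)‖ =
      (((‖(x : H →L[ℂ] H)‖ : ℂ) • (1 : M.toStarSubalgebra) : M.toStarSubalgebra) : H →L[ℂ] H) := by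
    rw [Algebra.algebraMap_eq_smul_one]; rfl
  rw [h2] at h1
  have h3 := (Complex.le_def.1 (h.nonneg ((‖(x : H →L[ℂ] H)‖ : ℂ) • 1 - x) h1)).2
  have h4 := (Complex.le_def.1 (h.nonneg 1 zero_le_one)).2
  rw [map_sub, map_smul, Complex.sub_im, smul_eq_mul, Complex.im_ofReal_mul, ← h4] at h3
  simp at h3
  exact h3

theorem IsOrderNormal.map_star (h : IsOrderNormal φ) (x : M.toStarSubalgebra) :
    φ (star x) = (starRingEnd ℂ) (φ x) := by
  have h1 := h.map_star_aux (x := x + star x) (by rw [star_add, star_star, add_comm])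
  have h2 := h.map_star_aux (x := Complex.I • (x - star x)) (by
    rw [star_smul, star_sub, star_star, Complex.star_def, Complex.conj_I, neg_smul, ← smul_neg,
      neg_sub])
  rw [map_add, Complex.add_im] at h1
  rw [map_smul, map_sub, smul_eq_mul, Complex.mul_im, Complex.I_re, Complex.I_im, zero_mul, zero_add,
    one_mul, Complex.sub_re] at h2
  apply Complex.ext
  · rw [Complex.conj_re]; linarith
  · rw [Complex.conj_im]; linarith

/-- The Cauchy-Schwarz inequality. -/
theorem IsOrderNormal.norm_sq_le (h : IsOrderNormal φ) (x y : M.toStarSubalgebra) :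
    ‖φ (star x * y)‖ ^ 2 ≤ (φ (star x * x)).re * (φ (star y * y)).re := by
  let c : PreInnerProductSpace.Core ℂ M.toStarSubalgebra :=
    { inner := fun x y => φ (star x * y)
      conj_inner_symm := fun x y => by rw [← h.map_star, star_mul, star_star]
      re_inner_nonneg := fun x => h.re_nonneg (star_mul_self_nonneg (x : H →L[ℂ] H))
      add_left := fun x y z => by rw [star_add, add_mul, map_add]
      smul_left := fun x y r => by
        rw [star_smul, smul_mul_assoc, map_smul]; rfl }
  have h1 := InnerProductSpace.Core.inner_mul_inner_self_le (𝕜 := ℂ) (c := c) x y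
  rw [InnerProductSpace.Core.norm_inner_symm (𝕜 := ℂ) (c := c) y x, ← sq] at h1
  exact h1

theorem star_mul_self_le_norm_sq (x : H →L[ℂ] H) : star x * x ≤ algebraMap ℝ _ (‖x‖ ^ 2) := by
  have := IsSelfAdjoint.le_algebraMap_norm_self (a := star x * x) (IsSelfAdjoint.star_mul_self x)
  rwa [CStarRing.norm_star_mul_self, ← sq] at this

theorem IsOrderNormal.norm_mul_sq_le (h : IsOrderNormal φ) (x y : M.toStarSubalgebra) :
    ‖φ (x * y)‖ ^ 2 ≤ ‖(x : H →L[ℂ] H)‖ ^ 2 * (φ 1).re * (φ (star y * y)).re := by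
  have h1 := h.norm_sq_le (star x) y
  rw [star_star] at h1
  refine h1.trans (mul_le_mul_of_nonneg_right ?_ (h.re_nonneg (star_mul_self_nonneg (y : H →L[ℂ] H))))
  have h2 := star_mul_self_le_norm_sq (star (x : H →L[ℂ] H))
  rw [norm_star] at h2
  have h3 : algebraMap ℝ (H →L[ℂ] H) (‖(x : H →L[ℂ] H)‖ ^ 2) =
      ((((‖(x : H →L[ℂ] H)‖ ^ 2 : ℝ) : ℂ) • (1 : M.toStarSubalgebra) : M.toStarSubalgebra) :
        H →L[ℂ] H) := by
    rw [Algebra.algebraMap_eq_smul_one]; rfl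
  rw [h3] at h2
  have h4 := h.mono (x := star (star x) * star x) h2
  rwa [map_smul, smul_eq_mul, Complex.re_ofReal_mul, star_star] at h4

/-- Comparison with a vector functional on a small projection. -/
theorem IsOrderNormal.exists_le_vector (h : IsOrderNormal φ) {e : M.toStarSubalgebra}
    (he : IsStarProjection (e : H →L[ℂ] H)) (he0 : e ≠ 0) :
    ∃ (g : M.toStarSubalgebra) (η : H), IsStarProjection (g : H →L[ℂ] H) ∧ g ≠ 0 ∧
      (e : H →L[ℂ] H) * g = g ∧ ∀ x : M.toStarSubalgebra, 0 ≤ (x : H →L[ℂ] H) →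
        (x : H →L[ℂ] H) * g = x → (φ x).re ≤ (inner ℂ η ((x : H →L[ℂ] H) η)).re := by
  obtain ⟨ζ, hζ⟩ : ∃ ζ, (e : H →L[ℂ] H) ζ ≠ 0 := by
    by_contra hn
    push Not at hn
    exact he0 (Subtype.ext (ContinuousLinearMap.ext hn))
  have hζ' : 0 < ‖(e : H →L[ℂ] H) ζ‖ := norm_pos_iff.2 hζ
  set r : ℝ := ((φ e).re + 1) / ‖(e : H →L[ℂ] H) ζ‖ with hr
  have hφe : 0 ≤ (φ e).re := h.re_nonneg (proj_nonneg he)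
  set η : H := (r : ℂ) • (e : H →L[ℂ] H) ζ with hη
  have heη : (e : H →L[ℂ] H) η = η := by
    rw [hη, map_smul]
    congr 1
    exact congrArg (fun z : H →L[ℂ] H => z ζ) he.isIdempotentElem.eq
  have hηn : ‖η‖ = (φ e).re + 1 := by
    rw [hη, norm_smul, Complex.norm_real, Real.norm_of_nonneg (by positivity), hr,
      div_mul_cancel₀ _ hζ'.ne']
  have hψe : (φ e).re < (inner ℂ η ((e : H →L[ℂ] H) η)).re := by
    rw [heη, show (inner ℂ η η).re = ‖η‖ ^ 2 from inner_self_eq_norm_sq (𝕜 := ℂ) η, hηn]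
    nlinarith
  set S : Set (H →L[ℂ] H) := {f | ∃ f' : M.toStarSubalgebra, (f' : H →L[ℂ] H) = f ∧
    IsStarProjection f ∧ f ≤ e ∧ (inner ℂ η (f η)).re ≤ (φ f').re}
  obtain ⟨f, hf⟩ : ∃ f, Maximal (· ∈ S) f := by
    refine zorn_le_nonempty₀ S (fun c hc hchain y hy => ?_) 0
      ⟨0, rfl, IsStarProjection.zero _, proj_nonneg he, by simp⟩ |>.imp fun f hf => hf.2
    have hd : DirectedOn (· ≤ ·) c := hchain.directedOn
    obtain ⟨u, huM, hu, hlub⟩ := exists_isLUB_projection M ⟨y, hy⟩ hd fun p hp => by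
      obtain ⟨p', rfl, h2, -⟩ := hc hp
      exact ⟨p'.2, h2⟩
    refine ⟨u, ⟨⟨u, huM⟩, rfl, hu, hlub.2 fun p hp => ?_, ?_⟩, fun z hz => hlub.1 hz⟩
    · obtain ⟨p', -, -, h3, -⟩ := hc hp
      exact h3
    · refine le_of_forall_pos_lt_add fun ε hε => ?_
      obtain ⟨p, hp, h5⟩ := ((isLUB_iff_inner ⟨y, hy⟩ hd).1 hlub).2 η ε hε
      obtain ⟨p', rfl, h2, h3, h4⟩ := hc hp
      have h6 := h.mono (x := p') (y := ⟨u, huM⟩) (hlub.1 hp)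
      rw [sub_apply, inner_sub_right, Complex.sub_re] at h5
      linarith
  obtain ⟨f', rfl, hfp, hfe, hfφ⟩ := hf.1
  have hef : (e : H →L[ℂ] H) * f' = f' := (proj_le_iff hfp he).1 hfe
  have hfe' : (f' : H →L[ℂ] H) * e = f' := by
    have := congrArg star hef
    rwa [star_mul, hfp.isSelfAdjoint.star_eq, he.isSelfAdjoint.star_eq] at this
  have hg : IsStarProjection ((e - f' : M.toStarSubalgebra) : H →L[ℂ] H) := by
    refine ⟨?_, he.isSelfAdjoint.sub hfp.isSelfAdjoint⟩
    change ((e : H →L[ℂ] H) - f') * (e - f') = e - f'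
    rw [mul_sub, sub_mul, sub_mul, he.isIdempotentElem.eq, hfp.isIdempotentElem.eq, hef, hfe']
    abel
  have hproj : ∀ p : M.toStarSubalgebra, IsStarProjection (p : H →L[ℂ] H) →
      (p : H →L[ℂ] H) * (e - f') = p → (φ p).re ≤ (inner ℂ η ((p : H →L[ℂ] H) η)).re := by
    intro p hp hpg
    by_contra hlt
    push Not at hlt
    have hfe0 : (f' : H →L[ℂ] H) * (e - f') = 0 := by
      rw [mul_sub, hfe', hfp.isIdempotentElem.eq, sub_self]
    have hgp : ((e : H →L[ℂ] H) - f') * p = p := by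
      have := congrArg star hpg
      rwa [star_mul, hp.isSelfAdjoint.star_eq, (show IsSelfAdjoint ((e : H →L[ℂ] H) - f') from
        hg.isSelfAdjoint).star_eq] at this
    have hfp0 : (f' : H →L[ℂ] H) * p = 0 := by rw [← hgp, ← mul_assoc, hfe0, zero_mul]
    have hpf0 : (p : H →L[ℂ] H) * f' = 0 := by
      have := congrArg star hfp0
      rwa [star_mul, hp.isSelfAdjoint.star_eq, hfp.isSelfAdjoint.star_eq, star_zero] at this
    have hsum : IsStarProjection ((f' + p : M.toStarSubalgebra) : H →L[ℂ] H) := by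
      refine ⟨?_, hfp.isSelfAdjoint.add hp.isSelfAdjoint⟩
      change ((f' : H →L[ℂ] H) + p) * (f' + p) = f' + p
      rw [mul_add, add_mul, add_mul, hfp.isIdempotentElem.eq, hp.isIdempotentElem.eq, hfp0, hpf0]
      abel
    have hmem : ((f' + p : M.toStarSubalgebra) : H →L[ℂ] H) ∈ S := by
      refine ⟨f' + p, rfl, hsum, (proj_le_iff hsum he).2 ?_, ?_⟩
      · change (e : H →L[ℂ] H) * (f' + p) = f' + p
        rw [mul_add, hef]
        congr 1
        rw [← hgp, ← mul_assoc, mul_sub, he.isIdempotentElem.eq, hef]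
      · rw [map_add, Complex.add_re]
        change (inner ℂ η (((f' : H →L[ℂ] H) + p) η)).re ≤ _
        rw [add_apply, inner_add_right, Complex.add_re]
        linarith
    have hle : ((f' + p : M.toStarSubalgebra) : H →L[ℂ] H) ≤ f' :=
      hf.2 hmem (le_add_of_nonneg_right (proj_nonneg hp))
    have hle' : (f' : H →L[ℂ] H) + p ≤ f' := hle
    have hp0 : (p : H →L[ℂ] H) = 0 :=
      le_antisymm (add_le_iff_nonpos_right _ |>.1 hle') (proj_nonneg hp)
    have hp0' : p = 0 := Subtype.ext hp0
    rw [hp0'] at hlt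
    simp at hlt
  refine ⟨e - f', η, hg, fun h0 => ?_, ?_, fun x hx hxg => ?_⟩
  · rw [sub_eq_zero] at h0
    rw [h0] at hψe
    exact absurd hfφ (not_le.2 hψe)
  · change (e : H →L[ℂ] H) * (e - f') = e - f'
    rw [mul_sub, he.isIdempotentElem.eq, hef]
  · have key : x ∈ {x : M.toStarSubalgebra | (φ x).re ≤ (inner ℂ η ((x : H →L[ℂ] H) η)).re} := by
      have hgx : ((e : H →L[ℂ] H) - f') * x = x := by
        have := congrArg star hxg
        rwa [star_mul, hx.isSelfAdjoint.star_eq, hg.isSelfAdjoint.star_eq] at this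
      have hxz : star (1 - ((e : H →L[ℂ] H) - f')) * (x : H →L[ℂ] H) * (1 - ((e : H →L[ℂ] H) - f')) = 0 := by
        rw [mul_assoc, mul_sub (x : H →L[ℂ] H), mul_one,
          show (x : H →L[ℂ] H) * ((e : H →L[ℂ] H) - f') = x from hxg, sub_self, mul_zero]
      let Q : ℝ → M.toStarSubalgebra → Prop := fun c x => 0 ≤ (x : H →L[ℂ] H) ∧
        (x : H →L[ℂ] H) ≤ algebraMap ℝ _ c ∧
        (x : H →L[ℂ] H) * (1 - ((e : H →L[ℂ] H) - f')) = 0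
      refine mem_of_dyadic (Q := Q) (c := ‖(x : H →L[ℂ] H)‖ + 1) ?_ ?_ ?_ ?_ ?_ (by positivity)
        (x := x) ⟨hx, ?_, ?_⟩
      · have hφc : Continuous fun x : M.toStarSubalgebra => φ x := by
          let φ' : M.toStarSubalgebra →L[ℂ] ℂ := φ.mkContinuous (φ 1).re fun x => by
            have := h.norm_mul_sq_le x 1
            rw [mul_one, star_one, mul_one] at this
            refine abs_le_of_sq_le_sq' ?_ ?_ |>.2
            · refine this.trans (le_of_eq ?_)
              change ‖x‖ ^ 2 * _ * _ = _
              ring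
            · exact mul_nonneg (h.re_nonneg zero_le_one) (norm_nonneg _)
          exact φ'.continuous
        refine isClosed_le (Complex.continuous_re.comp hφc) (Complex.continuous_re.comp ?_)
        exact continuous_const.inner ((ContinuousLinearMap.apply ℂ H η).continuous.comp
          continuous_subtype_val)
      · simp
      · intro x hx y hy
        simp only [Set.mem_ofPred_eq] at *
        rw [map_add, Complex.add_re]
        change _ ≤ (inner ℂ η (((x : H →L[ℂ] H) + y) η)).re
        rw [add_apply, inner_add_right, Complex.add_re]
        exact add_le_add hx hy
      · rintro c hc x ⟨h1, h2, h3⟩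
        obtain ⟨p, hpM, hp, h4, h5, h6⟩ := exists_dyadic_projection M x.2 hc h1 h2
        have h7 := h6 (1 - ((e : H →L[ℂ] H) - f')) (by rw [mul_assoc, h3, mul_zero])
        refine ⟨⟨p, hpM⟩, ?_, h4, h5, ?_⟩
        · have h8 := hproj ⟨p, hpM⟩ hp (by rwa [mul_sub, mul_one, sub_eq_zero, eq_comm] at h7)
          change (φ (((c / 2 : ℝ) : ℂ) • ⟨p, hpM⟩)).re ≤ (inner ℂ η ((((c / 2 : ℝ) : ℂ) • p) η)).re
          rw [map_smul, smul_eq_mul, Complex.re_ofReal_mul, smul_apply, inner_smul_right,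
            Complex.re_ofReal_mul]
          exact mul_le_mul_of_nonneg_left h8 (by positivity)
        · change ((x : H →L[ℂ] H) - (c / 2) • p) * _ = 0
          rw [sub_mul, h3, smul_mul_assoc, h7, smul_zero, sub_zero]
      · rintro c hc x ⟨h1, h2, -⟩
        exact norm_le_of_nonneg_of_le hc.le h1 h2
      · have h1 := IsSelfAdjoint.le_algebraMap_norm_self (a := (x : H →L[ℂ] H)) hx.isSelfAdjoint
        refine h1.trans ?_
        rw [← sub_nonneg, ← map_sub, add_sub_cancel_left, map_one]
        exact zero_le_one
      · rw [mul_sub, mul_one, sub_eq_zero]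
        exact hxg.symm
    exact key

/-- Order normal positive functionals are norm limits of sums of vector functionals. -/
theorem IsOrderNormal.isNormalFunctional (h : IsOrderNormal φ) : IsNormalFunctional M φ := by
  set S : Set (H →L[ℂ] H) := {e | ∃ e' : M.toStarSubalgebra, (e' : H →L[ℂ] H) = e ∧
    IsStarProjection e ∧ IsNormalFunctional M fun x => φ (x * e')}
  obtain ⟨e, he⟩ : ∃ e, Maximal (· ∈ S) e := by
    refine zorn_le_nonempty₀ S (fun c hc hchain y hy => ?_) 0
      ⟨0, rfl, IsStarProjection.zero _, fun ε hε => ⟨[], fun x => by simp; positivity⟩⟩ |>.imp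
        fun f hf => hf.2
    have hd : DirectedOn (· ≤ ·) c := hchain.directedOn
    obtain ⟨u, huM, hu, hlub⟩ := exists_isLUB_projection M ⟨y, hy⟩ hd fun p hp => by
      obtain ⟨p', rfl, h2, -⟩ := hc hp
      exact ⟨p'.2, h2⟩
    refine ⟨u, ⟨⟨u, huM⟩, rfl, hu, IsNormalFunctional.of_close fun ε hε => ?_⟩, fun z hz => hlub.1 hz⟩
    have h1 : 0 ≤ (φ 1).re := h.re_nonneg zero_le_one
    have himg : ((fun y : M.toStarSubalgebra => (y : H →L[ℂ] H)) ''
        {y : M.toStarSubalgebra | (y : H →L[ℂ] H) ∈ c}) = c := by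
      ext z
      constructor
      · rintro ⟨y, hy, rfl⟩; exact hy
      · intro hz
        obtain ⟨z', rfl, -⟩ := hc hz
        exact ⟨z', hz, rfl⟩
    obtain ⟨y', rfl, -⟩ := hc hy
    obtain ⟨p, hp, hlt⟩ := h.normal {y : M.toStarSubalgebra | (y : H →L[ℂ] H) ∈ c} ⟨u, huM⟩
      ⟨y', hy⟩ (by
        intro a ha b hb
        obtain ⟨z, hz, h3, h4⟩ := hd a ha b hb
        obtain ⟨z', rfl, -⟩ := hc hz
        exact ⟨z', hz, h3, h4⟩) (by rw [himg]; exact hlub) (ε ^ 2 / ((φ 1).re + 1)) (by positivity)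
    obtain ⟨p', hpp, hpp2, hpN⟩ := hc hp
    obtain rfl : p' = p := Subtype.ext hpp
    refine ⟨_, hpN, fun x => ?_⟩
    rw [← map_sub, ← mul_sub]
    refine abs_le_of_sq_le_sq' ?_ (by positivity) |>.2
    have h5 : star ((⟨u, huM⟩ : M.toStarSubalgebra) - p') * ((⟨u, huM⟩ : M.toStarSubalgebra) - p') =
        (⟨u, huM⟩ : M.toStarSubalgebra) - p' := by
      apply Subtype.ext
      change star (u - (p' : H →L[ℂ] H)) * (u - p') = u - p'
      have h6 := (proj_le_iff hpp2 hu).1 (hlub.1 hp)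
      have h7 := congrArg star h6
      rw [star_mul, hu.isSelfAdjoint.star_eq, hpp2.isSelfAdjoint.star_eq] at h7
      rw [star_sub, hu.isSelfAdjoint.star_eq, hpp2.isSelfAdjoint.star_eq, mul_sub, sub_mul, sub_mul,
        hu.isIdempotentElem.eq, hpp2.isIdempotentElem.eq, h6, h7]
      abel
    refine (h.norm_mul_sq_le x _).trans ?_
    rw [h5, mul_pow, mul_assoc, mul_comm (ε ^ 2)]
    refine mul_le_mul_of_nonneg_left ?_ (by positivity)
    calc (φ 1).re * _ ≤ (φ 1).re * (ε ^ 2 / ((φ 1).re + 1)) := by gcongr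
      _ = ε ^ 2 * ((φ 1).re / ((φ 1).re + 1)) := by ring
      _ ≤ ε ^ 2 * 1 := by
        gcongr
        exact (div_le_one (by positivity)).2 (by linarith)
      _ = ε ^ 2 := mul_one _
  obtain ⟨e', rfl, hep, heN⟩ := he.1
  have he1 : (1 - e' : M.toStarSubalgebra) = 0 := by
    by_contra hne
    obtain ⟨g, η, hg, hg0, heg, hle⟩ := h.exists_le_vector (e := 1 - e') (one_sub_proj hep) hne
    have hgN : IsNormalFunctional M fun x => φ (x * g) := by
      obtain ⟨ζ, hζ⟩ := exists_inner_eq_of_norm_le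
        (φ ∘ₗ LinearMap.mulRight ℂ g)
        ({ toFun := fun x : M.toStarSubalgebra => (x : H →L[ℂ] H) ((g : H →L[ℂ] H) η)
           map_add' := fun x y => rfl
           map_smul' := fun c x => rfl } : M.toStarSubalgebra →ₗ[ℂ] H) (√(φ 1).re) (fun x => by
          refine abs_le_of_sq_le_sq' ?_ (by positivity) |>.2
          have h1 := h.norm_sq_le 1 (x * g)
          rw [star_one, one_mul, one_mul] at h1
          refine h1.trans ?_
          rw [mul_pow, Real.sq_sqrt (h.re_nonneg zero_le_one)]
          refine mul_le_mul_of_nonneg_left ?_ (h.re_nonneg zero_le_one)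
          refine (hle (star (x * g) * (x * g)) (star_mul_self_nonneg ((x * g : M.toStarSubalgebra) :
            H →L[ℂ] H)) ?_).trans (le_of_eq ?_)
          · change star ((x : H →L[ℂ] H) * g) * (x * g) * g = star ((x : H →L[ℂ] H) * g) * (x * g)
            rw [mul_assoc, mul_assoc (x : H →L[ℂ] H), hg.isIdempotentElem.eq]
          · change (inner ℂ η (star ((x : H →L[ℂ] H) * g) (((x : H →L[ℂ] H) * g) η))).re = _
            rw [inner_star_right]
            exact inner_self_eq_norm_sq (𝕜 := ℂ) _)
      have := (isNormalFunctional_inner M ζ ((g : H →L[ℂ] H) η))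
      exact this.congr fun x => (hζ x).symm
    have heg0 : (e' : H →L[ℂ] H) * g = 0 := by
      change (1 - (e' : H →L[ℂ] H)) * g = g at heg
      rw [sub_mul, one_mul] at heg
      exact sub_eq_self.1 heg
    have hge0 : (g : H →L[ℂ] H) * e' = 0 := by
      have := congrArg star heg0
      rwa [star_mul, hg.isSelfAdjoint.star_eq, hep.isSelfAdjoint.star_eq, star_zero] at this
    have hmem : ((e' + g : M.toStarSubalgebra) : H →L[ℂ] H) ∈ S := by
      refine ⟨e' + g, rfl, ⟨?_, hep.isSelfAdjoint.add hg.isSelfAdjoint⟩, ?_⟩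
      · change ((e' : H →L[ℂ] H) + g) * (e' + g) = e' + g
        rw [mul_add, add_mul, add_mul, hep.isIdempotentElem.eq, hg.isIdempotentElem.eq, heg0, hge0]
        abel
      · exact (heN.add hgN).congr fun x => by rw [mul_add, map_add]
    have hle : ((e' + g : M.toStarSubalgebra) : H →L[ℂ] H) ≤ e' :=
      he.2 hmem (le_add_of_nonneg_right (proj_nonneg hg))
    have hle' : (e' : H →L[ℂ] H) + g ≤ e' := hle
    exact hg0 (Subtype.ext (le_antisymm (add_le_iff_nonpos_right _ |>.1 hle') (proj_nonneg hg)))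
  have he1' : (e' : M.toStarSubalgebra) = 1 := (sub_eq_zero.1 he1).symm
  exact heN.congr fun x => by rw [he1', mul_one]

end positive

section stonean
variable {X : Type*} [TopologicalSpace X] [ExtremallyDisconnected X]

/-- Bounded sets of continuous functions on an extremally disconnected space have suprema. -/
theorem exists_isLUB_continuousMap {F : Set C(X, ℝ)} (hF : F.Nonempty) {c : ℝ}
    (hc : ∀ f ∈ F, ∀ x, f x ≤ c) : ∃ g, IsLUB F g := by
  set O : ℝ → Set X := fun r => {x | ∃ f ∈ F, r < f x} with hO
  have hOo : ∀ r, IsOpen (O r) := fun r => by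
    have : O r = ⋃ f ∈ F, {x | r < f x} := by ext x; simp [hO]
    rw [this]
    exact isOpen_biUnion fun f _ => isOpen_lt continuous_const f.continuous
  set U : ℝ → Set X := fun r => closure (O r) with hU
  have hUo : ∀ r, IsOpen (U r) := fun r => ExtremallyDisconnected.open_closure _ (hOo r)
  have hUc : ∀ r, IsClosed (U r) := fun r => isClosed_closure
  have hanti : ∀ r r', r ≤ r' → U r' ⊆ U r := fun r r' h =>
    closure_mono fun x ⟨f, hf, hx⟩ => ⟨f, hf, h.trans_lt hx⟩
  have hub : ∀ k : C(X, ℝ), (∀ f ∈ F, f ≤ k) → ∀ r, ∀ x ∈ U r, r ≤ k x := by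
    intro k hk r x hx
    have : closure (O r) ⊆ {x | r ≤ k x} :=
      closure_minimal (fun y ⟨f, hf, hy⟩ => hy.le.trans (hk f hf y))
        (isClosed_le continuous_const k.continuous)
    exact this hx
  have hbdd : ∀ x, BddAbove {r | x ∈ U r} := fun x =>
    ⟨c, fun r hr => hub (ContinuousMap.const X c) (fun f hf y => hc f hf y) r x hr⟩
  obtain ⟨f0, hf0⟩ := hF
  have hne : ∀ x, {r | x ∈ U r}.Nonempty := fun x =>
    ⟨f0 x - 1, subset_closure ⟨f0, hf0, by linarith⟩⟩
  let g : X → ℝ := fun x => sSup {r | x ∈ U r}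
  have h1 : ∀ r x, x ∈ U r → r ≤ g x := fun r x hx => le_csSup (hbdd x) hx
  have h2 : ∀ r x, r < g x → x ∈ U r := fun r x hr => by
    obtain ⟨r', hr', h⟩ := exists_lt_of_lt_csSup (hne x) hr
    exact hanti _ _ h.le hr'
  have hg : Continuous g := by
    refine continuous_iff_continuousAt.2 fun x => ?_
    rw [ContinuousAt, tendsto_order]
    constructor
    · intro r hr
      obtain ⟨r', h3, h4⟩ := exists_between hr
      filter_upwards [(hUo r').mem_nhds (h2 _ _ h4)] with y hy
      exact h3.trans_le (h1 _ _ hy)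
    · intro r hr
      obtain ⟨r', h3, h4⟩ := exists_between hr
      have : x ∈ (U r')ᶜ := fun hx => absurd (h1 _ _ hx) (not_le.2 h3)
      filter_upwards [(hUc r').isOpen_compl.mem_nhds this] with y hy
      refine lt_of_le_of_lt (not_lt.1 fun h => hy (h2 _ _ h)) h4
  refine ⟨⟨g, hg⟩, fun f hf x => ?_, fun k hk x => ?_⟩
  · refine le_of_forall_lt fun r hr => ?_
    obtain ⟨r', h3, h4⟩ := exists_between hr
    exact h3.trans_le (h1 _ _ (subset_closure ⟨f, hf, h4⟩))
  · exact csSup_le (hne x) fun r hr => hub k (fun f hf => hk hf) r x hr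

theorem idem_apply {p : C(X, ℝ)} (hp : p * p = p) (x : X) : p x = 0 ∨ p x = 1 := by
  have : p x * p x = p x := congrArg (fun f : C(X, ℝ) => f x) hp
  have h : p x * (p x - 1) = 0 := by linarith
  rcases mul_eq_zero.1 h with h | h
  · exact Or.inl h
  · exact Or.inr (by linarith)

/-- Bounded functions that agree on the overlaps of a family of clopen sets have a common
extension. -/
theorem exists_patch {ι : Type*} (p f : ι → C(X, ℝ)) {C : ℝ} (hC : 0 ≤ C)
    (hp : ∀ i, p i * p i = p i) (hb : ∀ i x, |f i x| ≤ C)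
    (h : ∀ i j, f i * (p i * p j) = f j * (p i * p j)) :
    ∃ g : C(X, ℝ), (∀ x, |g x| ≤ C) ∧ ∀ i, g * p i = f i * p i := by
  rcases isEmpty_or_nonempty ι with hι | hι
  · exact ⟨0, fun x => by simpa using hC, fun i => isEmptyElim i⟩
  set u : ι → C(X, ℝ) := fun i => f i * p i - C • (1 - p i)
  set v : ι → C(X, ℝ) := fun i => f i * p i + C • (1 - p i)
  have hub : ∀ i x, u i x ≤ C := fun i x => by
    have := abs_le.1 (hb i x)
    change f i x * p i x - C * (1 - p i x) ≤ C
    rcases idem_apply (hp i) x with h | h <;> rw [h] <;> linarith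
  obtain ⟨g, hg⟩ := exists_isLUB_continuousMap (F := Set.range u) (Set.range_nonempty u) (c := C)
    (by rintro _ ⟨i, rfl⟩ x; exact hub i x)
  have h1 : ∀ i x, f i x * p i x - C * (1 - p i x) ≤ g x := fun i x => hg.1 ⟨i, rfl⟩ x
  have h2 : ∀ i x, g x ≤ f i x * p i x + C * (1 - p i x) := fun i x => by
    refine (show g ≤ v i from hg.2 ?_) x
    rintro _ ⟨j, rfl⟩ y
    change f j y * p j y - C * (1 - p j y) ≤ f i y * p i y + C * (1 - p i y)
    have e : f i y * (p i y * p j y) = f j y * (p i y * p j y) :=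
      congrArg (fun f : C(X, ℝ) => f y) (h i j)
    have b1 := abs_le.1 (hb i y)
    have b2 := abs_le.1 (hb j y)
    rcases idem_apply (hp i) y with h | h <;> rcases idem_apply (hp j) y with h' | h' <;>
      rw [h, h'] at e ⊢ <;> linarith
  refine ⟨g, fun x => ?_, fun i => ?_⟩
  · obtain ⟨i⟩ := hι
    have a1 := h1 i x
    have a2 := h2 i x
    have b1 := abs_le.1 (hb i x)
    rw [abs_le]
    rcases idem_apply (hp i) x with h | h <;> rw [h] at a1 a2 <;> constructor <;> linarith
  · ext x
    change g x * p i x = f i x * p i x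
    have a1 := h1 i x
    have a2 := h2 i x
    rcases idem_apply (hp i) x with h | h <;> rw [h] at a1 a2 ⊢ <;> linarith

end stonean

section complexify
variable {X : Type*} [TopologicalSpace X]

theorem complexify_apply (f : C(X, ℝ)) (x : X) : complexify f x = f x := rfl

theorem complexify_mul (f g : C(X, ℝ)) : complexify (f * g) = complexify f * complexify g := by
  ext x; simp [complexify_apply]

theorem complexify_sub (f g : C(X, ℝ)) : complexify (f - g) = complexify f - complexify g := by
  ext x; simp [complexify_apply]

theorem complexify_add (f g : C(X, ℝ)) : complexify (f + g) = complexify f + complexify g := by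
  ext x; simp [complexify_apply]

theorem complexify_smul (r : ℝ) (f : C(X, ℝ)) : complexify (r • f) = (r : ℂ) • complexify f := by
  ext x; simp [complexify_apply]

theorem complexify_one : complexify (1 : C(X, ℝ)) = 1 := by
  ext x; simp [complexify_apply]

theorem complexify_zero : complexify (0 : C(X, ℝ)) = 0 := by
  ext x; simp [complexify_apply]

theorem star_complexify (f : C(X, ℝ)) : star (complexify f) = complexify f := by
  ext x; simp [complexify_apply]

theorem complexify_injective : Function.Injective (complexify (X := X)) := fun f g h => by
  ext x
  have : complexify f x = complexify g x := by rw [h]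
  simpa [complexify_apply] using this

/-- The real part of a function. -/
noncomputable def rePart (f : C(X, ℂ)) : C(X, ℝ) := ⟨fun x => (f x).re, by fun_prop⟩

/-- The imaginary part of a function. -/
noncomputable def imPart (f : C(X, ℂ)) : C(X, ℝ) := ⟨fun x => (f x).im, by fun_prop⟩

theorem complexify_re_add_im (f : C(X, ℂ)) :
    complexify (rePart f) + Complex.I • complexify (imPart f) = f := by
  ext x
  change ((f x).re : ℂ) + Complex.I * ((f x).im : ℂ) = f x
  rw [mul_comm]; exact Complex.re_add_im _

end complexify

section abelian
variable {X : Type*} [TopologicalSpace X]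
  {H : Type*} [NormedAddCommGroup H] [InnerProductSpace ℂ H] [CompleteSpace H]

/-- Preservation of suprema of bounded increasing nets of real functions. -/
def IsNormalHom (π : C(X, ℂ) →⋆ₐ[ℂ] (H →L[ℂ] H)) : Prop :=
  ∀ (F : Set C(X, ℝ)) (f : C(X, ℝ)), F.Nonempty →
    DirectedOn (· ≤ ·) F → IsLUB F f → IsLUB ((fun g => π (complexify g)) '' F) (π (complexify f))

variable (π : C(X, ℂ) →⋆ₐ[ℂ] (H →L[ℂ] H))

theorem map_complexify_nonneg {f : C(X, ℝ)} (hf : 0 ≤ f) : 0 ≤ π (complexify f) := by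
  let g : C(X, ℝ) := ⟨fun x => √(f x), by fun_prop⟩
  have : f = g * g := by ext x; exact (Real.mul_self_sqrt (hf x)).symm
  have h := star_mul_self_nonneg (π (complexify g))
  rwa [← map_star, star_complexify, ← map_mul, ← complexify_mul, ← this] at h

theorem map_complexify_mono {f g : C(X, ℝ)} (hf : f ≤ g) :
    π (complexify f) ≤ π (complexify g) := by
  rw [← sub_nonneg, ← map_sub, ← complexify_sub]
  exact map_complexify_nonneg π (sub_nonneg.2 hf)

/-- The measure of a vector. -/
noncomputable def vecFun (ξ : H) : C(X, ℝ) →ₗ[ℝ] ℝ where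
  toFun f := (inner ℂ ξ (π (complexify f) ξ)).re
  map_add' f g := by rw [complexify_add, map_add, add_apply, inner_add_right, Complex.add_re]
  map_smul' r f := by
    rw [complexify_smul, map_smul, smul_apply, inner_smul_right, Complex.re_ofReal_mul]; rfl

variable {π}

theorem vecFun_nonneg (ξ : H) {f : C(X, ℝ)} (hf : 0 ≤ f) : 0 ≤ vecFun π ξ f := by
  have := le_iff_inner.1 (map_complexify_nonneg π hf) ξ
  rw [sub_zero] at this
  exact (Complex.le_def.1 this).1

theorem vecFun_mono (ξ : H) {f g : C(X, ℝ)} (hf : f ≤ g) : vecFun π ξ f ≤ vecFun π ξ g := by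
  have := vecFun_nonneg (π := π) ξ (sub_nonneg.2 hf)
  rw [map_sub] at this
  linarith

theorem norm_sq_eq_vecFun (ξ : H) (f : C(X, ℝ)) :
    ‖π (complexify f) ξ‖ ^ 2 = vecFun π ξ (f * f) := by
  rw [← inner_self_eq_norm_sq (𝕜 := ℂ)]
  change _ = (inner ℂ ξ (π (complexify (f * f)) ξ)).re
  rw [complexify_mul, map_mul, mul_apply_eq_comp]
  conv_rhs => enter [1, 3, 1]; rw [← star_complexify f, map_star]
  rw [inner_star_right]; rfl

theorem vecFun_le_norm (ξ : H) (f : C(X, ℝ)) :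
    vecFun π ξ f ≤ ‖ξ‖ * ‖π (complexify f) ξ‖ := re_inner_le_norm (𝕜 := ℂ) _ _

theorem abs_mul_abs_cm (f : C(X, ℝ)) : |f| * |f| = f * f := by
  ext x
  simp [abs_mul_abs_self]

theorem IsNormalHom.exists_lt (hn : IsNormalHom π) {F : Set C(X, ℝ)} {f : C(X, ℝ)}
    (hF : F.Nonempty) (hd : DirectedOn (· ≤ ·) F) (hf : IsLUB F f) (ξ : H) {ε : ℝ} (hε : 0 < ε) :
    ∃ g ∈ F, vecFun π ξ (f - g) < ε := by
  have hd' : DirectedOn (· ≤ ·) ((fun g => π (complexify g)) '' F) := by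
    rintro _ ⟨a, ha, rfl⟩ _ ⟨b, hb, rfl⟩
    obtain ⟨c, hc, h1, h2⟩ := hd a ha b hb
    exact ⟨_, ⟨c, hc, rfl⟩, map_complexify_mono π h1, map_complexify_mono π h2⟩
  obtain ⟨_, ⟨g, hg, rfl⟩, h⟩ := ((isLUB_iff_inner (hF.image _) hd').1 (hn F f hF hd hf)).2 ξ ε hε
  refine ⟨g, hg, ?_⟩
  change (inner ℂ ξ (π (complexify (f - g)) ξ)).re < ε
  rwa [complexify_sub, map_sub]

variable [ExtremallyDisconnected X]

/-- The support of a vector. -/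
theorem IsNormalHom.exists_support [CompactSpace X] (hn : IsNormalHom π) (ξ : H) :
    ∃ q : C(X, ℝ), q * q = q ∧ π (complexify q) ξ = ξ ∧
      ∀ f : C(X, ℝ), π (complexify f) ξ = 0 → f * q = 0 := by
  set F : Set C(X, ℝ) := {f | 0 ≤ f ∧ f ≤ 1 ∧ π (complexify f) ξ = 0}
  have hzero : ∀ f : C(X, ℝ), 0 ≤ f → vecFun π ξ (f * f) = 0 → π (complexify f) ξ = 0 := by
    intro f _ h
    rw [← norm_sq_eq_vecFun] at h
    exact norm_eq_zero.1 (pow_eq_zero_iff two_ne_zero |>.1 h)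
  have hF0 : (0 : C(X, ℝ)) ∈ F := ⟨le_rfl, zero_le_one, by rw [complexify_zero, map_zero]; rfl⟩
  obtain ⟨n, hn'⟩ := exists_isLUB_continuousMap (F := F) ⟨0, hF0⟩ (c := 1) fun f hf x => hf.2.1 x
  have hvz : ∀ f, π (complexify f) ξ = 0 → vecFun π ξ f = 0 := fun f hf => by
    change (inner ℂ ξ (π (complexify f) ξ)).re = 0
    rw [hf, inner_zero_right, Complex.zero_re]
  have hd : DirectedOn (· ≤ ·) F := by
    rintro a ⟨ha0, ha1, ha⟩ b ⟨hb0, hb1, hb⟩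
    refine ⟨a ⊔ b, ⟨le_sup_of_le_left ha0, sup_le ha1 hb1, hzero _ (le_sup_of_le_left ha0) ?_⟩,
      le_sup_left, le_sup_right⟩
    refine le_antisymm ?_ (vecFun_nonneg ξ fun x => mul_self_nonneg _)
    have h1 : (a ⊔ b) * (a ⊔ b) ≤ a + b := fun x => by
      have h1 : 0 ≤ a x := ha0 x
      have h2 : 0 ≤ b x := hb0 x
      have h3 : a x ≤ 1 := ha1 x
      have h4 : b x ≤ 1 := hb1 x
      change max (a x) (b x) * max (a x) (b x) ≤ a x + b x
      rcases max_cases (a x) (b x) with ⟨h, -⟩ | ⟨h, -⟩ <;> rw [h] <;> nlinarith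
    refine (vecFun_mono ξ h1).trans ?_
    rw [map_add, hvz a ha, hvz b hb, add_zero]
  have hn0 : 0 ≤ n := hn'.1 hF0
  have hn1 : n ≤ 1 := hn'.2 fun f hf => hf.2.1
  have hvn : vecFun π ξ n = 0 := by
    refine le_antisymm (le_of_forall_pos_lt_add fun ε hε => ?_) (vecFun_nonneg ξ hn0)
    obtain ⟨g, hg, h⟩ := hn.exists_lt ⟨0, hF0⟩ hd hn' ξ hε
    rw [map_sub, hvz g hg.2.2] at h
    linarith
  let s : C(X, ℝ) := ⟨fun x => √(n x), by fun_prop⟩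
  have hs : s * s = n := by ext x; exact Real.mul_self_sqrt (hn0 x)
  have hs0 : 0 ≤ s := fun x => Real.sqrt_nonneg _
  have hsF : s ∈ F := ⟨hs0, fun x => Real.sqrt_le_one.2 (hn1 x), hzero s hs0 (by rw [hs, hvn])⟩
  have hsn : s = n := by
    refine le_antisymm (hn'.1 hsF) ?_
    rw [← hs]
    intro x
    have h1 : s x ≤ 1 := hsF.2.1 x
    have h2 : 0 ≤ s x := hs0 x
    change s x * s x ≤ s x
    nlinarith
  have hnn : n * n = n := by rw [hsn] at hs; exact hs
  have hnξ : π (complexify n) ξ = 0 := by rw [← hsn]; exact hsF.2.2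
  refine ⟨1 - n, ?_, ?_, fun f hf => ?_⟩
  · linear_combination hnn
  · rw [complexify_sub, map_sub, complexify_one, map_one, sub_apply, hnξ, sub_zero]; rfl
  · set c := ‖f‖ + 1
    have hc : 0 < c := by positivity
    have hmem : c⁻¹ • |f| ∈ F := by
      refine ⟨fun x => by simp; positivity, fun x => ?_, ?_⟩
      · change c⁻¹ * |f x| ≤ 1
        rw [inv_mul_le_iff₀ hc, mul_one]
        have := f.norm_coe_le_norm x
        rw [Real.norm_eq_abs] at this
        simp only [c]; linarith
      · rw [complexify_smul, map_smul, smul_apply, hzero |f| (abs_nonneg f), smul_zero]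
        rw [abs_mul_abs_cm, ← norm_sq_eq_vecFun, hf, norm_zero, zero_pow two_ne_zero]
    ext x
    have h1 : c⁻¹ * |f x| ≤ n x := hn'.1 hmem x
    rw [inv_mul_le_iff₀ hc] at h1
    change f x * (1 - n x) = 0
    rcases idem_apply hnn x with h | h
    · rw [h, mul_zero] at h1
      rw [abs_nonpos_iff.1 h1, zero_mul]
    · rw [h]; ring

/-- Limits of bounded sequences of functions converging rapidly on two vectors. -/
theorem IsNormalHom.exists_limit (hn : IsNormalHom π) {C : ℝ} (f : ℕ → C(X, ℝ))
    (hC : ∀ n x, |f n x| ≤ C) (P : H → Prop)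
    (hf : ∀ ξ, P ξ → ∀ n, ‖ξ‖ * ‖π (complexify (f (n + 1) - f n)) ξ‖ ≤ (1 / 2) ^ n) :
    ∃ h : C(X, ℝ), (∀ x, |h x| ≤ C) ∧
      ∀ ξ, P ξ → Tendsto (fun n => π (complexify (f n)) ξ) atTop (𝓝 (π (complexify h) ξ)) := by
  set t : ℕ → ℕ → C(X, ℝ) := fun N => fun m => Nat.rec (f N) (fun m s => s ⊔ f (N + m + 1)) m with ht
  have t0 : ∀ N, t N 0 = f N := fun N => rfl
  have ts : ∀ N m, t N (m + 1) = t N m ⊔ f (N + m + 1) := fun N m => rfl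
  have tmono : ∀ N, Monotone (t N) := fun N => monotone_nat_of_le_succ fun m => by
    rw [ts]; exact le_sup_left
  have tC : ∀ N m x, t N m x ≤ C := fun N m x => by
    induction m with
    | zero => rw [t0]; exact (abs_le.1 (hC N x)).2
    | succ m ih => rw [ts]; exact sup_le ih (abs_le.1 (hC _ x)).2
  have fle : ∀ N m, f (N + m) ≤ t N m := fun N m => by
    cases m with
    | zero => exact le_rfl
    | succ m => rw [ts]; exact le_sup_right
  choose s hs using fun N => exists_isLUB_continuousMap (F := Set.range (t N)) (Set.range_nonempty _)
    (c := C) (by rintro _ ⟨m, rfl⟩ x; exact tC N m x)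
  have tshift : ∀ N m, t (N + 1) m ≤ t N (m + 1) := fun N m => by
    induction m with
    | zero => exact fle N 1
    | succ m ih =>
      rw [ts, ts N (m + 1)]
      refine sup_le_sup ih (le_of_eq ?_)
      congr 1; omega
  have santi : Antitone s := antitone_nat_of_succ_le fun N => (hs (N + 1)).2 (by
    rintro _ ⟨m, rfl⟩; exact (tshift N m).trans ((hs N).1 ⟨m + 1, rfl⟩))
  have fs : ∀ N, f N ≤ s N := fun N => (hs N).1 ⟨0, rfl⟩
  have sC : ∀ N x, |s N x| ≤ C := fun N x => abs_le.2 ⟨(abs_le.1 (hC N x)).1.trans (fs N x),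
    (show s N ≤ ContinuousMap.const X C from (hs N).2 (by rintro _ ⟨m, rfl⟩ x; exact tC N m x)) x⟩
  obtain ⟨h', hh⟩ := exists_isLUB_continuousMap (F := Set.range fun N => - s N)
    (Set.range_nonempty _) (c := C) (by
      rintro _ ⟨m, rfl⟩ x
      have := (abs_le.1 (sC m x)).1
      change - s m x ≤ C
      linarith)
  have hs' : ∀ N, - h' ≤ s N := fun N => neg_le.1 (hh.1 ⟨N, rfl⟩)
  have h'C : ∀ x, |(-h') x| ≤ C := fun x => abs_le.2 ⟨by
    have := (show h' ≤ ContinuousMap.const X C from hh.2 (by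
      rintro _ ⟨m, rfl⟩ x
      have := (abs_le.1 (sC m x)).1
      change - s m x ≤ C
      linarith)) x
    change h' x ≤ C at this
    change - C ≤ - h' x
    linarith, (hs' 0 x).trans (abs_le.1 (sC 0 x)).2⟩
  refine ⟨-h', h'C, fun ξ hξ => ?_⟩
  have tb : ∀ N m, vecFun π ξ (t N m - f N) ≤ ∑ k ∈ Finset.range m, (1 / 2 : ℝ) ^ (N + k) := by
    intro N m
    have : t N m - f N ≤ ∑ k ∈ Finset.range m, |f (N + k + 1) - f (N + k)| := by
      rw [sub_le_iff_le_add]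
      have key : t N m ≤ ∑ k ∈ Finset.range m, |f (N + k + 1) - f (N + k)| + f N ∧
          f (N + m) ≤ ∑ k ∈ Finset.range m, |f (N + k + 1) - f (N + k)| + f N := by
        induction m with
        | zero => simp [t0]
        | succ m ih =>
          rw [Finset.sum_range_succ, ts]
          have h1 := abs_nonneg (f (N + m + 1) - f (N + m))
          have h2 := le_abs_self (f (N + m + 1) - f (N + m))
          have h3 : f (N + m + 1) ≤ |f (N + m + 1) - f (N + m)| + f (N + m) := by
            rwa [sub_le_iff_le_add] at h2
          have h4 := h3.trans (add_le_add le_rfl ih.2)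
          refine ⟨sup_le (ih.1.trans ?_) ?_, ?_⟩
          · gcongr
            exact le_add_of_nonneg_right h1
          · refine h4.trans (le_of_eq ?_); abel
          · refine h4.trans (le_of_eq ?_); abel
      exact key.1
    refine (vecFun_mono ξ this).trans ?_
    rw [map_sum]
    refine Finset.sum_le_sum fun k _ => (vecFun_le_norm ξ _).trans ?_
    have e : ‖π (complexify |f (N + k + 1) - f (N + k)|) ξ‖ =
        ‖π (complexify (f (N + k + 1) - f (N + k))) ξ‖ := by
      rw [← sq_eq_sq₀ (norm_nonneg _) (norm_nonneg _), norm_sq_eq_vecFun, norm_sq_eq_vecFun,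
        abs_mul_abs_cm]
    rw [e]
    exact hf ξ hξ (N + k)
  have geo : ∀ N m, ∑ k ∈ Finset.range m, (1 / 2 : ℝ) ^ (N + k) ≤ 2 * (1 / 2) ^ N := fun N m => by
    simp only [pow_add]
    rw [← Finset.mul_sum, mul_comm]
    gcongr
    have := geom_sum_eq (x := (1 / 2 : ℝ)) (by norm_num) m
    rw [this]
    have : (0 : ℝ) ≤ (1 / 2) ^ m := by positivity
    rw [div_le_iff_of_neg (by norm_num)]
    linarith
  have sb : ∀ N, vecFun π ξ (s N - f N) ≤ 2 * (1 / 2) ^ N := fun N => by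
    refine le_of_forall_pos_lt_add fun ε hε => ?_
    obtain ⟨_, ⟨m, rfl⟩, hm⟩ := hn.exists_lt (Set.range_nonempty _)
      (directedOn_range.2 (tmono N).directed_le) (hs N) ξ hε
    have h1 := (tb N m).trans (geo N m)
    rw [map_sub] at *
    linarith
  have hz : Tendsto (fun N => vecFun π ξ (s N - f N) + vecFun π ξ (s N - -h')) atTop (𝓝 0) := by
    rw [← add_zero (0 : ℝ)]
    refine Tendsto.add ?_ ?_
    · refine squeeze_zero (fun N => vecFun_nonneg ξ (sub_nonneg.2 (fs N))) sb ?_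
      have := (tendsto_pow_atTop_nhds_zero_of_lt_one (r := (1 / 2 : ℝ)) (by norm_num)
        (by norm_num)).const_mul 2
      rwa [mul_zero] at this
    · rw [Metric.tendsto_atTop]
      intro ε hε
      obtain ⟨_, ⟨N, rfl⟩, hN⟩ := hn.exists_lt (Set.range_nonempty _)
        (directedOn_range.2 (Monotone.directed_le fun a b hab => neg_le_neg (santi hab))) hh ξ hε
      refine ⟨N, fun n hn => ?_⟩
      have h0 := vecFun_nonneg (π := π) ξ (sub_nonneg.2 (hs' n))
      rw [Real.dist_0_eq_abs, abs_of_nonneg h0]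
      have h1 := vecFun_mono (π := π) ξ (santi hn)
      rw [sub_neg_eq_add, map_add] at *
      linarith
  have hz' : Tendsto (fun N => ‖π (complexify (f N)) ξ - π (complexify (-h')) ξ‖ ^ 2) atTop (𝓝 0) := by
    have := hz.const_mul (2 * C)
    rw [mul_zero] at this
    refine squeeze_zero (fun N => by positivity) (fun N => ?_) this
    rw [← sub_apply, ← map_sub, ← complexify_sub, norm_sq_eq_vecFun, ← map_add]
    have h1 : (f N - -h') * (f N - -h') ≤ (2 * C) • (s N - f N + (s N - -h')) := fun x => by
      have a1 := abs_le.1 (hC N x)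
      have a2 := abs_le.1 (h'C x)
      have a3 : f N x ≤ s N x := fs N x
      have a4 : (-h') x ≤ s N x := hs' N x
      change (f N x - (-h') x) * (f N x - (-h') x) ≤ (2 * C) * (s N x - f N x + (s N x - (-h') x))
      rcases le_total (f N x) ((-h') x) with h | h <;> nlinarith
    refine (vecFun_mono ξ h1).trans (le_of_eq ?_)
    rw [map_smul]; rfl
  rw [tendsto_iff_norm_sub_tendsto_zero]
  have := hz'.sqrt
  simpa [Real.sqrt_sq (norm_nonneg _)] using this

/-- A selfadjoint operator in the double commutant of a faithful normal representation of `C(X)`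
comes from a real function. -/
theorem IsNormalHom.exists_real_eq [CompactSpace X] (hn : IsNormalHom π)
    (hinj : Function.Injective π) {y : H →L[ℂ] H}
    (hy : ∀ t, (∀ f, π f * t = t * π f) → y * t = t * y) (hsa : IsSelfAdjoint y) :
    ∃ f : C(X, ℝ), π (complexify f) = y := by
  have hyc : ∀ f, y * π f = π f * y := fun f => hy _ fun g => by rw [← map_mul, mul_comm, map_mul]
  set C := ‖y‖ + 2
  have hnorm : ∀ f, ‖π f‖ = ‖f‖ := fun f => NonUnitalStarAlgHom.norm_map π hinj f
  have happ : ∀ (f : Fin 2 → H) (ε : ℝ), 0 < ε → ∃ g : C(X, ℝ), (∀ x, |g x| ≤ C) ∧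
      ∀ i, ‖y (f i) - π (complexify g) (f i)‖ < ε := by
    intro f ε hε
    obtain ⟨_, ⟨a, rfl⟩, ha, hf⟩ := kaplansky π.range (x := y) (fun t ht => hy t fun g => ht _ ⟨g, rfl⟩)
      hsa f hε
    refine ⟨rePart a, fun x => ?_, fun i => ?_⟩
    · exact (Complex.abs_re_le_norm _).trans ((a.norm_coe_le_norm x).trans ((hnorm a).symm.le.trans ha))
    · have e1 : complexify (rePart a) = (1 / 2 : ℂ) • (a + star a) := by
        ext x
        change (((a x).re : ℝ) : ℂ) = (1 / 2 : ℂ) * (a x + (starRingEnd ℂ) (a x))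
        rw [Complex.add_conj]; push_cast; ring
      have e2 : y (f i) - π (complexify (rePart a)) (f i) =
          (1 / 2 : ℂ) • ((y - π a) (f i) + star (y - π a) (f i)) := by
        rw [e1, map_smul, map_add, map_star, star_sub, hsa.star_eq]
        simp only [smul_apply, add_apply, sub_apply]
        module
      have e3 : ‖star (y - π a) (f i)‖ = ‖(y - π a) (f i)‖ := by
        have hnm : star (y - π a) * (y - π a) = (y - π a) * star (y - π a) := by
          rw [star_sub, hsa.star_eq, ← map_star, sub_mul, mul_sub, mul_sub, sub_mul, mul_sub, mul_sub,
            hyc, hyc, ← map_mul, ← map_mul, mul_comm (star a)]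
          abel
        rw [← sq_eq_sq₀ (norm_nonneg _) (norm_nonneg _), ← inner_self_eq_norm_sq (𝕜 := ℂ),
          ← inner_self_eq_norm_sq (𝕜 := ℂ), ← inner_star_right, ← inner_star_right, star_star,
          ← mul_apply_eq_comp, ← mul_apply_eq_comp, hnm]
      rw [e2, norm_smul]
      have := norm_add_le ((y - π a) (f i)) (star (y - π a) (f i))
      rw [e3] at this
      have h4 : ‖(y - π a) (f i)‖ < ε := hf i
      have h5 : ‖(1 / 2 : ℂ)‖ = 1 / 2 := by norm_num
      rw [h5]
      linarith
  have hlim : ∀ ξ η : H, ∃ h : C(X, ℝ), (∀ x, |h x| ≤ C) ∧ π (complexify h) ξ = y ξ ∧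
      π (complexify h) η = y η := by
    intro ξ η
    set K := ‖ξ‖ + ‖η‖ + 1
    have hK : 0 < K := by positivity
    choose f hfC hf using fun n : ℕ => happ ![ξ, η] ((1 / 2) ^ n / (2 * K)) (by positivity)
    have hP : ∀ ζ, ζ = ξ ∨ ζ = η → (∀ n, ‖y ζ - π (complexify (f n)) ζ‖ < (1 / 2) ^ n / (2 * K)) ∧
        ‖ζ‖ ≤ K := by
      rintro ζ (rfl | rfl)
      · exact ⟨fun n => hf n 0, by have := norm_nonneg η; simp only [K]; linarith⟩
      · exact ⟨fun n => hf n 1, by have := norm_nonneg ξ; simp only [K]; linarith⟩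
    obtain ⟨h, hh, hl⟩ := hn.exists_limit f hfC (fun ζ => ζ = ξ ∨ ζ = η) fun ζ hζ n => by
      obtain ⟨h1, h2⟩ := hP ζ hζ
      rw [complexify_sub, map_sub, sub_apply]
      have h3 : ‖π (complexify (f (n + 1))) ζ - π (complexify (f n)) ζ‖ ≤ (1 / 2) ^ n / K := by
        have a1 := h1 n
        have a2 := h1 (n + 1)
        rw [norm_sub_rev] at a2
        have a3 := norm_add_le (π (complexify (f (n + 1))) ζ - y ζ) (y ζ - π (complexify (f n)) ζ)
        rw [sub_add_sub_cancel] at a3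
        have a4 : (1 / 2 : ℝ) ^ (n + 1) / (2 * K) ≤ (1 / 2) ^ n / (2 * K) := by
          gcongr ?_ / _
          exact pow_le_pow_of_le_one (by norm_num) (by norm_num) (Nat.le_succ n)
        have a5 : (1 / 2 : ℝ) ^ n / (2 * K) + (1 / 2) ^ n / (2 * K) = (1 / 2) ^ n / K := by
          field_simp; ring
        linarith
      calc _ ≤ K * ((1 / 2) ^ n / K) := by gcongr
        _ = _ := by field_simp
    have hval : ∀ ζ, ζ = ξ ∨ ζ = η → π (complexify h) ζ = y ζ := fun ζ hζ => by
      refine tendsto_nhds_unique (hl ζ hζ) ?_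
      rw [tendsto_iff_norm_sub_tendsto_zero]
      refine squeeze_zero (fun n => norm_nonneg _) (fun n => ?_)
        (tendsto_pow_atTop_nhds_zero_of_lt_one (r := (1 / 2 : ℝ)) (by norm_num) (by norm_num) |>.div_const
          (2 * K) |>.trans (by rw [zero_div]))
      rw [norm_sub_rev]
      exact ((hP ζ hζ).1 n).le
    exact ⟨h, hh, hval ξ (Or.inl rfl), hval η (Or.inr rfl)⟩
  choose q hqq hqξ hq using fun ξ : H => hn.exists_support ξ
  choose h hhC hh using fun ξ : H => hlim ξ ξ
  have hloc : ∀ ξ, π (complexify (h ξ * q ξ)) = y * π (complexify (q ξ)) := by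
    intro ξ
    ext η
    obtain ⟨h', -, h1, h2⟩ := hlim ξ η
    have e : (h ξ - h') * q ξ = 0 := hq ξ _ (by
      rw [complexify_sub, map_sub, sub_apply, (hh ξ).1, h1, sub_self])
    rw [sub_mul, sub_eq_zero] at e
    rw [e, hyc, mul_comm, complexify_mul, map_mul, mul_apply_eq_comp, h2, mul_apply_eq_comp]
  obtain ⟨g, -, hg⟩ := exists_patch q h (C := C) (by positivity) hqq hhC fun ξ η => by
    apply complexify_injective
    apply hinj
    rw [← mul_assoc, complexify_mul, map_mul, hloc, mul_comm (q ξ), ← mul_assoc, complexify_mul, map_mul,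
      hloc, mul_assoc, mul_assoc, ← map_mul, ← map_mul, mul_comm (complexify (q η))]
  refine ⟨g, ?_⟩
  ext ξ
  conv_lhs => rw [← hqξ ξ]
  rw [← mul_apply_eq_comp, ← map_mul, ← complexify_mul, hg, hloc, mul_apply_eq_comp, hqξ]

/-- The range of a faithful normal representation of `C(X)` is its double commutant. -/
theorem IsNormalHom.exists_eq [CompactSpace X] (hn : IsNormalHom π) (hinj : Function.Injective π)
    {y : H →L[ℂ] H} (hy : ∀ t, (∀ f, π f * t = t * π f) → y * t = t * y) : ∃ f, π f = y := by
  have hstar : ∀ t, (∀ f, π f * t = t * π f) → star y * t = t * star y := fun t ht => by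
    have := hy (star t) fun f => by
      have := ht (star f)
      rw [map_star] at this
      have := congrArg star this
      rw [star_mul, star_mul, star_star] at this
      exact this.symm
    have := congrArg star this
    rw [star_mul, star_mul, star_star] at this
    exact this.symm
  obtain ⟨f, hf⟩ := hn.exists_real_eq hinj (y := y + star y) (fun t ht => by
    rw [add_mul, mul_add, hy t ht, hstar t ht]) (IsSelfAdjoint.add_star_self y)
  obtain ⟨g, hg⟩ := hn.exists_real_eq hinj (y := Complex.I • (star y - y)) (fun t ht => by
    rw [smul_mul_assoc, mul_smul_comm, sub_mul, mul_sub, hy t ht, hstar t ht]) (by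
    rw [IsSelfAdjoint, star_smul, star_sub, star_star, Complex.star_def, Complex.conj_I, neg_smul,
      ← smul_neg, neg_sub])
  refine ⟨(1 / 2 : ℂ) • (complexify f + Complex.I • complexify g), ?_⟩
  rw [map_smul, map_add, map_smul, hf, hg, smul_smul, Complex.I_mul_I]
  module

end abelian

section inverse
variable {S : Type*} [Semigroup S] [IsInverseSemigroup S]

theorem NatLE.eq_mul {s t : S} (h : NatLE s t) : s = t * (dag s * s) := by
  obtain ⟨e, he, rfl⟩ := h
  have h1 := mul_dag_mul t
  have h2 := idem_comm he (idem_dag_mul t)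
  have h3 := he.eq
  rw [dag_mul, dag_idem he]
  calc t * e = t * dag t * t * (e * e) := by rw [h1, h3]
    _ = t * (dag t * t * e) * e := by simp only [mul_assoc]
    _ = t * (e * (dag t * t)) * e := by rw [h2]
    _ = _ := by simp only [mul_assoc]

end inverse

section projections
variable {H : Type*} [NormedAddCommGroup H] [InnerProductSpace ℂ H] [CompleteSpace H]

/-- A closed subspace containing the projections of `M` contains `M`. -/
theorem mem_of_projections (M : VonNeumannAlgebra H) (C : Submodule ℂ (H →L[ℂ] H))
    (hC : IsClosed (C : Set (H →L[ℂ] H))) (hP : ∀ p ∈ M, IsStarProjection p → p ∈ C)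
    {x : H →L[ℂ] H} (hx : x ∈ M) : x ∈ C := by
  have smulM : ∀ (r : ℂ) {y : H →L[ℂ] H}, y ∈ M → r • y ∈ M := fun r y hy =>
    M.toStarSubalgebra.smul_mem hy r
  have hpos : ∀ x ∈ M, 0 ≤ x → x ∈ C := by
    intro x hx h0
    have h1 : x ≤ algebraMap ℝ _ (‖x‖ + 1) := by
      refine (IsSelfAdjoint.le_algebraMap_norm_self (a := x) h0.isSelfAdjoint).trans ?_
      rw [← sub_nonneg, ← map_sub, add_sub_cancel_left, map_one]
      exact zero_le_one
    refine mem_of_dyadic (C := (C : Set (H →L[ℂ] H)))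
      (Q := fun c x => x ∈ M ∧ 0 ≤ x ∧ x ≤ algebraMap ℝ _ c) hC C.zero_mem
      (fun x hx y hy => C.add_mem hx hy) ?_ ?_ (c := ‖x‖ + 1) (by positivity) ⟨hx, h0, h1⟩
    · rintro c hc x ⟨h1, h2, h3⟩
      obtain ⟨p, hpM, hp, h4, h5, -⟩ := exists_dyadic_projection M h1 hc h2 h3
      refine ⟨p, ?_, ?_, h4, h5⟩
      · rw [← Complex.coe_smul]
        exact C.smul_mem _ (hP p hpM hp)
      · rw [← Complex.coe_smul]
        exact sub_mem h1 (smulM _ hpM)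
    · rintro c hc x ⟨-, h1, h2⟩
      exact norm_le_of_nonneg_of_le hc.le h1 h2
  have hsa : ∀ x ∈ M, IsSelfAdjoint x → x ∈ C := by
    intro x hx h
    have h1 : 0 ≤ x + algebraMap ℝ _ ‖x‖ := by
      have := IsSelfAdjoint.neg_algebraMap_norm_le_self (a := x) h
      rwa [neg_le_iff_add_nonneg] at this
    have h2 : algebraMap ℝ (H →L[ℂ] H) ‖x‖ ∈ M := by
      rw [Algebra.algebraMap_eq_smul_one, ← Complex.coe_smul]
      exact smulM _ (one_mem M)
    have h3 : 0 ≤ algebraMap ℝ (H →L[ℂ] H) ‖x‖ := by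
      have := algebraMap_mono (H →L[ℂ] H) (norm_nonneg x)
      rwa [map_zero] at this
    have := C.sub_mem (hpos _ (add_mem hx h2) h1) (hpos _ h2 h3)
    rwa [add_sub_cancel_right] at this
  have e : x = (1 / 2 : ℂ) • ((x + star x) + (-Complex.I) • (Complex.I • (x - star x))) := by
    rw [smul_smul, neg_mul, Complex.I_mul_I]
    module
  rw [e]
  refine C.smul_mem _ (C.add_mem (hsa _ (add_mem hx (star_mem hx)) (IsSelfAdjoint.add_star_self x))
    (C.smul_mem _ (hsa _ (smulM _ (sub_mem hx (star_mem hx))) ?_)))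
  rw [IsSelfAdjoint, star_smul, star_sub, star_star, Complex.star_def, Complex.conj_I, neg_smul,
    ← smul_neg, neg_sub]

end projections

section pair
variable {H : Type*} [NormedAddCommGroup H] [InnerProductSpace ℂ H] [CompleteSpace H]
  {M D : VonNeumannAlgebra H} (h : IsCartanPair M D)

/-- Partial isometries of `D` are groupoid normalizers. -/
def ofD (u : H →L[ℂ] H) (hu : u ∈ D) (hu' : u * star u * u = u) : GN h :=
  ⟨u, h.le hu, hu', fun _ hd => ⟨mul_mem (mul_mem hu hd) (star_mem hu),
    mul_mem (mul_mem (star_mem hu) hd) hu⟩⟩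

/-- Projections of `D` as idempotents. -/
def idemOfProj (e : H →L[ℂ] H) (he : e ∈ D) (hp : IsStarProjection e) : Idem (GN h) :=
  ⟨ofD h e he (by rw [hp.isSelfAdjoint.star_eq, hp.isIdempotentElem.eq, hp.isIdempotentElem.eq]),
    Subtype.ext hp.isIdempotentElem⟩

variable {h}

theorem coe_dag (v : GN h) : (dag v : GN h) = star (v : H →L[ℂ] H) := by
  have := dag_eq (s := v) (t := ⟨star (v : H →L[ℂ] H), v.2.adjoint⟩) (Subtype.ext v.2.2.1)
    (Subtype.ext (by
      have := v.2.adjoint.2.1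
      rwa [star_star] at this))
  rw [this]

theorem isStarProjection_idem {e : GN h} (he : IsIdempotentElem e) :
    IsStarProjection (e : H →L[ℂ] H) :=
  ⟨congrArg Subtype.val he, by
    have := coe_dag e
    rw [dag_idem he] at this
    exact this.symm⟩

theorem coe_dag_munn {G : Type*} [Semigroup G] [IsInverseSemigroup G] (v : G) :
    dag (v : MunnQuotient G) = ((dag v : G) : MunnQuotient G) := by
  apply dag_eq
  · rw [← Con.coe_mul, ← Con.coe_mul, mul_dag_mul]
  · rw [← Con.coe_mul, ← Con.coe_mul, dag_mul_dag]

theorem munn_eq_iff {v w : GN h} : (v : MunnQuotient (GN h)) = w ↔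
    ∀ d ∈ D, (v : H →L[ℂ] H) * d * star (v : H →L[ℂ] H) = w * d * star (w : H →L[ℂ] H) := by
  rw [Con.eq]
  constructor
  · intro hvw d hd
    let C : Submodule ℂ (H →L[ℂ] H) :=
      { carrier := {d | (v : H →L[ℂ] H) * d * star (v : H →L[ℂ] H) = w * d * star (w : H →L[ℂ] H)}
        zero_mem' := by simp
        add_mem' := fun {a b} ha hb => by
          simp only [Set.mem_ofPred_eq] at *
          rw [mul_add, add_mul, ha, hb, mul_add, add_mul]
        smul_mem' := fun c a ha => by
          simp only [Set.mem_ofPred_eq] at *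
          rw [mul_smul_comm, smul_mul_assoc, ha, mul_smul_comm, smul_mul_assoc] }
    refine mem_of_projections D C (isClosed_eq (by fun_prop) (by fun_prop)) (fun p hp hpp => ?_) hd
    have := congrArg Subtype.val (hvw (idemOfProj h p hp hpp) (idemOfProj h p hp hpp).2)
    simp only [Submonoid.coe_mul, coe_dag] at this
    exact this
  · intro hd e he
    apply Subtype.ext
    simp only [Submonoid.coe_mul, coe_dag]
    exact hd e (idem_GN h he)

theorem idem_eq_of_munn_eq {e f : GN h} (he : IsIdempotentElem e) (hf : IsIdempotentElem f)
    (hef : (e : MunnQuotient (GN h)) = f) : e = f := by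
  have := munn_eq_iff.1 hef 1 (one_mem D)
  rw [mul_one, mul_one, (isStarProjection_idem he).isSelfAdjoint.star_eq,
    (isStarProjection_idem hf).isSelfAdjoint.star_eq,
    (isStarProjection_idem he).isIdempotentElem.eq,
    (isStarProjection_idem hf).isIdempotentElem.eq] at this
  exact Subtype.ext this

theorem eq_zero_of_munn_eq_zero {v : GN h} (hv : (v : MunnQuotient (GN h)) = 0) : v = 0 := by
  have h1 := munn_eq_iff.1 (show (v : MunnQuotient (GN h)) = ((0 : GN h) : MunnQuotient (GN h)) from hv)
    1 (one_mem D)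
  rw [mul_one] at h1
  have h2 : ((0 : GN h) : H →L[ℂ] H) = 0 := rfl
  rw [h2, zero_mul, zero_mul, CStarRing.mul_star_self_eq_zero_iff] at h1
  exact Subtype.ext h1

theorem exists_idem_lift {x : MunnQuotient (GN h)} (hx : IsIdempotentElem x) :
    ∃ e : Idem (GN h), ((e : GN h) : MunnQuotient (GN h)) = x := by
  induction x using Con.induction_on with
  | H v =>
    refine ⟨⟨dag v * v, idem_dag_mul v⟩, ?_⟩
    change ((dag v * v : GN h) : MunnQuotient (GN h)) = v
    rw [Con.coe_mul, ← coe_dag_munn, dag_idem hx]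
    exact hx

theorem mem_D_of_idem {v : GN h} (hv : IsIdempotentElem (v : MunnQuotient (GN h))) :
    (v : H →L[ℂ] H) ∈ D := by
  have h0 : (v : MunnQuotient (GN h)) = ((dag v * v : GN h) : MunnQuotient (GN h)) := by
    rw [Con.coe_mul, ← coe_dag_munn, dag_idem hv]
    exact hv.symm
  have h1 := munn_eq_iff.1 h0
  have hp := isStarProjection_idem (idem_dag_mul v)
  have heD : ((dag v * v : GN h) : H →L[ℂ] H) ∈ D := idem_GN h (idem_dag_mul v)
  have he : ((dag v * v : GN h) : H →L[ℂ] H) = star (v : H →L[ℂ] H) * v := by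
    rw [Submonoid.coe_mul, coe_dag]
  set e : H →L[ℂ] H := ((dag v * v : GN h) : H →L[ℂ] H)
  have hpi : e * e = e := hp.isIdempotentElem
  simp only [hp.isSelfAdjoint.star_eq] at h1
  have hve : (v : H →L[ℂ] H) * e = v := by rw [he, ← mul_assoc]; exact v.2.2.1
  have hvv : (v : H →L[ℂ] H) * star (v : H →L[ℂ] H) = e := by
    have := h1 1 (one_mem D)
    rwa [mul_one, mul_one, hpi] at this
  have hev : e * v = v := by rw [← hvv]; exact v.2.2.1
  refine (h.masa _ v.2.1).2 fun d hd => ?_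
  symm
  calc (v : H →L[ℂ] H) * d = v * (e * d) := by rw [← mul_assoc, hve]
    _ = v * d * star (v : H →L[ℂ] H) * v := by
      rw [h.comm heD hd, he]; simp only [mul_assoc]
    _ = e * d * e * v := by rw [h1 d hd]
    _ = d * v := by rw [h.comm heD hd, mul_assoc d, hpi, mul_assoc, hev]

theorem munn_eq_of_mem_D {v : GN h} (hv : (v : H →L[ℂ] H) ∈ D) :
    (v : MunnQuotient (GN h)) = ((dag v * v : GN h) : MunnQuotient (GN h)) := by
  rw [munn_eq_iff]
  intro d hd
  rw [(isStarProjection_idem (idem_dag_mul v)).isSelfAdjoint.star_eq, Submonoid.coe_mul, coe_dag]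
  have h1 := h.comm hv (star_mem hv)
  have h2 := h.comm hv hd
  have h3 := h.comm (star_mem hv) hd
  have h4 : (v : H →L[ℂ] H) * star (v : H →L[ℂ] H) * v = v := v.2.2.1
  grind

theorem idem_of_mem_D {v : GN h} (hv : (v : H →L[ℂ] H) ∈ D) :
    IsIdempotentElem (v : MunnQuotient (GN h)) := by
  rw [munn_eq_of_mem_D hv]
  exact idem_mk ⟨_, idem_dag_mul v⟩

/-- The largest projection on which two normalizers agree modulo the Munn congruence. -/
theorem exists_agreement (v w : GN h) : ∃ e : Idem (GN h),
    ((v * e : GN h) : MunnQuotient (GN h)) = (w * e : GN h) ∧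
    ∀ g : Idem (GN h), ((v * g : GN h) : MunnQuotient (GN h)) = (w * g : GN h) →
      (e : GN h) * g = g := by
  set V : H →L[ℂ] H := (v : H →L[ℂ] H)
  set W : H →L[ℂ] H := (w : H →L[ℂ] H)
  have hV : V * star V * V = V := v.2.2.1
  have hW : W * star W * W = W := w.2.2.1
  have hVs : star V * V ∈ D := v.2.star_mul_mem
  have hWs : star W * W ∈ D := w.2.star_mul_mem
  set P : Set (H →L[ℂ] H) := {g | g ∈ D ∧ (star V * V - star W * W) * g = 0 ∧
    (1 - W * star W) * V * g = 0 ∧ ∀ d ∈ D, (d * (star W * V) - star W * V * d) * g = 0}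
  obtain ⟨e, heD, he, h1, h2⟩ := exists_sup_projection D P fun p hp => hp.1
  have e1 := h2 _ fun p hp => hp.2.1
  have e2 := h2 _ fun p hp => hp.2.2.1
  have e3 := fun d hd => h2 _ fun p hp => hp.2.2.2 d hd
  rw [sub_mul, sub_eq_zero] at e1
  rw [sub_mul, sub_mul, one_mul, sub_eq_zero] at e2
  set e' := idemOfProj h e heD he
  have hee : ((e' : GN h) : H →L[ℂ] H) = e := rfl
  refine ⟨e', ?_, fun g hg => ?_⟩
  · set u : GN h := dag w * (v * e') with hu
    have huv : (u : H →L[ℂ] H) = star W * V * e := by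
      rw [hu, Submonoid.coe_mul, Submonoid.coe_mul, coe_dag, hee, mul_assoc]
    have huD : (u : H →L[ℂ] H) ∈ D := by
      refine (h.masa _ u.2.1).2 fun d hd => ?_
      have := e3 d hd
      rw [sub_mul, sub_eq_zero] at this
      rw [huv, ← mul_assoc, this, mul_assoc _ d, h.comm hd heD]
      simp only [mul_assoc]
    have huu : (dag u * u : GN h) = dag v * v * e' := by
      apply Subtype.ext
      rw [Submonoid.coe_mul, coe_dag, huv, Submonoid.coe_mul, Submonoid.coe_mul, coe_dag, hee,
        star_mul, star_mul, star_star, he.isSelfAdjoint.star_eq]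
      calc e * (star V * W) * (star W * V * e) = e * (star V * (W * star W * V * e)) := by
            simp only [mul_assoc]
        _ = e * (star V * V) * e := by rw [← e2]; simp only [mul_assoc]
        _ = star V * V * e := by rw [h.comm heD hVs, mul_assoc, he.isIdempotentElem.eq]
    have a1 : v * (e' : GN h) = w * u := by
      apply Subtype.ext
      rw [Submonoid.coe_mul, Submonoid.coe_mul, huv, hee]
      refine e2.trans ?_
      simp only [mul_assoc]; rfl
    rw [a1, Con.coe_mul, munn_eq_of_mem_D huD, huu, ← Con.coe_mul]
    congr 1
    apply Subtype.ext
    simp only [Submonoid.coe_mul, coe_dag, hee]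
    change W * (star V * V * e) = W * e
    rw [e1, ← mul_assoc, ← mul_assoc, hW]
  · apply Subtype.ext
    refine h1 _ ?_
    have hgp := isStarProjection_idem g.2
    have hgD := idem_GN h g.2
    set g' : H →L[ℂ] H := ((g : GN h) : H →L[ℂ] H)
    have hgi : g' * g' = g' := hgp.isIdempotentElem
    have hr : V * g' * star V = W * g' * star W := by
      have := munn_eq_iff.1 hg 1 (one_mem D)
      simp only [Submonoid.coe_mul, star_mul, mul_one] at this
      change V * g' * (star g' * star V) = W * g' * (star g' * star W) at this
      rwa [hgp.isSelfAdjoint.star_eq, ← mul_assoc, mul_assoc V, hgi, ← mul_assoc, mul_assoc W, hgi]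
        at this
    refine ⟨hgD, ?_, ?_, fun d hd => ?_⟩
    · have h3 : ((dag (v * g) * (v * g) : GN h) : MunnQuotient (GN h)) =
          ((dag (w * g) * (w * g) : GN h) : MunnQuotient (GN h)) := by
        rw [Con.coe_mul, ← coe_dag_munn, hg, coe_dag_munn, ← Con.coe_mul]
      have h4 := congrArg Subtype.val (idem_eq_of_munn_eq (idem_dag_mul _) (idem_dag_mul _) h3)
      simp only [Submonoid.coe_mul, coe_dag, star_mul] at h4
      change star g' * star V * (V * g') = star g' * star W * (W * g') at h4
      rw [hgp.isSelfAdjoint.star_eq] at h4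
      rw [sub_mul, sub_eq_zero]
      calc star V * V * g' = (star V * V * g') * g' := by rw [mul_assoc _ g', hgi]
        _ = g' * star V * (V * g') := by rw [h.comm hVs hgD]; simp only [mul_assoc]
        _ = (star W * W * g') * g' := by rw [h4, h.comm hWs hgD]; simp only [mul_assoc]
        _ = _ := by rw [mul_assoc _ g', hgi]
    · rw [sub_mul, sub_mul, one_mul, sub_eq_zero]
      have h3 : V * g' = W * g' * star W * (V * g') := by
        rw [← hr]
        calc V * g' = V * star V * V * (g' * g') := by rw [hV, hgi]
          _ = V * (star V * V * g') * g' := by simp only [mul_assoc]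
          _ = _ := by rw [h.comm hVs hgD]; simp only [mul_assoc]
      calc V * g' = W * g' * star W * (V * g') := h3
        _ = W * star W * W * g' * star W * (V * g') := by rw [hW]
        _ = W * star W * (W * g' * star W * (V * g')) := by simp only [mul_assoc]
        _ = _ := by rw [← h3, mul_assoc _ V]
    · have h3 : IsIdempotentElem ((dag w * (v * g) : GN h) : MunnQuotient (GN h)) := by
        rw [Con.coe_mul, hg, ← Con.coe_mul, ← mul_assoc]
        exact idem_mk ⟨_, idem_mul_aux (idem_dag_mul w) g.2⟩
      have h4 := mem_D_of_idem h3
      have h5 := (h.masa _ (h.le h4)).1 h4 d hd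
      simp only [Submonoid.coe_mul, coe_dag] at h5
      change d * (star W * (V * g')) = star W * (V * g') * d at h5
      rw [sub_mul, sub_eq_zero]
      calc d * (star W * V) * g' = d * (star W * (V * g')) := by simp only [mul_assoc]
        _ = star W * V * (g' * d) := by rw [h5]; simp only [mul_assoc]
        _ = _ := by rw [h.comm hgD hd]; simp only [mul_assoc]

end pair

section sums
variable {H : Type*} [NormedAddCommGroup H] [InnerProductSpace ℂ H] [CompleteSpace H]
  {M D : VonNeumannAlgebra H} {ι : Type*}

theorem sum_mul_star_aux [DecidableEq ι] {v : ι → H →L[ℂ] H} {i : ι} {d : H →L[ℂ] H}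
    (ho : ∀ j, j ≠ i → v j * d * star (v i) = 0) {s : Finset ι} (hi : i ∈ s) :
    (∑ j ∈ s, v j) * d * star (v i) = v i * d * star (v i) := by
  rw [Finset.sum_mul, Finset.sum_mul]
  exact Finset.sum_eq_single_of_mem i hi fun j _ hj => ho j hj

theorem conj_mem_of_sum (h : IsCartanPair M D) {v : ι → H →L[ℂ] H}
    (hv : ∀ i, IsGroupoidNormalizer M D (v i)) (ho : ∀ i j, i ≠ j → v i * star (v j) = 0)
    {𝒰 : Ultrafilter (Finset ι)} (h𝒰 : (𝒰 : Filter (Finset ι)) ≤ atTop) {u : H →L[ℂ] H}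
    (hu : WTendsto (fun s : Finset ι => ∑ i ∈ s, v i) 𝒰 u) {d : H →L[ℂ] H} (hd : d ∈ D) :
    u * d * star u ∈ D := by
  classical
  have h1 : ∀ i j, j ≠ i → v j * d * star (v i) = 0 := by
    intro i j hj
    have a1 : star (v j) * v j * d = d * (star (v j) * v j) := h.comm (hv j).star_mul_mem hd
    have a2 : star (v j) * v j * (star (v i) * v i) = 0 := by
      rw [mul_assoc, ← mul_assoc (v j), ho j i hj, zero_mul, mul_zero]
    have a3 : star (v i) * v i * star (v i) = star (v i) := by
      have := (hv i).adjoint.2.1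
      rwa [star_star] at this
    calc v j * d * star (v i) = v j * star (v j) * v j * d * (star (v i) * v i * star (v i)) := by
          rw [(hv j).2.1, a3]
      _ = v j * (star (v j) * v j * d) * (star (v i) * v i) * star (v i) := by
        simp only [mul_assoc]
      _ = v j * d * (star (v j) * v j * (star (v i) * v i)) * star (v i) := by
        rw [a1]; simp only [mul_assoc]
      _ = 0 := by rw [a2, mul_zero, zero_mul]
  have h2 : ∀ i, u * d * star (v i) = v i * d * star (v i) := fun i => by
    refine WTendsto.unique ((hu.mul_right d).mul_right (star (v i))) ((wTendsto_const _).congr' ?_)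
    filter_upwards [h𝒰 (eventually_ge_atTop {i})] with s hs
    exact (sum_mul_star_aux (h1 i) (Finset.singleton_subset_iff.1 hs)).symm
  refine (hu.star.mul_left (u * d)).mem D (Eventually.of_forall fun s => ?_)
  rw [star_sum, Finset.mul_sum]
  refine sum_mem fun i _ => ?_
  rw [h2]
  exact ((hv i).2.2 d hd).1

/-- The sum of an orthogonal family of normalizers. -/
theorem exists_sum_normalizer (h : IsCartanPair M D) (v : ι → H →L[ℂ] H)
    (hv : ∀ i, IsGroupoidNormalizer M D (v i))
    (ho : ∀ i j, i ≠ j → star (v i) * v j = 0 ∧ v i * star (v j) = 0) :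
    ∃ u, IsGroupoidNormalizer M D u ∧ (∀ i, u * (star (v i) * v i) = v i) ∧
      (∀ y, (∀ i, y * v i = 0) → y * u = 0) ∧ ∀ y, (∀ i, v i * y = 0) → u * y = 0 := by
  classical
  set F : Finset ι → H →L[ℂ] H := fun s => ∑ i ∈ s, v i with hF
  set 𝒰 : Ultrafilter (Finset ι) := Ultrafilter.of atTop
  have h𝒰 : (𝒰 : Filter (Finset ι)) ≤ atTop := Ultrafilter.of_le _
  have a3 : ∀ i, star (v i) * v i * star (v i) = star (v i) := fun i => by
    have := (hv i).adjoint.2.1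
    rwa [star_star] at this
  have f1 : ∀ s, ∀ i ∈ s, F s * star (v i) = v i * star (v i) := fun s i hi => by
    have := sum_mul_star_aux (v := v) (i := i) (d := 1)
      (fun j hj => by rw [mul_one, (ho j i hj).2]) hi
    rwa [mul_one, mul_one] at this
  have f2 : ∀ s, ∀ i ∈ s, star (v i) * F s = star (v i) * v i := fun s i hi => by
    rw [hF, Finset.mul_sum]
    exact Finset.sum_eq_single_of_mem i hi fun j _ hj => (ho i j hj.symm).1
  have f3 : ∀ s, star (F s) * F s = ∑ i ∈ s, star (v i) * v i := fun s => by
    conv_lhs => rw [hF, Finset.mul_sum]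
    refine Finset.sum_congr rfl fun i hi => ?_
    have := congrArg star (f2 s i hi)
    rwa [star_mul, star_mul, star_star] at this
  have f4 : ∀ s, IsStarProjection (star (F s) * F s) := fun s => by
    refine ⟨?_, IsSelfAdjoint.star_mul_self _⟩
    rw [IsIdempotentElem]
    conv_lhs => rw [mul_assoc, f3, Finset.mul_sum]
    rw [Finset.sum_congr rfl fun i hi => show F s * (star (v i) * v i) = v i by
      rw [← mul_assoc, f1 s i hi, (hv i).2.1]]
  have f5 : ∀ s, ‖F s‖ ≤ 1 := fun s => by
    have h1 := norm_le_of_nonneg_of_le zero_le_one (proj_nonneg (f4 s))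
      (by rw [map_one]; exact proj_le_one (f4 s))
    rw [CStarRing.norm_star_mul_self] at h1
    nlinarith [norm_nonneg (F s)]
  obtain ⟨u, hu⟩ := exists_wTendsto 𝒰 F 1 (Eventually.of_forall f5)
  have hmem : ∀ i, ∀ᶠ s in (𝒰 : Filter (Finset ι)), i ∈ s := fun i => by
    filter_upwards [h𝒰 (eventually_ge_atTop {i})] with s hs using Finset.singleton_subset_iff.1 hs
  have uA : ∀ i, star (v i) * u = star (v i) * v i := fun i =>
    (hu.mul_left _).unique ((wTendsto_const _).congr' ((hmem i).mono fun s hs => (f2 s i hs).symm))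
  have uB : ∀ i, u * star (v i) = v i * star (v i) := fun i =>
    (hu.mul_right _).unique ((wTendsto_const _).congr' ((hmem i).mono fun s hs => (f1 s i hs).symm))
  have uy : ∀ y, (∀ i, y * v i = 0) → y * u = 0 := fun y hy =>
    (hu.mul_left y).unique ((wTendsto_const _).congr' (Eventually.of_forall fun s => by
      change 0 = y * ∑ i ∈ s, v i
      rw [Finset.mul_sum]; exact (Finset.sum_eq_zero fun i _ => hy i).symm))
  have uy' : ∀ y, (∀ i, v i * y = 0) → u * y = 0 := fun y hy =>
    (hu.mul_right y).unique ((wTendsto_const _).congr' (Eventually.of_forall fun s => by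
      change 0 = (∑ i ∈ s, v i) * y
      rw [Finset.sum_mul]; exact (Finset.sum_eq_zero fun i _ => hy i).symm))
  obtain ⟨P, hPD, hP, h1, h2⟩ := exists_sup_projection D (Set.range fun i => star (v i) * v i)
    (by rintro _ ⟨i, rfl⟩; exact (hv i).star_mul_mem)
  have hvP : ∀ i, v i * P = v i := fun i => by
    have := congrArg star (h1 _ ⟨i, rfl⟩)
    rw [star_mul, star_mul, star_star, hP.isSelfAdjoint.star_eq] at this
    rw [← (hv i).2.1, mul_assoc, mul_assoc, ← mul_assoc (star (v i)), this, mul_assoc]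
  have huP : u * P = u := by
    have := uy' (1 - P) fun i => by rw [mul_sub, mul_one, hvP, sub_self]
    rw [mul_sub, mul_one, sub_eq_zero] at this
    exact this.symm
  have huuP : star u * u * P = P := by
    have := h2 (star u * u - 1) (by
      rintro _ ⟨i, rfl⟩
      have e := congrArg star (uA i)
      rw [star_mul, star_mul, star_star] at e
      rw [sub_mul, one_mul, sub_eq_zero]
      calc star u * u * (star (v i) * v i) = star u * (u * star (v i)) * v i := by
            simp only [mul_assoc]
        _ = star u * (v i * star (v i) * v i) := by rw [uB]; simp only [mul_assoc]
        _ = star (v i) * v i := by rw [(hv i).2.1, e])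
    rwa [sub_mul, one_mul, sub_eq_zero] at this
  have huu : star u * u = P := by
    rw [← huuP, mul_assoc, huP]
  refine ⟨u, ⟨?_, ?_, fun d hd => ⟨?_, ?_⟩⟩, fun i => ?_, uy, uy'⟩
  · exact hu.mem M (Eventually.of_forall fun s => sum_mem fun i _ => (hv i).1)
  · rw [mul_assoc, huu, huP]
  · exact conj_mem_of_sum h hv (fun i j hij => (ho i j hij).2) h𝒰 hu hd
  · have := conj_mem_of_sum h (fun i => (hv i).adjoint) (fun i j hij => by
      rw [star_star]; exact (ho i j hij).1) h𝒰 (hu.star.congr' (Eventually.of_forall fun s =>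
        star_sum s v)) hd
    rwa [star_star] at this
  · rw [← mul_assoc, uB, (hv i).2.1]

end sums

section monoid
variable {H : Type*} [NormedAddCommGroup H] [InnerProductSpace ℂ H] [CompleteSpace H]
  {M D : VonNeumannAlgebra H} {h : IsCartanPair M D}

theorem munn_exists_meet (s t : MunnQuotient (GN h)) : ∃ m, IsMeet s t m := by
  induction s using Con.induction_on with
  | H v =>
  induction t using Con.induction_on with
  | H w =>
  obtain ⟨e, he, h1⟩ := exists_agreement v w
  refine ⟨(v * e : GN h), ⟨_, idem_mk e, rfl⟩, ⟨_, idem_mk e, he⟩, fun r hr hr' => ?_⟩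
  induction r using Con.induction_on with
  | H x =>
  have a1 := hr.eq_mul
  have a2 := hr'.eq_mul
  rw [coe_dag_munn, ← Con.coe_mul, ← Con.coe_mul] at a1 a2
  have a3 := h1 ⟨_, idem_dag_mul x⟩ (a1.symm.trans a2)
  refine ⟨_, idem_mk ⟨_, idem_dag_mul x⟩, ?_⟩
  rw [← Con.coe_mul, mul_assoc, a3]
  exact a1

theorem munn_exists_join (A : Set (MunnQuotient (GN h))) (hA : A.Pairwise Orthogonal) :
    ∃ m, IsJoin A m := by
  choose v hv using fun a : A => Con.mk'_surjective (a : MunnQuotient (GN h))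
  have hv' : ∀ a : A, (v a : MunnQuotient (GN h)) = a := hv
  have ho : ∀ a b : A, a ≠ b → star (v a : H →L[ℂ] H) * v b = 0 ∧ (v a : H →L[ℂ] H) * star (v b : H →L[ℂ] H) = 0 := by
    intro a b hab
    have h1 := (hA a.2 b.2 fun hh => hab (Subtype.ext hh)).1
    have h2 := (hA b.2 a.2 fun hh => hab (Subtype.ext hh.symm)).2
    rw [← hv' a, ← hv' b, coe_dag_munn, ← Con.coe_mul] at h1 h2
    have h3 := congrArg Subtype.val (eq_zero_of_munn_eq_zero h1)
    have h4 := congrArg Subtype.val (eq_zero_of_munn_eq_zero h2)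
    rw [Submonoid.coe_mul, coe_dag] at h3 h4
    exact ⟨h3, h4⟩
  obtain ⟨u, hu, h1, -, h2⟩ := exists_sum_normalizer h (fun a => (v a : H →L[ℂ] H))
    (fun a => (v a).2) ho
  set U : GN h := ⟨u, hu⟩
  have hUv : ∀ a, U * (dag (v a) * v a) = v a := fun a => by
    apply Subtype.ext
    rw [Submonoid.coe_mul, Submonoid.coe_mul, coe_dag]
    exact h1 a
  have hUa : ∀ a : A, (a : MunnQuotient (GN h)) = U * ((dag (v a) * v a : GN h) : MunnQuotient (GN h)) :=
    fun a => by rw [← Con.coe_mul, hUv, hv']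
  refine ⟨U, fun a ha => ⟨_, idem_mk ⟨_, idem_dag_mul (v ⟨a, ha⟩)⟩, hUa ⟨a, ha⟩⟩, fun r hr => ?_⟩
  induction r using Con.induction_on with
  | H w =>
  obtain ⟨e, he, h3⟩ := exists_agreement U w
  have hve : ∀ a : A, (e : GN h) * (dag (v a) * v a) = dag (v a) * v a := fun a => by
    refine h3 ⟨_, idem_dag_mul (v a)⟩ ?_
    change ((U * (dag (v a) * v a) : GN h) : MunnQuotient (GN h)) = _
    rw [hUv, hv']
    have := (hr a a.2).eq_mul
    rw [← hv' a, coe_dag_munn, ← Con.coe_mul, ← Con.coe_mul, hv' a] at this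
    exact this
  have hUe : U * (e : GN h) = U := by
    apply Subtype.ext
    have := h2 (1 - (e : GN h)) fun a => by
      have h4 : (v a) * (e : GN h) = v a := by
        have h5 := idem_comm e.2 (idem_dag_mul (v a))
        rw [hve a] at h5
        calc (v a) * (e : GN h) = v a * dag (v a) * v a * e := by rw [mul_dag_mul]
          _ = v a * (dag (v a) * v a * e) := by simp only [mul_assoc]
          _ = v a := by rw [← h5, ← mul_assoc, mul_dag_mul]
      have h6 := congrArg Subtype.val h4
      rw [Submonoid.coe_mul] at h6
      rw [mul_sub, mul_one, h6, sub_self]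
    rw [mul_sub, mul_one, sub_eq_zero] at this
    exact this.symm
  refine ⟨_, idem_mk e, ?_⟩
  rw [← Con.coe_mul, ← he, hUe]

theorem orthogonal_symm {S : Type*} [MonoidWithZero S] [IsInverseSemigroup S] {s t : S}
    (h : Orthogonal s t) : Orthogonal t s := by
  have h0 : dag (0 : S) = 0 := dag_idem (mul_zero 0)
  refine ⟨?_, ?_⟩
  · have := congrArg dag h.1
    rwa [dag_mul, dag_dag, h0] at this
  · have := congrArg dag h.2
    rwa [dag_mul, dag_dag, h0] at this

theorem munn_fundamental : IsFundamental (MunnQuotient (GN h)) := by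
  intro s t hst
  induction s using Con.induction_on with
  | H v =>
  induction t using Con.induction_on with
  | H w =>
  rw [Con.eq]
  intro e he
  have h1 := hst e (idem_mk ⟨e, he⟩)
  rw [coe_dag_munn, coe_dag_munn, ← Con.coe_mul, ← Con.coe_mul, ← Con.coe_mul, ← Con.coe_mul] at h1
  exact idem_eq_of_munn_eq (idem_conj v he) (idem_conj w he) h1

/-- `D` as a commutative C*-algebra. -/
@[reducible] noncomputable def commCStar (h : IsCartanPair M D) : CommCStarAlgebra D.toStarSubalgebra :=
  haveI : IsClosed (D.toStarSubalgebra : Set (H →L[ℂ] H)) := by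
    have : (D.toStarSubalgebra : Set (H →L[ℂ] H)) = Set.centralizer (Set.centralizer D) :=
      D.centralizer_centralizer.symm
    rw [this]
    exact Set.isClosed_centralizer _
  { (inferInstance : CStarAlgebra D.toStarSubalgebra) with
    mul_comm := fun x y => Subtype.ext (h.comm x.2 y.2) }

theorem idem_D (e : Idem (GN h)) :
    IsIdempotentElem (⟨((e : GN h) : H →L[ℂ] H), idem_GN h e.2⟩ : D.toStarSubalgebra) :=
  Subtype.ext (show ((e : GN h) : H →L[ℂ] H) * (e : GN h) = (e : GN h) from
    congrArg Subtype.val e.2)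

/-- The idempotents of the Munn quotient are the projections of `D`. -/
theorem exists_idem_equiv (h : IsCartanPair M D) :
    ∃ f : Idem (MunnQuotient (GN h)) ≃ {p : D.toStarSubalgebra // IsIdempotentElem p},
      ∀ e : Idem (GN h), ((f ⟨(e : GN h), idem_mk e⟩ : D.toStarSubalgebra) : H →L[ℂ] H) = (e : GN h) := by
  let g : {p : D.toStarSubalgebra // IsIdempotentElem p} → Idem (GN h) := fun p =>
    idemOfProj h (p.1 : H →L[ℂ] H) p.1.2 (by
      have hi : IsIdempotentElem (p.1 : H →L[ℂ] H) := congrArg Subtype.val p.2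
      refine ⟨hi, (hi.isSelfAdjoint_iff_isStarNormal).2 ⟨h.comm (star_mem p.1.2) p.1.2⟩⟩)
  have hg : ∀ p, ((g p : GN h) : H →L[ℂ] H) = (p.1 : H →L[ℂ] H) := fun p => rfl
  let k : {p : D.toStarSubalgebra // IsIdempotentElem p} → Idem (MunnQuotient (GN h)) := fun p =>
    ⟨((g p : GN h) : MunnQuotient (GN h)), idem_mk (g p)⟩
  have hk : Function.Bijective k := by
    constructor
    · intro p p' hpp
      have := idem_eq_of_munn_eq (g p).2 (g p').2 (congrArg Subtype.val hpp)
      apply Subtype.ext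
      apply Subtype.ext
      rw [← hg p, this, hg p']
    · intro x
      obtain ⟨e, he⟩ := exists_idem_lift x.2
      refine ⟨⟨⟨(e : GN h), idem_GN h e.2⟩, idem_D e⟩, Subtype.ext ?_⟩
      rw [← he]
      rfl
  refine ⟨(Equiv.ofBijective k hk).symm, fun e => ?_⟩
  have : (Equiv.ofBijective k hk).symm ⟨(e : GN h), idem_mk e⟩ =
      ⟨⟨(e : GN h), idem_GN h e.2⟩, idem_D e⟩ := by
    rw [Equiv.symm_apply_eq]
    rfl
  rw [this]

theorem exists_booleanAlgebra_equiv {α β : Type*} [BooleanAlgebra β] (f : α ≃ β) :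
    ∃ B : BooleanAlgebra α, ∀ x y, B.le x y ↔ f x ≤ f y := by
  letI : Max α := ⟨fun a b => f.symm (f a ⊔ f b)⟩
  letI : Min α := ⟨fun a b => f.symm (f a ⊓ f b)⟩
  letI : LE α := ⟨fun a b => f a ≤ f b⟩
  letI : LT α := ⟨fun a b => f a < f b⟩
  letI : Top α := ⟨f.symm ⊤⟩
  letI : Bot α := ⟨f.symm ⊥⟩
  letI : Compl α := ⟨fun a => f.symm (f a)ᶜ⟩
  letI : SDiff α := ⟨fun a b => f.symm (f a \ f b)⟩
  letI : HImp α := ⟨fun a b => f.symm (f a ⇨ f b)⟩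
  exact ⟨f.injective.booleanAlgebra f Iff.rfl Iff.rfl (fun a b => f.apply_symm_apply _)
    (fun a b => f.apply_symm_apply _) (f.apply_symm_apply _) (f.apply_symm_apply _)
    (fun a => f.apply_symm_apply _) (fun a b => f.apply_symm_apply _)
    (fun a b => f.apply_symm_apply _), fun x y => Iff.rfl⟩

theorem exists_booleanAlgebra_idem {α R : Type*} [CommRing R] (f : α ≃ {p : R // IsIdempotentElem p}) :
    ∃ B : BooleanAlgebra α, ∀ x y, B.le x y ↔ (f x : R) * f y = f x :=
  exists_booleanAlgebra_equiv f

theorem munn_booleanAlgebra (h : IsCartanPair M D) :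
    ∃ B : BooleanAlgebra (Idem (MunnQuotient (GN h))), ∀ e f, B.le e f ↔
      NatLE (e : MunnQuotient (GN h)) f := by
  letI := commCStar h
  obtain ⟨f, hf⟩ := exists_idem_equiv h
  obtain ⟨B, hB⟩ := exists_booleanAlgebra_idem f
  refine ⟨B, fun x y => (hB x y).trans ?_⟩
  obtain ⟨e, he⟩ := exists_idem_lift x.2
  obtain ⟨g, hg⟩ := exists_idem_lift y.2
  obtain rfl : x = ⟨_, idem_mk e⟩ := Subtype.ext he.symm
  obtain rfl : y = ⟨_, idem_mk g⟩ := Subtype.ext hg.symm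
  have h1 : (f ⟨_, idem_mk e⟩ : D.toStarSubalgebra) * (f ⟨_, idem_mk g⟩ : D.toStarSubalgebra) =
      (f ⟨_, idem_mk e⟩ : D.toStarSubalgebra) ↔ (e : GN h) * g = e := by
    rw [Subtype.ext_iff, Subtype.ext_iff]
    change ((f ⟨_, idem_mk e⟩ : D.toStarSubalgebra) : H →L[ℂ] H) * (f ⟨_, idem_mk g⟩ : D.toStarSubalgebra) =
      (f ⟨_, idem_mk e⟩ : D.toStarSubalgebra) ↔ ((e : GN h) : H →L[ℂ] H) * (g : GN h) = (e : GN h)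
    rw [hf e, hf g]
  rw [h1]
  constructor
  · intro h2
    refine ⟨_, idem_mk e, ?_⟩
    rw [← Con.coe_mul, idem_comm g.2 e.2, h2]
  · intro h2
    have h3 := mul_eq_of_natLE (idem_mk e) h2
    rw [← Con.coe_mul] at h3
    rw [idem_comm e.2 g.2]
    exact idem_eq_of_munn_eq (idem_mul_aux g.2 e.2) e.2 h3

theorem munn_boolean (h : IsCartanPair M D) : IsCompleteBooleanInverseMonoid (MunnQuotient (GN h)) where
  booleanAlgebra := munn_booleanAlgebra h
  exists_meet := munn_exists_meet
  exists_join s t hst := munn_exists_join _ (by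
    rintro a ha b hb hab
    rcases ha with rfl | rfl <;> rcases hb with rfl | rfl
    · exact absurd rfl hab
    · exact hst
    · exact orthogonal_symm hst
    · exact absurd rfl hab)
  exists_join_of_pairwise := munn_exists_join

end monoid

section chi
variable {S : Type*} [MonoidWithZero S]

theorem chi_apply (e : Idem S) (ρ : Character S) : chi e ρ = if ρ e then 1 else 0 := rfl

theorem chi_apply_eq_one {e : Idem S} {ρ : Character S} : chi e ρ = 1 ↔ ρ e = true := by
  rw [chi_apply]; split_ifs with h <;> simp [h]

theorem chi_one (e : Idem S) (he : (e : S) = 1) : chi e = 1 := by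
  ext ρ; rw [chi_apply, ρ.2.2.1 e he]; rfl

theorem chi_zero (e : Idem S) (he : (e : S) = 0) : chi e = 0 := by
  ext ρ; rw [chi_apply, ρ.2.1 e he]; rfl

instance : T2Space (Character S) :=
  inferInstanceAs (T2Space {ρ : Idem S → Bool // IsCharacter ρ})

instance : TotallyDisconnectedSpace (Character S) :=
  inferInstanceAs (TotallyDisconnectedSpace {ρ : Idem S → Bool // IsCharacter ρ})

/-- Closed subspaces of `C(X)` that contain the projections are everything. -/
theorem mem_of_chi [IsInverseSemigroup S] [CompactSpace (Character S)] (C : Submodule ℂ (CharAlg S))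
    (hC : IsClosed (C : Set (CharAlg S))) (h : ∀ e, chi e ∈ C) (f : CharAlg S) : f ∈ C := by
  let A : StarSubalgebra ℂ (CharAlg S) :=
    { carrier := Submodule.span ℂ (Set.range (chi (S := S)))
      mul_mem' := by
        intro a b ha hb
        have := Submodule.mul_mem_mul ha hb
        rw [Submodule.span_mul_span] at this
        refine Submodule.span_mono ?_ this
        rintro _ ⟨_, ⟨e, rfl⟩, _, ⟨g, rfl⟩, rfl⟩
        exact ⟨⟨_, idem_mul_aux e.2 g.2⟩, (chi_mul e g _ rfl).symm⟩
      add_mem' := fun ha hb => Submodule.add_mem _ ha hb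
      algebraMap_mem' := fun r => by
        rw [Algebra.algebraMap_eq_smul_one]
        refine Submodule.smul_mem _ _ (Submodule.subset_span ⟨⟨1, mul_one 1⟩, chi_one _ rfl⟩)
      star_mem' := by
        intro a ha
        induction ha using Submodule.span_induction with
        | mem x hx =>
          obtain ⟨e, rfl⟩ := hx
          rw [star_chi]
          exact Submodule.subset_span ⟨e, rfl⟩
        | zero => rw [star_zero]; exact Submodule.zero_mem _
        | add x y _ _ hx hy => rw [star_add]; exact Submodule.add_mem _ hx hy
        | smul c x _ hx => rw [star_smul]; exact Submodule.smul_mem _ _ hx }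
  have hA : A.topologicalClosure = ⊤ := by
    refine ContinuousMap.starSubalgebra_topologicalClosure_eq_top_of_separatesPoints A ?_
    intro ρ τ hρτ
    obtain ⟨e, he⟩ : ∃ e, ρ.1 e ≠ τ.1 e := by
      by_contra hcon
      push Not at hcon
      exact hρτ (Subtype.ext (funext hcon))
    refine ⟨chi e, ⟨chi e, Submodule.subset_span ⟨e, rfl⟩, rfl⟩, fun hh => he ?_⟩
    rw [chi_apply, chi_apply] at hh
    cases h1 : ρ.1 e <;> cases h2 : τ.1 e <;> simp_all
  have hf : f ∈ A.topologicalClosure := by rw [hA]; trivial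
  have hf' : f ∈ closure (Submodule.span ℂ (Set.range (chi (S := S))) : Set (CharAlg S)) := hf
  refine closure_minimal (fun x hx => ?_) hC hf'
  exact Submodule.span_le.2 (by rintro _ ⟨e, rfl⟩; exact h e) hx

end chi

section gelfand
open WeakDual
variable {S : Type*} [MonoidWithZero S] [IsBooleanInverseMonoid S] {A : Type*} [CommCStarAlgebra A]

theorem char_idem (χ : characterSpace ℂ A) {p : A} (hp : IsIdempotentElem p) : χ p = 0 ∨ χ p = 1 := by
  have h : χ p * χ p = χ p := by rw [← map_mul, hp.eq]
  have h' : χ p * (χ p - 1) = 0 := by rw [mul_sub, h, mul_one, sub_self]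
  rcases mul_eq_zero.1 h' with h | h
  · exact Or.inl h
  · exact Or.inr (sub_eq_zero.1 h)

/-- A commutative C*-algebra densely spanned by its idempotents is the algebra of continuous
functions on the Stone space of its idempotents. -/
theorem exists_gelfand (f : Idem S ≃ {p : A // IsIdempotentElem p})
    (hmul : ∀ e e' g : Idem S, (g : S) = e * e' → (f g : A) = f e * f e')
    (h0 : ∀ e : Idem S, (e : S) = 0 → (f e : A) = 0) (h1 : ∀ e : Idem S, (e : S) = 1 → (f e : A) = 1)
    (hd : ∀ C : Submodule ℂ A, IsClosed (C : Set A) → (∀ p : A, IsIdempotentElem p → p ∈ C) →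
      ∀ x, x ∈ C) :
    CompactSpace (Character S) ∧ ∃ Φ : CharAlg S ≃⋆ₐ[ℂ] A, ∀ e, Φ (chi e) = f e := by
  classical
  have hle : ∀ e e' : Idem S, NatLE (e : S) e' ↔ (f e : A) = f e' * f e := by
    intro e e'
    constructor
    · intro h
      exact hmul _ _ _ (mul_eq_of_natLE e.2 h).symm
    · intro h
      have h2 := hmul e' e ⟨_, idem_mul_aux e'.2 e.2⟩ rfl
      rw [← h] at h2
      have h3 := congrArg Subtype.val (f.injective (Subtype.ext h2))
      exact ⟨e, e.2, h3.symm⟩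
  have hjoin : ∀ e e' g : Idem S, IsJoin {(e : S), (e' : S)} (g : S) →
      (f g : A) = f e + f e' - f e * f e' := by
    intro e e' g hg
    have hi : IsIdempotentElem ((f e : A) + f e' - f e * f e') := (f e).2.add_sub_mul (f e').2
    have he : (f e : A) * f e = f e := (f e).2
    have he' : (f e' : A) * f e' = f e' := (f e').2
    obtain ⟨k, hk⟩ := f.surjective ⟨_, hi⟩
    have hk' : (f k : A) = f e + f e' - f e * f e' := by rw [hk]
    have a1 := (hle e k).2 (by rw [hk']; linear_combination (f e' - 1 : A) * he)
    have a2 := (hle e' k).2 (by rw [hk']; linear_combination (f e - 1 : A) * he')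
    have a3 := (hle g k).1 (hg.2 k (by rintro a (rfl | rfl) <;> assumption))
    have a4 := (hle e g).1 (hg.1 e (Or.inl rfl))
    have a5 := (hle e' g).1 (hg.1 e' (Or.inr rfl))
    rw [hk'] at a3
    rw [a3]
    linear_combination (-1 : A) * a4 - a5 + f e * a5
  let ev : characterSpace ℂ A → Idem S → Bool := fun χ e => decide (χ (f e : A) = 1)
  have evt : ∀ χ e, ev χ e = true ↔ χ (f e : A) = 1 := fun χ e => decide_eq_true_iff
  have evf : ∀ χ e, ev χ e = false ↔ χ (f e : A) = 0 := fun χ e => by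
    rw [← Bool.not_eq_true, evt]
    rcases char_idem χ (f e).2 with h | h <;> rw [h] <;> simp
  have evc : ∀ χ, IsCharacter (ev χ) := by
    intro χ
    refine ⟨fun e he => ?_, fun e he => ?_, fun e e' g hg => ?_, fun e e' g hg => ?_⟩
    · rw [evf, h0 e he, map_zero]
    · rw [evt, h1 e he, map_one]
    · have h2 := congrArg χ (hmul e e' g hg)
      rw [map_mul] at h2
      cases h3 : ev χ e <;> cases h4 : ev χ e' <;> simp only [evt, evf] at h3 h4 <;>
        simp [evt, evf, h2, h3, h4]
    · have h2 := congrArg χ (hjoin e e' g hg)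
      rw [map_sub, map_add, map_mul] at h2
      cases h3 : ev χ e <;> cases h4 : ev χ e' <;> simp only [evt, evf] at h3 h4 <;>
        simp [evt, evf, h2, h3, h4]
  have hevc : ∀ p : A, Continuous fun χ : characterSpace ℂ A => χ p := fun p =>
    (WeakDual.eval_continuous p).comp continuous_subtype_val
  let Θ : characterSpace ℂ A → Character S := fun χ => ⟨ev χ, evc χ⟩
  have hΘ : Continuous Θ := by
    refine Continuous.subtype_mk (continuous_pi fun e => ?_) _
    rw [continuous_bool_rng true]
    have e1 : (fun χ => ev χ e) ⁻¹' {true} = (fun χ : characterSpace ℂ A => χ (f e : A)) ⁻¹' {1} := by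
      ext χ; exact evt χ e
    have e2 : (fun χ => ev χ e) ⁻¹' {true} = ((fun χ : characterSpace ℂ A => χ (f e : A)) ⁻¹' {0})ᶜ := by
      ext χ
      rw [Set.mem_compl_iff, Set.mem_preimage, Set.mem_preimage, Set.mem_singleton_iff,
        Set.mem_singleton_iff, ← evf, Bool.not_eq_false]
    constructor
    · rw [e1]; exact isClosed_singleton.preimage (hevc _)
    · rw [e2]; exact (isClosed_singleton.preimage (hevc _)).isOpen_compl
  have hinj : Function.Injective Θ := by
    intro χ χ' hχ
    have h2 : ∀ e, ev χ e = ev χ' e := fun e => congrFun (congrArg Subtype.val hχ) e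
    let C : Submodule ℂ A :=
      { carrier := {x | χ x = χ' x}
        zero_mem' := by simp
        add_mem' := fun {a b} ha hb => by
          simp only [Set.mem_ofPred_eq] at *
          rw [map_add, map_add, ha, hb]
        smul_mem' := fun c a ha => by
          simp only [Set.mem_ofPred_eq] at *
          rw [map_smul, map_smul, ha] }
    refine CharacterSpace.ext fun x => hd C (isClosed_eq (map_continuous χ) (map_continuous χ')) ?_ x
    intro p hp
    obtain ⟨e, he⟩ := f.surjective ⟨p, hp⟩
    have hp' : p = f e := by rw [he]
    change χ p = χ' p
    rw [hp']
    cases h3 : ev χ e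
    · rw [(evf χ e).1 h3, (evf χ' e).1 (by rw [← h2, h3])]
    · rw [(evt χ e).1 h3, (evt χ' e).1 (by rw [← h2, h3])]
  have hsurj : Function.Surjective Θ := by
    intro τ
    let Z : {e : Idem S // τ e = true} → Set (characterSpace ℂ A) := fun e => {χ | χ (f e.1 : A) = 1}
    have hZc : ∀ e, IsClosed (Z e) := fun e => isClosed_singleton.preimage (hevc _)
    haveI : Nonempty {e : Idem S // τ e = true} := ⟨⟨⟨1, mul_one 1⟩, τ.2.2.1 _ rfl⟩⟩
    have hdir : Directed (· ⊇ ·) Z := by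
      rintro ⟨e, he⟩ ⟨e', he'⟩
      refine ⟨⟨⟨_, idem_mul_aux e.2 e'.2⟩, ?_⟩, fun χ hχ => ?_, fun χ hχ => ?_⟩
      · have := τ.2.2.2.1 e e' ⟨_, idem_mul_aux e.2 e'.2⟩ rfl
        rw [this]
        have he1 : τ.1 e = true := he
        have he1' : τ.1 e' = true := he'
        rw [he1, he1']; rfl
      · have h2 : χ (f ⟨_, idem_mul_aux e.2 e'.2⟩ : A) = 1 := hχ
        rw [hmul e e' _ rfl, map_mul] at h2
        refine (char_idem χ (f e).2).resolve_left fun h3 => ?_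
        rw [h3, zero_mul] at h2
        exact zero_ne_one h2
      · have h2 : χ (f ⟨_, idem_mul_aux e.2 e'.2⟩ : A) = 1 := hχ
        rw [hmul e e' _ rfl, map_mul] at h2
        refine (char_idem χ (f e').2).resolve_left fun h3 => ?_
        rw [h3, mul_zero] at h2
        exact zero_ne_one h2
    have hZne : ∀ e, (Z e).Nonempty := by
      rintro ⟨e, he⟩
      by_contra hne
      have hz : ∀ χ : characterSpace ℂ A, χ (f e : A) = 0 := fun χ => by
        rcases char_idem χ (f e).2 with h | h
        · exact h
        · exact absurd ⟨χ, h⟩ hne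
      have h2 : gelfandTransform ℂ A (f e : A) = 0 := by
        ext χ; exact hz χ
      have h3 : (f e : A) = 0 := (gelfandTransform_isometry A).injective (by rw [h2, map_zero])
      rw [← h0 ⟨0, mul_zero 0⟩ rfl] at h3
      have h4 := f.injective (Subtype.ext h3)
      have h5 := τ.2.1 ⟨0, mul_zero 0⟩ rfl
      rw [← h4] at h5
      have he1 : τ.1 e = true := he
      rw [he1] at h5
      exact absurd h5 (by decide)
    obtain ⟨χ, hχ⟩ := IsCompact.nonempty_iInter_of_directed_nonempty_isCompact_isClosed Z hdir hZne
      (fun e => (hZc e).isCompact) hZc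
    refine ⟨χ, Subtype.ext (funext fun e => ?_)⟩
    have hχ' : ∀ e : Idem S, τ e = true → ev χ e = true := fun e he =>
      (evt χ e).2 (Set.mem_iInter.1 hχ ⟨e, he⟩)
    change ev χ e = τ e
    cases h2 : τ e
    · obtain ⟨k, hk⟩ := f.surjective ⟨_, (f e).2.one_sub⟩
      have hk' : (f k : A) = 1 - f e := by rw [hk]
      have hek : (e : S) * k = 0 := by
        have h3 := hmul e k ⟨_, idem_mul_aux e.2 k.2⟩ rfl
        rw [hk', mul_sub, mul_one, (f e).2.eq, sub_self, ← h0 ⟨0, mul_zero 0⟩ rfl] at h3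
        exact congrArg Subtype.val (f.injective (Subtype.ext h3))
      obtain ⟨m, hm⟩ := IsBooleanInverseMonoid.exists_join (e : S) k (by
        refine ⟨by rw [dag_idem e.2, hek], by rw [dag_idem e.2, ← idem_comm e.2 k.2, hek]⟩)
      have hm1 : NatLE m 1 := hm.2 1 (by
        rintro a (rfl | rfl)
        · exact ⟨e, e.2, (one_mul _).symm⟩
        · exact ⟨k, k.2, (one_mul _).symm⟩)
      have hmi : IsIdempotentElem m := by
        obtain ⟨x, hx, hx'⟩ := hm1
        rw [hx', one_mul]; exact hx
      have h3 := hjoin e k ⟨m, hmi⟩ hm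
      rw [hk', mul_sub, mul_one, (f e).2.eq, sub_self, sub_zero, add_sub_cancel,
        ← h1 ⟨1, mul_one 1⟩ rfl] at h3
      have h4 : m = 1 := congrArg Subtype.val (f.injective (Subtype.ext h3))
      subst h4
      have h5 := τ.2.2.2.2 e k ⟨1, hmi⟩ hm
      have h6 := τ.2.2.1 ⟨1, hmi⟩ rfl
      rw [h6] at h5
      have h7 : τ k = true := by
        have h2' : τ.1 e = false := h2
        rw [h2', Bool.false_or] at h5
        exact h5.symm
      have h8 := (evt χ k).1 (hχ' k h7)
      rw [hk', map_sub, map_one, sub_eq_self] at h8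
      exact (evf χ e).2 h8
    · exact hχ' e h2
  let T : characterSpace ℂ A ≃ₜ Character S :=
    Continuous.homeoOfEquivCompactToT2 (f := Equiv.ofBijective Θ ⟨hinj, hsurj⟩) hΘ
  refine ⟨T.compactSpace, (T.compStarAlgEquiv' ℂ ℂ).trans (gelfandStarTransform A).symm, fun e => ?_⟩
  suffices h2 : T.compStarAlgEquiv' ℂ ℂ (chi e) = gelfandStarTransform A (f e : A) by
    rw [StarAlgEquiv.trans_apply, h2, StarAlgEquiv.symm_apply_apply]
  ext χ
  change (if ev χ e then (1 : ℂ) else 0) = χ (f e : A)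
  cases h3 : ev χ e
  · rw [(evf χ e).1 h3]; rfl
  · rw [(evt χ e).1 h3]; rfl

end gelfand

section order
variable {X : Type*} [TopologicalSpace X] {H : Type*} [NormedAddCommGroup H] [InnerProductSpace ℂ H]
  [CompleteSpace H] {π : C(X, ℂ) →⋆ₐ[ℂ] (H →L[ℂ] H)}

theorem nonneg_of_map_nonneg (hinj : Function.Injective π) {f : C(X, ℝ)}
    (hf : 0 ≤ π (complexify f)) : 0 ≤ f := by
  let m : C(X, ℝ) := ⟨fun x => max (-f x) 0, by fun_prop⟩
  have hm : m * f * m = - (m * m * m) := by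
    ext x
    change max (-f x) 0 * f x * max (-f x) 0 = - (max (-f x) 0 * max (-f x) 0 * max (-f x) 0)
    rcases max_cases (-f x) 0 with ⟨h, -⟩ | ⟨h, -⟩ <;> rw [h] <;> ring
  have hm0 : 0 ≤ m * m * m := fun x => by
    have : 0 ≤ m x := le_max_right _ _
    change 0 ≤ m x * m x * m x
    positivity
  have h1 := conj_nonneg hf (π (complexify m))
  rw [← map_star, star_complexify, ← map_mul, ← map_mul, ← complexify_mul, ← complexify_mul, hm,
    ← zero_sub, complexify_sub, map_sub, complexify_zero, map_zero, zero_sub, neg_nonneg] at h1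
  have h2 := le_antisymm h1 (map_complexify_nonneg π hm0)
  have h3 : m * m * m = 0 := complexify_injective (hinj (by rw [h2, complexify_zero, map_zero]))
  intro x
  have h4 : m x * m x * m x = 0 := congrArg (fun f : C(X, ℝ) => f x) h3
  have h5 : m x = 0 := by simpa using h4
  have h6 : -f x ≤ m x := le_max_left _ _
  change 0 ≤ f x
  linarith

theorem le_of_map_le (hinj : Function.Injective π) {f g : C(X, ℝ)}
    (hf : π (complexify f) ≤ π (complexify g)) : f ≤ g := by
  rw [← sub_nonneg, ← map_sub, ← complexify_sub] at hf
  exact sub_nonneg.1 (nonneg_of_map_nonneg hinj hf)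

/-- A faithful representation whose range is a von Neumann algebra is normal. -/
theorem isNormalHom_of_range (hinj : Function.Injective π) (D : VonNeumannAlgebra H)
    (hD : ∀ x, x ∈ D ↔ ∃ f, π f = x) : IsNormalHom π := by
  intro F g hne hd hg
  have hd' : DirectedOn (· ≤ ·) ((fun g => π (complexify g)) '' F) := by
    rintro _ ⟨a, ha, rfl⟩ _ ⟨b, hb, rfl⟩
    obtain ⟨c, hc, h1, h2⟩ := hd a ha b hb
    exact ⟨_, ⟨c, hc, rfl⟩, map_complexify_mono π h1, map_complexify_mono π h2⟩
  have hub : ∀ y ∈ (fun g => π (complexify g)) '' F, y ≤ π (complexify g) := by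
    rintro _ ⟨a, ha, rfl⟩
    exact map_complexify_mono π (hg.1 ha)
  obtain ⟨x, hx, -⟩ := exists_wTendsto_of_directed (hne.image _) hd' hub
  have hxD := IsLUB.mem_vN D (hne.image _) hd' hx (by
    rintro _ ⟨a, ha, rfl⟩; exact (hD _).2 ⟨_, rfl⟩)
  obtain ⟨k, rfl⟩ := (hD _).1 hxD
  obtain ⟨a, ha⟩ := hne
  have hsa : IsSelfAdjoint (π k) := by
    have h1 : 0 ≤ π k - π (complexify a) := sub_nonneg.2 (hx.1 ⟨a, ha, rfl⟩)
    have h2 : IsSelfAdjoint (π (complexify a)) := by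
      rw [IsSelfAdjoint, ← map_star, star_complexify]
    have := h1.isSelfAdjoint.add h2
    rwa [sub_add_cancel] at this
  have hk : complexify (rePart k) = k := by
    have h1 : star k = k := hinj (by rw [map_star, hsa.star_eq])
    ext x
    have h2 : (starRingEnd ℂ) (k x) = k x := congrArg (fun f : C(X, ℂ) => f x) h1
    exact Complex.conj_eq_iff_re.1 h2
  rw [← hk] at hx
  have h1 : g ≤ rePart k := hg.2 fun b hb => le_of_map_le hinj (hx.1 ⟨b, hb, rfl⟩)
  rw [le_antisymm (map_complexify_mono π h1) (hx.2 hub)]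
  exact hx

theorem IsNormalHom.isHyperstonean [CompactSpace X] [T2Space X] [ExtremallyDisconnected X]
    (hn : IsNormalHom π) (hinj : Function.Injective π) : IsHyperstonean X := by
  refine ⟨inferInstance, inferInstance, inferInstance, fun f hf hf0 => ?_⟩
  let s : C(X, ℝ) := ⟨fun x => √(f x), by fun_prop⟩
  have hs : s * s = f := by ext x; exact Real.mul_self_sqrt (hf x)
  obtain ⟨ξ, hξ⟩ : ∃ ξ, π (complexify s) ξ ≠ 0 := by
    by_contra hcon
    push Not at hcon
    have h1 : π (complexify s) = 0 := by ext ξ; exact hcon ξ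
    have h2 : s = 0 := complexify_injective (hinj (by rw [h1, complexify_zero, map_zero]))
    exact hf0 (by rw [← hs, h2, mul_zero])
  refine ⟨vecFun π ξ, fun g hg => vecFun_nonneg ξ hg, fun F g hne hd hg => ⟨?_, fun b hb => ?_⟩, ?_⟩
  · rintro _ ⟨a, ha, rfl⟩
    exact vecFun_mono ξ (hg.1 ha)
  · refine le_of_forall_pos_lt_add fun ε hε => ?_
    obtain ⟨a, ha, h1⟩ := hn.exists_lt hne hd hg ξ hε
    have := hb ⟨a, ha, rfl⟩
    rw [map_sub] at h1
    linarith
  · rw [← hs, ← norm_sq_eq_vecFun]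
    exact pow_ne_zero 2 (norm_ne_zero_iff.2 hξ)

end order

section pair
variable {H : Type*} [NormedAddCommGroup H] [InnerProductSpace ℂ H] [CompleteSpace H]
  {M D : VonNeumannAlgebra H}

/-- The identification of `D` with the functions on the character space. -/
theorem exists_charAlg_equiv (h : IsCartanPair M D) : CompactSpace (Character (MunnQuotient (GN h))) ∧
    ∃ Φ : CharAlg (MunnQuotient (GN h)) ≃⋆ₐ[ℂ] D.toStarSubalgebra,
    ∀ e : Idem (GN h),
      (Φ (chi ⟨((e : GN h) : MunnQuotient (GN h)), idem_mk e⟩) : H →L[ℂ] H) = (e : GN h) := by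
  haveI := munn_boolean h
  letI := commCStar h
  obtain ⟨f, hf⟩ := exists_idem_equiv h
  have key : ∀ x : Idem (MunnQuotient (GN h)), ∃ e : Idem (GN h), x = ⟨((e : GN h) : MunnQuotient (GN h)), idem_mk e⟩ :=
    fun x => by
      obtain ⟨e, he⟩ := exists_idem_lift x.2
      exact ⟨e, Subtype.ext he.symm⟩
  suffices hs : CompactSpace (Character (MunnQuotient (GN h))) ∧
      ∃ Φ : CharAlg (MunnQuotient (GN h)) ≃⋆ₐ[ℂ] D.toStarSubalgebra,
        ∀ e, Φ (chi e) = (f e : D.toStarSubalgebra) by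
    obtain ⟨hc, Φ, hΦ⟩ := hs
    exact ⟨hc, Φ, fun e => (congrArg Subtype.val (hΦ _)).trans (hf e)⟩
  refine exists_gelfand (A := D.toStarSubalgebra) f ?_ ?_ ?_ ?_
  · intro x y z hz
    obtain ⟨e, rfl⟩ := key x
    obtain ⟨e', rfl⟩ := key y
    obtain ⟨g, rfl⟩ := key z
    have h1 : (g : GN h) = e * e' := idem_eq_of_munn_eq g.2 (idem_mul_aux e.2 e'.2) (by
      rw [Con.coe_mul]; exact hz)
    apply Subtype.ext
    rw [hf g, h1]
    change _ = (f ⟨_, idem_mk e⟩ : H →L[ℂ] H) * (f ⟨_, idem_mk e'⟩ : H →L[ℂ] H)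
    rw [hf e, hf e']
    rfl
  · intro x hx
    obtain ⟨e, rfl⟩ := key x
    have h1 := eq_zero_of_munn_eq_zero hx
    apply Subtype.ext
    rw [hf e, h1]
    rfl
  · intro x hx
    obtain ⟨e, rfl⟩ := key x
    have h1 : (e : GN h) = 1 := idem_eq_of_munn_eq e.2 (mul_one 1) hx
    apply Subtype.ext
    rw [hf e, h1]
    rfl
  · intro C hC hp x
    have hcl : IsClosed (D.toStarSubalgebra : Set (H →L[ℂ] H)) := by
      have : (D.toStarSubalgebra : Set (H →L[ℂ] H)) = Set.centralizer (Set.centralizer D) :=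
        D.centralizer_centralizer.symm
      rw [this]
      exact Set.isClosed_centralizer _
    let C' : Submodule ℂ (H →L[ℂ] H) := C.map (D.toStarSubalgebra.subtype.toAlgHom.toLinearMap)
    have hC' : IsClosed (C' : Set (H →L[ℂ] H)) := hcl.isClosedEmbedding_subtypeVal.isClosedMap _ hC
    obtain ⟨y, hy, hyx⟩ := mem_of_projections D C' hC' (fun p hpD hpp =>
      ⟨⟨p, hpD⟩, hp _ (Subtype.ext hpp.isIdempotentElem), rfl⟩) x.2
    rwa [show x = y from Subtype.ext hyx.symm]

variable {h : IsCartanPair M D}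

/-- The representation of the functions on the character space by `D`. -/
noncomputable def repOf (Φ : CharAlg (MunnQuotient (GN h)) ≃⋆ₐ[ℂ] D.toStarSubalgebra) :
    CharAlg (MunnQuotient (GN h)) →⋆ₐ[ℂ] (H →L[ℂ] H) :=
  D.toStarSubalgebra.subtype.comp (Φ : CharAlg (MunnQuotient (GN h)) →⋆ₐ[ℂ] D.toStarSubalgebra)

variable {Φ : CharAlg (MunnQuotient (GN h)) ≃⋆ₐ[ℂ] D.toStarSubalgebra}

theorem repOf_apply (f : CharAlg (MunnQuotient (GN h))) : repOf Φ f = Φ f := rfl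

theorem repOf_injective : Function.Injective (repOf Φ) :=
  fun _ _ hfg => Φ.injective (Subtype.ext hfg)

theorem mem_range_repOf (x : H →L[ℂ] H) : x ∈ D ↔ ∃ f, repOf Φ f = x :=
  ⟨fun hx => ⟨Φ.symm ⟨x, hx⟩, by rw [repOf_apply, StarAlgEquiv.apply_symm_apply]⟩, by
    rintro ⟨f, rfl⟩; exact (Φ f).2⟩

theorem equiv_injective (a b : CharAlg (MunnQuotient (GN h))) (hab : Φ a = Φ b) : a = b := by
  simpa using congrArg Φ.symm hab

theorem exists_proj_of_isClopen (hΦ : ∀ e : Idem (GN h),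
      (Φ (chi ⟨((e : GN h) : MunnQuotient (GN h)), idem_mk e⟩) : H →L[ℂ] H) = (e : GN h))
    {V : Set (Character (MunnQuotient (GN h)))} (hV : IsClopen V) :
    ∃ e : Idem (GN h), ∀ ρ : Character (MunnQuotient (GN h)),
      ρ ⟨((e : GN h) : MunnQuotient (GN h)), idem_mk e⟩ = true ↔ ρ ∈ V := by
  classical
  let f : CharAlg (MunnQuotient (GN h)) := ⟨V.indicator 1, hV.continuous_indicator continuous_one⟩
  have hf : ∀ ρ, f ρ = if ρ ∈ V then 1 else 0 := fun ρ => by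
    change V.indicator 1 ρ = _
    rw [Set.indicator_apply]; rfl
  have h1 : f * f = f := by
    ext ρ; change f ρ * f ρ = f ρ; rw [hf]; split_ifs <;> simp
  have h2 : star f = f := by
    ext ρ; change (starRingEnd ℂ) (f ρ) = f ρ; rw [hf]; split_ifs <;> simp
  set e := idemOfProj h (Φ f : H →L[ℂ] H) (Φ f).2 ⟨by
    rw [IsIdempotentElem]
    exact congrArg Subtype.val (show Φ f * Φ f = Φ f by rw [← map_mul, h1]), by
    rw [IsSelfAdjoint]
    exact congrArg Subtype.val (show star (Φ f) = Φ f by rw [← map_star, h2])⟩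
  refine ⟨e, fun ρ => ?_⟩
  have h3 : chi ⟨((e : GN h) : MunnQuotient (GN h)), idem_mk e⟩ = f :=
    equiv_injective (Φ := Φ) _ _ (Subtype.ext (hΦ e))
  rw [← chi_apply_eq_one, h3, hf]
  split_ifs with h4 <;> simp [h4]

theorem munn_extremallyDisconnected (hΦ : ∀ e : Idem (GN h),
      (Φ (chi ⟨((e : GN h) : MunnQuotient (GN h)), idem_mk e⟩) : H →L[ℂ] H) = (e : GN h))
    [CompactSpace (Character (MunnQuotient (GN h)))] :
    ExtremallyDisconnected (Character (MunnQuotient (GN h))) := by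
  refine ⟨fun U hU => ?_⟩
  let c : Idem (GN h) → Idem (MunnQuotient (GN h)) := fun e =>
    ⟨((e : GN h) : MunnQuotient (GN h)), idem_mk e⟩
  have hmul : ∀ e g : Idem (GN h), ((e : GN h) : H →L[ℂ] H) * (g : GN h) = 0 →
      ∀ ρ : Character (MunnQuotient (GN h)),
      ¬ (ρ (c e) = true ∧ ρ (c g) = true) := by
    rintro e g heg ρ ⟨h1, h2⟩
    have h3 : chi (c e) * chi (c g) = 0 := equiv_injective (Φ := Φ) _ _ (Subtype.ext (by
      rw [map_mul, map_zero]
      change (Φ (chi (c e)) : H →L[ℂ] H) * (Φ (chi (c g)) : H →L[ℂ] H) = 0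
      rw [hΦ e, hΦ g, heg]))
    have h4 : chi (c e) ρ * chi (c g) ρ = 0 := congrArg (fun f : CharAlg _ => f ρ) h3
    rw [chi_apply_eq_one.2 h1, chi_apply_eq_one.2 h2, one_mul] at h4
    exact one_ne_zero h4
  have hmul' : ∀ e g : Idem (GN h), (∀ ρ : Character (MunnQuotient (GN h)), ¬ (ρ (c e) = true ∧ ρ (c g) = true)) →
      ((e : GN h) : H →L[ℂ] H) * (g : GN h) = 0 := by
    intro e g hr
    have h3 : chi (c e) * chi (c g) = 0 := by
      ext ρ
      change chi (c e) ρ * chi (c g) ρ = 0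
      rw [chi_apply, chi_apply]
      split_ifs with h1 h2 <;> simp
      exact hr ρ ⟨h1, h2⟩
    have h4 := congrArg (fun x : D.toStarSubalgebra => (x : H →L[ℂ] H)) (congrArg Φ h3)
    rw [map_mul, map_zero] at h4
    change (Φ (chi (c e)) : H →L[ℂ] H) * (Φ (chi (c g)) : H →L[ℂ] H) = 0 at h4
    rwa [hΦ e, hΦ g] at h4
  obtain ⟨e0, he0D, he0, h1, h2⟩ := exists_sup_projection D
    {p | ∃ e : Idem (GN h), ((e : GN h) : H →L[ℂ] H) = p ∧
      ∀ ρ : Character (MunnQuotient (GN h)), ρ (c e) = true → ρ ∈ U} (by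
      rintro _ ⟨e, rfl, -⟩; exact idem_GN h e.2)
  set E := idemOfProj h e0 he0D he0
  have hcl : closure U = {ρ | chi (c E) ρ = 1} := by
    apply subset_antisymm
    · refine closure_minimal (fun ρ hρ => ?_) (isClosed_eq (chi (c E)).continuous continuous_const)
      obtain ⟨V, hV, hρV, hVU⟩ := compact_exists_isClopen_in_isOpen hU hρ
      obtain ⟨e, he⟩ := exists_proj_of_isClopen hΦ hV
      have h3 := h1 _ ⟨e, rfl, fun τ hτ => hVU ((he τ).1 hτ)⟩
      have h4 : (c e : MunnQuotient (GN h)) = c E * c e := by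
        change ((e : GN h) : MunnQuotient (GN h)) = (E : GN h) * (e : GN h)
        rw [← Con.coe_mul]
        congr 1
        exact Subtype.ext h3.symm
      have h5 := ρ.2.2.2.1 _ _ _ h4
      rw [Set.mem_ofPred_eq, chi_apply_eq_one]
      have h6 : ρ.1 (c e) = true := (he ρ).2 hρV
      rw [h6] at h5
      exact (Bool.and_eq_true_iff.1 h5.symm).1
    · intro ρ hρ
      rw [Set.mem_ofPred_eq, chi_apply_eq_one] at hρ
      by_contra hcon
      obtain ⟨V, hV, hρV, hVU⟩ := compact_exists_isClopen_in_isOpen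
        (isClosed_closure (s := U)).isOpen_compl hcon
      obtain ⟨g, hg⟩ := exists_proj_of_isClopen hΦ hV
      have h3 : ((g : GN h) : H →L[ℂ] H) * e0 = 0 := h2 _ (by
        rintro _ ⟨e, rfl, he⟩
        refine hmul' g e fun τ ⟨h4, h5⟩ => ?_
        exact hVU ((hg τ).1 h4) (subset_closure (he τ h5)))
      exact hmul g E h3 ρ ⟨(hg ρ).2 hρV, hρ⟩
  rw [hcl]
  have : {ρ | chi (c E) ρ = 1} = {ρ | chi (c E) ρ ≠ 0} := by
    ext ρ
    simp only [Set.mem_ofPred_eq, chi_apply]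
    split_ifs <;> simp
  rw [this]
  exact isOpen_ne_fun (chi (c E)).continuous continuous_const

/-- The Munn quotient of the groupoid normalizers of a Cartan pair is a Cartan inverse monoid. -/
theorem munn_cartan (h : IsCartanPair M D) : IsCartanInverseMonoid (MunnQuotient (GN h)) :=
  { munn_boolean h with
    fundamental := munn_fundamental
    hyperstonean := by
      obtain ⟨hc, Φ, hΦ⟩ := exists_charAlg_equiv h
      haveI := munn_extremallyDisconnected hΦ
      exact (isNormalHom_of_range (π := repOf Φ) repOf_injective D mem_range_repOf).isHyperstonean
        repOf_injective }

/-- The extension of a Cartan pair. -/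
theorem exists_extension_of_equiv (hΦ : ∀ e : Idem (GN h),
      (Φ (chi ⟨((e : GN h) : MunnQuotient (GN h)), idem_mk e⟩) : H →L[ℂ] H) = (e : GN h))
    [CompactSpace (Character (MunnQuotient (GN h)))] :
    ∃ Y : Extension (MunnQuotient (GN h)) (GN h),
      (∀ v : GN h, Y.q v = (v : MunnQuotient (GN h))) ∧
      ∀ p : partialIsometries (MunnQuotient (GN h)),
        (Y.ι p : H →L[ℂ] H) = Φ (p : CharAlg (MunnQuotient (GN h))) := by
  have hpi : ∀ p : partialIsometries (MunnQuotient (GN h)),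
      (Φ (p : CharAlg _) : H →L[ℂ] H) * star (Φ (p : CharAlg _) : H →L[ℂ] H) * Φ (p : CharAlg _) =
        Φ (p : CharAlg _) := fun p => by
    have h1 : (p : CharAlg (MunnQuotient (GN h))) * star (p : CharAlg (MunnQuotient (GN h))) *
        (p : CharAlg (MunnQuotient (GN h))) = p := p.2
    have h2 := congrArg (fun x : D.toStarSubalgebra => (x : H →L[ℂ] H)) (congrArg Φ h1)
    rwa [map_mul, map_mul, map_star] at h2
  let ι : partialIsometries (MunnQuotient (GN h)) →ₙ* GN h :=
    { toFun := fun p => ofD h (Φ (p : CharAlg _)) (Φ (p : CharAlg _)).2 (hpi p)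
      map_mul' := fun p p' => Subtype.ext (by
        change (Φ ((p : CharAlg _) * (p' : CharAlg _)) : H →L[ℂ] H) = _
        rw [map_mul]; rfl) }
  have hι : ∀ p, (ι p : H →L[ℂ] H) = Φ (p : CharAlg _) := fun p => rfl
  have hιinj : Function.Injective ι := fun p p' hpp => Subtype.ext (equiv_injective (Φ := Φ) _ _ (Subtype.ext
    (congrArg (fun x : GN h => (x : H →L[ℂ] H)) hpp)))
  refine ⟨{ ι := ι
            q := ((munnCon (GN h)).mk' : GN h →* MunnQuotient (GN h))
            ι_injective := hιinj
            q_surjective := Con.mk'_surjective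
            isIdempotentElem_q_iff := fun v => ⟨fun hv => ?_, ?_⟩
            q_ι_chiP := fun x => ?_
            q_ι_injOn := fun p p' hp hp' hpp => ?_
            conj_ι := fun v p p' hpp ρ τ hρτ => ?_ }, fun v => rfl, fun p => rfl⟩
  · have hvD := mem_D_of_idem (v := v) hv
    refine ⟨⟨Φ.symm ⟨v, hvD⟩, ?_⟩, Subtype.ext ?_⟩
    · change _ * star _ * _ = _
      refine equiv_injective (Φ := Φ) _ _ ?_
      rw [map_mul, map_mul, map_star, StarAlgEquiv.apply_symm_apply]
      exact Subtype.ext v.2.2.1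
    · rw [hι, StarAlgEquiv.apply_symm_apply]
  · rintro ⟨p, rfl⟩
    exact idem_of_mem_D (v := ι p) (Φ (p : CharAlg _)).2
  · obtain ⟨e, he⟩ := exists_idem_lift x.2
    obtain rfl : x = ⟨_, idem_mk e⟩ := Subtype.ext he.symm
    change ((ι (chiP _) : GN h) : MunnQuotient (GN h)) = ((e : GN h) : MunnQuotient (GN h))
    congr 1
    exact Subtype.ext (hΦ e)
  · refine hιinj (idem_eq_of_munn_eq ?_ ?_ hpp)
    · rw [IsIdempotentElem, ← map_mul, hp.eq]
    · rw [IsIdempotentElem, ← map_mul, hp'.eq]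
  · let V : H →L[ℂ] H := (v : H →L[ℂ] H)
    have hVD : ∀ d ∈ D, star V * d * V ∈ D := fun d hd => (v.2.2.2 d hd).2
    let L0 : CharAlg (MunnQuotient (GN h)) →ₗ[ℂ] CharAlg (MunnQuotient (GN h)) :=
      { toFun := fun f => Φ.symm ⟨star V * (Φ f : H →L[ℂ] H) * V, hVD _ (Φ f).2⟩
        map_add' := fun f g => by
          refine equiv_injective (Φ := Φ) _ _ ?_
          refine (Φ.apply_symm_apply _).trans (Eq.trans ?_ (map_add Φ _ _).symm)
          rw [StarAlgEquiv.apply_symm_apply, StarAlgEquiv.apply_symm_apply]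
          apply Subtype.ext
          change star V * (Φ (f + g) : H →L[ℂ] H) * V = star V * (Φ f : H →L[ℂ] H) * V +
            star V * (Φ g : H →L[ℂ] H) * V
          rw [map_add, ← add_mul, ← mul_add]; rfl
        map_smul' := fun c f => by
          refine equiv_injective (Φ := Φ) _ _ ?_
          refine (Φ.apply_symm_apply _).trans (Eq.trans ?_ (map_smul Φ c _).symm)
          rw [StarAlgEquiv.apply_symm_apply]
          apply Subtype.ext
          change star V * (Φ (c • f) : H →L[ℂ] H) * V = c • (star V * (Φ f : H →L[ℂ] H) * V)
          rw [map_smul, ← smul_mul_assoc, ← mul_smul_comm]; rfl }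
    have hL0 : ∀ f, (Φ (L0 f) : H →L[ℂ] H) = star V * (Φ f : H →L[ℂ] H) * V := fun f =>
      congrArg Subtype.val (Φ.apply_symm_apply _)
    have hnorm : ∀ f, ‖(Φ f : H →L[ℂ] H)‖ = ‖f‖ := fun f =>
      NonUnitalStarAlgHom.norm_map (repOf Φ) repOf_injective f
    let L := L0.mkContinuous (‖star V‖ * ‖V‖) fun f => by
      rw [← hnorm, hL0, ← hnorm f]
      refine (norm_mul_le _ _).trans ((mul_le_mul_of_nonneg_right (norm_mul_le _ _)
        (norm_nonneg _)).trans (le_of_eq ?_))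
      ring
    have hL : ∀ f, (Φ (L f) : H →L[ℂ] H) = star V * (Φ f : H →L[ℂ] H) * V := hL0
    let C : Submodule ℂ (CharAlg (MunnQuotient (GN h))) :=
      { carrier := {f | L f ρ = f τ}
        zero_mem' := by simp
        add_mem' := fun {a b} ha hb => by
          simp only [Set.mem_ofPred_eq] at *
          rw [map_add, ContinuousMap.add_apply, ha, hb]; rfl
        smul_mem' := fun c a ha => by
          simp only [Set.mem_ofPred_eq] at *
          rw [map_smul, ContinuousMap.smul_apply, ha]; rfl }
    have hC := mem_of_chi C (isClosed_eq ((continuous_eval_const ρ).comp L.continuous)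
      (continuous_eval_const τ)) (fun x => by
        obtain ⟨e, he⟩ := exists_idem_lift x.2
        obtain rfl : x = ⟨_, idem_mk e⟩ := Subtype.ext he.symm
        have hg : IsIdempotentElem (dag v * e * v) := by
          have := idem_conj (dag v) e.2
          rwa [dag_dag] at this
        have h1 : L (chi ⟨_, idem_mk e⟩) = chi ⟨_, idem_mk ⟨_, hg⟩⟩ := by
          refine equiv_injective (Φ := Φ) _ _ ?_
          apply Subtype.ext
          rw [hL, hΦ e, hΦ ⟨_, hg⟩, Submonoid.coe_mul, Submonoid.coe_mul, coe_dag]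
        change L (chi _) ρ = chi _ τ
        rw [h1, chi_apply, chi_apply, hρτ ⟨_, idem_mk e⟩ ⟨_, idem_mk ⟨_, hg⟩⟩ ?_]
        change ((dag v * e * v : GN h) : MunnQuotient (GN h)) = dag (v : MunnQuotient (GN h)) *
          ((e : GN h) : MunnQuotient (GN h)) * (v : MunnQuotient (GN h))
        rw [coe_dag_munn, ← Con.coe_mul, ← Con.coe_mul]) p
    have h2 : (p' : CharAlg (MunnQuotient (GN h))) = L p := by
      refine equiv_injective (Φ := Φ) _ _ ?_
      apply Subtype.ext
      rw [hL]
      have h3 := congrArg (fun x : GN h => (x : H →L[ℂ] H)) hpp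
      simp only [Submonoid.coe_mul, coe_dag, hι] at h3
      exact h3.symm
    rw [h2]
    exact hC

theorem exists_isExtensionOf (h : IsCartanPair M D) :
    ∃ Y : Extension (MunnQuotient (GN h)) (GN h), IsExtensionOf h Y := by
  obtain ⟨hc, Φ, hΦ⟩ := exists_charAlg_equiv h
  obtain ⟨Y, h1, h2⟩ := exists_extension_of_equiv hΦ
  exact ⟨Y, h1, Φ, hΦ, h2⟩

end pair

section expectation
variable {H : Type*} [NormedAddCommGroup H] [InnerProductSpace ℂ H] [CompleteSpace H]

theorem cfc_mem_vN (M : VonNeumannAlgebra H) {a : H →L[ℂ] H} (ha : a ∈ M) (f : ℝ → ℝ) :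
    cfc f a ∈ M := by
  rw [mem_vN_iff] at ha ⊢
  intro t ht
  have h1 : Commute a t := (ha t ht).symm
  exact (h1.cfc_real f).symm.eq

theorem exists_sqrt_mem (M : VonNeumannAlgebra H) {a : H →L[ℂ] H} (ha : a ∈ M) (h0 : 0 ≤ a) :
    ∃ s ∈ M, star s * s = a := by
  have hsa : IsSelfAdjoint a := h0.isSelfAdjoint
  refine ⟨cfc Real.sqrt a, cfc_mem_vN M ha _, ?_⟩
  rw [(cfc_predicate Real.sqrt a : IsSelfAdjoint _).star_eq,
    ← cfc_mul _ _ a Real.continuous_sqrt.continuousOn Real.continuous_sqrt.continuousOn]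
  conv_rhs => rw [← cfc_id ℝ a]
  exact cfc_congr fun t ht => Real.mul_self_sqrt (spectrum_nonneg_of_nonneg h0 ht)

theorem wTendsto_of_diag {ι : Type*} {l : Filter ι} {F : ι → H →L[ℂ] H} {x : H →L[ℂ] H}
    (h : ∀ ξ, Tendsto (fun i => inner ℂ ξ (F i ξ)) l (𝓝 (inner ℂ ξ (x ξ)))) : WTendsto F l x := by
  intro ξ η
  have key : ∀ T : H →L[ℂ] H, inner ℂ ξ (T η) =
      (inner ℂ (ξ + η) (T (ξ + η)) - inner ℂ (ξ - η) (T (ξ - η)) -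
        Complex.I * (inner ℂ (ξ + Complex.I • η) (T (ξ + Complex.I • η)) -
          inner ℂ (ξ - Complex.I • η) (T (ξ - Complex.I • η)))) / 4 := by
    intro T
    simp only [map_add, map_sub, map_smul, inner_add_left, inner_add_right, inner_sub_left,
      inner_sub_right, inner_smul_left, inner_smul_right, Complex.conj_I]
    linear_combination (1 / 2 * inner ℂ ξ (T η) - 1 / 2 * inner ℂ η (T ξ)) * Complex.I_mul_I
  rw [key x]
  simp only [fun i => key (F i)]
  exact ((((h _).sub (h _)).sub (((h _).sub (h _)).const_mul _))).div_const _

variable {K : Type*} [NormedAddCommGroup K] [InnerProductSpace ℂ K] [CompleteSpace K]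
  {M D : VonNeumannAlgebra H} {D' : VonNeumannAlgebra K} {ρ : D.toStarSubalgebra →⋆ₐ[ℂ] (K →L[ℂ] K)}

theorem map_nonneg_vN (ρ : D.toStarSubalgebra →⋆ₐ[ℂ] (K →L[ℂ] K)) {d : D.toStarSubalgebra}
    (hd : 0 ≤ (d : H →L[ℂ] H)) : 0 ≤ ρ d := by
  obtain ⟨s, hs, h1⟩ := exists_sqrt_mem D d.2 hd
  have : d = star (⟨s, hs⟩ : D.toStarSubalgebra) * ⟨s, hs⟩ := Subtype.ext h1.symm
  rw [this, map_mul, map_star]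
  exact star_mul_self_nonneg _

theorem nonneg_of_map_nonneg_vN (hinj : Function.Injective ρ) (hD' : ∀ x, x ∈ D' ↔ ∃ d, ρ d = x)
    {d : D.toStarSubalgebra} (hd : 0 ≤ ρ d) : 0 ≤ (d : H →L[ℂ] H) := by
  obtain ⟨s', hs', h1⟩ := exists_sqrt_mem D' ((hD' _).2 ⟨d, rfl⟩) hd
  obtain ⟨s, rfl⟩ := (hD' _).1 hs'
  rw [← map_star, ← map_mul] at h1
  rw [← hinj h1]
  exact star_mul_self_nonneg (s : H →L[ℂ] H)

/-- Isomorphisms of von Neumann algebras preserve suprema. -/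
theorem map_isLUB_vN (hinj : Function.Injective ρ) (hD' : ∀ x, x ∈ D' ↔ ∃ d, ρ d = x)
    {F : Set D.toStarSubalgebra} {x : D.toStarSubalgebra} (hne : F.Nonempty)
    (hd : DirectedOn (fun y z : D.toStarSubalgebra => (y : H →L[ℂ] H) ≤ z) F)
    (hx : IsLUB ((fun y : D.toStarSubalgebra => (y : H →L[ℂ] H)) '' F) x) :
    DirectedOn (· ≤ ·) (ρ '' F) ∧ IsLUB (ρ '' F) (ρ x) := by
  have mono : ∀ {y z : D.toStarSubalgebra}, (y : H →L[ℂ] H) ≤ z → ρ y ≤ ρ z := fun {y z} hyz => by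
    rw [← sub_nonneg, ← map_sub]
    exact map_nonneg_vN ρ (sub_nonneg.2 hyz)
  have anti : ∀ {y z : D.toStarSubalgebra}, ρ y ≤ ρ z → (y : H →L[ℂ] H) ≤ z := fun {y z} hyz => by
    rw [← sub_nonneg, ← map_sub] at hyz
    exact sub_nonneg.1 (nonneg_of_map_nonneg_vN hinj hD' hyz)
  have hd' : DirectedOn (· ≤ ·) (ρ '' F) := by
    rintro _ ⟨a, ha, rfl⟩ _ ⟨b, hb, rfl⟩
    obtain ⟨c, hc, h1, h2⟩ := hd a ha b hb
    exact ⟨_, ⟨c, hc, rfl⟩, mono h1, mono h2⟩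
  have hub : ∀ y ∈ ρ '' F, y ≤ ρ x := by
    rintro _ ⟨a, ha, rfl⟩
    exact mono (hx.1 ⟨a, ha, rfl⟩)
  obtain ⟨k, hk, -⟩ := exists_wTendsto_of_directed (hne.image _) hd' hub
  obtain ⟨k, rfl⟩ := (hD' _).1 (IsLUB.mem_vN D' (hne.image _) hd' hk (by
    rintro _ ⟨a, ha, rfl⟩; exact (hD' _).2 ⟨a, rfl⟩))
  have h1 : (x : H →L[ℂ] H) ≤ k := hx.2 (by
    rintro _ ⟨a, ha, rfl⟩
    exact anti (hk.1 ⟨a, ha, rfl⟩))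
  refine ⟨hd', ?_⟩
  rw [le_antisymm (mono h1) (hk.2 hub)]
  exact hk

variable {E : M.toStarSubalgebra →ₗ[ℂ] D.toStarSubalgebra}

/-- The functional `x ↦ ⟨ξ, ρ(E x) ξ⟩`. -/
noncomputable def vecLin (ρ : D.toStarSubalgebra →⋆ₐ[ℂ] (K →L[ℂ] K))
    (E : M.toStarSubalgebra →ₗ[ℂ] D.toStarSubalgebra) (ξ : K) : M.toStarSubalgebra →ₗ[ℂ] ℂ where
  toFun x := inner ℂ ξ (ρ (E x) ξ)
  map_add' x y := by rw [map_add, map_add, add_apply, inner_add_right]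
  map_smul' c x := by rw [map_smul, map_smul, smul_apply, inner_smul_right]; rfl

theorem IsNormalExpectation.isOrderNormal (hE : IsNormalExpectation M D E)
    (hinj : Function.Injective ρ) (hD' : ∀ x, x ∈ D' ↔ ∃ d, ρ d = x) (ξ : K) :
    IsOrderNormal (vecLin ρ E ξ) where
  nonneg x hx := by
    have := le_iff_inner.1 (map_nonneg_vN ρ (hE.nonneg x hx)) ξ
    rwa [sub_zero] at this
  normal F x hne hd hx ε hε := by
    have h1 := hE.normal F x hne hd hx
    rw [← Set.image_image (fun y : D.toStarSubalgebra => (y : H →L[ℂ] H)) E] at h1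
    obtain ⟨h2, h3⟩ := map_isLUB_vN hinj hD' (hne.image E) (by
      rintro _ ⟨a, ha, rfl⟩ _ ⟨b, hb, rfl⟩
      obtain ⟨c, hc, e1, e2⟩ := hd a ha b hb
      refine ⟨_, ⟨c, hc, rfl⟩, ?_, ?_⟩
      · have := hE.nonneg (c - a) (sub_nonneg.2 e1)
        rw [map_sub] at this
        exact sub_nonneg.1 this
      · have := hE.nonneg (c - b) (sub_nonneg.2 e2)
        rw [map_sub] at this
        exact sub_nonneg.1 this) h1
    obtain ⟨_, ⟨_, ⟨y, hy, rfl⟩, rfl⟩, h4⟩ :=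
      ((isLUB_iff_inner ((hne.image E).image ρ) h2).1 h3).2 ξ ε hε
    refine ⟨y, hy, ?_⟩
    rw [← map_sub, ← map_sub] at h4
    exact h4

theorem IsNormalExpectation.wTendsto_map (hE : IsNormalExpectation M D E)
    (hinj : Function.Injective ρ) (hD' : ∀ x, x ∈ D' ↔ ∃ d, ρ d = x) {ι : Type*} {l : Filter ι}
    {F : ι → M.toStarSubalgebra} {x : M.toStarSubalgebra} {C : ℝ}
    (hb : ∀ᶠ i in l, ‖(F i : H →L[ℂ] H)‖ ≤ C)
    (hF : WTendsto (fun i => (F i : H →L[ℂ] H)) l x) :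
    WTendsto (fun i => ρ (E (F i))) l (ρ (E x)) :=
  wTendsto_of_diag fun ξ => (hE.isOrderNormal hinj hD' ξ).isNormalFunctional.tendsto hb hF

theorem subtype_range_vN (D : VonNeumannAlgebra H) (x : H →L[ℂ] H) :
    x ∈ D ↔ ∃ d, D.toStarSubalgebra.subtype d = x :=
  ⟨fun hx => ⟨⟨x, hx⟩, rfl⟩, by rintro ⟨d, rfl⟩; exact d.2⟩

theorem IsNormalExpectation.wTendsto (hE : IsNormalExpectation M D E) {ι : Type*} {l : Filter ι}
    {F : ι → M.toStarSubalgebra} {x : M.toStarSubalgebra} {C : ℝ}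
    (hb : ∀ᶠ i in l, ‖(F i : H →L[ℂ] H)‖ ≤ C)
    (hF : WTendsto (fun i => (F i : H →L[ℂ] H)) l x) :
    WTendsto (fun i => (E (F i) : H →L[ℂ] H)) l (E x) :=
  hE.wTendsto_map (ρ := D.toStarSubalgebra.subtype) Subtype.val_injective (subtype_range_vN D) hb hF

theorem IsNormalExpectation.map_star (hE : IsNormalExpectation M D E) (x : M.toStarSubalgebra) :
    E (star x) = star (E x) := by
  apply Subtype.ext
  rw [← ContinuousLinearMap.coe_inj]
  refine (ext_inner_map _ _).1 fun ξ => ?_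
  have h1 := (hE.isOrderNormal (ρ := D.toStarSubalgebra.subtype) Subtype.val_injective
    (subtype_range_vN D) ξ).map_star x
  have h2 := congrArg (starRingEnd ℂ) h1
  rw [Complex.conj_conj] at h2
  change (starRingEnd ℂ) (inner ℂ ξ ((E (star x) : H →L[ℂ] H) ξ)) =
    inner ℂ ξ ((E x : H →L[ℂ] H) ξ) at h2
  rw [inner_conj_symm] at h2
  exact h2.trans (inner_star_left _ _ _).symm

end expectation

section pair
variable {H : Type*} [NormedAddCommGroup H] [InnerProductSpace ℂ H] [CompleteSpace H]
  {M D : VonNeumannAlgebra H}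

theorem IsCartanPair.commute_of_normalizers (h : IsCartanPair M D) {t : H →L[ℂ] H}
    (ht : ∀ v, IsGroupoidNormalizer M D v → v * t = t * v) {x : H →L[ℂ] H} (hx : x ∈ M) :
    x * t = t * x := by
  have hcont : ∀ ξ η : H, @Continuous _ _ (sigmaWeakTopology H) _
      (fun x : H →L[ℂ] H => inner ℂ ξ (x η)) := by
    classical
    intro ξ η
    have h1 := continuous_iInf_dom (i := ((lp.single 2 (0 : ℕ) ξ, lp.single 2 (0 : ℕ) η) :
      lp (fun _ : ℕ => H) 2 × lp (fun _ : ℕ => H) 2))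
      (t₁ := fun ζ : lp (fun _ : ℕ => H) 2 × lp (fun _ : ℕ => H) 2 =>
      TopologicalSpace.induced (fun x : H →L[ℂ] H => ∑' n, inner ℂ (ζ.1 n) (x (ζ.2 n))) inferInstance)
      continuous_induced_dom
    convert h1 using 2 with x
    rw [tsum_eq_single 0]
    · simp
    · intro n hn
      simp [lp.single_apply, Pi.single_eq_of_ne hn]
  have hsub : (Submodule.span ℂ {v | IsGroupoidNormalizer M D v} : Set (H →L[ℂ] H)) ⊆
      {x | x * t = t * x} := by
    intro y hy
    induction hy using Submodule.span_induction with
    | mem v hv => exact ht v hv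
    | zero => simp
    | add a b _ _ ha hb =>
      simp only [Set.mem_ofPred_eq] at *
      rw [add_mul, mul_add, ha, hb]
    | smul c a _ ha =>
      simp only [Set.mem_ofPred_eq] at *
      rw [smul_mul_assoc, mul_smul_comm, ha]
  letI := sigmaWeakTopology H
  have hcl : IsClosed {x : H →L[ℂ] H | x * t = t * x} := by
    have : {x : H →L[ℂ] H | x * t = t * x} =
        ⋂ ξ : H, ⋂ η : H, {x | inner ℂ ξ (x (t η)) = inner ℂ (star t ξ) (x η)} := by
      ext x
      simp only [Set.mem_ofPred_eq, Set.mem_iInter]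
      constructor
      · intro h1 ξ η
        rw [inner_star_left]
        exact congrArg (fun y : H →L[ℂ] H => inner ℂ ξ (y η)) h1
      · intro h1
        refine ext_inner_op fun ξ η => (h1 ξ η).trans ?_
        rw [inner_star_left]; rfl
    rw [this]
    exact isClosed_iInter fun ξ => isClosed_iInter fun η => isClosed_eq (hcont _ _) (hcont _ _)
  exact closure_minimal hsub hcl (h.regular hx)

/-- The conditional expectation of a normalizer is its restriction to the largest projection on
which it belongs to `D`. -/
theorem exists_expectation_eq (h : IsCartanPair M D)
    {E : M.toStarSubalgebra →ₗ[ℂ] D.toStarSubalgebra} (hE : IsNormalExpectation M D E) (v : GN h) :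
    ∃ e : Idem (GN h), (E ⟨v, v.2.1⟩ : H →L[ℂ] H) = (v : H →L[ℂ] H) * (e : GN h) ∧
      (v : H →L[ℂ] H) * (e : GN h) ∈ D ∧
      ∀ g : Idem (GN h), (v : H →L[ℂ] H) * (g : GN h) ∈ D → (e : GN h) * g = g := by
  set V : H →L[ℂ] H := (v : H →L[ℂ] H)
  have hVM : V ∈ M := v.2.1
  have hV : V * star V * V = V := v.2.2.1
  obtain ⟨e, heD, he, h1, h2⟩ := exists_sup_projection D {x | x ∈ D ∧ V * x ∈ D} fun x hx => hx.1
  have hVe : V * e ∈ D := by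
    refine (h.masa _ (mul_mem hVM (h.le heD))).2 fun d hd => ?_
    have h3 := h2 (V * d - d * V) fun x hx => by
      rw [sub_mul, sub_eq_zero, mul_assoc, h.comm hd hx.1, ← mul_assoc, h.comm hx.2 hd, mul_assoc]
    rw [sub_mul, sub_eq_zero] at h3
    rw [← mul_assoc, ← h3, mul_assoc, h.comm hd heD, mul_assoc]
  have bim : ∀ (x : H →L[ℂ] H) (hx : x ∈ M) (d d' : H →L[ℂ] H) (hd : d ∈ D) (hd' : d' ∈ D)
      (hy : d * x * d' ∈ M),
      (E ⟨d * x * d', hy⟩ : H →L[ℂ] H) = d * E ⟨x, hx⟩ * d' := fun x hx d d' hd hd' hy =>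
    congrArg Subtype.val (hE.bimodule ⟨x, hx⟩ ⟨_, hy⟩ ⟨d, hd⟩ ⟨d', hd'⟩ rfl)
  have bimr : ∀ (x : H →L[ℂ] H) (hx : x ∈ M) (d : H →L[ℂ] H) (hd : d ∈ D) (hy : x * d ∈ M),
      (E ⟨x * d, hy⟩ : H →L[ℂ] H) = E ⟨x, hx⟩ * d := fun x hx d hd hy => by
    have := bim x hx 1 d (one_mem D) hd (by rwa [one_mul])
    simpa only [one_mul] using this
  have biml : ∀ (x : H →L[ℂ] H) (hx : x ∈ M) (d : H →L[ℂ] H) (hd : d ∈ D) (hy : d * x ∈ M),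
      (E ⟨d * x, hy⟩ : H →L[ℂ] H) = d * E ⟨x, hx⟩ := fun x hx d hd hy => by
    have := bim x hx d 1 hd (one_mem D) (by rwa [mul_one])
    simpa only [mul_one] using this
  have congE : ∀ {x y : H →L[ℂ] H} (hx : x ∈ M) (hy : y ∈ M), x = y →
      (E ⟨x, hx⟩ : H →L[ℂ] H) = E ⟨y, hy⟩ := fun hx hy hxy => by subst hxy; rfl
  set c : H →L[ℂ] H := (E ⟨V, hVM⟩ : H →L[ℂ] H) with hc
  have hcD : c ∈ D := (E ⟨V, hVM⟩).2
  have hVV : V * star V ∈ D := v.2.mul_star_mem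
  have hsVV : star V * V ∈ D := v.2.star_mul_mem
  have c1 : V * star V * c = c := by
    rw [hc, ← biml V hVM _ hVV (mul_mem (h.le hVV) hVM)]
    exact congE _ _ hV
  have c2 : c * (star V * V) = c := by
    rw [hc, ← bimr V hVM _ hsVV (mul_mem hVM (h.le hsVV))]
    exact congE _ _ (by rw [← mul_assoc, hV])
  have c3 : ∀ d ∈ D, c * d = V * d * star V * c := fun d hd => by
    have hf : V * d * star V ∈ D := (v.2.2.2 d hd).1
    have h3 : c * (star V * V * d) = V * d * star V * c := by
      rw [hc, ← biml V hVM _ hf (mul_mem (h.le hf) hVM),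
        ← bimr V hVM _ (mul_mem hsVV hd) (mul_mem hVM (h.le (mul_mem hsVV hd)))]
      refine congE _ _ ?_
      rw [h.comm hsVV hd]; simp only [mul_assoc]
    rw [← h3, ← mul_assoc, c2]
  have hw : star V * c ∈ D := by
    refine (h.masa _ (mul_mem (star_mem hVM) (h.le hcD))).2 fun d hd => ?_
    calc d * (star V * c) = d * (star V * (V * star V * c)) := by rw [c1]
      _ = (d * (star V * V)) * star V * c := by simp only [mul_assoc]
      _ = (star V * V * d) * star V * c := by rw [h.comm hd hsVV]
      _ = star V * (V * d * star V * c) := by simp only [mul_assoc]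
      _ = star V * c * d := by rw [← c3 d hd, mul_assoc]
  have hcw : V * (star V * c) = c := by rw [← mul_assoc, c1]
  have hew : e * (star V * c) = star V * c := h1 _ ⟨hw, by rwa [hcw]⟩
  have hce : c * e = c := by
    rw [← hcw, mul_assoc, h.comm hw heD, hew]
  refine ⟨idemOfProj h e heD he, ?_, hVe, fun g hg => ?_⟩
  · change c = V * e
    have h3 : (E ⟨V * e, h.le hVe⟩ : H →L[ℂ] H) = V * e :=
      congrArg Subtype.val (hE.map_mem ⟨V * e, h.le hVe⟩ ⟨V * e, hVe⟩ rfl)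
    rw [← h3, bimr V hVM e heD]
    exact hce.symm
  · exact Subtype.ext (h1 _ ⟨idem_GN h g.2, hg⟩)

end pair

section approx
variable {H : Type*} [NormedAddCommGroup H] [InnerProductSpace ℂ H] [CompleteSpace H]

/-- The Kaplansky density theorem: bounded strong approximation. -/
theorem exists_bounded_approx (A : StarSubalgebra ℂ (H →L[ℂ] H)) (M : VonNeumannAlgebra H)
    (hd : ∀ t, (∀ a ∈ A, a * t = t * a) → ∀ x ∈ M, x * t = t * x) {x : H →L[ℂ] H} (hx : x ∈ M) :
    ∃ a : Finset H × ℕ → H →L[ℂ] H, (∀ i, a i ∈ A) ∧ (∀ i, ‖a i‖ ≤ 2 * ‖x‖ + 4) ∧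
      ∀ ξ, Tendsto (fun i => a i ξ) atTop (𝓝 (x ξ)) := by
  classical
  have hre : ((realPart x : selfAdjoint _) : H →L[ℂ] H) ∈ M := by
    rw [realPart_apply_coe]
    exact SMulMemClass.smul_mem (S := StarSubalgebra ℂ (H →L[ℂ] H)) (s := M.toStarSubalgebra)
      ((2⁻¹ : ℝ) : ℂ) (add_mem hx (star_mem hx))
  have him : ((imaginaryPart x : selfAdjoint _) : H →L[ℂ] H) ∈ M := by
    rw [imaginaryPart_apply_coe]
    refine SMulMemClass.smul_mem (S := StarSubalgebra ℂ (H →L[ℂ] H)) (s := M.toStarSubalgebra) _ ?_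
    exact SMulMemClass.smul_mem (S := StarSubalgebra ℂ (H →L[ℂ] H)) (s := M.toStarSubalgebra)
      ((2⁻¹ : ℝ) : ℂ) (sub_mem hx (star_mem hx))
  have key : ∀ i : Finset H × ℕ, ∃ a ∈ A, ‖a‖ ≤ 2 * ‖x‖ + 4 ∧
      ∀ ξ ∈ i.1, ‖x ξ - a ξ‖ < 1 / (i.2 + 1 : ℝ) := by
    rintro ⟨S, n⟩
    have hε : (0 : ℝ) < 1 / (n + 1 : ℝ) / 2 := by positivity
    obtain ⟨a, ha, ha1, ha2⟩ := kaplansky A (fun t ht => hd t ht _ hre) (realPart x).2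
      (fun ξ : S => (ξ : H)) hε
    obtain ⟨b, hb, hb1, hb2⟩ := kaplansky A (fun t ht => hd t ht _ him) (imaginaryPart x).2
      (fun ξ : S => (ξ : H)) hε
    refine ⟨a + Complex.I • b, add_mem ha (SMulMemClass.smul_mem _ hb), ?_, fun ξ hξ => ?_⟩
    · refine (norm_add_le _ _).trans ?_
      rw [norm_smul, Complex.norm_I, one_mul]
      have := realPart.norm_le x
      have := imaginaryPart.norm_le x
      rw [← AddSubgroup.coe_norm] at ha1 hb1
      linarith
    · have h1 : x ξ - (a + Complex.I • b) ξ = ((realPart x : H →L[ℂ] H) ξ - a ξ) +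
          Complex.I • ((imaginaryPart x : H →L[ℂ] H) ξ - b ξ) := by
        conv_lhs => rw [← realPart_add_I_smul_imaginaryPart x]
        simp only [add_apply, smul_apply, smul_sub]
        abel
      rw [h1]
      refine (norm_add_le _ _).trans_lt ?_
      rw [norm_smul, Complex.norm_I, one_mul]
      have := ha2 ⟨ξ, hξ⟩
      have := hb2 ⟨ξ, hξ⟩
      linarith
  choose a ha ha1 ha2 using key
  refine ⟨a, ha, ha1, fun ξ => ?_⟩
  rw [Metric.tendsto_nhds]
  intro ε hε
  obtain ⟨n, hn⟩ := exists_nat_one_div_lt hε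
  filter_upwards [eventually_ge_atTop (({ξ} : Finset H), n)] with i hi
  rw [dist_comm, dist_eq_norm]
  refine (ha2 i ξ (hi.1 (Finset.mem_singleton_self ξ))).trans_le (le_trans ?_ hn.le)
  exact one_div_le_one_div_of_le (by positivity) (by
    have : n ≤ i.2 := hi.2
    have : (n : ℝ) ≤ i.2 := by exact_mod_cast this
    linarith)

instance instNeBotFinsetNat {α : Type*} : (atTop : Filter (Finset α × ℕ)).NeBot := by
  classical exact atTop_neBot

theorem wTendsto_of_strong {ι : Type*} {l : Filter ι} {F : ι → H →L[ℂ] H} {x : H →L[ℂ] H}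
    (h : ∀ ξ, Tendsto (fun i => F i ξ) l (𝓝 (x ξ))) : WTendsto F l x :=
  fun _ η => tendsto_const_nhds.inner (h η)

end approx

section dense
variable {H : Type*} [NormedAddCommGroup H] [InnerProductSpace ℂ H] [CompleteSpace H]
  {M D : VonNeumannAlgebra H} {B : Type*} [Ring B] [Algebra ℂ B]

/-- `E` is a faithful normal expectation and `T` maps onto a weakly dense star subalgebra. -/
structure IsDenseRep (σ : B → B) (E : M.toStarSubalgebra →ₗ[ℂ] D.toStarSubalgebra)
    (T : B →ₐ[ℂ] M.toStarSubalgebra) : Prop where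
  normal : IsNormalExpectation M D E
  faithful : ∀ x : M.toStarSubalgebra, E (star x * x) = 0 → x = 0
  map_star : ∀ z, T (σ z) = star (T z)
  dense : ∀ t : H →L[ℂ] H, (∀ z, (T z : H →L[ℂ] H) * t = t * T z) → ∀ x ∈ M, x * t = t * x

variable {σ : B → B} {E : M.toStarSubalgebra →ₗ[ℂ] D.toStarSubalgebra} {T : B →ₐ[ℂ] M.toStarSubalgebra}

theorem IsDenseRep.exists_approx (hT : IsDenseRep σ E T) (x : M.toStarSubalgebra) :
    ∃ (z : Finset H × ℕ → B) (C : ℝ), (∀ i, ‖(T (z i) : H →L[ℂ] H)‖ ≤ C) ∧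
      ∀ ξ, Tendsto (fun i => (T (z i) : H →L[ℂ] H) ξ) atTop (𝓝 ((x : H →L[ℂ] H) ξ)) := by
  let A : StarSubalgebra ℂ (H →L[ℂ] H) :=
    { carrier := {y | ∃ z, (T z : H →L[ℂ] H) = y}
      mul_mem' := by rintro _ _ ⟨z, rfl⟩ ⟨w, rfl⟩; exact ⟨z * w, by rw [map_mul]; rfl⟩
      add_mem' := by rintro _ _ ⟨z, rfl⟩ ⟨w, rfl⟩; exact ⟨z + w, by rw [map_add]; rfl⟩
      algebraMap_mem' := fun c => ⟨algebraMap ℂ B c, by rw [AlgHom.commutes]; rfl⟩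
      star_mem' := by rintro _ ⟨z, rfl⟩; exact ⟨σ z, by rw [hT.map_star]; rfl⟩ }
  obtain ⟨a, ha, ha1, ha2⟩ := exists_bounded_approx A M
    (fun t ht => hT.dense t fun z => ht _ ⟨z, rfl⟩) x.2
  choose z hz using ha
  exact ⟨z, _, fun i => by rw [hz]; exact ha1 i, fun ξ => by simp only [hz]; exact ha2 ξ⟩

theorem IsDenseRep.coe_map_sub (hT : IsDenseRep σ E T) (c : ℝ) (z : B) :
    (T ((c : ℂ) • 1 - σ z * z) : H →L[ℂ] H) =
      algebraMap ℝ (H →L[ℂ] H) c - star (T z : H →L[ℂ] H) * T z := by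
  have h1 : T ((c : ℂ) • 1 - σ z * z) = (c : ℂ) • 1 - star (T z) * T z := by
    rw [map_sub, map_smul, map_one, map_mul, hT.map_star]
  rw [h1, Algebra.algebraMap_eq_smul_one]
  rfl

theorem IsDenseRep.eq_zero (hT : IsDenseRep σ E T) {y : M.toStarSubalgebra}
    (h : ∀ b, E (y * T b) = 0) : y = 0 := by
  obtain ⟨z, C, h1, h2⟩ := hT.exists_approx (star y)
  have h3 := hT.normal.wTendsto (F := fun i => y * T (z i)) (l := atTop) (x := y * star y)
    (C := ‖(y : H →L[ℂ] H)‖ * C)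
    (Eventually.of_forall fun i => (norm_mul_le _ _).trans
      (mul_le_mul_of_nonneg_left (h1 i) (norm_nonneg _)))
    ((wTendsto_of_strong h2).mul_left _)
  simp only [h] at h3
  have h4 : E (y * star y) = 0 := Subtype.ext (WTendsto.unique h3 (wTendsto_const _))
  have h5 := hT.faithful (star y) (by rwa [star_star])
  rwa [star_eq_zero] at h5

theorem IsDenseRep.nonneg (hT : IsDenseRep σ E T) {y : M.toStarSubalgebra}
    (hy : IsSelfAdjoint (y : H →L[ℂ] H))
    (h : ∀ b, 0 ≤ (E (star (T b) * y * T b) : H →L[ℂ] H)) : 0 ≤ (y : H →L[ℂ] H) := by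
  have h1 : ∀ m : M.toStarSubalgebra, 0 ≤ (E (star m * y * m) : H →L[ℂ] H) := by
    intro m
    obtain ⟨z, C, h1, h2⟩ := hT.exists_approx m
    have h0 : 0 ≤ C := (norm_nonneg _).trans (h1 (∅, 0))
    refine (hT.normal.wTendsto (F := fun i => star (T (z i)) * y * T (z i)) (l := atTop)
      (x := star m * y * m) (C := C * ‖(y : H →L[ℂ] H)‖ * C)
      (Eventually.of_forall fun i => ?_) (fun ξ η => ?_)).ge (Eventually.of_forall fun i => h _)
    · refine (norm_mul_le _ _).trans (mul_le_mul ((norm_mul_le _ _).trans ?_) (h1 i)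
        (norm_nonneg _) (by positivity))
      refine mul_le_mul_of_nonneg_right ?_ (norm_nonneg _)
      exact (norm_star (T (z i) : H →L[ℂ] H)).le.trans (h1 i)
    · have e : ∀ a : M.toStarSubalgebra,
          inner ℂ ξ (((star a * y * a : M.toStarSubalgebra) : H →L[ℂ] H) η) =
          inner ℂ ((a : H →L[ℂ] H) ξ) ((y : H →L[ℂ] H) ((a : H →L[ℂ] H) η)) := fun a => by
        change inner ℂ ξ ((star (a : H →L[ℂ] H)) ((y : H →L[ℂ] H) ((a : H →L[ℂ] H) η))) = _
        rw [inner_star_right]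
      simp only [e]
      exact (h2 ξ).inner (((y : H →L[ℂ] H).continuous.tendsto _).comp (h2 η))
  set Y : H →L[ℂ] H := (y : H →L[ℂ] H)
  let k : M.toStarSubalgebra := ⟨cfc (fun t : ℝ => √(max (-t) 0)) Y, cfc_mem_vN M y.2 _⟩
  let n : M.toStarSubalgebra := ⟨cfc (fun t : ℝ => max (-t) 0) Y, cfc_mem_vN M y.2 _⟩
  have hk : star k = k := Subtype.ext (cfc_predicate _ Y : IsSelfAdjoint _).star_eq
  have hn : star n = n := Subtype.ext (cfc_predicate _ Y : IsSelfAdjoint _).star_eq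
  have c1 : Continuous fun t : ℝ => √(max (-t) 0) := by fun_prop
  have c2 : Continuous fun t : ℝ => max (-t) 0 := by fun_prop
  have e1 : star k * y * k = -(star n * n) := by
    rw [hk, hn]
    apply Subtype.ext
    change cfc _ Y * Y * cfc _ Y = - (cfc _ Y * cfc _ Y)
    conv_lhs => enter [1, 2]; rw [← cfc_id ℝ Y]
    rw [← cfc_mul _ _ Y c1.continuousOn continuousOn_id,
      ← cfc_mul (fun t : ℝ => √(max (-t) 0) * id t) _ Y (c1.mul continuous_id).continuousOn c1.continuousOn,
      ← cfc_mul _ _ Y c2.continuousOn c2.continuousOn, ← cfc_neg]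
    refine cfc_congr fun t _ => ?_
    have h2 := Real.mul_self_sqrt (le_max_right (-t) 0)
    simp only [id]
    rcases max_cases (-t) 0 with ⟨h3, -⟩ | ⟨h3, -⟩
    · rw [h3] at h2 ⊢
      linear_combination t * h2
    · rw [h3]; simp
  have e2 := h1 k
  have e3 := hT.normal.nonneg (star n * n) (star_mul_self_nonneg (n : H →L[ℂ] H))
  rw [e1, map_neg] at e2
  have e4 : (E (star n * n) : H →L[ℂ] H) = 0 := le_antisymm (neg_nonneg.1 e2) e3
  have e5 : cfc (fun t : ℝ => max (-t) 0) Y = 0 :=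
    congrArg Subtype.val (hT.faithful n (Subtype.ext e4))
  have e6 : Y = cfc (fun t : ℝ => max t 0) Y := by
    conv_lhs => rw [← cfc_id ℝ Y]
    rw [← sub_zero (cfc (fun t : ℝ => max t 0) Y), ← e5,
      ← cfc_sub _ _ Y (by fun_prop) c2.continuousOn]
    refine cfc_congr fun t _ => ?_
    simp only [id]
    rcases max_cases t 0 with ⟨h3, h4⟩ | ⟨h3, h4⟩ <;>
      rcases max_cases (-t) 0 with ⟨h5, h6⟩ | ⟨h5, h6⟩ <;> rw [h3, h5] <;> linarith
  rw [e6]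
  exact cfc_nonneg fun t _ => le_max_right _ _

end dense

section uniqueness
variable {H₁ : Type*} [NormedAddCommGroup H₁] [InnerProductSpace ℂ H₁] [CompleteSpace H₁]
  {H₂ : Type*} [NormedAddCommGroup H₂] [InnerProductSpace ℂ H₂] [CompleteSpace H₂]
  {M₁ D₁ : VonNeumannAlgebra H₁} {M₂ D₂ : VonNeumannAlgebra H₂} {B : Type*} [Ring B] [Algebra ℂ B]
  {σ : B → B} {E₁ : M₁.toStarSubalgebra →ₗ[ℂ] D₁.toStarSubalgebra}
  {E₂ : M₂.toStarSubalgebra →ₗ[ℂ] D₂.toStarSubalgebra} {T₁ : B →ₐ[ℂ] M₁.toStarSubalgebra}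
  {T₂ : B →ₐ[ℂ] M₂.toStarSubalgebra} {φ : D₁.toStarSubalgebra ≃⋆ₐ[ℂ] D₂.toStarSubalgebra}

/-- An isomorphism of von Neumann algebras as a representation. -/
noncomputable def equivRep (φ : D₁.toStarSubalgebra ≃⋆ₐ[ℂ] D₂.toStarSubalgebra) :
    D₁.toStarSubalgebra →⋆ₐ[ℂ] (H₂ →L[ℂ] H₂) :=
  D₂.toStarSubalgebra.subtype.comp (φ : D₁.toStarSubalgebra →⋆ₐ[ℂ] D₂.toStarSubalgebra)

theorem equivRep_injective : Function.Injective (equivRep φ) := fun u v huv => by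
  have : φ u = φ v := Subtype.ext huv
  simpa using congrArg φ.symm this

theorem mem_range_equivRep (t : H₂ →L[ℂ] H₂) : t ∈ D₂ ↔ ∃ d, equivRep φ d = t :=
  ⟨fun ht => ⟨φ.symm ⟨t, ht⟩, congrArg Subtype.val (φ.apply_symm_apply ⟨t, ht⟩)⟩, by
    rintro ⟨d, rfl⟩; exact (φ d).2⟩

/-- `x` and `y` have the same matrix coefficients. -/
def Matches (E₁ : M₁.toStarSubalgebra →ₗ[ℂ] D₁.toStarSubalgebra)
    (E₂ : M₂.toStarSubalgebra →ₗ[ℂ] D₂.toStarSubalgebra) (T₁ : B →ₐ[ℂ] M₁.toStarSubalgebra)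
    (T₂ : B →ₐ[ℂ] M₂.toStarSubalgebra) (φ : D₁.toStarSubalgebra ≃⋆ₐ[ℂ] D₂.toStarSubalgebra)
    (x : M₁.toStarSubalgebra) (y : M₂.toStarSubalgebra) : Prop :=
  ∀ a b, E₂ (T₂ a * y * T₂ b) = φ (E₁ (T₁ a * x * T₁ b))

theorem Matches.symm {x : M₁.toStarSubalgebra} {y : M₂.toStarSubalgebra}
    (h : Matches E₁ E₂ T₁ T₂ φ x y) : Matches E₂ E₁ T₂ T₁ φ.symm y x := fun a b => by
  rw [h a b, StarAlgEquiv.symm_apply_apply]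

theorem Matches.unique (hT₂ : IsDenseRep σ E₂ T₂) {x : M₁.toStarSubalgebra}
    {y y' : M₂.toStarSubalgebra} (h : Matches E₁ E₂ T₁ T₂ φ x y) (h' : Matches E₁ E₂ T₁ T₂ φ x y') :
    y = y' := by
  rw [← sub_eq_zero]
  refine hT₂.eq_zero fun b => ?_
  have h1 := h 1 b
  rw [← h' 1 b, map_one, one_mul, one_mul] at h1
  rw [sub_mul, map_sub, h1, sub_self]

theorem norm_map_le (hT₁ : IsDenseRep σ E₁ T₁) (hT₂ : IsDenseRep σ E₂ T₂)
    (hE : ∀ z, E₂ (T₂ z) = φ (E₁ (T₁ z))) (z : B) :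
    ‖(T₂ z : H₂ →L[ℂ] H₂)‖ ≤ ‖(T₁ z : H₁ →L[ℂ] H₁)‖ := by
  set c : ℝ := ‖(T₁ z : H₁ →L[ℂ] H₁)‖ ^ 2 with hc
  set w : B := (c : ℂ) • 1 - σ z * z
  have hw1 := hT₁.coe_map_sub c z
  have hw2 := hT₂.coe_map_sub c z
  have h0 : 0 ≤ (T₁ w : H₁ →L[ℂ] H₁) := by
    rw [hw1, sub_nonneg]
    exact star_mul_self_le_norm_sq _
  have h1 : 0 ≤ (T₂ w : H₂ →L[ℂ] H₂) := by
    refine hT₂.nonneg ?_ fun b => ?_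
    · rw [hw2]
      exact (IsSelfAdjoint.algebraMap _ (IsSelfAdjoint.all c)).sub (IsSelfAdjoint.star_mul_self _)
    · rw [← hT₂.map_star, ← map_mul, ← map_mul, hE]
      refine map_nonneg_vN (equivRep φ) ?_
      refine hT₁.normal.nonneg _ ?_
      rw [map_mul, map_mul, hT₁.map_star]
      exact conj_nonneg h0 _
  rw [hw2, sub_nonneg] at h1
  have h2 := norm_le_of_nonneg_of_le (by positivity) (star_mul_self_nonneg _) h1
  rw [CStarRing.norm_star_mul_self, ← sq] at h2
  exact (pow_le_pow_iff_left₀ (norm_nonneg _) (norm_nonneg _) two_ne_zero).1 h2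

/-- Bounded nets with the same coefficients have matching limits. -/
theorem exists_matches (hT₁ : IsDenseRep σ E₁ T₁) (hT₂ : IsDenseRep σ E₂ T₂)
    (hE : ∀ z, E₂ (T₂ z) = φ (E₁ (T₁ z))) (x : M₁.toStarSubalgebra) :
    ∃ y, Matches E₁ E₂ T₁ T₂ φ x y ∧ ∃ (l : Filter (Finset H₁ × ℕ)) (_ : l.NeBot)
      (z : Finset H₁ × ℕ → B) (C : ℝ), (∀ i, ‖(T₁ (z i) : H₁ →L[ℂ] H₁)‖ ≤ C) ∧
      (∀ i, ‖(T₂ (z i) : H₂ →L[ℂ] H₂)‖ ≤ C) ∧ WTendsto (fun i => (T₁ (z i) : H₁ →L[ℂ] H₁)) l x ∧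
      WTendsto (fun i => (T₂ (z i) : H₂ →L[ℂ] H₂)) l y := by
  obtain ⟨z, C, h1, h2⟩ := hT₁.exists_approx x
  have h3 : ∀ i, ‖(T₂ (z i) : H₂ →L[ℂ] H₂)‖ ≤ C := fun i =>
    (norm_map_le hT₁ hT₂ hE (z i)).trans (h1 i)
  let 𝒰 : Ultrafilter (Finset H₁ × ℕ) := Ultrafilter.of atTop
  have hle : (𝒰 : Filter (Finset H₁ × ℕ)) ≤ atTop := Ultrafilter.of_le atTop
  have h4 : WTendsto (fun i => (T₁ (z i) : H₁ →L[ℂ] H₁)) (𝒰 : Filter _) x :=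
    wTendsto_of_strong fun ξ => (h2 ξ).mono_left hle
  obtain ⟨y, hy⟩ := exists_wTendsto 𝒰 (fun i => (T₂ (z i) : H₂ →L[ℂ] H₂)) C
    (Eventually.of_forall h3)
  have hyM : y ∈ M₂ := hy.mem M₂ (Eventually.of_forall fun i => (T₂ (z i)).2)
  refine ⟨⟨y, hyM⟩, fun a b => ?_, (𝒰 : Filter _), inferInstance, z, C, h1, h3, h4, hy⟩
  have e1 := hT₂.normal.wTendsto (F := fun i => T₂ a * T₂ (z i) * T₂ b) (l := (𝒰 : Filter _))
    (x := T₂ a * ⟨y, hyM⟩ * T₂ b)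
    (C := ‖(T₂ a : H₂ →L[ℂ] H₂)‖ * C * ‖(T₂ b : H₂ →L[ℂ] H₂)‖)
    (Eventually.of_forall fun i => (norm_mul_le _ _).trans (mul_le_mul_of_nonneg_right
      ((norm_mul_le _ _).trans (mul_le_mul_of_nonneg_left (h3 i) (norm_nonneg _))) (norm_nonneg _)))
    ((hy.mul_left _).mul_right _)
  have e2 := hT₁.normal.wTendsto_map
    (ρ := equivRep φ) (D' := D₂) equivRep_injective mem_range_equivRep
    (F := fun i => T₁ a * T₁ (z i) * T₁ b) (l := (𝒰 : Filter _)) (x := T₁ a * x * T₁ b)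
    (C := ‖(T₁ a : H₁ →L[ℂ] H₁)‖ * C * ‖(T₁ b : H₁ →L[ℂ] H₁)‖)
    (Eventually.of_forall fun i => (norm_mul_le _ _).trans (mul_le_mul_of_nonneg_right
      ((norm_mul_le _ _).trans (mul_le_mul_of_nonneg_left (h1 i) (norm_nonneg _))) (norm_nonneg _)))
    ((h4.mul_left _).mul_right _)
  apply Subtype.ext
  refine WTendsto.unique e1 (e2.congr' (Eventually.of_forall fun i => ?_))
  change (φ (E₁ (T₁ a * T₁ (z i) * T₁ b)) : H₂ →L[ℂ] H₂) = E₂ (T₂ a * T₂ (z i) * T₂ b)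
  rw [← map_mul, ← map_mul, ← map_mul, ← map_mul, hE]

theorem Matches.mul (hT₁ : IsDenseRep σ E₁ T₁) (hT₂ : IsDenseRep σ E₂ T₂)
    (hE : ∀ z, E₂ (T₂ z) = φ (E₁ (T₁ z))) {x x' : M₁.toStarSubalgebra} {y y' : M₂.toStarSubalgebra}
    (h : Matches E₁ E₂ T₁ T₂ φ x y) (h' : Matches E₁ E₂ T₁ T₂ φ x' y') :
    Matches E₁ E₂ T₁ T₂ φ (x * x') (y * y') := by
  have key : ∀ (a : B) {m : M₁.toStarSubalgebra} {n : M₂.toStarSubalgebra},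
      Matches E₁ E₂ T₁ T₂ φ m n → E₂ (T₂ a * y * n) = φ (E₁ (T₁ a * x * m)) := by
    intro a m n hmn
    obtain ⟨n', hn', l, hl, z, C, h1, h3, h4, h5⟩ := exists_matches hT₁ hT₂ hE m
    obtain rfl := hn'.unique hT₂ hmn
    have e1 := hT₂.normal.wTendsto (F := fun i => T₂ a * y * T₂ (z i)) (l := l)
      (x := T₂ a * y * n')
      (C := ‖((T₂ a * y : M₂.toStarSubalgebra) : H₂ →L[ℂ] H₂)‖ * C)
      (Eventually.of_forall fun i => (norm_mul_le _ _).trans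
        (mul_le_mul_of_nonneg_left (h3 i) (norm_nonneg _)))
      (h5.mul_left _)
    have e2 := hT₁.normal.wTendsto_map
      (ρ := equivRep φ) (D' := D₂) equivRep_injective mem_range_equivRep
      (F := fun i => T₁ a * x * T₁ (z i)) (l := l) (x := T₁ a * x * m)
      (C := ‖((T₁ a * x : M₁.toStarSubalgebra) : H₁ →L[ℂ] H₁)‖ * C)
      (Eventually.of_forall fun i => (norm_mul_le _ _).trans
        (mul_le_mul_of_nonneg_left (h1 i) (norm_nonneg _)))
      (h4.mul_left _)
    apply Subtype.ext
    refine WTendsto.unique e1 (e2.congr' (Eventually.of_forall fun i => ?_))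
    exact congrArg Subtype.val (h a (z i)).symm
  intro a b
  have h1 : Matches E₁ E₂ T₁ T₂ φ (x' * T₁ b) (y' * T₂ b) := fun a' b' => by
    have := h' a' (b * b')
    rw [map_mul T₂, map_mul T₁] at this
    simpa only [mul_assoc] using this
  have := key a h1
  simpa only [mul_assoc] using this

/-- A dense algebra and the values of a faithful normal expectation on it determine a von Neumann
algebra. -/
theorem exists_starAlgEquiv (hT₁ : IsDenseRep σ E₁ T₁) (hT₂ : IsDenseRep σ E₂ T₂)
    (hE : ∀ z, E₂ (T₂ z) = φ (E₁ (T₁ z))) :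
    ∃ θ : M₁.toStarSubalgebra ≃⋆ₐ[ℂ] M₂.toStarSubalgebra, ∀ z, θ (T₁ z) = T₂ z := by
  have hE' : ∀ z, E₁ (T₁ z) = φ.symm (E₂ (T₂ z)) := fun z => by
    rw [hE, StarAlgEquiv.symm_apply_apply]
  choose f hf using fun x => (exists_matches hT₁ hT₂ hE x).imp fun y hy => hy.1
  choose g hg using fun y => (exists_matches hT₂ hT₁ hE' y).imp fun x hx => hx.1
  have hun : ∀ {x : M₁.toStarSubalgebra} {y : M₂.toStarSubalgebra},
      Matches E₁ E₂ T₁ T₂ φ x y → f x = y := fun h => (hf _).unique hT₂ h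
  refine ⟨{ toFun := f
            invFun := g
            left_inv := fun x => (hg (f x)).unique hT₁ (hf x).symm
            right_inv := fun y => hun (hg y).symm
            map_mul' := fun x x' => hun ((hf x).mul hT₁ hT₂ hE (hf x'))
            map_add' := fun x x' => hun fun a b => ?_
            map_star' := fun x => hun fun a b => ?_
            map_smul' := fun c x => hun fun a b => ?_ }, fun z => hun fun a b => ?_⟩
  · rw [mul_add, add_mul, map_add, mul_add, add_mul, map_add, map_add, hf x a b, hf x' a b]
  · have h1 := hf x (σ b) (σ a)
    have h2 := congrArg star h1
    rw [← map_star φ, ← hT₂.normal.map_star, ← hT₁.normal.map_star] at h2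
    simpa only [star_mul, hT₁.map_star, hT₂.map_star, star_star, mul_assoc] using h2
  · rw [mul_smul_comm, smul_mul_assoc, map_smul, mul_smul_comm, smul_mul_assoc, map_smul, map_smul,
      hf x a b]
  · rw [← map_mul, ← map_mul, ← map_mul, ← map_mul, hE]

end uniqueness

section single
variable {H : Type*} [NormedAddCommGroup H] [InnerProductSpace ℂ H] [CompleteSpace H]
  {M D : VonNeumannAlgebra H}

/-- The inclusion of the normalizers into `M`. -/
def gnHom (h : IsCartanPair M D) : GN h →* M.toStarSubalgebra where
  toFun v := ⟨v, v.2.1⟩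
  map_one' := rfl
  map_mul' _ _ := rfl

theorem mem_D_iff_commute (h : IsCartanPair M D) {x : H →L[ℂ] H} (hx : x ∈ M) :
    x ∈ D ↔ ∀ e : Idem (GN h), ((e : GN h) : H →L[ℂ] H) * x = x * (e : GN h) := by
  rw [h.masa x hx]
  refine ⟨fun hc e => hc _ (idem_GN h e.2), fun hc d hd => ?_⟩
  let C : Submodule ℂ (H →L[ℂ] H) :=
    { carrier := {d | d * x = x * d}
      zero_mem' := by simp
      add_mem' := fun {a b} ha hb => by
        simp only [Set.mem_ofPred_eq] at *
        rw [add_mul, mul_add, ha, hb]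
      smul_mem' := fun c a ha => by
        simp only [Set.mem_ofPred_eq] at *
        rw [smul_mul_assoc, mul_smul_comm, ha] }
  exact mem_of_projections D C (isClosed_eq (continuous_id.mul continuous_const)
    (continuous_const.mul continuous_id)) (fun p hpD hpp => hc (idemOfProj h p hpD hpp)) hd

end single

section pairs
variable {H₁ : Type*} [NormedAddCommGroup H₁] [InnerProductSpace ℂ H₁] [CompleteSpace H₁]
  {H₂ : Type*} [NormedAddCommGroup H₂] [InnerProductSpace ℂ H₂] [CompleteSpace H₂]
  {M₁ D₁ : VonNeumannAlgebra H₁} {M₂ D₂ : VonNeumannAlgebra H₂}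
  {h₁ : IsCartanPair M₁ D₁} {h₂ : IsCartanPair M₂ D₂}

section compat
variable (α : GN h₁ ≃* GN h₂) (φ : D₁.toStarSubalgebra ≃⋆ₐ[ℂ] D₂.toStarSubalgebra)
  (hα : ∀ (v : GN h₁) (hv : (v : H₁ →L[ℂ] H₁) ∈ D₁), (α v : H₂ →L[ℂ] H₂) = φ ⟨v, hv⟩)

theorem mem_D_of_map_mem (α : GN h₁ ≃* GN h₂) (φ : D₁.toStarSubalgebra ≃⋆ₐ[ℂ] D₂.toStarSubalgebra)
    (hα : ∀ (v : GN h₁) (hv : (v : H₁ →L[ℂ] H₁) ∈ D₁), (α v : H₂ →L[ℂ] H₂) = φ ⟨v, hv⟩)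
    {v : GN h₁} (hv : (α v : H₂ →L[ℂ] H₂) ∈ D₂) : (v : H₁ →L[ℂ] H₁) ∈ D₁ := by
  set u := φ.symm ⟨α v, hv⟩ with hu
  have hφu : φ u = ⟨α v, hv⟩ := φ.apply_symm_apply _
  have hpi : u * star u * u = u := by
    have h1 : φ (u * star u * u) = φ u := by
      rw [map_mul, map_mul, map_star, hφu]
      exact Subtype.ext (α v).2.2.1
    simpa using congrArg φ.symm h1
  let u' : GN h₁ := ofD h₁ u u.2 (congrArg Subtype.val hpi)
  have h2 : α u' = α v := Subtype.ext (by
    rw [hα u' u.2]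
    exact congrArg Subtype.val hφu)
  rw [← α.injective h2]
  exact u.2

theorem expectation_map (α : GN h₁ ≃* GN h₂) (φ : D₁.toStarSubalgebra ≃⋆ₐ[ℂ] D₂.toStarSubalgebra)
    (hα : ∀ (v : GN h₁) (hv : (v : H₁ →L[ℂ] H₁) ∈ D₁), (α v : H₂ →L[ℂ] H₂) = φ ⟨v, hv⟩)
    {E₁ : M₁.toStarSubalgebra →ₗ[ℂ] D₁.toStarSubalgebra}
    {E₂ : M₂.toStarSubalgebra →ₗ[ℂ] D₂.toStarSubalgebra} (hE₁ : IsNormalExpectation M₁ D₁ E₁)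
    (hE₂ : IsNormalExpectation M₂ D₂ E₂) (v : GN h₁) :
    E₂ (gnHom h₂ (α v)) = φ (E₁ (gnHom h₁ v)) := by
  obtain ⟨e, he1, he2, he3⟩ := exists_expectation_eq h₁ hE₁ v
  obtain ⟨f, hf1, hf2, hf3⟩ := exists_expectation_eq h₂ hE₂ (α v)
  have hαe : IsIdempotentElem (α (e : GN h₁)) := by
    rw [IsIdempotentElem, ← map_mul, e.2.eq]
  have hαf : IsIdempotentElem (α.symm (f : GN h₂)) := by
    rw [IsIdempotentElem, ← map_mul, f.2.eq]
  have a1 : (α (v * e) : H₂ →L[ℂ] H₂) = φ ⟨_, he2⟩ := hα (v * e) he2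
  have a2 : (f : GN h₂) * α e = α e := hf3 ⟨_, hαe⟩ (by
    change ((α v * α e : GN h₂) : H₂ →L[ℂ] H₂) ∈ D₂
    rw [← map_mul, a1]
    exact (φ _).2)
  have a3 : (e : GN h₁) * α.symm f = α.symm f := he3 ⟨_, hαf⟩ (by
    change ((v * α.symm f : GN h₁) : H₁ →L[ℂ] H₁) ∈ D₁
    refine mem_D_of_map_mem α φ hα ?_
    rw [map_mul, α.apply_symm_apply]
    exact hf2)
  have a4 : α (e : GN h₁) * f = f := by
    have := congrArg α a3
    rwa [map_mul, α.apply_symm_apply] at this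
  have a5 : α (e : GN h₁) = f := by
    rw [← a2, idem_comm f.2 hαe, a4]
  apply Subtype.ext
  refine hf1.trans ?_
  rw [← a5]
  change ((α v * α e : GN h₂) : H₂ →L[ℂ] H₂) = _
  rw [← map_mul, a1]
  exact congrArg (fun x => (φ x : H₂ →L[ℂ] H₂)) (Subtype.ext he1.symm)

theorem cartanPairIso_of_compat (α : GN h₁ ≃* GN h₂)
    (φ : D₁.toStarSubalgebra ≃⋆ₐ[ℂ] D₂.toStarSubalgebra)
    (hα : ∀ (v : GN h₁) (hv : (v : H₁ →L[ℂ] H₁) ∈ D₁), (α v : H₂ →L[ℂ] H₂) = φ ⟨v, hv⟩) :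
    CartanPairIso M₁ D₁ M₂ D₂ := by
  obtain ⟨E₁, hE₁, hf₁⟩ := h₁.exists_expectation
  obtain ⟨E₂, hE₂, hf₂⟩ := h₂.exists_expectation
  let T₁ := MonoidAlgebra.lift ℂ M₁.toStarSubalgebra (GN h₁) (gnHom h₁)
  let T₂ := MonoidAlgebra.lift ℂ M₂.toStarSubalgebra (GN h₁) ((gnHom h₂).comp (α : GN h₁ →* GN h₂))
  have t₁ : ∀ v c, T₁ (MonoidAlgebra.single v c) = c • gnHom h₁ v := fun v c =>
    MonoidAlgebra.lift_single _ _ _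
  have t₂ : ∀ v c, T₂ (MonoidAlgebra.single v c) = c • gnHom h₂ (α v) := fun v c =>
    MonoidAlgebra.lift_single _ _ _
  have hdag : ∀ v : GN h₁, α (dag v) = dag (α v) := fun v => map_dag (α : GN h₁ →ₙ* GN h₂) v
  have hs : ∀ z, ∃ z', T₁ z' = star (T₁ z) ∧ T₂ z' = star (T₂ z) := by
    intro z
    induction z using MonoidAlgebra.induction_linear with
    | zero => exact ⟨0, by simp⟩
    | add x y hx hy =>
      obtain ⟨x', hx1, hx2⟩ := hx
      obtain ⟨y', hy1, hy2⟩ := hy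
      exact ⟨x' + y', by rw [map_add, map_add, star_add, hx1, hy1],
        by rw [map_add, map_add, star_add, hx2, hy2]⟩
    | single v c =>
      refine ⟨MonoidAlgebra.single (dag v) (star c), ?_, ?_⟩
      · rw [t₁, t₁, star_smul]
        congr 1
        exact Subtype.ext (coe_dag v)
      · rw [t₂, t₂, star_smul, hdag]
        congr 1
        exact Subtype.ext (coe_dag (α v))
  choose σ hσ₁ hσ₂ using hs
  have hT₁ : IsDenseRep σ E₁ T₁ := ⟨hE₁, hf₁, hσ₁, fun t ht x hx =>
    h₁.commute_of_normalizers (fun v hv => by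
      have := ht (MonoidAlgebra.single ⟨v, hv⟩ 1)
      rw [t₁, one_smul] at this
      exact this) hx⟩
  have hT₂ : IsDenseRep σ E₂ T₂ := ⟨hE₂, hf₂, hσ₂, fun t ht x hx =>
    h₂.commute_of_normalizers (fun v hv => by
      have := ht (MonoidAlgebra.single (α.symm ⟨v, hv⟩) 1)
      rw [t₂, one_smul, α.apply_symm_apply] at this
      exact this) hx⟩
  have hE : ∀ z, E₂ (T₂ z) = φ (E₁ (T₁ z)) := by
    intro z
    induction z using MonoidAlgebra.induction_linear with
    | zero => simp
    | add x y hx hy => rw [map_add T₂, map_add E₂, hx, hy, map_add T₁, map_add E₁, map_add φ]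
    | single v c => rw [t₁, t₂, map_smul, map_smul, map_smul, expectation_map α φ hα hE₁ hE₂]
  obtain ⟨θ, hθ⟩ := exists_starAlgEquiv hT₁ hT₂ hE
  have hθv : ∀ v : GN h₁, θ (gnHom h₁ v) = gnHom h₂ (α v) := fun v => by
    have := hθ (MonoidAlgebra.single v 1)
    rwa [t₁, t₂, one_smul, one_smul] at this
  refine ⟨θ, fun x => ?_⟩
  rw [mem_D_iff_commute h₁ x.2, mem_D_iff_commute h₂ (θ x).2]
  have key : ∀ v : GN h₁, (((α v : GN h₂) : H₂ →L[ℂ] H₂) * θ x = θ x * (α v : GN h₂)) ↔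
      ((v : H₁ →L[ℂ] H₁) * x = x * (v : H₁ →L[ℂ] H₁)) := by
    intro v
    have e1 : ((α v : GN h₂) : H₂ →L[ℂ] H₂) * θ x = θ (gnHom h₁ v * x) := by
      rw [map_mul, hθv]; rfl
    have e2 : (θ x : H₂ →L[ℂ] H₂) * (α v : GN h₂) = θ (x * gnHom h₁ v) := by
      rw [map_mul, hθv]; rfl
    rw [e1, e2]
    constructor
    · intro h3
      have h4 : θ (gnHom h₁ v * x) = θ (x * gnHom h₁ v) := Subtype.ext h3
      have h5 : gnHom h₁ v * x = x * gnHom h₁ v := by simpa using congrArg θ.symm h4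
      exact congrArg Subtype.val h5
    · intro h3
      have h5 : gnHom h₁ v * x = x * gnHom h₁ v := Subtype.ext h3
      rw [h5]
  constructor
  · intro hc e
    exact (key e).1 (hc ⟨α e, by rw [IsIdempotentElem, ← map_mul, e.2.eq]⟩)
  · intro hc e
    have := (key (α.symm e)).2 (hc ⟨α.symm e, by rw [IsIdempotentElem, ← map_mul, e.2.eq]⟩)
    rwa [α.apply_symm_apply] at this

end compat

/-- Cartan pairs with equivalent extensions are isomorphic. -/
theorem cartanPairIso_of_extEquiv {Y₁ : Extension (MunnQuotient (GN h₁)) (GN h₁)}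
    {Y₂ : Extension (MunnQuotient (GN h₂)) (GN h₂)} (hY₁ : IsExtensionOf h₁ Y₁)
    (hY₂ : IsExtensionOf h₂ Y₂) (he : ExtEquiv Y₁ Y₂) : CartanPairIso M₁ D₁ M₂ D₂ := by
  obtain ⟨-, Φ₁, -, hι₁⟩ := hY₁
  obtain ⟨-, Φ₂, -, hι₂⟩ := hY₂
  obtain ⟨θ, α, -, hα⟩ := he
  let c : Character (MunnQuotient (GN h₂)) ≃ₜ Character (MunnQuotient (GN h₁)) :=
    { toFun := characterMap θ
      invFun := characterMap θ.symm
      left_inv := fun ρ => Subtype.ext (funext fun e =>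
        congrArg (ρ : Idem _ → Bool) (Subtype.ext (θ.apply_symm_apply e)))
      right_inv := fun ρ => Subtype.ext (funext fun e =>
        congrArg (ρ : Idem _ → Bool) (Subtype.ext (θ.symm_apply_apply e)))
      continuous_toFun := (characterMap θ).continuous
      continuous_invFun := (characterMap θ.symm).continuous }
  refine cartanPairIso_of_compat α ((Φ₁.symm.trans (c.compStarAlgEquiv' ℂ ℂ)).trans Φ₂)
    fun v hv => ?_
  set f := Φ₁.symm ⟨v, hv⟩ with hf
  have hΦf : Φ₁ f = ⟨v, hv⟩ := Φ₁.apply_symm_apply _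
  have hpi : f * star f * f = f := by
    have h1 : Φ₁ (f * star f * f) = Φ₁ f := by
      rw [map_mul, map_mul, map_star, hΦf]
      exact Subtype.ext v.2.2.1
    simpa using congrArg Φ₁.symm h1
  have h3 : Y₁.ι ⟨f, hpi⟩ = v := Subtype.ext ((hι₁ _).trans (congrArg Subtype.val hΦf))
  have h4 : α v = α (Y₁.ι ⟨f, hpi⟩) := by rw [h3]
  rw [h4, ← hα, hι₂]
  rfl

theorem isGroupoidNormalizer_map (h₁ : IsCartanPair M₁ D₁) (h₂ : IsCartanPair M₂ D₂)
    (θ : M₁.toStarSubalgebra ≃⋆ₐ[ℂ] M₂.toStarSubalgebra)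
    (hθ : ∀ x : M₁.toStarSubalgebra, (θ x : H₂ →L[ℂ] H₂) ∈ D₂ ↔ (x : H₁ →L[ℂ] H₁) ∈ D₁) (v : GN h₁) :
    IsGroupoidNormalizer M₂ D₂ (θ (gnHom h₁ v)) := by
  refine ⟨(θ _).2, ?_, fun d hd => ?_⟩
  · have h1 : gnHom h₁ v * star (gnHom h₁ v) * gnHom h₁ v = gnHom h₁ v := Subtype.ext v.2.2.1
    have h2 := congrArg θ h1
    rw [map_mul, map_mul, map_star] at h2
    exact congrArg Subtype.val h2
  · obtain ⟨d', hθd⟩ : ∃ d', θ d' = ⟨d, h₂.le hd⟩ := ⟨_, θ.apply_symm_apply _⟩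
    have hdD : (d' : H₁ →L[ℂ] H₁) ∈ D₁ := by
      rw [← hθ, hθd]; exact hd
    obtain ⟨h3, h4⟩ := v.2.2.2 d' hdD
    have h5 := (hθ (gnHom h₁ v * d' * star (gnHom h₁ v))).2 h3
    have h6 := (hθ (star (gnHom h₁ v) * d' * gnHom h₁ v)).2 h4
    rw [map_mul, map_mul, map_star, hθd] at h5 h6
    exact ⟨h5, h6⟩

/-- An isomorphism of Cartan pairs restricts to the groupoid normalizers. -/
theorem exists_gnEquiv (h₁ : IsCartanPair M₁ D₁) (h₂ : IsCartanPair M₂ D₂)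
    (θ : M₁.toStarSubalgebra ≃⋆ₐ[ℂ] M₂.toStarSubalgebra)
    (hθ : ∀ x : M₁.toStarSubalgebra, (θ x : H₂ →L[ℂ] H₂) ∈ D₂ ↔ (x : H₁ →L[ℂ] H₁) ∈ D₁) :
    ∃ α : GN h₁ ≃* GN h₂, ∀ v, gnHom h₂ (α v) = θ (gnHom h₁ v) := by
  have gn' : ∀ v : GN h₂, IsGroupoidNormalizer M₁ D₁ (θ.symm (gnHom h₂ v)) :=
    isGroupoidNormalizer_map h₂ h₁ θ.symm fun x => by rw [← hθ, StarAlgEquiv.apply_symm_apply]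
  exact ⟨{ toFun := fun v => ⟨θ (gnHom h₁ v), isGroupoidNormalizer_map h₁ h₂ θ hθ v⟩
           invFun := fun v => ⟨θ.symm (gnHom h₂ v), gn' v⟩
           left_inv := fun v => by
             have : (θ.symm (θ (gnHom h₁ v)) : H₁ →L[ℂ] H₁) = gnHom h₁ v := by
               rw [StarAlgEquiv.symm_apply_apply]
             exact Subtype.ext this
           right_inv := fun v => by
             have : (θ (θ.symm (gnHom h₂ v)) : H₂ →L[ℂ] H₂) = gnHom h₂ v := by
               rw [StarAlgEquiv.apply_symm_apply]
             exact Subtype.ext this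
           map_mul' := fun v w => by
             have : (θ (gnHom h₁ (v * w)) : H₂ →L[ℂ] H₂) = θ (gnHom h₁ v) * θ (gnHom h₁ w) := by
               rw [map_mul, map_mul]; rfl
             exact Subtype.ext this }, fun v => rfl⟩

theorem munnCon_eq_comap {G₁ G₂ : Type*} [Semigroup G₁] [IsInverseSemigroup G₁] [Semigroup G₂]
    [IsInverseSemigroup G₂] (α : G₁ ≃* G₂) : munnCon G₁ = (munnCon G₂).comap α (map_mul α) := by
  have hdag : ∀ v : G₁, α (dag v) = dag (α v) := fun v => map_dag (α : G₁ →ₙ* G₂) v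
  ext v w
  constructor
  · intro hvw e he
    have := congrArg α (hvw (α.symm e) (by rw [IsIdempotentElem, ← map_mul, he.eq]))
    simpa only [map_mul, hdag, α.apply_symm_apply] using this
  · intro hvw e he
    apply α.injective
    have := hvw (α e) (by rw [IsIdempotentElem, ← map_mul, he.eq])
    simpa only [map_mul, hdag] using this

/-- Isomorphic Cartan pairs have equivalent extensions. -/
theorem extEquiv_of_cartanPairIso {Y₁ : Extension (MunnQuotient (GN h₁)) (GN h₁)}
    {Y₂ : Extension (MunnQuotient (GN h₂)) (GN h₂)} (hY₁ : IsExtensionOf h₁ Y₁)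
    (hY₂ : IsExtensionOf h₂ Y₂) (hi : CartanPairIso M₁ D₁ M₂ D₂) : ExtEquiv Y₁ Y₂ := by
  obtain ⟨hq₁, Φ₁, hΦ₁, hι₁⟩ := hY₁
  obtain ⟨hq₂, Φ₂, hΦ₂, hι₂⟩ := hY₂
  obtain ⟨θ, hθ⟩ := hi
  obtain ⟨α, hα⟩ := exists_gnEquiv h₁ h₂ θ hθ
  have hαv : ∀ v : GN h₁, (α v : H₂ →L[ℂ] H₂) = θ (gnHom h₁ v) := fun v => congrArg Subtype.val (hα v)
  let θS : MunnQuotient (GN h₁) ≃* MunnQuotient (GN h₂) := Con.congr α (munnCon_eq_comap α)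
  have hθS : ∀ v : GN h₁, θS (v : MunnQuotient (GN h₁)) = (α v : MunnQuotient (GN h₂)) :=
    fun v => rfl
  refine ⟨θS, α, fun v => by rw [hq₁, hq₂, hθS], fun p => ?_⟩
  obtain ⟨hc, -⟩ := exists_charAlg_equiv h₁
  obtain ⟨hc', -⟩ := exists_charAlg_equiv h₂
  let ψ₁ : CharAlg (MunnQuotient (GN h₁)) →⋆ₐ[ℂ] (H₂ →L[ℂ] H₂) :=
    (repOf Φ₂).comp (ContinuousMap.compStarAlgHom' ℂ ℂ (characterMap θS))
  let ψ₂ : CharAlg (MunnQuotient (GN h₁)) →⋆ₐ[ℂ] (H₂ →L[ℂ] H₂) :=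
    (M₂.toStarSubalgebra.subtype.comp (θ : M₁.toStarSubalgebra →⋆ₐ[ℂ] M₂.toStarSubalgebra)).comp
      ((StarSubalgebra.inclusion (S₁ := D₁.toStarSubalgebra) (S₂ := M₁.toStarSubalgebra)
        (fun x hx => h₁.le hx)).comp
        (Φ₁ : CharAlg (MunnQuotient (GN h₁)) →⋆ₐ[ℂ] D₁.toStarSubalgebra))
  have hψ : ∀ f, ψ₁ f = ψ₂ f := fun f =>
    mem_of_chi (LinearMap.eqLocus (ψ₁.toAlgHom.toLinearMap) (ψ₂.toAlgHom.toLinearMap))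
      (isClosed_eq (map_continuous ψ₁) (map_continuous ψ₂)) (fun x => by
        obtain ⟨e, he⟩ := exists_idem_lift x.2
        obtain rfl : x = ⟨_, idem_mk e⟩ := Subtype.ext he.symm
        have hαe : IsIdempotentElem (α (e : GN h₁)) := by
          rw [IsIdempotentElem, ← map_mul, e.2.eq]
        change (Φ₂ (chi ⟨((α e : GN h₂) : MunnQuotient (GN h₂)), idem_mk ⟨α e, hαe⟩⟩) : H₂ →L[ℂ] H₂)
          = ψ₂ (chi ⟨((e : GN h₁) : MunnQuotient (GN h₁)), idem_mk e⟩)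
        rw [hΦ₂ ⟨α e, hαe⟩]
        refine (hαv e).trans ?_
        change (θ (gnHom h₁ e) : H₂ →L[ℂ] H₂) = (θ _ : H₂ →L[ℂ] H₂)
        congr 2
        exact Subtype.ext (hΦ₁ e).symm) f
  apply Subtype.ext
  rw [hι₂, hαv]
  refine (hψ p).trans ?_
  change (θ _ : H₂ →L[ℂ] H₂) = (θ _ : H₂ →L[ℂ] H₂)
  congr 2
  exact Subtype.ext (hι₁ p).symm

end pairs

section action
variable {S : Type*} [MonoidWithZero S] [IsBooleanInverseMonoid S]

theorem NatLE.trans {r s t : S} (h : NatLE r s) (h' : NatLE s t) : NatLE r t := by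
  obtain ⟨e, he, rfl⟩ := h
  obtain ⟨f, hf, rfl⟩ := h'
  exact ⟨f * e, idem_mul_aux hf he, mul_assoc _ _ _⟩

theorem natLE_one {e : S} (he : IsIdempotentElem e) : NatLE e 1 := ⟨e, he, (one_mul e).symm⟩

theorem isIdempotentElem_of_natLE_one {e : S} (h : NatLE e 1) : IsIdempotentElem e := by
  obtain ⟨x, hx, rfl⟩ := h
  rwa [one_mul]

theorem natLE_antisymm {s t : S} (h : NatLE s t) (h' : NatLE t s) : s = t := by
  have h1 := h.eq_mul
  obtain ⟨e, he, h2⟩ := h'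
  have h3 : t * e = t := by
    conv_lhs => rw [h2]
    rw [mul_assoc, he.eq, ← h2]
  calc s = t * (dag s * s) := h1
    _ = t * e * (dag s * s) := by rw [h3]
    _ = t * (dag s * s) * e := by rw [mul_assoc, ← idem_comm (idem_dag_mul s) he, ← mul_assoc]
    _ = t := by rw [← h1, ← h2]

/-- The domain idempotent `s† s`. -/
noncomputable def dom (s : S) : Idem S := ⟨dag s * s, idem_dag_mul s⟩

/-- The product of idempotents. -/
def idemMul (e f : Idem S) : Idem S := ⟨e * f, idem_mul_aux e.2 f.2⟩

/-- The idempotent `s† e s`. -/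
noncomputable def conjIdem (s : S) (e : Idem S) : Idem S :=
  ⟨dag s * e * s, by
    have := idem_conj (dag s) e.2
    rwa [dag_dag] at this⟩

theorem char_idemMul (ρ : Character S) (e f : Idem S) : ρ (idemMul e f) = (ρ e && ρ f) :=
  ρ.2.2.2.1 e f _ rfl

theorem exists_compl (e : Idem S) : ∃ e' : Idem S, (e * e' : S) = 0 ∧
    (∀ g : Idem S, (e * g : S) = 0 → (e' * g : S) = g) ∧ ∀ ρ : Character S, ρ e' = !ρ e := by
  obtain ⟨B, hB⟩ := IsBooleanInverseMonoid.booleanAlgebra (S := S)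
  have hbot : ((⊥ : Idem S) : S) = 0 := by
    have h1 : NatLE ((⊥ : Idem S) : S) ((⟨0, zero_mul 0⟩ : Idem S) : S) := (hB _ _).1 bot_le
    obtain ⟨x, -, hx⟩ := h1
    rw [hx, zero_mul]
  have htop : ((⊤ : Idem S) : S) = 1 := by
    have h1 : NatLE ((⟨1, mul_one 1⟩ : Idem S) : S) ((⊤ : Idem S) : S) := (hB _ _).1 le_top
    have := mul_eq_of_natLE (mul_one 1) h1
    rwa [mul_one] at this
  have hle : ∀ e f : Idem S, NatLE (idemMul e f : S) e ∧ NatLE (idemMul e f : S) f := fun e f =>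
    ⟨⟨f, f.2, rfl⟩, ⟨e, e.2, idem_comm e.2 f.2⟩⟩
  have h0 : (e * (eᶜ : Idem S) : S) = 0 := by
    have h1 : idemMul e eᶜ ≤ e ⊓ eᶜ := le_inf ((hB _ _).2 (hle _ _).1) ((hB _ _).2 (hle _ _).2)
    rw [inf_compl_eq_bot, le_bot_iff] at h1
    rw [← hbot, ← h1]; rfl
  refine ⟨eᶜ, h0, fun g hg => ?_, fun ρ => ?_⟩
  · refine mul_eq_of_natLE g.2 ((hB _ _).1 (le_compl_iff_disjoint_left.2 (disjoint_iff_inf_le.2 ?_)))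
    set k := e ⊓ g
    have h1 : (e * k : S) = k := mul_eq_of_natLE k.2 ((hB _ _).1 inf_le_left)
    have h2 : (g * k : S) = k := mul_eq_of_natLE k.2 ((hB _ _).1 inf_le_right)
    have h3 : (k : S) = 0 := by rw [← h1, ← h2, ← mul_assoc, hg, zero_mul]
    exact le_of_eq (Subtype.ext (h3.trans hbot.symm))
  · obtain ⟨m, hm⟩ := IsBooleanInverseMonoid.exists_join (e : S) (eᶜ : Idem S) (by
      constructor
      · rw [dag_idem e.2, h0]
      · rw [dag_idem e.2, idem_comm (eᶜ : Idem S).2 e.2, h0])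
    have hm1 : NatLE m 1 := hm.2 1 (by
      rintro a (rfl | rfl)
      · exact natLE_one e.2
      · exact natLE_one (eᶜ : Idem S).2)
    have hmi := isIdempotentElem_of_natLE_one hm1
    have h1 : (⊤ : Idem S) ≤ ⟨m, hmi⟩ := by
      rw [← sup_compl_eq_top (x := e)]
      exact sup_le ((hB _ _).2 (hm.1 _ (Or.inl rfl))) ((hB _ _).2 (hm.1 _ (Or.inr rfl)))
    have h2 : m = 1 := by
      rw [top_le_iff] at h1
      rw [← htop, ← h1]
    have h3 := ρ.2.2.2.2 e eᶜ ⟨m, hmi⟩ hm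
    rw [ρ.2.2.1 ⟨m, hmi⟩ h2] at h3
    have h4 := ρ.2.2.2.1 e eᶜ ⟨0, zero_mul 0⟩ h0.symm
    rw [ρ.2.1 ⟨0, zero_mul 0⟩ rfl] at h4
    clear h0 hm hm1 h1 hB hbot htop hle
    change ρ.1 eᶜ = !ρ.1 e
    revert h3 h4
    cases ρ.1 e <;> cases ρ.1 eᶜ <;> simp

theorem conj_mul_conj (s : S) (e f : Idem S) :
    dag s * (e * f) * s = (dag s * e * s) * (dag s * f * s) := by
  have h1 := idem_comm (idem_mul_dag s) f.2
  have h2 := mul_dag_mul s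
  calc dag s * (e * f) * s = dag s * e * f * (s * dag s * s) := by rw [h2]; simp only [mul_assoc]
    _ = dag s * e * (f * (s * dag s)) * s := by simp only [mul_assoc]
    _ = _ := by rw [← h1]; simp only [mul_assoc]

theorem conjIdem_dom (s : S) (e : Idem S) : (conjIdem s e : S) = dom s * conjIdem s e := by
  change dag s * e * s = dag s * s * (dag s * e * s)
  conv_lhs => rw [← dag_mul_dag s]
  simp only [mul_assoc]

theorem isCharacter_conj (s : S) (ρ : Character S) (h : ρ (dom s) = true) :
    IsCharacter fun e => ρ (conjIdem s e) := by
  refine ⟨fun e he => ρ.2.1 _ ?_, fun e he => ?_, fun e f g hg => ρ.2.2.2.1 _ _ _ ?_,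
    fun e f g hg => ?_⟩
  · change dag s * e * s = 0
    rw [he, mul_zero, zero_mul]
  · have h1 : conjIdem s e = dom s := Subtype.ext (by
      change dag s * e * s = dag s * s
      rw [he, mul_one])
    change ρ.1 (conjIdem s e) = true
    rw [h1]
    exact h
  · change dag s * g * s = _
    rw [hg]
    exact conj_mul_conj s e f
  · have le : ∀ e : Idem S, NatLE (e : S) g →
        ρ (conjIdem s e) = (ρ (conjIdem s g) && ρ (conjIdem s e)) := fun e he =>
      ρ.2.2.2.1 _ _ _ (by
        change dag s * e * s = (dag s * g * s) * (dag s * e * s)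
        rw [← conj_mul_conj, mul_eq_of_natLE e.2 he])
    have h1 := le e (hg.1 _ (Or.inl rfl))
    have h2 := le f (hg.1 _ (Or.inr rfl))
    cases hg1 : ρ.1 (conjIdem s g)
    · have : ρ.1 (conjIdem s e) = false := by rw [hg1] at h1; exact h1
      have : ρ.1 (conjIdem s f) = false := by rw [hg1] at h2; exact h2
      simp_all
    change ρ.1 (conjIdem s g) = (ρ.1 (conjIdem s e) || ρ.1 (conjIdem s f))
    rw [hg1]
    by_contra hcon
    rw [eq_comm, Bool.or_eq_true] at hcon
    push Not at hcon
    obtain ⟨he, hf⟩ := hcon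
    replace he : ρ (conjIdem s e) = false := Bool.eq_false_iff.2 he
    replace hf : ρ (conjIdem s f) = false := Bool.eq_false_iff.2 hf
    obtain ⟨a, ha0, ha1, ha2⟩ := exists_compl (conjIdem s e)
    obtain ⟨b, hb0, hb1, hb2⟩ := exists_compl (conjIdem s f)
    set c := idemMul (conjIdem s g) (idemMul a b) with hc
    have hρc : ρ c = true := by
      rw [hc, char_idemMul, char_idemMul, ha2, hb2, he, hf, hg1]; rfl
    have hcc : (c : S) = conjIdem s g * (a * b) := rfl
    have c1 : (conjIdem s e * c : S) = 0 := by
      rw [hcc, ← mul_assoc, idem_comm (conjIdem s e).2 (conjIdem s g).2, mul_assoc,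
        ← mul_assoc (conjIdem s e : S), ha0, zero_mul, mul_zero]
    have c2 : (conjIdem s f * c : S) = 0 := by
      rw [hcc, ← mul_assoc, idem_comm (conjIdem s f).2 (conjIdem s g).2, mul_assoc,
        idem_comm a.2 b.2, ← mul_assoc (conjIdem s f : S), hb0, zero_mul, mul_zero]
    have c3 : (dag s * s * c : S) = c := by
      rw [hcc, ← mul_assoc, ← show (conjIdem s g : S) = dag s * s * conjIdem s g from conjIdem_dom s g]
    have c4 : (conjIdem s g * c : S) = c := by
      rw [hcc, ← mul_assoc, (conjIdem s g).2.eq]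
    have hbi := idem_conj s c.2
    have key : ∀ x : Idem S, (conjIdem s x * c : S) = 0 → (s * c * dag s) * (x : S) = 0 := by
      intro x hx
      rw [idem_comm hbi x.2]
      have h3 := idem_comm (idem_mul_dag s) x.2
      calc (x : S) * (s * c * dag s) = x * (s * (dag s * s * c) * dag s) := by rw [c3]
        _ = (x * (s * dag s)) * s * c * dag s := by simp only [mul_assoc]
        _ = s * (dag s * x * s * c) * dag s := by rw [← h3]; simp only [mul_assoc]
        _ = 0 := by
          rw [show (dag s * x * s * c : S) = 0 from hx, mul_zero, zero_mul]
    obtain ⟨d, hd0, hd1, -⟩ := exists_compl ⟨_, hbi⟩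
    have hgd : NatLE (g : S) d := hg.2 d (by
      rintro x (rfl | rfl)
      · exact ⟨e, e.2, (hd1 e (key e c1)).symm⟩
      · exact ⟨f, f.2, (hd1 f (key f c2)).symm⟩)
    have h3 : (s * c * dag s) * (g : S) = 0 := by
      rw [← mul_eq_of_natLE g.2 hgd, ← mul_assoc, show (s * c * dag s) * (d : S) = 0 from hd0,
        zero_mul]
    have h4 : (c : S) = 0 := by
      rw [← c4, idem_comm (conjIdem s g).2 c.2]
      have h5 : (c * (dag s * s) : S) = c := by rw [idem_comm c.2 (idem_dag_mul s), c3]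
      calc (c : S) * (dag s * g * s) = dag s * s * c * (dag s * g * s) := by rw [c3]
        _ = dag s * ((s * c * dag s) * g) * s := by simp only [mul_assoc]
        _ = 0 := by rw [h3, mul_zero, zero_mul]
    have := ρ.2.1 c h4
    rw [show ρ.1 c = true from hρc] at this
    exact Bool.noConfusion this

/-- The partial homeomorphism `β_s` of the character space. -/
noncomputable def beta (s : S) (ρ : Character S) (h : ρ (dom s) = true) : Character S :=
  ⟨fun e => ρ (conjIdem s e), isCharacter_conj s ρ h⟩

theorem isClopen_char (e : Idem S) : IsClopen {ρ : Character S | ρ e = true} :=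
  (isClopen_discrete {true}).preimage
    (show Continuous fun ρ : Character S => ρ.1 e from
      (continuous_apply e).comp continuous_subtype_val)

section
variable {R : Type*} [TopologicalSpace R] [Zero R]

/-- The action `f ↦ s† f s` of `S` on continuous functions. -/
noncomputable def act (s : S) (f : C(Character S, R)) : C(Character S, R) where
  toFun ρ := if h : ρ (dom s) = true then f (beta s ρ h) else 0
  continuous_toFun := by
    have hU := isClopen_char (dom s)
    rw [continuous_iff_continuousAt]
    intro ρ
    by_cases h : ρ (dom s) = true
    · refine (hU.isOpen.isOpenEmbedding_subtypeVal.continuousAt_iff (x := ⟨ρ, h⟩)).1 ?_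
      have : ((fun ρ : Character S => if h : ρ (dom s) = true then f (beta s ρ h) else 0) ∘
          (Subtype.val : {ρ : Character S | ρ (dom s) = true} → Character S)) =
          fun ρ => f (beta s ρ.1 ρ.2) := by
        funext ρ
        exact dif_pos ρ.2
      rw [this]
      refine (f.continuous.comp ?_).continuousAt
      refine Continuous.subtype_mk (continuous_pi fun e => ?_) _
      exact ((continuous_apply (conjIdem s e)).comp continuous_subtype_val).comp
        continuous_subtype_val
    · refine (hU.compl.isOpen.isOpenEmbedding_subtypeVal.continuousAt_iff (x := ⟨ρ, h⟩)).1 ?_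
      have : ((fun ρ : Character S => if h : ρ (dom s) = true then f (beta s ρ h) else 0) ∘
          (Subtype.val : ({ρ : Character S | ρ (dom s) = true}ᶜ : Set (Character S)) → Character S)) =
          fun _ => 0 := by
        funext ρ
        exact dif_neg ρ.2
      rw [this]
      exact continuousAt_const

theorem act_pos {s : S} {ρ : Character S} (h : ρ (dom s) = true) (f : C(Character S, R)) :
    act s f ρ = f (beta s ρ h) := dif_pos h

theorem act_neg {s : S} {ρ : Character S} (h : ¬ ρ (dom s) = true) (f : C(Character S, R)) :
    act s f ρ = 0 := dif_neg h

theorem act_one (f : C(Character S, R)) : act (1 : S) f = f := by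
  have h1 : dag (1 : S) = 1 := dag_idem (mul_one 1)
  ext ρ
  have h : ρ (dom (1 : S)) = true := ρ.2.2.1 _ (by change dag (1 : S) * 1 = 1; rw [h1, one_mul])
  rw [act_pos h]
  congr 1
  refine Subtype.ext (funext fun e => congrArg (ρ : Idem S → Bool) (Subtype.ext ?_))
  change dag (1 : S) * e * 1 = e
  rw [h1, one_mul, mul_one]

theorem act_act (s t : S) (f : C(Character S, R)) : act (s * t) f = act t (act s f) := by
  ext ρ
  by_cases h : ρ (dom t) = true
  · rw [act_pos h]
    have h1 : (dom (s * t)) = conjIdem t (dom s) := Subtype.ext (by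
      change dag (s * t) * (s * t) = dag t * (dag s * s) * t
      rw [dag_mul]; simp only [mul_assoc])
    by_cases h2 : ρ (dom (s * t)) = true
    · have h3 : beta t ρ h (dom s) = true := by rw [h1] at h2; exact h2
      rw [act_pos h2, act_pos h3]
      congr 1
      refine Subtype.ext (funext fun e => congrArg (ρ : Idem S → Bool) (Subtype.ext ?_))
      change dag (s * t) * e * (s * t) = dag t * (dag s * e * s) * t
      rw [dag_mul]; simp only [mul_assoc]
    · have h3 : ¬ beta t ρ h (dom s) = true := by rw [h1] at h2; exact h2
      rw [act_neg h2, act_neg h3]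
  · rw [act_neg h, act_neg]
    intro h2
    apply h
    have := ρ.2.2.2.1 (dom (s * t)) (dom t) (dom (s * t)) (by
      change dag (s * t) * (s * t) = dag (s * t) * (s * t) * (dag t * t)
      calc dag (s * t) * (s * t) = dag (s * t) * (s * (t * dag t * t)) := by rw [mul_dag_mul]
        _ = _ := by simp only [mul_assoc])
    rw [show ρ.1 (dom (s * t)) = true from h2] at this
    exact this.symm

theorem act_idem_apply (e : Idem S) (f : C(Character S, R)) (ρ : Character S) :
    act (e : S) f ρ = if ρ e = true then f ρ else 0 := by
  have h1 : dag (e : S) = e := dag_idem e.2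
  have h0 : dom (e : S) = e := Subtype.ext (by change dag (e : S) * e = e; rw [h1, e.2.eq])
  by_cases h : ρ e = true
  · have h' : ρ (dom (e : S)) = true := by rwa [h0]
    rw [if_pos h, act_pos h']
    congr 1
    refine Subtype.ext (funext fun x => ?_)
    have := ρ.2.2.2.1 e x (conjIdem (e : S) x) (by
      change dag (e : S) * x * e = e * x
      rw [h1, mul_assoc, idem_comm x.2 e.2, ← mul_assoc, e.2.eq])
    change ρ.1 (conjIdem (e : S) x) = ρ.1 x
    rw [this, show ρ.1 e = true from h, Bool.true_and]
  · rw [if_neg h, act_neg (by rwa [h0])]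

end

theorem act_idem (e : Idem S) (f : CharAlg S) : act (e : S) f = f * chi e := by
  ext ρ
  rw [act_idem_apply, ContinuousMap.mul_apply, chi_apply]
  split_ifs <;> simp

theorem act_chi (s : S) (e : Idem S) : act s (chi e) = chi (conjIdem s e) := by
  ext ρ
  by_cases h : ρ (dom s) = true
  · rw [act_pos h]; rfl
  · rw [act_neg h, chi_apply]
    have := ρ.2.2.2.1 _ _ _ (conjIdem_dom s e)
    rw [Bool.not_eq_true] at h
    rw [show ρ.1 (dom s) = false from h, Bool.false_and] at this
    rw [show ρ.1 (conjIdem s e) = false from this]; rfl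

theorem act_add (s : S) (f g : CharAlg S) : act s (f + g) = act s f + act s g := by
  ext ρ
  by_cases h : ρ (dom s) = true
  · simp only [ContinuousMap.add_apply, act_pos h]
  · simp only [ContinuousMap.add_apply, act_neg h, add_zero]

theorem act_mul (s : S) (f g : CharAlg S) : act s (f * g) = act s f * act s g := by
  ext ρ
  by_cases h : ρ (dom s) = true
  · simp only [ContinuousMap.mul_apply, act_pos h]
  · simp only [ContinuousMap.mul_apply, act_neg h, mul_zero]

theorem act_smul (s : S) (c : ℂ) (f : CharAlg S) : act s (c • f) = c • act s f := by
  ext ρ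
  by_cases h : ρ (dom s) = true
  · simp only [ContinuousMap.smul_apply, act_pos h]
  · simp only [ContinuousMap.smul_apply, act_neg h, smul_zero]

theorem act_star (s : S) (f : CharAlg S) : act s (star f) = star (act s f) := by
  ext ρ
  by_cases h : ρ (dom s) = true
  · simp only [ContinuousMap.star_apply, act_pos h]
  · simp only [ContinuousMap.star_apply, act_neg h, star_zero]

theorem act_complexify (s : S) (f : C(Character S, ℝ)) :
    act s (complexify f) = complexify (act s f) := by
  ext ρ
  by_cases h : ρ (dom s) = true
  · simp only [complexify_apply, act_pos h]
  · simp only [complexify_apply, act_neg h, Complex.ofReal_zero]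

theorem act_one_fun (s : S) : act s (1 : CharAlg S) = chi (dom s) := by
  have h1 : chi (⟨1, mul_one 1⟩ : Idem S) = 1 := chi_one _ rfl
  rw [← h1, act_chi]
  congr 1
  apply Subtype.ext
  change dag s * 1 * s = dag s * s
  rw [mul_one]

theorem act_mono (s : S) {f g : C(Character S, ℝ)} (h : f ≤ g) : act s f ≤ act s g := fun ρ => by
  change act s f ρ ≤ act s g ρ
  by_cases hs : ρ (dom s) = true
  · rw [act_pos hs, act_pos hs]; exact h _
  · rw [act_neg hs, act_neg hs]

theorem act_dag_act_apply (s : S) (f : C(Character S, ℝ)) (ρ : Character S) :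
    act s (act (dag s) f) ρ = if ρ (dom s) = true then f ρ else 0 := by
  rw [← act_act]
  exact act_idem_apply (dom s) f ρ

/-- The action preserves suprema. -/
theorem act_isLUB (s : S) {F : Set C(Character S, ℝ)} {f : C(Character S, ℝ)} (hne : F.Nonempty)
    (hf : IsLUB F f) : IsLUB (act s '' F) (act s f) := by
  refine ⟨?_, fun h hh => ?_⟩
  · rintro _ ⟨y, hy, rfl⟩
    exact act_mono s (hf.1 hy)
  have h0 : ∀ ρ : Character S, ¬ ρ (dom s) = true → 0 ≤ h ρ := fun ρ hρ => by
    obtain ⟨y, hy⟩ := hne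
    have : act s y ρ ≤ h ρ := hh ⟨y, hy, rfl⟩ ρ
    rwa [act_neg hρ] at this
  have h2 : ∀ (y : C(Character S, ℝ)) (ρ : Character S),
      act (dag s) (act s y) ρ = if ρ (dom (dag s)) = true then y ρ else 0 := fun y ρ => by
    have := act_dag_act_apply (dag s) y ρ
    rwa [dag_dag] at this
  let k : C(Character S, ℝ) := act (dag s) h + (f - act (dag s) (act s f))
  have hfk : f ≤ k := hf.2 fun y hy ρ => by
    change y ρ ≤ act (dag s) h ρ + (f ρ - act (dag s) (act s f) ρ)
    have h3 : act (dag s) (act s y) ρ ≤ act (dag s) h ρ := act_mono (dag s) (hh ⟨y, hy, rfl⟩) ρ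
    rw [h2] at h3 ⊢
    have h4 : y ρ ≤ f ρ := hf.1 hy ρ
    split_ifs at h3 ⊢ with h5
    · linarith
    · rw [act_neg h5, zero_add, sub_zero]; exact h4
  have hfk' : act (dag s) (act s f) ≤ act (dag s) h := fun ρ => by
    have : f ρ ≤ act (dag s) h ρ + (f ρ - act (dag s) (act s f) ρ) := hfk ρ
    change act (dag s) (act s f) ρ ≤ act (dag s) h ρ
    linarith
  intro ρ
  have h6 : act s (act (dag s) (act s f)) ρ ≤ act s (act (dag s) h) ρ := act_mono s hfk' ρ
  rw [act_dag_act_apply, act_dag_act_apply] at h6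
  by_cases h5 : ρ (dom s) = true
  · rwa [if_pos h5, if_pos h5] at h6
  · change act s f ρ ≤ h ρ
    rw [act_neg h5]; exact h0 ρ h5

section extension
variable {G : Type*} [Semigroup G] [IsInverseSemigroup G] (X : Extension S G)

theorem chi_injective (X : Extension S G) {e f : Idem S} (h : chi e = chi f) : e = f := by
  have h1 : chiP e = chiP f := Subtype.ext h
  apply Subtype.ext
  rw [← X.q_ι_chiP e, h1, X.q_ι_chiP]

theorem exists_chi_eq (X : Extension S G) {p : CharAlg S} (hp : p * p = p) (hs : star p = p) :
    ∃ e, chi e = p := by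
  let p' : partialIsometries S := ⟨p, by
    change p * star p * p = p
    rw [hs, hp, hp]⟩
  have hp' : IsIdempotentElem p' := Subtype.ext hp
  have h1 : IsIdempotentElem (X.q (X.ι p')) := by
    rw [IsIdempotentElem, ← map_mul, ← map_mul, hp'.eq]
  refine ⟨⟨_, h1⟩, ?_⟩
  have h2 := X.q_ι_injOn (chiP ⟨_, h1⟩) p' (Subtype.ext (chi_mul_self _)) hp' (X.q_ι_chiP _)
  exact congrArg Subtype.val h2

theorem eq_act_of_conj (X : Extension S G) {g : G} {p p' : partialIsometries S}
    (h : dag g * X.ι p * g = X.ι p') : (p' : CharAlg S) = act (X.q g) (p : CharAlg S) := by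
  ext ρ
  by_cases hρ : ρ (dom (X.q g)) = true
  · rw [act_pos hρ]
    refine X.conj_ι g p p' h ρ _ fun e f hf => ?_
    exact congrArg (ρ : Idem S → Bool) (Subtype.ext hf.symm)
  · rw [act_neg hρ]
    have h1 : X.ι p' * X.ι (chiP (dom (X.q g))) = X.ι p' := by
      have h2 : X.ι (chiP (dom (X.q g))) = dag g * g := by
        refine q_injOn X ?_ (idem_dag_mul g) ?_
        · rw [IsIdempotentElem, ← map_mul]
          exact congrArg _ (Subtype.ext (chi_mul_self _))
        · rw [X.q_ι_chiP, map_mul, map_dag]; rfl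
      rw [h2, ← h, mul_assoc, ← mul_assoc g, mul_dag_mul]
    have h2 : (p' : CharAlg S) * chi (dom (X.q g)) = p' := by
      rw [← map_mul] at h1
      exact congrArg Subtype.val (X.ι_injective h1)
    rw [← h2, ContinuousMap.mul_apply, chi_apply, if_neg hρ, mul_zero]

end extension

theorem fixIdem_mul_idem (s r : S) (e : Idem S) :
    (fixIdem (s * e) r : S) = fixIdem s r * e := by
  have h1 : (fixIdem s r * e : S) = fixIdem (s * e) r * (fixIdem s r * e) := by
    refine natLE_fixIdem (idemMul (fixIdem s r) e) ⟨_, (idemMul (fixIdem s r) e).2, ?_⟩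
    change (fixIdem s r * e : S) = dag (s * e) * r * (fixIdem s r * e)
    have h2 := mul_eq_of_natLE (fixIdem s r).2 (fixIdem_isMeet s r).1
    rw [dag_mul, dag_idem e.2]
    calc (fixIdem s r * e : S) = e * (fixIdem s r * e) := by
          rw [idem_comm (fixIdem s r).2 e.2, ← mul_assoc, e.2.eq]
      _ = e * (dag s * r * fixIdem s r * e) := by rw [h2]
      _ = _ := by simp only [mul_assoc]
  have h3 := (fixIdem_isMeet (s * e) r).1
  have h4 := mul_eq_of_natLE (fixIdem (s * e) r).2 h3
  rw [dag_mul, dag_idem e.2] at h3 h4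
  have h5 : NatLE (e * dag s * r) (dag s * r) :=
    natLE_iff_left.2 ⟨e, e.2, mul_assoc _ _ _⟩
  have h6 := natLE_fixIdem (fixIdem (s * e) r) (h3.trans h5)
  have h7 : (e * fixIdem (s * e) r : S) = fixIdem (s * e) r := by
    conv_lhs => rw [← h4]
    rw [← mul_assoc, ← mul_assoc, ← mul_assoc, e.2.eq, h4]
  have h8 : (fixIdem s r * e * fixIdem (s * e) r : S) = fixIdem (s * e) r := by
    rw [mul_assoc, h7, ← h6]
  exact h8.symm.trans ((idem_comm (idemMul (fixIdem s r) e).2 (fixIdem (s * e) r).2).trans h1.symm)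

theorem kern_mul_idem (r s : S) (e : Idem S) : kern r (s * e) = kern r s * chi e :=
  (chi_mul _ _ _ (fixIdem_mul_idem s r e)).symm

theorem mul_dom (s : S) : s * (dom s : S) = s := by
  change s * (dag s * s) = s
  rw [← mul_assoc, mul_dag_mul]

theorem kern_dom (r s : S) : kern r s * chi (dom s) = kern r s := by
  rw [← kern_mul_idem, mul_dom]

theorem kern_self (s : S) : kern s s = chi (dom s) := by
  unfold kern
  congr 1
  apply Subtype.ext
  exact natLE_antisymm (fixIdem_isMeet s s).1 ((fixIdem_isMeet s s).2.2 _
    ⟨dag s * s, idem_dag_mul s, (idem_dag_mul s).eq.symm⟩ (natLE_one (idem_dag_mul s)))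

theorem kern_one_one : kern (1 : S) 1 = 1 := by
  rw [kern_self]
  refine chi_one _ ?_
  change dag (1 : S) * 1 = 1
  rw [mul_one, dag_idem (show IsIdempotentElem (1 : S) from mul_one 1)]

theorem kern_mul_act (s t : S) (f : CharAlg S) : kern s t * act s f = kern s t * act t f := by
  have h := mul_fixIdem t s
  have h1 : ∀ r : S, act (r * (fixIdem t s : S)) f = act r f * kern s t := fun r => by
    rw [act_act, act_idem]; rfl
  have h2 := h1 t
  rw [h, h1 s] at h2
  rw [mul_comm, h2, mul_comm]

end action

section tensor
variable {S : Type*} [MonoidWithZero S] [IsBooleanInverseMonoid S]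
  {H : Type*} [NormedAddCommGroup H] [InnerProductSpace ℂ H] [CompleteSpace H]
  {π : CharAlg S →⋆ₐ[ℂ] (H →L[ℂ] H)}

theorem interiorTensor_induction {Y : Type*} [TopologicalSpace Y] [T2Space Y] [AddCommGroup Y]
    {f g : InteriorTensor π → Y} (hf : Continuous f) (hg : Continuous g)
    (hf0 : ∀ a b, f (a + b) = f a + f b) (hg0 : ∀ a b, g (a + b) = g a + g b)
    (h : ∀ s ξ, f (tmul π s ξ) = g (tmul π s ξ)) (z : InteriorTensor π) : f z = g z := by
  refine UniformSpace.Completion.induction_on z (isClosed_eq hf hg) fun a => ?_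
  induction a using preTensor_induction with
  | h0 =>
    have h1 : f 0 = 0 := by have := hf0 0 0; rwa [add_zero, left_eq_add] at this
    have h2 : g 0 = 0 := by have := hg0 0 0; rwa [add_zero, left_eq_add] at this
    rw [UniformSpace.Completion.coe_zero, h1, h2]
  | hadd a b ha hb => rw [UniformSpace.Completion.coe_add, hf0, hg0, ha, hb]
  | hs s ξ => exact h s ξ

theorem clm_ext_tmul {Y : Type*} [NormedAddCommGroup Y] [NormedSpace ℂ Y]
    {x y : InteriorTensor π →L[ℂ] Y}
    (h : ∀ s ξ, x (tmul π s ξ) = y (tmul π s ξ)) : x = y :=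
  ContinuousLinearMap.ext fun z => interiorTensor_induction x.continuous y.continuous
    (map_add x) (map_add y) h z

theorem eq_of_inner_tmul {z w : InteriorTensor π}
    (h : ∀ s ξ, inner ℂ (tmul π s ξ) z = inner ℂ (tmul π s ξ) w) : z = w :=
  ext_inner_left ℂ fun v => interiorTensor_induction (f := fun v => inner ℂ v z)
    (g := fun v => inner ℂ v w) (by fun_prop) (by fun_prop) (fun _ _ => inner_add_left _ _ _)
    (fun _ _ => inner_add_left _ _ _) h v

theorem tmul_eq {s t : S} {ξ η : H} (h : ∀ r, π (kern r s) ξ = π (kern r t) η) :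
    tmul π s ξ = tmul π t η :=
  eq_of_inner_tmul fun r ζ => by rw [inner_tmul, inner_tmul, h]

theorem tmul_add (s : S) (ξ η : H) : tmul π s (ξ + η) = tmul π s ξ + tmul π s η :=
  eq_of_inner_tmul fun r ζ => by simp only [inner_add_right, inner_tmul, map_add]

theorem tmul_smul (s : S) (c : ℂ) (ξ : H) : tmul π s (c • ξ) = c • tmul π s ξ :=
  eq_of_inner_tmul fun r ζ => by simp only [inner_smul_right, inner_tmul, map_smul]

theorem tmul_zero (s : S) : tmul π s (0 : H) = 0 :=
  eq_of_inner_tmul fun r ζ => by simp only [inner_zero_right, inner_tmul, map_zero]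

theorem tmul_mul_idem (s : S) (e : Idem S) (ξ : H) :
    tmul π (s * e) ξ = tmul π s (π (chi e) ξ) :=
  tmul_eq fun r => by rw [kern_mul_idem, map_mul]; rfl

theorem tmul_dom (s : S) (ξ : H) : tmul π s (π (chi (dom s)) ξ) = tmul π s ξ := by
  rw [← tmul_mul_idem, mul_dom]

theorem clm_ext_inner_tmul {x y : InteriorTensor π →L[ℂ] InteriorTensor π}
    (h : ∀ s ξ t η, inner ℂ (tmul π s ξ) (x (tmul π t η)) =
      inner ℂ (tmul π s ξ) (y (tmul π t η))) : x = y :=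
  clm_ext_tmul fun t η => eq_of_inner_tmul fun s ξ => h s ξ t η

variable (π) in
/-- The isometry `ξ ↦ k_1 ⊗ ξ`. -/
noncomputable def unitIsometry : H →L[ℂ] InteriorTensor π :=
  LinearMap.mkContinuous
    { toFun := tmul π 1
      map_add' := tmul_add 1
      map_smul' := tmul_smul 1 } 1 fun ξ => by
    rw [one_mul]
    change ‖tmul π 1 ξ‖ ≤ _
    refine le_of_eq ((sq_eq_sq₀ (norm_nonneg _) (norm_nonneg _)).1 ?_)
    rw [← inner_self_eq_norm_sq (𝕜 := ℂ), inner_tmul, kern_one_one, map_one]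
    exact inner_self_eq_norm_sq (𝕜 := ℂ) ξ

theorem unitIsometry_apply (ξ : H) : unitIsometry π ξ = tmul π 1 ξ := rfl

theorem inner_unitIsometry (ξ η : H) :
    inner ℂ (unitIsometry π ξ) (unitIsometry π η) = inner ℂ ξ η := by
  rw [unitIsometry_apply, unitIsometry_apply, inner_tmul, kern_one_one, map_one]; rfl

theorem inner_preMap_act (f g : CharAlg S) (x y : PreTensor π) :
    inner ℂ (preMap π id (fun s => act s f) x) (preMap π id (fun s => act s g) y) =
      inner ℂ x (preMap π id (fun s => act s (star f * g)) y) := by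
  induction x using preTensor_induction with
  | h0 => simp
  | hadd x x' hx hx' => simp only [map_add, inner_add_left, hx, hx']
  | hs s ξ =>
    induction y using preTensor_induction with
    | h0 => simp
    | hadd y y' hy hy' => simp only [map_add, inner_add_right, hy, hy']
    | hs t η =>
      simp only [preMap_preTmul, inner_preTmul, id]
      rw [← inner_star_right, ← map_star, ← mul_apply_eq_comp, ← mul_apply_eq_comp,
        ← mul_apply_eq_comp, ← map_mul, ← map_mul, ← map_mul, ← act_star, act_mul,
        mul_comm (act s (star f)), kern_mul_act]
      congr 3
      ring

theorem inner_preMap_act_add (f g : CharAlg S) (x y : PreTensor π) :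
    inner ℂ x (preMap π id (fun s => act s (f + g)) y) =
      inner ℂ x (preMap π id (fun s => act s f) y) +
        inner ℂ x (preMap π id (fun s => act s g) y) := by
  rw [← inner_add_right]
  congr 1
  induction y using preTensor_induction with
  | h0 => simp
  | hadd y y' hy hy' => simp only [map_add, hy, hy']; abel
  | hs t η =>
    simp only [preMap_preTmul, act_add, map_add, add_apply]
    exact Finsupp.single_add _ _ _

theorem inner_preMap_act_smul_one (c : ℂ) (x y : PreTensor π) :
    inner ℂ x (preMap π id (fun s => act s (c • 1)) y) = c * inner ℂ x y := by
  induction x using preTensor_induction with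
  | h0 => simp
  | hadd x x' hx hx' => simp only [inner_add_left, hx, hx', mul_add]
  | hs s ξ =>
    induction y using preTensor_induction with
    | h0 => simp
    | hadd y y' hy hy' => simp only [map_add, inner_add_right, hy, hy', mul_add]
    | hs t η =>
      simp only [preMap_preTmul, inner_preTmul, id]
      rw [act_smul, act_one_fun, ← mul_apply_eq_comp, ← map_mul, mul_smul_comm, kern_dom,
        map_smul, smul_apply, inner_smul_right]

variable [CompactSpace (Character S)]

theorem norm_preMap_act_le (f : CharAlg S) (x : PreTensor π) :
    ‖preMap π id (fun s => act s f) x‖ ≤ ‖f‖ * ‖x‖ := by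
  let g : CharAlg S := complexify ⟨fun ρ => √(‖f‖ ^ 2 - ‖f ρ‖ ^ 2), by fun_prop⟩
  have hfg : star f * f + star g * g = ((‖f‖ ^ 2 : ℝ) : ℂ) • (1 : CharAlg S) := by
    ext ρ
    have h1 : (0 : ℝ) ≤ ‖f‖ ^ 2 - ‖f ρ‖ ^ 2 := by
      have := f.norm_coe_le_norm ρ
      have := norm_nonneg (f ρ)
      nlinarith
    have h2 : star (f ρ) * f ρ = ((‖f ρ‖ ^ 2 : ℝ) : ℂ) := by
      rw [Complex.star_def, Complex.conj_mul']; push_cast; rfl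
    have h3 : g ρ = ((√(‖f‖ ^ 2 - ‖f ρ‖ ^ 2) : ℝ) : ℂ) := rfl
    change star (f ρ) * f ρ + star (g ρ) * g ρ = ((‖f‖ ^ 2 : ℝ) : ℂ) * 1
    rw [h2, h3, Complex.star_def, Complex.conj_ofReal, ← Complex.ofReal_mul, Real.mul_self_sqrt h1,
      mul_one, ← Complex.ofReal_add]
    congr 1
    ring
  have h := inner_preMap_act_add (star f * f) (star g * g) x x
  rw [hfg, inner_preMap_act_smul_one, ← inner_preMap_act, ← inner_preMap_act] at h
  have h' := congrArg Complex.re h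
  rw [Complex.re_ofReal_mul, Complex.add_re] at h'
  have e1 := inner_self_eq_norm_sq (𝕜 := ℂ) x
  have e2 := inner_self_eq_norm_sq (𝕜 := ℂ) (preMap π id (fun s => act s f) x)
  have e3 := inner_self_eq_norm_sq (𝕜 := ℂ) (preMap π id (fun s => act s g) x)
  simp only [RCLike.re_to_complex] at e1 e2 e3
  rw [e1, e2, e3] at h'
  refine abs_le_of_sq_le_sq' ?_ (by positivity) |>.2
  rw [mul_pow, h']
  exact le_add_of_nonneg_right (sq_nonneg _)

variable (π) in
/-- Left multiplication by `f` on `𝔄 ⊗_π H`: `k_s ⊗ ξ ↦ k_s ⊗ π(s† f s) ξ`. -/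
noncomputable def diagOpr (f : CharAlg S) : InteriorTensor π →L[ℂ] InteriorTensor π :=
  ((preMap π id (fun s => act s f)).mkContinuous ‖f‖ (norm_preMap_act_le f)).completion

theorem diagOpr_tmul (f : CharAlg S) (s : S) (ξ : H) :
    diagOpr π f (tmul π s ξ) = tmul π s (π (act s f) ξ) := by
  unfold diagOpr tmul
  rw [ContinuousLinearMap.completion_apply_coe, LinearMap.mkContinuous_apply, preMap_preTmul]
  rfl

variable (π) in
/-- Left multiplication as a representation of `C(X)` on `𝔄 ⊗_π H`. -/
noncomputable def diagRep : CharAlg S →⋆ₐ[ℂ] (InteriorTensor π →L[ℂ] InteriorTensor π) where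
  toFun := diagOpr π
  map_one' := clm_ext_tmul fun s ξ => by rw [diagOpr_tmul, act_one_fun, tmul_dom]; rfl
  map_mul' f g := clm_ext_tmul fun s ξ => by
    rw [mul_apply_eq_comp, diagOpr_tmul, diagOpr_tmul, diagOpr_tmul, act_mul, map_mul]; rfl
  map_zero' := clm_ext_tmul fun s ξ => by
    have : act s (0 : CharAlg S) = 0 := by
      have := act_smul s 0 (0 : CharAlg S)
      rwa [zero_smul, zero_smul] at this
    rw [diagOpr_tmul, this, map_zero, zero_apply, zero_apply, tmul_zero]
  map_add' f g := clm_ext_tmul fun s ξ => by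
    rw [add_apply, diagOpr_tmul, diagOpr_tmul, diagOpr_tmul, act_add, map_add, add_apply, tmul_add]
  commutes' c := clm_ext_tmul fun s ξ => by
    rw [Algebra.algebraMap_eq_smul_one, Algebra.algebraMap_eq_smul_one, diagOpr_tmul, act_smul,
      map_smul, act_one_fun, smul_apply, smul_apply, tmul_smul, tmul_dom]; rfl
  map_star' f := clm_ext_inner_tmul fun s ξ t η => by
    rw [inner_star_right, diagOpr_tmul, diagOpr_tmul, inner_tmul, inner_tmul, ← inner_star_right,
      ← map_star, ← mul_apply_eq_comp, ← mul_apply_eq_comp, ← map_mul, ← map_mul, ← act_star,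
      mul_comm (act s (star f)), kern_mul_act]

theorem diagRep_tmul (f : CharAlg S) (s : S) (ξ : H) :
    diagRep π f (tmul π s ξ) = tmul π s (π (act s f) ξ) := diagOpr_tmul f s ξ

theorem diagRep_unitIsometry (f : CharAlg S) :
    diagRep π f ∘L unitIsometry π = unitIsometry π ∘L π f := by
  ext ξ
  change diagRep π f (tmul π 1 ξ) = tmul π 1 (π f ξ)
  rw [diagRep_tmul, act_one]

theorem diagRep_injective (hπ : Function.Injective π) : Function.Injective (diagRep π) := by
  rw [injective_iff_map_eq_zero]
  intro f hf
  rw [injective_iff_map_eq_zero] at hπ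
  refine hπ f (ContinuousLinearMap.ext fun ξ => ?_)
  have h1 := congrArg (fun T => T ξ) (diagRep_unitIsometry (π := π) f)
  rw [hf] at h1
  have h2 := inner_unitIsometry (π := π) (π f ξ) (π f ξ)
  rw [show unitIsometry π (π f ξ) = 0 from h1.symm, inner_zero_left] at h2
  exact inner_self_eq_zero.1 h2.symm

theorem apply_eq_zero_of_re_inner {K : Type*} [NormedAddCommGroup K] [InnerProductSpace ℂ K]
    [CompleteSpace K] {T : K →L[ℂ] K} (hT : 0 ≤ T) {z : K}
    (h : (inner ℂ z (T z)).re = 0) : T z = 0 := by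
  have h1 := (Complex.le_def.1 (le_iff_inner.1 hT z))
  rw [sub_zero] at h1
  have h2 : inner ℂ z (T z) = 0 := Complex.ext h h1.2.symm
  have h3 := inner_sq_le hT (T z) z
  rw [h2] at h3
  simp only [Complex.zero_re, mul_zero] at h3
  have h4 : ‖inner ℂ (T z) (T z)‖ = 0 := by
    have := norm_nonneg (inner ℂ (T z) (T z))
    nlinarith
  rwa [norm_eq_zero, inner_self_eq_zero] at h4

theorem diagRep_isNormalHom (hπ : IsNormalHom π) : IsNormalHom (diagRep π) := by
  intro F f hne hd hf
  have hmono : ∀ {y z : C(Character S, ℝ)}, y ≤ z →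
    diagRep π (complexify y) ≤ diagRep π (complexify z) := fun h => map_complexify_mono _ h
  have hd' : DirectedOn (· ≤ ·) ((fun g => diagRep π (complexify g)) '' F) := by
    rintro _ ⟨y, hy, rfl⟩ _ ⟨z, hz, rfl⟩
    obtain ⟨w, hw, h1, h2⟩ := hd y hy z hz
    exact ⟨_, ⟨w, hw, rfl⟩, hmono h1, hmono h2⟩
  obtain ⟨T, hT, -⟩ := exists_wTendsto_of_directed (hne.image _) hd' (z := diagRep π (complexify f))
    (by rintro _ ⟨y, hy, rfl⟩; exact hmono (hf.1 hy))
  have hle : T ≤ diagRep π (complexify f) :=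
    hT.2 (by rintro _ ⟨y, hy, rfl⟩; exact hmono (hf.1 hy))
  have h0 : 0 ≤ diagRep π (complexify f) - T := sub_nonneg.2 hle
  have key : diagRep π (complexify f) - T = 0 := clm_ext_tmul fun s ξ => by
    rw [zero_apply]
    refine apply_eq_zero_of_re_inner h0 (le_antisymm ?_ ?_)
    · refine le_of_forall_pos_lt_add fun ε hε => ?_
      rw [zero_add]
      have hds : DirectedOn (· ≤ ·) (act s '' F) := by
        rintro _ ⟨y, hy, rfl⟩ _ ⟨z, hz, rfl⟩
        obtain ⟨w, hw, h1, h2⟩ := hd y hy z hz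
        exact ⟨_, ⟨w, hw, rfl⟩, act_mono s h1, act_mono s h2⟩
      have h1 := hπ _ _ (hne.image _) hds (act_isLUB s hne hf)
      have hds' : DirectedOn (· ≤ ·) ((fun g => π (complexify g)) '' (act s '' F)) := by
        rintro _ ⟨y, hy, rfl⟩ _ ⟨z, hz, rfl⟩
        obtain ⟨w, hw, h1, h2⟩ := hds y hy z hz
        exact ⟨_, ⟨w, hw, rfl⟩, map_complexify_mono _ h1, map_complexify_mono _ h2⟩
      obtain ⟨_, ⟨_, ⟨y, hy, rfl⟩, rfl⟩, h2⟩ :=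
        ((isLUB_iff_inner ((hne.image _).image _) hds').1 h1).2 ξ ε hε
      refine lt_of_le_of_lt ?_ h2
      have h3 : diagRep π (complexify f) - T ≤ diagRep π (complexify f) - diagRep π (complexify y) :=
        sub_le_sub_left (hT.1 ⟨y, hy, rfl⟩) _
      have h4 := (Complex.le_def.1 (le_iff_inner.1 h3 (tmul π s ξ))).1
      rw [sub_apply, inner_sub_right, Complex.sub_re, Complex.zero_re, sub_nonneg] at h4
      refine h4.trans (le_of_eq ?_)
      rw [← map_sub, diagRep_tmul, inner_tmul, kern_self, ← complexify_sub, act_complexify,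
        ← mul_apply_eq_comp, ← map_mul, ← act_one_fun, ← act_complexify, ← act_mul, one_mul,
        complexify_sub, sub_eq_add_neg, act_add, ← neg_one_smul ℂ, act_smul, map_add, map_smul,
        neg_one_smul, ← sub_eq_add_neg]
      simp only [act_complexify]
    · have := (Complex.le_def.1 (le_iff_inner.1 h0 (tmul π s ξ))).1
      rwa [sub_zero] at this
  rw [sub_eq_zero] at key
  rwa [key]

end tensor

section lambda
variable {S G H : Type*} [MonoidWithZero S] [IsBooleanInverseMonoid S]
  [Semigroup G] [IsInverseSemigroup G] [NormedAddCommGroup H] [InnerProductSpace ℂ H]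
  [CompleteSpace H] {X : Extension S G} (j : OrderSection X) (π : CharAlg S →⋆ₐ[ℂ] (H →L[ℂ] H))

theorem eq_j_of_idem {g : G} (hg : IsIdempotentElem g) : g = j.j (X.q g) := by
  have h : IsIdempotentElem (X.q g) := by rw [IsIdempotentElem, ← map_mul, hg.eq]
  exact q_injOn X hg (j_idem j h) (j.q_j _).symm

theorem q_idem {g : G} (hg : IsIdempotentElem g) : IsIdempotentElem (X.q g) := by
  rw [IsIdempotentElem, ← map_mul, hg.eq]

theorem sigma_mul (v w : G) (s : S) :
    (sigma j (v * w) s : CharAlg S) = sigma j v (X.q w * s) * sigma j w s := by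
  have h : sigma j (v * w) s = sigma j v (X.q w * s) * sigma j w s := by
    apply X.ι_injective
    rw [map_mul, ι_sigma, ι_sigma, ι_sigma]
    have h1 : j.j (X.q w * s) * dag (j.j (X.q w * s)) = (w * j.j s) * dag (w * j.j s) := by
      refine q_injOn X (idem_mul_dag _) (idem_mul_dag _) ?_
      simp only [map_mul, map_dag, j.q_j]
    have h2 : j.j (X.q w * s) * dag (j.j (X.q w * s)) * (w * j.j s) = w * j.j s := by
      rw [h1, mul_dag_mul]
    calc dag (j.j (X.q (v * w) * s)) * (v * w) * j.j s
        = dag (j.j (X.q (v * w) * s)) * v * (w * j.j s) := by simp only [mul_assoc]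
      _ = dag (j.j (X.q v * (X.q w * s))) * v *
          (j.j (X.q w * s) * dag (j.j (X.q w * s)) * (w * j.j s)) := by
            rw [h2, map_mul]; simp only [mul_assoc]
      _ = _ := by simp only [mul_assoc]
  exact congrArg Subtype.val h

theorem lam_mul (v w : G) : lam j π (v * w) = lam j π v * lam j π w :=
  clm_ext_tmul fun s ξ => by
    rw [mul_apply_eq_comp, lam_tmul, lam_tmul, lam_tmul, sigma_mul, map_mul, map_mul, mul_assoc]
    rfl

theorem lam_idem_tmul {g : G} (hg : IsIdempotentElem g) (s : S) (ξ : H) :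
    lam j π g (tmul π s ξ) = tmul π (X.q g * s) ξ := by
  have h : sigma j g s = chiP (dom (X.q g * s)) := by
    apply X.ι_injective
    rw [ι_sigma, ι_chiP j]
    conv_lhs => rw [mul_assoc]; enter [2, 1]; rw [eq_j_of_idem j hg]
    rw [← j_idem_mul j s (q_idem hg)]
    exact j_source j _
  rw [lam_tmul, h]
  exact tmul_dom _ _

theorem star_lam_mul_lam (v : G) : star (lam j π v) * lam j π v = lam j π (dag v * v) := by
  have h1 : star (lam j π v) * lam j π v = star (lam j π (dag v * v)) :=
    clm_ext_inner_tmul fun s ξ t η => by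
      rw [mul_apply_eq_comp, inner_star_right, inner_star_right, lam_tmul, lam_tmul, inner_tmul,
        lam_idem_tmul j π (idem_dag_mul v), inner_tmul, map_mul, map_dag, ← sigma_kern,
        map_mul, map_mul, map_star, mul_apply_eq_comp, mul_apply_eq_comp, inner_star_right]
  have h2 := congrArg star h1
  rw [star_mul, star_star, star_star] at h2
  exact h2

theorem lam_dag (v : G) : lam j π (dag v) = star (lam j π v) := by
  have ha := star_lam_mul_lam j π v
  have hb := star_lam_mul_lam j π (dag v)
  rw [dag_dag, lam_mul] at hb
  rw [lam_mul] at ha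
  have h1 : lam j π v * lam j π (dag v) * lam j π v = lam j π v := by
    rw [← lam_mul, ← lam_mul, mul_dag_mul]
  have h2 : lam j π (dag v) * lam j π v * lam j π (dag v) = lam j π (dag v) := by
    rw [← lam_mul, ← lam_mul, dag_mul_dag]
  have h3 := congrArg star hb
  rw [star_mul, star_star, hb] at h3
  calc lam j π (dag v) = star (lam j π v) * lam j π v * lam j π (dag v) := by rw [ha, h2]
    _ = star (lam j π v * lam j π (dag v) * lam j π v) := by
        rw [star_mul, ← h3, mul_assoc]
    _ = _ := by rw [h1]

theorem lam_partial (v : G) : lam j π v * star (lam j π v) * lam j π v = lam j π v := by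
  rw [← lam_dag, ← lam_mul, ← lam_mul, mul_dag_mul]

theorem conj_idem_eq (v : G) (e : Idem S) :
    dag v * j.j e * v = j.j (conjIdem (X.q v) e : S) := by
  have h := idem_conj (dag v) (j_idem j e.2)
  rw [dag_dag] at h
  rw [eq_j_of_idem j h, map_mul, map_mul, map_dag, j.q_j]; rfl

variable [CompactSpace (Character S)]

theorem diagRep_chi (e : Idem S) : diagRep π (chi e) = lam j π (j.j e) :=
  clm_ext_tmul fun s ξ => by
    rw [diagRep_tmul, act_chi, ← tmul_mul_idem, lam_idem_tmul j π (j_idem j e.2), j.q_j]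
    congr 1
    change s * (dag s * e * s) = e * s
    calc s * (dag s * e * s) = s * dag s * e * s := by simp only [mul_assoc]
      _ = e * (s * dag s * s) := by rw [idem_comm (idem_mul_dag s) e.2, mul_assoc]
      _ = _ := by rw [mul_dag_mul]

theorem lam_ι (p : partialIsometries S) : lam j π (X.ι p) = diagRep π p := by
  have hp : (p : CharAlg S) * star (p : CharAlg S) * p = p := p.2
  have hx : IsIdempotentElem (X.q (X.ι p)) := (X.isIdempotentElem_q_iff _).2 ⟨p, rfl⟩
  have h1 : X.ι (chiP ⟨_, hx⟩) = X.ι p * dag (X.ι p) := by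
    rw [ι_chiP j]
    refine q_injOn X (j_idem j hx) (idem_mul_dag _) ?_
    rw [j.q_j, map_mul, map_dag, dag_idem hx, hx.eq]
  have h2 : chi ⟨_, hx⟩ * (p : CharAlg S) = p := by
    have : chiP ⟨_, hx⟩ * p = p := X.ι_injective (by rw [map_mul, h1, mul_dag_mul])
    exact congrArg Subtype.val this
  refine clm_ext_tmul fun s ξ => ?_
  rw [lam_tmul, diagRep_tmul]
  have h3 : dag (j.j s) * X.ι p * j.j s = X.ι (sigma j (X.ι p) s) := by
    rw [ι_sigma, j_idem_mul j s hx, dag_mul, dag_idem (j_idem j hx), ← ι_chiP j ⟨_, hx⟩,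
      mul_assoc (dag (j.j s)) (X.ι (chiP _)), ← map_mul]
    congr 3
    exact Subtype.ext h2.symm
  have h4 := eq_act_of_conj X h3
  rw [j.q_j] at h4
  rw [h4]
  have h5 : X.q (X.ι p) * s = s * (conjIdem s ⟨_, hx⟩ : S) := by
    change X.q (X.ι p) * s = s * (dag s * X.q (X.ι p) * s)
    calc _ = X.q (X.ι p) * (s * dag s * s) := by rw [mul_dag_mul]
      _ = X.q (X.ι p) * (s * dag s) * s := by simp only [mul_assoc]
      _ = _ := by rw [idem_comm hx (idem_mul_dag s)]; simp only [mul_assoc]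
  rw [h5, tmul_mul_idem, ← mul_apply_eq_comp, ← map_mul, ← act_chi, ← act_mul, h2]

theorem diagRep_mul_lam (v : G) (f : CharAlg S) :
    diagRep π f * lam j π v = lam j π v * diagRep π (act (X.q v) f) :=
  clm_ext_tmul fun s ξ => by
    rw [mul_apply_eq_comp, mul_apply_eq_comp, lam_tmul, diagRep_tmul, diagRep_tmul, lam_tmul,
      act_act, ← mul_apply_eq_comp, ← mul_apply_eq_comp, ← map_mul, ← map_mul, mul_comm]

theorem chi_dom_mul_act (s : S) (f : CharAlg S) : chi (dom s) * act s f = act s f := by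
  rw [← act_one_fun, ← act_mul, one_mul]

theorem star_lam_mul_lam_eq (v : G) :
    star (lam j π v) * lam j π v = diagRep π (chi (dom (X.q v))) := by
  rw [star_lam_mul_lam, diagRep_chi j]
  congr 1
  rw [eq_j_of_idem j (idem_dag_mul v), map_mul, map_dag]; rfl

theorem lam_covariant (v : G) (f : CharAlg S) :
    star (lam j π v) * diagRep π f * lam j π v = diagRep π (act (X.q v) f) := by
  rw [mul_assoc, diagRep_mul_lam, ← mul_assoc, star_lam_mul_lam_eq, ← map_mul, chi_dom_mul_act]

end lambda

local instance {S : Type*} [MonoidWithZero S] [IsCartanInverseMonoid S] : CompactSpace (Character S) :=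
  IsCartanInverseMonoid.hyperstonean.1

local instance {S : Type*} [MonoidWithZero S] [IsCartanInverseMonoid S] :
    ExtremallyDisconnected (Character S) :=
  IsCartanInverseMonoid.hyperstonean.2.2.1

theorem mem_bicommutant {K : Type*} [NormedAddCommGroup K] [InnerProductSpace ℂ K]
    [CompleteSpace K] {T : Set (K →L[ℂ] K)} (hT : ∀ a ∈ T, star a ∈ T) {x : K →L[ℂ] K} :
    x ∈ bicommutant T ↔ ∀ t, (∀ a ∈ T, a * t = t * a) → x * t = t * x := by
  change x ∈ StarSubalgebra.centralizer ℂ (StarSubalgebra.centralizer ℂ T : Set (K →L[ℂ] K)) ↔ _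
  rw [StarSubalgebra.mem_centralizer_iff]
  constructor
  · intro h t ht
    refine (h t ?_).1.symm
    rw [SetLike.mem_coe, StarSubalgebra.mem_centralizer_iff]
    exact fun a ha => ⟨ht a ha, ht _ (hT a ha)⟩
  · intro h t ht
    have ht' := star_mem ht
    rw [SetLike.mem_coe, StarSubalgebra.mem_centralizer_iff] at ht
    rw [StarSubalgebra.mem_centralizer_iff] at ht'
    exact ⟨(h t fun a ha => (ht a ha).1).symm, (h _ fun a ha => (ht' a ha).1).symm⟩

/-- The bounded operators on `𝔄 ⊗_π H`. -/
abbrev Opr {S H : Type*} [MonoidWithZero S] [IsBooleanInverseMonoid S] [NormedAddCommGroup H]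
    [InnerProductSpace ℂ H] [CompleteSpace H] (π : FaithfulNormalRep S H) : Type _ :=
  InteriorTensor π.toHom →L[ℂ] InteriorTensor π.toHom

section pair
variable {S G H : Type*} [MonoidWithZero S] [IsCartanInverseMonoid S]
  [Semigroup G] [IsInverseSemigroup G] [NormedAddCommGroup H] [InnerProductSpace ℂ H]
  [CompleteSpace H] {X : Extension S G} (j : OrderSection X) (π : FaithfulNormalRep S H)

theorem mem_algM {x : Opr π} :
    x ∈ algM j π ↔ ∀ t, (∀ v, lam j π.toHom v * t = t * lam j π.toHom v) → x * t = t * x := by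
  unfold algM
  rw [mem_bicommutant]
  · simp only [Set.forall_mem_range]
  · rintro _ ⟨v, rfl⟩
    exact ⟨dag v, lam_dag j _ v⟩

theorem lam_mem_algM (v : G) : lam j π.toHom v ∈ algM j π :=
  (mem_algM j π).2 fun _ ht => ht v

theorem lam_idem_eq {g : G} (hg : IsIdempotentElem g) :
    lam j π.toHom g = diagRep π.toHom (chi ⟨X.q g, q_idem hg⟩) := by
  rw [diagRep_chi j]
  congr 1
  exact eq_j_of_idem j hg

theorem commute_diagRep {t : Opr π}
    (ht : ∀ e, diagRep π.toHom (chi e) * t = t * diagRep π.toHom (chi e)) (f : CharAlg S) :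
    diagRep π.toHom f * t = t * diagRep π.toHom f := by
  refine mem_of_chi
    { carrier := {f | diagRep π.toHom f * t = t * diagRep π.toHom f}
      add_mem' := fun {f g} hf hg => by
        simp only [Set.mem_ofPred_eq, map_add, add_mul, mul_add] at *
        rw [hf, hg]
      zero_mem' := by simp
      smul_mem' := fun c f hf => by
        simp only [Set.mem_ofPred_eq, map_smul, smul_mul_assoc, mul_smul_comm] at *
        rw [hf] } ?_ ht f
  have hc : Continuous (diagRep π.toHom) := map_continuous _
  exact isClosed_eq (hc.mul continuous_const) (continuous_const.mul hc)

theorem mem_algD {x : Opr π} :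
    x ∈ algD j π ↔ ∃ f, diagRep π.toHom f = x := by
  unfold algD
  rw [mem_bicommutant]
  · constructor
    · intro h
      refine (diagRep_isNormalHom π.normal).exists_eq (diagRep_injective π.injective) fun t ht => ?_
      refine h t ?_
      rintro _ ⟨g, hg, rfl⟩
      rw [lam_idem_eq j π hg]
      exact ht _
    · rintro ⟨f, rfl⟩ t ht
      refine commute_diagRep π (fun e => ?_) f
      rw [diagRep_chi j]
      exact ht _ ⟨_, j_idem j e.2, rfl⟩
  · rintro _ ⟨g, hg, rfl⟩
    refine ⟨g, hg, ?_⟩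
    rw [← lam_dag, dag_idem hg]

theorem diagRep_mem_algD (f : CharAlg S) : diagRep π.toHom f ∈ algD j π :=
  (mem_algD j π).2 ⟨f, rfl⟩

theorem algD_le_algM : algD j π ≤ algM j π := by
  intro x hx
  obtain ⟨f, rfl⟩ := (mem_algD j π).1 hx
  refine (mem_algM j π).2 fun t ht => commute_diagRep π (fun e => ?_) f
  rw [diagRep_chi j]
  exact ht _

theorem lam_isGroupoidNormalizer (v : G) :
    IsGroupoidNormalizer (algM j π) (algD j π) (lam j π.toHom v) := by
  refine ⟨lam_mem_algM j π v, lam_partial j _ v, fun d hd => ?_⟩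
  obtain ⟨f, rfl⟩ := (mem_algD j π).1 hd
  constructor
  · have := lam_covariant j π.toHom (dag v) f
    rw [lam_dag, star_star] at this
    rw [this]
    exact diagRep_mem_algD j π _
  · rw [lam_covariant]
    exact diagRep_mem_algD j π _

theorem lam_j_one : lam j π.toHom (j.j 1) = 1 := by
  rw [← map_one (diagRep π.toHom), ← chi_one (⟨1, mul_one 1⟩ : Idem S) rfl, diagRep_chi j]

/-- The star algebra spanned by `λ(G)`. -/
noncomputable def lamSpan :
    StarSubalgebra ℂ (Opr π) where
  carrier := Submodule.span ℂ (Set.range (lam j π.toHom))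
  mul_mem' := by
    intro a b ha hb
    have := Submodule.mul_mem_mul ha hb
    rw [Submodule.span_mul_span] at this
    refine Submodule.span_mono ?_ this
    rintro _ ⟨_, ⟨v, rfl⟩, _, ⟨w, rfl⟩, rfl⟩
    exact ⟨v * w, lam_mul j _ v w⟩
  add_mem' := Submodule.add_mem _
  algebraMap_mem' c := by
    rw [Algebra.algebraMap_eq_smul_one, ← lam_j_one j]
    exact Submodule.smul_mem _ _ (Submodule.subset_span ⟨_, rfl⟩)
  star_mem' := by
    intro a ha
    change a ∈ Submodule.span ℂ _ at ha
    change star a ∈ Submodule.span ℂ _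
    induction ha using Submodule.span_induction with
    | mem x hx =>
      obtain ⟨v, rfl⟩ := hx
      exact Submodule.subset_span ⟨dag v, lam_dag j _ v⟩
    | zero => rw [star_zero]; exact Submodule.zero_mem _
    | add x y _ _ hx hy => rw [star_add]; exact Submodule.add_mem _ hx hy
    | smul c x _ hx => rw [star_smul]; exact Submodule.smul_mem _ _ hx

theorem mem_lamSpan {x : Opr π} :
    x ∈ lamSpan j π ↔ x ∈ Submodule.span ℂ (Set.range (lam j π.toHom)) := Iff.rfl

theorem lamSpan_le {x : Opr π}
    (hx : x ∈ lamSpan j π) : x ∈ algM j π := by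
  rw [mem_lamSpan] at hx
  induction hx using Submodule.span_induction with
  | mem x hx =>
    obtain ⟨v, rfl⟩ := hx
    exact lam_mem_algM j π v
  | zero => exact zero_mem _
  | add x y _ _ hx hy => exact add_mem hx hy
  | smul c x _ hx => exact SMulMemClass.smul_mem (s := (algM j π).toStarSubalgebra) _ hx

theorem commute_of_lamSpan {t x : Opr π}
    (ht : ∀ a ∈ lamSpan j π, a * t = t * a) (hx : x ∈ algM j π) : x * t = t * x :=
  (mem_algM j π).1 hx t fun v => ht _ ((mem_lamSpan j π).2 (Submodule.subset_span ⟨v, rfl⟩))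

theorem algM_regular : ((algM j π : VonNeumannAlgebra _) : Set _) ⊆
    @closure _ (sigmaWeakTopology (InteriorTensor π.toHom))
      (Submodule.span ℂ {v | IsGroupoidNormalizer (algM j π) (algD j π) v} : Set _) := by
  intro x hx
  letI := sigmaWeakTopology (InteriorTensor π.toHom)
  refine closure_mono ?_ (mem_sigmaWeak_closure (lamSpan j π)
    fun t ht => commute_of_lamSpan j π ht hx)
  refine Submodule.span_mono ?_
  rintro _ ⟨v, rfl⟩
  exact lam_isGroupoidNormalizer j π v

/-- The compression of an operator by the isometry `ξ ↦ k_1 ⊗ ξ`. -/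
noncomputable def compress (x : Opr π) : H →L[ℂ] H :=
  (unitIsometry π.toHom).adjoint ∘L x ∘L unitIsometry π.toHom

theorem inner_compress (x : Opr π) (ξ η : H) :
    inner ℂ ξ (compress π x η) = inner ℂ (unitIsometry π.toHom ξ) (x (unitIsometry π.toHom η)) :=
  ContinuousLinearMap.adjoint_inner_right (unitIsometry π.toHom) ξ (x (unitIsometry π.toHom η))

theorem compress_lam (v : G) : compress π (lam j π.toHom v) =
    π.toHom (kern 1 (X.q v) * sigma j v 1) :=
  ext_inner_op fun ξ η => by
    rw [inner_compress, unitIsometry_apply, unitIsometry_apply, lam_tmul, inner_tmul, mul_one,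
      map_mul]; rfl

theorem compress_add (x y : Opr π) :
    compress π (x + y) = compress π x + compress π y :=
  ext_inner_op fun ξ η => by simp only [inner_compress, add_apply, inner_add_right]

theorem compress_smul (c : ℂ) (x : Opr π) :
    compress π (c • x) = c • compress π x :=
  ext_inner_op fun ξ η => by simp only [inner_compress, smul_apply, inner_smul_right]

theorem compress_bimodule (f g : CharAlg S)
    (x : Opr π) :
    compress π (diagRep π.toHom f * x * diagRep π.toHom g) =
      π.toHom f * compress π x * π.toHom g :=
  ext_inner_op fun ξ η => by
    have h : ∀ (f : CharAlg S) (ξ : H), diagRep π.toHom f (unitIsometry π.toHom ξ) =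
      unitIsometry π.toHom (π.toHom f ξ) := fun f ξ =>
        congrArg (fun T => T ξ) (diagRep_unitIsometry (π := π.toHom) f)
    rw [inner_compress, mul_assoc, mul_assoc, mul_apply_eq_comp, mul_apply_eq_comp,
      mul_apply_eq_comp, mul_apply_eq_comp, h, ← star_star f, map_star, map_star (π.toHom),
      inner_star_right, inner_star_right, h, inner_compress]

theorem compress_diagRep (f : CharAlg S) : compress π (diagRep π.toHom f) = π.toHom f := by
  have h := compress_bimodule π f 1 1
  have h1 : compress π 1 = 1 := ext_inner_op fun ξ η => by
    rw [inner_compress]; exact inner_unitIsometry _ _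
  rwa [h1, map_one, map_one, mul_one, mul_one, mul_one, mul_one] at h

theorem exists_compress_eq {x : Opr π}
    (hx : x ∈ algM j π) : ∃ f, π.toHom f = compress π x := by
  have h1 : ∀ x ∈ lamSpan j π, ∃ f, π.toHom f = compress π x := by
    intro x hx
    rw [mem_lamSpan] at hx
    induction hx using Submodule.span_induction with
    | mem x hx =>
      obtain ⟨v, rfl⟩ := hx
      exact ⟨_, (compress_lam j π v).symm⟩
    | zero =>
      refine ⟨0, ?_⟩
      rw [map_zero]
      refine ext_inner_op fun ξ η => ?_
      rw [inner_compress, zero_apply, zero_apply, inner_zero_right, inner_zero_right]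
    | add x y _ _ hx hy =>
      obtain ⟨f, hf⟩ := hx
      obtain ⟨g, hg⟩ := hy
      exact ⟨f + g, by rw [map_add, hf, hg, compress_add]⟩
    | smul c x _ hx =>
      obtain ⟨f, hf⟩ := hx
      exact ⟨c • f, by rw [map_smul, hf, compress_smul]⟩
  refine IsNormalHom.exists_eq π.normal π.injective fun t ht => ?_
  obtain ⟨a, ha, -, hlim⟩ := exists_bounded_approx (lamSpan j π) (algM j π)
    (fun t ht x hx => commute_of_lamSpan j π ht hx) hx
  have h2 : WTendsto (fun i => compress π (a i)) atTop (compress π x) := fun ξ η => by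
    simp only [inner_compress]
    exact wTendsto_of_strong hlim _ _
  refine (h2.mul_right t).unique ((h2.mul_left t).congr' (Eventually.of_forall fun i => ?_))
  obtain ⟨f, hf⟩ := h1 _ (ha i)
  change t * compress π (a i) = compress π (a i) * t
  rw [← hf, ht]

/-- The conditional expectation of `M_q` onto `D_q`. -/
noncomputable def condExp : (algM j π).toStarSubalgebra →ₗ[ℂ] (algD j π).toStarSubalgebra where
  toFun x := ⟨diagRep π.toHom (exists_compress_eq j π x.2).choose, diagRep_mem_algD j π _⟩
  map_add' x y := Subtype.ext (by
    change diagRep π.toHom _ = diagRep π.toHom _ + diagRep π.toHom _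
    rw [← map_add]
    congr 1
    apply π.injective
    rw [map_add, (exists_compress_eq j π x.2).choose_spec, (exists_compress_eq j π y.2).choose_spec,
      (exists_compress_eq j π (x + y).2).choose_spec]
    exact compress_add π _ _)
  map_smul' c x := Subtype.ext (by
    change diagRep π.toHom _ = c • diagRep π.toHom _
    rw [← map_smul]
    congr 1
    apply π.injective
    rw [map_smul, (exists_compress_eq j π x.2).choose_spec,
      (exists_compress_eq j π (c • x).2).choose_spec]
    exact compress_smul π _ _)

theorem exists_condExp_eq (x : (algM j π).toStarSubalgebra) :
    ∃ f, π.toHom f = compress π x ∧ (condExp j π x : Opr π) = diagRep π.toHom f :=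
  ⟨_, (exists_compress_eq j π x.2).choose_spec, rfl⟩

theorem condExp_eq {x : (algM j π).toStarSubalgebra} {f : CharAlg S}
    (h : π.toHom f = compress π x) : (condExp j π x : Opr π) = diagRep π.toHom f := by
  obtain ⟨g, hg, h'⟩ := exists_condExp_eq j π x
  rw [h', π.injective (hg.trans h.symm)]

theorem complexify_rePart_of_map {X K : Type*} [TopologicalSpace X] [NormedAddCommGroup K]
    [InnerProductSpace ℂ K] [CompleteSpace K] {ρ : C(X, ℂ) →⋆ₐ[ℂ] (K →L[ℂ] K)}
    (hinj : Function.Injective ρ) {k : C(X, ℂ)} (h : 0 ≤ ρ k) :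
    complexify (rePart k) = k ∧ 0 ≤ rePart k := by
  have hk : complexify (rePart k) = k := by
    have h1 : star k = k := hinj (by rw [map_star, h.isSelfAdjoint.star_eq])
    ext x
    have h2 : (starRingEnd ℂ) (k x) = k x := congrArg (fun f : C(X, ℂ) => f x) h1
    exact Complex.conj_eq_iff_re.1 h2
  rw [← hk] at h
  exact ⟨hk, nonneg_of_map_nonneg hinj h⟩

theorem compress_nonneg {x : Opr π} (hx : 0 ≤ x) :
    0 ≤ compress π x := by
  rw [le_iff_inner] at hx ⊢
  intro ξ
  have := hx (unitIsometry π.toHom ξ)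
  rwa [sub_zero, inner_compress, ← sub_zero x]

theorem condExp_nonneg_aux {x : (algM j π).toStarSubalgebra} (hx : 0 ≤ (x : Opr π)) :
    ∃ k, 0 ≤ k ∧ π.toHom (complexify k) = compress π x ∧
      (condExp j π x : Opr π) = diagRep π.toHom (complexify k) := by
  obtain ⟨f, hf, h⟩ := exists_condExp_eq j π x
  obtain ⟨h1, h2⟩ := complexify_rePart_of_map π.injective (hf.ge.trans' (compress_nonneg π hx))
  exact ⟨_, h2, by rw [h1, hf], by rw [h1, h]⟩

theorem compress_sub (x y : Opr π) : compress π (x - y) = compress π x - compress π y := by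
  rw [eq_sub_iff_add_eq, ← compress_add, sub_add_cancel]

theorem nonpos_of_le_compress {F : Set (Opr π)} {x : Opr π} (hne : F.Nonempty)
    (hd : DirectedOn (· ≤ ·) F) (hx : IsLUB F x) {T : H →L[ℂ] H} (hT : star T = T)
    (h : ∀ y ∈ F, T ≤ compress π (x - y)) : T ≤ 0 := by
  have h3 := ((isLUB_iff_inner hne hd).1 hx).2
  refine le_iff_inner.2 fun ξ => ?_
  have h5 : (inner ℂ ξ (T ξ)).im = 0 := by
    rw [← Complex.conj_eq_iff_im, inner_conj_symm]
    conv_lhs => rw [← hT, inner_star_left]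
  have h4 : (inner ℂ ξ (T ξ)).re ≤ 0 := by
    refine le_of_forall_pos_lt_add fun ε hε => ?_
    obtain ⟨y, hy, h7⟩ := h3 (unitIsometry π.toHom ξ) ε hε
    have h8 := (Complex.le_def.1 (le_iff_inner.1 (h y hy) ξ)).1
    rw [sub_apply, inner_sub_right, Complex.sub_re, inner_compress, Complex.zero_re] at h8
    rw [zero_add]
    exact lt_of_le_of_lt (sub_nonneg.1 h8) h7
  rw [zero_sub, neg_apply, inner_neg_right, Complex.le_def]
  exact ⟨by simpa using h4, by simpa using h5⟩

theorem condExp_sub_coe (x y : (algM j π).toStarSubalgebra) :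
    (condExp j π y : Opr π) = condExp j π x - (condExp j π (x - y) : Opr π) := by
  rw [map_sub, AddSubgroupClass.coe_sub, sub_sub_cancel]

theorem diagRep_complexify_neg (k : C(Character S, ℝ)) :
    diagRep π.toHom (complexify (-k)) = -diagRep π.toHom (complexify k) := by
  rw [← map_neg, ← zero_sub, complexify_sub, complexify_zero, zero_sub]

theorem isLUB_of_isLUB_sub {K : Type*} [NormedAddCommGroup K] [InnerProductSpace ℂ K]
    [CompleteSpace K] {ι : Type*} {a b : ι → K →L[ℂ] K} {c : K →L[ℂ] K} (hab : ∀ i, a i = c + b i)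
    (hb : IsLUB (Set.range b) 0) : IsLUB (Set.range a) c := by
  refine ⟨?_, fun z hz => ?_⟩
  · rintro _ ⟨i, rfl⟩
    rw [hab]
    exact add_le_of_nonpos_right (hb.1 ⟨i, rfl⟩)
  · refine sub_nonneg.1 (hb.2 ?_)
    rintro _ ⟨i, rfl⟩
    rw [le_sub_iff_add_le', ← hab]
    exact hz ⟨i, rfl⟩

theorem condExp_isNormalExpectation : IsNormalExpectation (algM j π) (algD j π) (condExp j π) where
  map_mem x d hxd := by
    obtain ⟨f, hf⟩ := (mem_algD j π).1 d.2
    refine Subtype.ext ((condExp_eq j π ?_).trans hf)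
    rw [hxd, ← hf, compress_diagRep]
  nonneg x hx := by
    obtain ⟨k, hk, -, h⟩ := condExp_nonneg_aux j π hx
    rw [h]
    exact map_complexify_nonneg _ hk
  bimodule x y d d' hy := by
    obtain ⟨f, hf⟩ := (mem_algD j π).1 d.2
    obtain ⟨g, hg⟩ := (mem_algD j π).1 d'.2
    obtain ⟨k, hk, h⟩ := exists_condExp_eq j π x
    apply Subtype.ext
    change (condExp j π y : Opr π) = d * (condExp j π x : Opr π) * d'
    rw [h, ← hf, ← hg, ← map_mul, ← map_mul]
    apply condExp_eq
    rw [hy, ← hf, ← hg, compress_bimodule, map_mul, map_mul, hk]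
  normal F x hne hd hx := by
    have hle : ∀ y ∈ F, (y : Opr π) ≤ x := fun y hy => hx.1 ⟨y, hy, rfl⟩
    have hk : ∀ y : F, ∃ k, 0 ≤ k ∧ π.toHom (complexify k) = compress π (x - y : (algM j π).toStarSubalgebra) ∧
      (condExp j π (x - y) : Opr π) = diagRep π.toHom (complexify k) := fun y =>
        condExp_nonneg_aux j π (sub_nonneg.2 (hle y y.2))
    choose k hk0 hk1 hk2 using hk
    have hanti : ∀ y z : F, (y : Opr π) ≤ (z : (algM j π).toStarSubalgebra) → k z ≤ k y := by
      intro y z hyz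
      refine le_of_map_le π.injective ?_
      rw [hk1, hk1]
      change compress π ((x : Opr π) - _) ≤ compress π ((x : Opr π) - _)
      rw [← sub_nonneg, ← compress_sub, sub_sub_sub_cancel_left]
      exact compress_nonneg π (sub_nonneg.2 hyz)
    have hF : Nonempty F := hne.to_subtype
    have hdk : DirectedOn (· ≤ ·) (Set.range fun y => -k y) := by
      rintro _ ⟨y, rfl⟩ _ ⟨z, rfl⟩
      obtain ⟨w, hw, h1, h2⟩ := hd y y.2 z z.2
      exact ⟨_, ⟨⟨w, hw⟩, rfl⟩, neg_le_neg (hanti _ ⟨w, hw⟩ h1), neg_le_neg (hanti _ ⟨w, hw⟩ h2)⟩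
    have hlub : IsLUB (Set.range fun y => -k y) 0 := by
      refine ⟨?_, fun h hh => ?_⟩
      · rintro _ ⟨y, rfl⟩
        exact neg_nonpos.2 (hk0 y)
      · have hd' : DirectedOn (· ≤ ·)
            ((fun y : (algM j π).toStarSubalgebra => (y : Opr π)) '' F) := by
          rintro _ ⟨a, ha, rfl⟩ _ ⟨b, hb, rfl⟩
          obtain ⟨c, hc, e1, e2⟩ := hd a ha b hb
          exact ⟨_, ⟨c, hc, rfl⟩, e1, e2⟩
        have h2 : π.toHom (complexify (-h)) ≤ 0 := by
          refine nonpos_of_le_compress π (hne.image _) hd' hx (by rw [← map_star, star_complexify]) ?_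
          rintro _ ⟨y, hy, rfl⟩
          refine le_trans ?_ (hk1 ⟨y, hy⟩).le
          exact map_complexify_mono _ (neg_le.1 (hh ⟨⟨y, hy⟩, rfl⟩))
        have h9 := le_of_map_le π.injective (f := -h) (g := 0) (by rwa [complexify_zero, map_zero])
        exact neg_nonpos.1 h9
    have hN := diagRep_isNormalHom π.normal _ _ (Set.range_nonempty _) hdk hlub
    rw [← Set.range_comp, complexify_zero, map_zero] at hN
    have hval : ∀ y : F, (condExp j π y : Opr π) =
        condExp j π x + diagRep π.toHom (complexify (-k y)) := fun y => by
      rw [diagRep_complexify_neg, ← hk2 y, ← sub_eq_add_neg]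
      exact condExp_sub_coe j π x y
    have := isLUB_of_isLUB_sub hval hN
    rwa [Set.image_eq_range]

end pair

section meet
variable {S : Type*} [MonoidWithZero S] [IsBooleanInverseMonoid S]

theorem dag_one : dag (1 : S) = 1 := dag_idem (mul_one 1)

theorem fixIdem_one_isMeet (t : S) : IsMeet t 1 (fixIdem 1 t : S) := by
  have := fixIdem_isMeet 1 t
  rwa [dag_one, one_mul] at this

theorem fixIdem_one_conj (r t : S) :
    fixIdem 1 (dag r * t * r) = conjIdem r (fixIdem 1 t) := by
  obtain ⟨h1, -, h3⟩ := fixIdem_one_isMeet t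
  obtain ⟨h1', -, h3'⟩ := fixIdem_one_isMeet (dag r * t * r)
  apply Subtype.ext
  change (fixIdem 1 (dag r * t * r) : S) = dag r * fixIdem 1 t * r
  set m := fixIdem 1 t
  set m' := fixIdem 1 (dag r * t * r)
  have e1 := mul_eq_of_natLE m.2 h1
  have e1' := mul_eq_of_natLE m'.2 h1'
  apply natLE_antisymm
  · have hn := idem_conj r m'.2
    set n := r * (m' : S) * dag r with hn_def
    have e2 : n = r * dag r * (t * n) := by
      conv_lhs => rw [hn_def, ← e1']
      rw [hn_def]
      simp only [mul_assoc]
    have h4 : NatLE n t := by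
      refine NatLE.trans (s := t * n) ?_ ⟨n, hn, rfl⟩
      exact natLE_iff_left.2 ⟨_, idem_mul_dag r, e2⟩
    have e3 := mul_eq_of_natLE hn (h3 n h4 (natLE_one hn))
    have e4 : dag r * r * (m' : S) = m' := by
      rw [← e1']
      calc dag r * r * (dag r * t * r * (m' : S)) = dag r * r * dag r * t * r * m' := by
            simp only [mul_assoc]
        _ = _ := by rw [dag_mul_dag]
    have e5 : dag r * n * r = m' := by
      calc dag r * n * r = dag r * r * m' * (dag r * r) := by rw [hn_def]; simp only [mul_assoc]
        _ = m' := by rw [e4, idem_comm m'.2 (idem_dag_mul r), e4]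
    refine ⟨(m' : S), m'.2, ?_⟩
    conv_rhs => rw [← e5, ← conj_mul_conj r m ⟨n, hn⟩]
    rw [e3, e5]
  · refine h3' _ ⟨_, (conjIdem r m).2, ?_⟩ (natLE_one (conjIdem r m).2)
    change dag r * (m : S) * r = dag r * t * r * (dag r * m * r)
    have e6 := idem_comm (idem_mul_dag r) m.2
    calc dag r * (m : S) * r = dag r * (t * m) * (r * dag r * r) := by rw [e1, mul_dag_mul]
      _ = dag r * t * (m * (r * dag r)) * r := by simp only [mul_assoc]
      _ = _ := by rw [← e6]; simp only [mul_assoc]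

end meet

section pair
variable {S G H : Type*} [MonoidWithZero S] [IsCartanInverseMonoid S]
  [Semigroup G] [IsInverseSemigroup G] [NormedAddCommGroup H] [InnerProductSpace ℂ H]
  [CompleteSpace H] {X : Extension S G} (j : OrderSection X) (π : FaithfulNormalRep S H)

theorem q_mul_fixIdem_idem (w : G) :
    IsIdempotentElem (X.q (w * j.j (fixIdem 1 (X.q w) : S))) := by
  rw [map_mul, j.q_j, mul_eq_of_natLE (fixIdem 1 (X.q w)).2 (fixIdem_one_isMeet _).1]
  exact (fixIdem 1 (X.q w)).2

theorem compress_mul_diagRep (x : Opr π) (g : CharAlg S) :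
    compress π (x * diagRep π.toHom g) = compress π x * π.toHom g := by
  have := compress_bimodule π 1 g x
  rwa [map_one, map_one, one_mul, one_mul] at this

theorem compress_diagRep_mul (x : Opr π) (g : CharAlg S) :
    compress π (diagRep π.toHom g * x) = π.toHom g * compress π x := by
  have := compress_bimodule π g 1 x
  rwa [map_one, map_one, mul_one, mul_one] at this

theorem compress_lam_eq {w : G} {p : partialIsometries S}
    (h : X.ι p = w * j.j (fixIdem 1 (X.q w) : S)) : compress π (lam j π.toHom w) = π.toHom p := by
  have h1 : compress π (lam j π.toHom w) =
      compress π (lam j π.toHom w * diagRep π.toHom (chi (fixIdem 1 (X.q w)))) := by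
    rw [compress_mul_diagRep, compress_lam, ← map_mul, mul_right_comm, kern_comm]
    unfold kern
    rw [chi_mul_self]
  rw [h1, diagRep_chi j, ← lam_mul, ← h, lam_ι, compress_diagRep]

theorem compress_lam_conj (v w : G) : ∃ f, π.toHom f = compress π (lam j π.toHom w) ∧
    π.toHom (act (X.q v) f) =
      compress π (star (lam j π.toHom v) * lam j π.toHom w * lam j π.toHom v) := by
  obtain ⟨p, hp⟩ := (X.isIdempotentElem_q_iff _).1 (q_mul_fixIdem_idem j w)
  refine ⟨p, (compress_lam_eq j π hp).symm, ?_⟩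
  rw [← lam_dag, ← lam_mul, ← lam_mul]
  obtain ⟨p', hp'⟩ := (X.isIdempotentElem_q_iff _).1 (q_mul_fixIdem_idem j (dag v * w * v))
  have h1 : dag v * X.ι p * v = X.ι p' := by
    rw [hp', hp, map_mul, map_mul, map_dag, fixIdem_one_conj, ← conj_idem_eq]
    have e6 := idem_comm (idem_mul_dag v) (j_idem j (fixIdem 1 (X.q w)).2)
    calc _ = dag v * w * (j.j (fixIdem 1 (X.q w) : S)) * (v * dag v * v) := by
          rw [mul_dag_mul]; simp only [mul_assoc]
      _ = dag v * w * (j.j (fixIdem 1 (X.q w) : S) * (v * dag v)) * v := by simp only [mul_assoc]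
      _ = _ := by rw [← e6]; simp only [mul_assoc]
  rw [compress_lam_eq j π hp', eq_act_of_conj X h1]

theorem conj_mem_algM (v : G) {y : Opr π} (hy : y ∈ algM j π) :
    star (lam j π.toHom v) * y * lam j π.toHom v ∈ algM j π :=
  mul_mem (mul_mem (star_mem (lam_mem_algM j π v)) hy) (lam_mem_algM j π v)

theorem compress_zero : compress π (0 : Opr π) = 0 := by
  have := compress_smul π 0 (0 : Opr π)
  rwa [zero_smul, zero_smul] at this

theorem compress_conj_of_mem (v : G) {y : Opr π} (hy : y ∈ lamSpan j π) :
    ∃ f, π.toHom f = compress π y ∧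
      π.toHom (act (X.q v) f) = compress π (star (lam j π.toHom v) * y * lam j π.toHom v) := by
  generalize hb : star (lam j π.toHom v) = b
  generalize hc : lam j π.toHom v = c
  rw [mem_lamSpan] at hy
  induction hy using Submodule.span_induction with
  | mem x hx =>
    obtain ⟨w, rfl⟩ := hx
    rw [← hb, ← hc]
    exact compress_lam_conj j π v w
  | zero =>
    refine ⟨(0 : ℂ) • 1, ?_, ?_⟩
    · rw [map_smul, zero_smul, compress_zero]
    · rw [act_smul, map_smul, zero_smul, mul_zero, zero_mul, compress_zero]
  | add x y _ _ hx hy =>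
    obtain ⟨f, hf, hf'⟩ := hx
    obtain ⟨g, hg, hg'⟩ := hy
    exact ⟨f + g, by rw [map_add, hf, hg, compress_add],
      by rw [act_add, map_add, hf', hg', ← compress_add, mul_add, add_mul]⟩
  | smul c x _ hx =>
    obtain ⟨f, hf, hf'⟩ := hx
    exact ⟨c • f, by rw [map_smul, hf, compress_smul],
      by rw [act_smul, map_smul, hf', ← compress_smul, mul_smul_comm, smul_mul_assoc]⟩

theorem condExp_conj_of_mem (v : G) {y : Opr π} (hy : y ∈ lamSpan j π) :
    (condExp j π ⟨_, conj_mem_algM j π v (lamSpan_le j π hy)⟩ : Opr π) =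
      star (lam j π.toHom v) * condExp j π ⟨y, lamSpan_le j π hy⟩ * lam j π.toHom v := by
  obtain ⟨f, h1, h2⟩ := compress_conj_of_mem j π v hy
  have e1 := condExp_eq j π (x := ⟨y, lamSpan_le j π hy⟩) h1
  have e2 := condExp_eq j π (x := ⟨_, conj_mem_algM j π v (lamSpan_le j π hy)⟩) h2
  refine e2.trans ?_
  rw [e1, lam_covariant]

theorem exists_approx_lamSpan (x : (algM j π).toStarSubalgebra) :
    ∃ (a : Finset (InteriorTensor π.toHom) × ℕ → Opr π) (C : ℝ) (_ : ∀ i, a i ∈ lamSpan j π),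
      (∀ i, ‖a i‖ ≤ C) ∧ WTendsto a atTop (x : Opr π) := by
  obtain ⟨a, ha, hb, hlim⟩ := exists_bounded_approx (lamSpan j π) (algM j π)
    (fun t ht x hx => commute_of_lamSpan j π ht hx) x.2
  exact ⟨a, _, ha, hb, wTendsto_of_strong hlim⟩

/-- Continuity of the conditional expectation along bounded nets in the span of `λ(G)`. -/
theorem condExp_eq_of_lamSpan (b c : Opr π) (hb : b ∈ algM j π) (hc : c ∈ algM j π)
    (L : Opr π → Opr π)
    (hL : ∀ (a : Finset (InteriorTensor π.toHom) × ℕ → Opr π) (x : Opr π),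
      WTendsto a atTop x → WTendsto (fun i => L (a i)) atTop (L x))
    (h : ∀ (y : Opr π) (hy : y ∈ lamSpan j π),
      (condExp j π ⟨b * y * c, mul_mem (mul_mem hb (lamSpan_le j π hy)) hc⟩ : Opr π) =
        L (condExp j π ⟨y, lamSpan_le j π hy⟩)) (x : (algM j π).toStarSubalgebra) :
    (condExp j π ⟨b * x * c, mul_mem (mul_mem hb x.2) hc⟩ : Opr π) = L (condExp j π x) := by
  obtain ⟨a, C, ha, hC, hlim⟩ := exists_approx_lamSpan j π x
  have hE := condExp_isNormalExpectation j π
  have h1 := hE.wTendsto (F := fun i => ⟨a i, lamSpan_le j π (ha i)⟩) (x := x)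
    (Eventually.of_forall hC) hlim
  have h2 := hE.wTendsto (C := ‖b‖ * C * ‖c‖) (F := fun i =>
    ⟨b * a i * c, mul_mem (mul_mem hb (lamSpan_le j π (ha i))) hc⟩)
    (x := ⟨b * x * c, mul_mem (mul_mem hb x.2) hc⟩) (Eventually.of_forall fun i => by
      refine (norm_mul_le _ _).trans ?_
      gcongr
      refine (norm_mul_le _ _).trans ?_
      gcongr
      exact hC i) ((hlim.mul_left b).mul_right c)
  refine h2.unique ((hL _ _ h1).congr' (Eventually.of_forall fun i => ?_))
  exact (h _ (ha i)).symm

theorem condExp_conj (v : G) (x : (algM j π).toStarSubalgebra) :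
    (condExp j π ⟨_, conj_mem_algM j π v x.2⟩ : Opr π) =
      star (lam j π.toHom v) * condExp j π x * lam j π.toHom v :=
  condExp_eq_of_lamSpan j π _ _ (star_mem (lam_mem_algM j π v)) (lam_mem_algM j π v)
    (fun z => star (lam j π.toHom v) * z * lam j π.toHom v)
    (fun _ _ h => (h.mul_left _).mul_right _) (fun _ hy => condExp_conj_of_mem j π v hy) x

theorem lam_j_tmul_one (s : S) (ξ : H) :
    lam j π.toHom (j.j s) (tmul π.toHom 1 ξ) = tmul π.toHom s ξ := by
  have h : sigma j (j.j s) 1 = chiP (dom s) := by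
    apply X.ι_injective
    rw [ι_sigma, ι_chiP j, j.q_j, mul_one, (j.j_one _).2]
    exact j_source j s
  rw [lam_tmul, h, j.q_j, mul_one]
  exact tmul_dom _ _

theorem compress_eq_zero {x : (algM j π).toStarSubalgebra} (h : condExp j π x = 0) :
    compress π x = 0 := by
  obtain ⟨f, hf, h'⟩ := exists_condExp_eq j π x
  rw [h] at h'
  have h1 : f = 0 := diagRep_injective π.injective (h'.symm.trans (map_zero _).symm)
  rw [← hf, h1, map_zero]

theorem condExp_faithful {x : (algM j π).toStarSubalgebra} (h : condExp j π (star x * x) = 0) :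
    x = 0 := by
  apply Subtype.ext
  refine clm_ext_tmul fun s ξ => ?_
  have h1 : condExp j π ⟨_, conj_mem_algM j π (j.j s) (star x * x).2⟩ = 0 := by
    apply Subtype.ext
    rw [condExp_conj, h]
    change _ * (0 : Opr π) * _ = 0
    rw [mul_zero, zero_mul]
  have h2 := congrArg (fun T : H →L[ℂ] H => inner ℂ ξ (T ξ)) (compress_eq_zero j π h1)
  have h3 : star (lam j π.toHom (j.j s)) * (star (x : Opr π) * x) * lam j π.toHom (j.j s) =
      star ((x : Opr π) * lam j π.toHom (j.j s)) * ((x : Opr π) * lam j π.toHom (j.j s)) := by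
    rw [star_mul]; simp only [mul_assoc]
  change inner ℂ ξ (compress π (star (lam j π.toHom (j.j s)) * (star (x : Opr π) * x) *
    lam j π.toHom (j.j s)) ξ) = inner ℂ ξ ((0 : H →L[ℂ] H) ξ) at h2
  rw [h3, inner_compress, mul_apply_eq_comp, inner_star_right, zero_apply, inner_zero_right,
    inner_self_eq_zero, mul_apply_eq_comp, unitIsometry_apply, lam_j_tmul_one] at h2
  exact h2

theorem exists_idem_ne_zero (X : Extension S G) {f : CharAlg S} (hf : f ≠ 0) :
    ∃ e : Idem S, (∃ ρ : Character S, ρ e = true) ∧ ∀ ρ : Character S, ρ e = true → f ρ ≠ 0 := by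
  obtain ⟨ρ, hρ⟩ : ∃ ρ, f ρ ≠ 0 := by
    by_contra! h
    exact hf (ContinuousMap.ext h)
  obtain ⟨U, hU, hρU, hUf⟩ := compact_exists_isClopen_in_isOpen
    (isOpen_ne.preimage f.continuous : IsOpen (f ⁻¹' {y | y ≠ 0})) hρ
  classical
  let p : CharAlg S := ⟨U.indicator fun _ => 1, hU.continuous_indicator continuous_const⟩
  have hp : ∀ τ, p τ = if τ ∈ U then 1 else 0 := fun τ => by
    change U.indicator (fun _ => (1 : ℂ)) τ = _
    rw [Set.indicator_apply]
  obtain ⟨e, he⟩ := exists_chi_eq X (p := p) (by ext τ; rw [ContinuousMap.mul_apply, hp]; split_ifs <;> simp)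
    (by ext τ; rw [ContinuousMap.star_apply, hp]; split_ifs <;> simp)
  have h : ∀ τ : Character S, τ e = true ↔ τ ∈ U := fun τ => by
    rw [← chi_apply_eq_one, he, hp]; split_ifs with h <;> simp [h]
  exact ⟨e, ⟨ρ, (h ρ).2 hρU⟩, fun τ hτ => hUf ((h τ).1 hτ)⟩

theorem mul_idem_eq_of_agree (X : Extension S G) {r : S} {e : Idem S}
    (h : ∀ e' : Idem S, chi e * chi e' = chi e * chi (conjIdem r e')) : r * (e : S) = e := by
  have h1 : ∀ e' : Idem S, (e * e' : S) = e * (dag r * e' * r) := fun e' => by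
    have h2 := h e'
    rw [chi_mul e e' (idemMul e e') rfl, chi_mul e _ (idemMul e (conjIdem r e')) rfl] at h2
    exact congrArg Subtype.val (chi_injective X h2)
  have h2 : (e : S) * dag r = e := by
    refine IsCartanInverseMonoid.fundamental _ _ fun e' he' => ?_
    rw [dag_mul, dag_dag, dag_idem e.2]
    calc (e : S) * dag r * e' * (r * e) = e * (dag r * e' * r) * e := by simp only [mul_assoc]
      _ = _ := by rw [← h1 ⟨e', he'⟩]
  have h3 := congrArg dag h2
  rwa [dag_mul, dag_dag, dag_idem e.2] at h3

theorem compress_lam_mul_eq_zero {x : (algM j π).toStarSubalgebra}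
    (hx : ∀ f, diagRep π.toHom f * (x : Opr π) = x * diagRep π.toHom f)
    (h0 : condExp j π x = 0) (v : G) : compress π (lam j π.toHom v * x) = 0 := by
  obtain ⟨f, hf⟩ := exists_compress_eq j π (mul_mem (lam_mem_algM j π v) x.2)
  suffices f = 0 by rw [← hf, this, map_zero]
  by_contra hne
  have h1 : ∀ g, f * g = f * act (X.q v) g := fun g => by
    apply π.injective
    rw [mul_comm, map_mul, map_mul, hf, ← compress_mul_diagRep, ← compress_diagRep_mul,
      ← mul_assoc, diagRep_mul_lam, mul_assoc, hx, mul_assoc]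
  obtain ⟨e, ⟨ρ, hρ⟩, he⟩ := exists_idem_ne_zero X hne
  have h2 : X.q v * (e : S) = e := mul_idem_eq_of_agree X fun e' => by
    rw [← act_chi]
    ext τ
    have h3 := congrArg (fun k : CharAlg S => k τ) (h1 (chi e'))
    simp only [ContinuousMap.mul_apply] at h3 ⊢
    rw [chi_apply e]
    split_ifs with h4
    · rw [mul_left_cancel₀ (he τ h4) h3]
    · rw [zero_mul, zero_mul]
  obtain ⟨p, hp⟩ := (X.isIdempotentElem_q_iff (v * j.j e)).1 (by
    rw [map_mul, j.q_j, h2]; exact e.2)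
  have h3 : f * chi e = 0 := by
    apply π.injective
    rw [map_mul, hf, ← compress_mul_diagRep, mul_assoc, ← hx, ← mul_assoc, diagRep_chi j,
      ← lam_mul, ← hp, lam_ι, compress_diagRep_mul, compress_eq_zero j π h0, mul_zero, map_zero]
  have h4 := congrArg (fun k : CharAlg S => k ρ) h3
  simp only [ContinuousMap.mul_apply, ContinuousMap.zero_apply] at h4
  rw [chi_apply_eq_one.2 hρ, mul_one] at h4
  exact he ρ hρ h4

theorem eq_condExp_of_commute {x : (algM j π).toStarSubalgebra}
    (hx : ∀ f, diagRep π.toHom f * (x : Opr π) = x * diagRep π.toHom f) :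
    (x : Opr π) = condExp j π x := by
  have hE := condExp_isNormalExpectation j π
  let y : (algM j π).toStarSubalgebra := ⟨condExp j π x, algD_le_algM j π (condExp j π x).2⟩
  obtain ⟨k, -, hk⟩ := exists_condExp_eq j π x
  have hyx : ∀ f, diagRep π.toHom f * ((x - y : (algM j π).toStarSubalgebra) : Opr π) =
      (x - y : (algM j π).toStarSubalgebra) * diagRep π.toHom f := fun f => by
    change diagRep π.toHom f * ((x : Opr π) - (condExp j π x : Opr π)) =
      ((x : Opr π) - (condExp j π x : Opr π)) * diagRep π.toHom f
    rw [mul_sub, sub_mul, hx, hk, ← map_mul, ← map_mul, mul_comm f k]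
  have h0 : condExp j π (x - y) = 0 := by
    rw [map_sub, hE.map_mem y (condExp j π x) rfl, sub_self]
  have h1 : ∀ z : (algM j π).toStarSubalgebra, condExp j π (z * (x - y)) = 0 := by
    intro z
    apply Subtype.ext
    have h2 := condExp_eq_of_lamSpan j π 1 (x - y : (algM j π).toStarSubalgebra) (one_mem _)
      (x - y : (algM j π).toStarSubalgebra).2 (fun _ => 0) (fun a x _ => wTendsto_const _)
      (fun w hw => ?_) z
    · simp only [one_mul] at h2
      exact h2
    · have h3 : compress π (1 * w * (x - y : (algM j π).toStarSubalgebra)) = 0 := by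
        rw [one_mul]
        rw [mem_lamSpan] at hw
        induction hw using Submodule.span_induction with
        | mem _ hv =>
          obtain ⟨v, rfl⟩ := hv
          exact compress_lam_mul_eq_zero j π hyx h0 v
        | zero => rw [zero_mul, compress_zero]
        | add a b _ _ ha hb => rw [add_mul, compress_add, ha, hb, add_zero]
        | smul c a _ ha => rw [smul_mul_assoc, compress_smul, ha, smul_zero]
      rw [condExp_eq j π (f := 0) (by rw [map_zero, h3]), map_zero]
  have h2 := condExp_faithful j π (h1 (star (x - y)))
  rw [sub_eq_zero] at h2
  exact congrArg Subtype.val h2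

/-- The pair constructed from an extension is a Cartan pair. -/
theorem isCartanPair : IsCartanPair (algM j π) (algD j π) where
  le := algD_le_algM j π
  masa x hx := by
    constructor
    · intro h d hd
      obtain ⟨f, rfl⟩ := (mem_algD j π).1 h
      obtain ⟨g, rfl⟩ := (mem_algD j π).1 hd
      rw [← map_mul, ← map_mul, mul_comm]
    · intro h
      have := eq_condExp_of_commute j π (x := ⟨x, hx⟩) fun f => h _ (diagRep_mem_algD j π f)
      change x = _ at this
      rw [this]
      exact (condExp j π ⟨x, hx⟩).2
  exists_expectation := ⟨condExp j π, condExp_isNormalExpectation j π,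
    fun _ h => condExp_faithful j π h⟩
  regular := algM_regular j π

end pair

/-- Maximal families of pairwise related elements. -/
theorem exists_maximal_pairwise {α : Type*} (R : α → α → Prop) (B C₀ : Set α) (h₀ : C₀ ⊆ B)
    (hp : C₀.Pairwise R) : ∃ C, C₀ ⊆ C ∧ C ⊆ B ∧ C.Pairwise R ∧
      ∀ a ∈ B, (∀ c ∈ C, c ≠ a → R a c ∧ R c a) → a ∈ C := by
  obtain ⟨C, hC₀, hC⟩ := zorn_subset_nonempty {C | C ⊆ B ∧ C.Pairwise R} (fun c hc hchain _ =>
    ⟨⋃₀ c, ⟨Set.sUnion_subset fun s hs => (hc hs).1,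
      (Set.pairwise_sUnion hchain.directedOn).2 fun s hs => (hc hs).2⟩,
      fun s hs => Set.subset_sUnion_of_mem hs⟩) C₀ ⟨h₀, hp⟩
  refine ⟨C, hC₀, hC.prop.1, hC.prop.2, fun a ha hac => ?_⟩
  have h : insert a C ∈ {C | C ⊆ B ∧ C.Pairwise R} :=
    ⟨Set.insert_subset ha hC.prop.1, hC.prop.2.insert fun c hc hne => hac c hc hne.symm⟩
  exact hC.le_of_ge h (Set.subset_insert a C) (Set.mem_insert a C)

section pair
variable {S G H : Type*} [MonoidWithZero S] [IsCartanInverseMonoid S]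
  [Semigroup G] [IsInverseSemigroup G] [NormedAddCommGroup H] [InnerProductSpace ℂ H]
  [CompleteSpace H] {X : Extension S G} (j : OrderSection X) (π : FaithfulNormalRep S H)

/-- The function `χ_e` as an operator on `𝔄 ⊗_π H`. -/
noncomputable abbrev proj (e : Idem S) : Opr π := diagRep π.toHom (chi e)

theorem proj_mul_self (e : Idem S) : proj π e * proj π e = proj π e := by
  rw [← map_mul, chi_mul_self]

theorem star_proj (e : Idem S) : star (proj π e) = proj π e := by
  rw [← map_star, star_chi]

theorem proj_mul (e f : Idem S) : proj π e * proj π f = proj π (idemMul e f) := by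
  rw [← map_mul, chi_mul e f (idemMul e f) rfl]

theorem proj_eq_zero (X : Extension S G) {e : Idem S} (h : proj π e = 0) : (e : S) = 0 := by
  have h1 : chi e = chi (⟨0, zero_mul 0⟩ : Idem S) := by
    rw [chi_zero ⟨0, zero_mul 0⟩ rfl]
    exact diagRep_injective π.injective (h.trans (map_zero _).symm)
  exact congrArg Subtype.val (chi_injective X h1)

theorem q_eq_zero {g : G} (h : lam j π.toHom g = 0) : X.q g = 0 := by
  have h1 := star_lam_mul_lam_eq j π.toHom g
  rw [h, mul_zero] at h1
  have h2 := proj_eq_zero π X h1.symm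
  rw [← mul_dom (X.q g), h2, mul_zero]

theorem isGroupoidNormalizer_mul {v w : Opr π}
    (hv : IsGroupoidNormalizer (algM j π) (algD j π) v)
    (hw : IsGroupoidNormalizer (algM j π) (algD j π) w) :
    IsGroupoidNormalizer (algM j π) (algD j π) (v * w) :=
  (groupoidNormalizers (isCartanPair j π)).mul_mem hv hw

theorem isGroupoidNormalizer_proj (e : Idem S) :
    IsGroupoidNormalizer (algM j π) (algD j π) (proj π e) := by
  have := lam_isGroupoidNormalizer j π (j.j e)
  rwa [← diagRep_chi] at this

theorem exists_partial_eq {x : Opr π} (hx : x ∈ algD j π) (hx' : x * star x * x = x) :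
    ∃ p : partialIsometries S, lam j π.toHom (X.ι p) = x := by
  obtain ⟨f, rfl⟩ := (mem_algD j π).1 hx
  refine ⟨⟨f, ?_⟩, lam_ι j _ _⟩
  apply diagRep_injective π.injective
  rw [map_mul, map_mul, map_star, hx']

theorem exists_condExp_star_lam_mul_ne_zero {w : Opr π} (hw : w ∈ algM j π) (h0 : w ≠ 0) :
    ∃ v : G, condExp j π ⟨star (lam j π.toHom v) * w,
      mul_mem (star_mem (lam_mem_algM j π v)) hw⟩ ≠ 0 := by
  by_contra! h
  have h1 : ∀ v : G, compress π (lam j π.toHom v * w) = 0 := fun v => by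
    have := compress_eq_zero j π (h (dag v))
    change compress π (star (lam j π.toHom (dag v)) * w) = 0 at this
    rwa [lam_dag, star_star] at this
  have h2 := condExp_eq_of_lamSpan j π 1 w (one_mem _) hw (fun _ => 0)
    (fun a x _ => wTendsto_const _) (fun y hy => by
      have h3 : compress π (1 * y * w) = 0 := by
        rw [one_mul]
        rw [mem_lamSpan] at hy
        induction hy using Submodule.span_induction with
        | mem _ hv =>
          obtain ⟨v, rfl⟩ := hv
          exact h1 v
        | zero => rw [zero_mul, compress_zero]
        | add a b _ _ ha hb => rw [add_mul, compress_add, ha, hb, add_zero]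
        | smul c a _ ha => rw [smul_mul_assoc, compress_smul, ha, smul_zero]
      rw [condExp_eq j π (f := 0) (by rw [map_zero, h3]), map_zero]) ⟨star w, star_mem hw⟩
  have h4 : condExp j π (star ⟨w, hw⟩ * ⟨w, hw⟩) = 0 := by
    apply Subtype.ext
    simp only [one_mul] at h2
    exact h2
  exact h0 (congrArg Subtype.val (condExp_faithful j π h4))

/-- Every nonzero groupoid normalizer has a nonzero restriction in `λ(G)`. -/
theorem exists_restriction {w : Opr π} (hw : IsGroupoidNormalizer (algM j π) (algD j π) w)
    (h0 : w ≠ 0) : ∃ (x : Idem S) (g : G), lam j π.toHom g = w * proj π x ∧ w * proj π x ≠ 0 := by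
  obtain ⟨v, hv⟩ := exists_condExp_star_lam_mul_ne_zero j π hw.1 h0
  have hu := isGroupoidNormalizer_mul j π (lam_isGroupoidNormalizer j π v).adjoint hw
  obtain ⟨e, he, heD, -⟩ := exists_expectation_eq (isCartanPair j π)
    (condExp_isNormalExpectation j π) ⟨_, hu⟩
  have hne : star (lam j π.toHom v) * w * (e : GN (isCartanPair j π)) ≠ 0 := fun h => by
    apply hv
    apply Subtype.ext
    exact he.trans h
  have heGN : IsGroupoidNormalizer (algM j π) (algD j π) (e : GN (isCartanPair j π)) :=
    (e : GN (isCartanPair j π)).2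
  obtain ⟨p, hp⟩ := exists_partial_eq j π heD
    (isGroupoidNormalizer_mul j π hu heGN).2.1
  have hee : ((e : GN (isCartanPair j π)) : Opr π) ∈ algD j π := idem_GN _ e.2
  set e' : Opr π := ((e : GN (isCartanPair j π)) : Opr π)
  have hproj : IsStarProjection e' := isStarProjection_idem e.2
  set L := lam j π.toHom v with hL
  have hc : star w * (L * star L) * w ∈ algD j π :=
    (hw.2.2 _ (lam_isGroupoidNormalizer j π v).mul_star_mem).2
  have hcp : star w * (L * star L) * w * e' = star (star L * w * e') * (star L * w * e') := by
    rw [star_mul, star_mul, star_star, hproj.isSelfAdjoint.star_eq]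
    have hcomm := (isCartanPair j π).comm hc hee
    calc star w * (L * star L) * w * e' = star w * (L * star L) * w * (e' * e') := by
          rw [hproj.isIdempotentElem.eq]
      _ = e' * (star w * (L * star L) * w) * e' := by rw [← mul_assoc, hcomm]
      _ = _ := by simp only [mul_assoc]
  have hz : proj π (dom (X.q (X.ι p))) = star w * (L * star L) * w * e' := by
    rw [hcp]
    change _ = star (star L * w * e') * (star L * w * e')
    rw [← hp, star_lam_mul_lam_eq]
  have hwz : w * proj π (dom (X.q (X.ι p))) = L * (star L * w * e') := by
    rw [hz]
    have h1 : w * star w * (L * star L) = L * star L * (w * star w) :=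
      (isCartanPair j π).comm hw.mul_star_mem (lam_isGroupoidNormalizer j π v).mul_star_mem
    calc w * (star w * (L * star L) * w * e') = (w * star w * (L * star L)) * w * e' := by
          simp only [mul_assoc]
      _ = L * star L * (w * star w * w) * e' := by rw [h1]; simp only [mul_assoc]
      _ = _ := by rw [hw.2.1]; simp only [mul_assoc]
  refine ⟨dom (X.q (X.ι p)), v * X.ι p, ?_, fun h => hne ?_⟩
  · rw [lam_mul, hwz, hp]
  · rw [hwz] at h
    have h2 : star L * (L * (star L * w * e')) = star L * w * e' := by
      have := (lam_isGroupoidNormalizer j π v).adjoint.2.1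
      rw [star_star] at this
      rw [← mul_assoc, ← mul_assoc, ← mul_assoc, this]
    rw [← h2, h, mul_zero]

theorem exists_lam_eq_mul {g g' : G} (h : X.q g = X.q g') :
    ∃ p : partialIsometries S, g = g' * X.ι p := by
  obtain ⟨p, hp⟩ := (X.isIdempotentElem_q_iff (dag g' * g)).1 (by
    rw [map_mul, map_dag, h]; exact idem_dag_mul _)
  refine ⟨p, ?_⟩
  have h1 : g' * dag g' = g * dag g := q_injOn X (idem_mul_dag _) (idem_mul_dag _) (by
    rw [map_mul, map_mul, map_dag, map_dag, h])
  rw [hp, ← mul_assoc, h1, mul_dag_mul]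

/-- The operators `λ(v)` exhaust the groupoid normalizers. -/
theorem exists_lam_eq {w : Opr π} (hw : IsGroupoidNormalizer (algM j π) (algD j π) w) :
    ∃ g : G, lam j π.toHom g = w := by
  have hCP := isCartanPair j π
  let B : Set (Idem S) := {x | w * proj π x ≠ 0 ∧ ∃ g : G, lam j π.toHom g = w * proj π x}
  obtain ⟨C, -, hCB, hCp, hmax⟩ := exists_maximal_pairwise
    (fun x y : Idem S => (x * y : S) = 0) B ∅ (Set.empty_subset _) (Set.pairwise_empty _)
  have hg : ∀ x : C, ∃ g : G, lam j π.toHom g = w * proj π (x : Idem S) := fun x => (hCB x.2).2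
  choose g hg using hg
  have hdisj : ∀ x y : C, x ≠ y → proj π (x : Idem S) * proj π (y : Idem S) = 0 := fun x y hxy => by
    have h1 := hCp x.2 y.2 (fun h => hxy (Subtype.ext h))
    rw [proj_mul, show idemMul (x : Idem S) y = ⟨0, zero_mul 0⟩ from Subtype.ext h1]
    unfold proj
    rw [chi_zero _ rfl, map_zero]
  have horth : (Set.range fun x => X.q (g x)).Pairwise Orthogonal := by
    rintro _ ⟨x, rfl⟩ _ ⟨y, rfl⟩ hne
    have hxy : x ≠ y := fun h => hne (by rw [h])
    constructor
    · rw [← map_dag, ← map_mul]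
      refine q_eq_zero j π ?_
      have h1 := hCP.comm hw.star_mul_mem (diagRep_mem_algD j π (chi (y : Idem S)))
      rw [lam_mul, lam_dag, hg, hg, star_mul, star_proj]
      calc proj π (x : Idem S) * star w * (w * proj π (y : Idem S))
          = proj π (x : Idem S) * (star w * w * proj π (y : Idem S)) := by simp only [mul_assoc]
        _ = 0 := by rw [h1, ← mul_assoc, hdisj x y hxy, zero_mul]
    · rw [← map_dag, ← map_mul]
      refine q_eq_zero j π ?_
      rw [lam_mul, lam_dag, hg, hg, star_mul, star_proj]
      calc w * proj π (y : Idem S) * (proj π (x : Idem S) * star w)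
          = w * (proj π (y : Idem S) * proj π (x : Idem S)) * star w := by simp only [mul_assoc]
        _ = 0 := by rw [hdisj y x hxy.symm, mul_zero, zero_mul]
  obtain ⟨m, hm⟩ := IsCompleteBooleanInverseMonoid.exists_join_of_pairwise _ horth
  have hLM := lam_isGroupoidNormalizer j π (j.j m)
  set L := lam j π.toHom (j.j m) with hL
  obtain ⟨P, hPD, hP, hP1, hP2⟩ := exists_sup_projection (algD j π)
    {a | ∃ x ∈ C, a = proj π x} (by rintro _ ⟨x, -, rfl⟩; exact diagRep_mem_algD j π _)
  have hmem : ∀ x : C, star L * w * proj π (x : Idem S) ∈ algD j π := fun x => by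
    obtain ⟨e, he, hle⟩ := hm.1 _ ⟨x, rfl⟩
    obtain ⟨p, hp⟩ := exists_lam_eq_mul (X := X) (g := g x) (g' := j.j m * j.j e) (by
      rw [map_mul, j.q_j, j.q_j]; exact hle)
    rw [mul_assoc, ← hg, hp, mul_assoc, lam_mul, lam_mul, lam_ι, ← mul_assoc]
    refine mul_mem ?_ (mul_mem ?_ (diagRep_mem_algD j π _))
    · exact hLM.star_mul_mem
    · rw [lam_idem_eq j π (j_idem j he)]
      exact diagRep_mem_algD j π _
  have hwP : w * P = w := by
    obtain ⟨f, hf⟩ := (mem_algD j π).1 hPD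
    obtain ⟨y, hy⟩ := exists_chi_eq X (p := 1 - f)
      (diagRep_injective π.injective (by
        rw [map_mul, map_sub, map_one, hf]; exact hP.one_sub.isIdempotentElem))
      (diagRep_injective π.injective (by
        rw [map_star, map_sub, map_one, hf]; exact hP.one_sub.isSelfAdjoint.star_eq))
    have hyP : proj π y = 1 - P := by
      change diagRep π.toHom (chi y) = _
      rw [hy, map_sub, map_one, hf]
    by_contra hne
    have hwy : w * proj π y ≠ 0 := fun h => hne (by
      rw [hyP, mul_sub, mul_one, sub_eq_zero] at h
      exact h.symm)
    obtain ⟨x, g', hg', hx⟩ := exists_restriction j π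
      (isGroupoidNormalizer_mul j π hw (isGroupoidNormalizer_proj j π y)) hwy
    rw [mul_assoc, proj_mul] at hg' hx
    have hzero : ∀ c ∈ C, proj π (idemMul y x) * proj π c = 0 := fun c hc => by
      have h1 : P * proj π c = proj π c := hP1 _ ⟨c, hc, rfl⟩
      have h2 := hCP.comm (diagRep_mem_algD j π (chi y)) (diagRep_mem_algD j π (chi x))
      rw [← proj_mul, h2]
      change proj π x * proj π y * proj π c = 0
      rw [hyP, mul_assoc, sub_mul, one_mul, h1, sub_self, mul_zero]
    have hzero' : ∀ c ∈ C, (idemMul y x * c : S) = 0 := fun c hc => by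
      have h1 := hzero c hc
      rw [proj_mul] at h1
      exact proj_eq_zero π X h1
    have hin := hmax (idemMul y x) ⟨hx, g', hg'⟩ fun c hc _ =>
      ⟨hzero' c hc, by rw [idem_comm c.2 (idemMul y x).2]; exact hzero' c hc⟩
    have h3 := hzero _ hin
    rw [proj_mul_self] at h3
    exact hx (by rw [h3, mul_zero])
  have huM : star L * w ∈ algM j π := mul_mem (star_mem hLM.1) hw.1
  have hu : star L * w ∈ algD j π := by
    refine (hCP.masa _ huM).2 fun d hd => ?_
    have h1 : (d * (star L * w) - star L * w * d) * P = 0 := hP2 _ (by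
      rintro _ ⟨x, hx, rfl⟩
      have h2 := hCP.comm hd (hmem ⟨x, hx⟩)
      have h3 := hCP.comm hd (diagRep_mem_algD j π (chi x))
      rw [sub_mul, sub_eq_zero, mul_assoc, h2, mul_assoc (star L * w) d, h3]
      simp only [mul_assoc])
    have h4 : star L * w * P = star L * w := by rw [mul_assoc, hwP]
    rw [sub_mul, sub_eq_zero, mul_assoc d, h4, mul_assoc _ d, hCP.comm hd hPD] at h1
    rw [h1, ← mul_assoc, h4]
  have hLu : L * (star L * w) = w := by
    have h1 : (L * (star L * w) - w) * P = 0 := hP2 _ (by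
      rintro _ ⟨x, hx, rfl⟩
      have h2 : j.j m * dag (j.j m) * g ⟨x, hx⟩ = g ⟨x, hx⟩ := by
        obtain ⟨e, he, hle⟩ := hm.1 _ ⟨⟨x, hx⟩, rfl⟩
        obtain ⟨p, hp⟩ := exists_lam_eq_mul (X := X) (g := g ⟨x, hx⟩) (g' := j.j m * j.j e) (by
          rw [map_mul, j.q_j, j.q_j]; exact hle)
        rw [hp, ← mul_assoc, ← mul_assoc, mul_dag_mul]
      rw [sub_mul, sub_eq_zero, mul_assoc, mul_assoc (star L), ← hg ⟨x, hx⟩, hL, ← lam_dag,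
        ← lam_mul, ← lam_mul, ← mul_assoc, h2])
    rw [sub_mul, hwP, sub_eq_zero, mul_assoc, mul_assoc (star L), hwP] at h1
    exact h1
  obtain ⟨p, hp⟩ := exists_partial_eq j π hu
    (isGroupoidNormalizer_mul j π hLM.adjoint hw).2.1
  exact ⟨j.j m * X.ι p, by rw [lam_mul, hp, hLu]⟩

theorem range_lam : Set.range (lam j π.toHom) =
    {v | IsGroupoidNormalizer (algM j π) (algD j π) v} :=
  Set.Subset.antisymm (by rintro _ ⟨v, rfl⟩; exact lam_isGroupoidNormalizer j π v)
    fun _ hw => exists_lam_eq j π hw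

theorem q_eq_of_conj {g g' : G}
    (h : ∀ e : G, IsIdempotentElem e → g * e * dag g = g' * e * dag g') (j : OrderSection X) :
    X.q g = X.q g' := by
  refine IsCartanInverseMonoid.fundamental _ _ fun e he => ?_
  have := congrArg X.q (h _ (j_idem j he))
  simpa only [map_mul, map_dag, j.q_j] using this

theorem lam_injective : Function.Injective (lam j π.toHom) := by
  intro g g' h
  have hidem : ∀ a b : G, IsIdempotentElem a → IsIdempotentElem b →
      lam j π.toHom a = lam j π.toHom b → a = b := fun a b ha hb hab => by
    rw [lam_idem_eq j π ha, lam_idem_eq j π hb] at hab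
    exact q_injOn X ha hb (congrArg Subtype.val (chi_injective X (diagRep_injective π.injective hab)))
  have hq : X.q g = X.q g' := q_eq_of_conj (fun e he => by
    refine hidem _ _ (idem_conj g he) (idem_conj g' he) ?_
    rw [lam_mul, lam_mul, lam_mul, lam_mul, lam_dag, lam_dag, h]) j
  obtain ⟨p, hp⟩ := exists_lam_eq_mul hq
  have h1 : X.ι (chiP (dom (X.q g'))) = dag g' * g' := by
    refine q_injOn X ?_ (idem_dag_mul g') ?_
    · rw [IsIdempotentElem, ← map_mul]
      exact congrArg _ (Subtype.ext (chi_mul_self _))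
    · rw [X.q_ι_chiP, map_mul, map_dag]; rfl
  have h2 : chiP (dom (X.q g')) * p = chiP (dom (X.q g')) := by
    apply Subtype.ext
    apply diagRep_injective π.injective
    change diagRep π.toHom (chi (dom (X.q g')) * p) = diagRep π.toHom (chi (dom (X.q g')))
    rw [map_mul, ← star_lam_mul_lam_eq j, ← lam_ι j, mul_assoc, ← lam_mul, ← hp, h]
  calc g = g' * dag g' * g' * X.ι p := by rw [mul_dag_mul, hp]
    _ = g' * (X.ι (chiP (dom (X.q g'))) * X.ι p) := by rw [h1]; simp only [mul_assoc]
    _ = g' := by rw [← map_mul, h2, h1, ← mul_assoc, mul_dag_mul]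

/-- The isomorphism `λ` of `G` onto the groupoid normalizers. -/
noncomputable def lamEquiv : G ≃* GN (isCartanPair j π) :=
  MulEquiv.ofBijective
    ({ toFun := fun g => ⟨lam j π.toHom g, lam_isGroupoidNormalizer j π g⟩
       map_mul' := fun g g' => Subtype.ext (lam_mul j _ g g') } : G →ₙ* GN (isCartanPair j π))
    ⟨fun _ _ h => lam_injective j π (congrArg Subtype.val h), fun w => by
      obtain ⟨g, hg⟩ := exists_lam_eq j π w.2
      exact ⟨g, Subtype.ext hg⟩⟩

theorem coe_lamEquiv (g : G) : (lamEquiv j π g : Opr π) = lam j π.toHom g := rfl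

theorem munn_lamEquiv_eq_iff {g g' : G} :
    (lamEquiv j π g : MunnQuotient (GN (isCartanPair j π))) = lamEquiv j π g' ↔ X.q g = X.q g' := by
  have h1 : (lamEquiv j π g : MunnQuotient (GN (isCartanPair j π))) = lamEquiv j π g' ↔
      munnCon G g g' := by
    rw [Con.eq, munnCon_eq_comap (lamEquiv j π)]; rfl
  rw [h1]
  refine ⟨fun h => q_eq_of_conj h j, fun h e he => ?_⟩
  refine q_injOn X (idem_conj g he) (idem_conj g' he) ?_
  simp only [map_mul, map_dag, h]

/-- The isomorphism of `S` onto the Munn quotient of the groupoid normalizers. -/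
noncomputable def munnEquiv : S ≃* MunnQuotient (GN (isCartanPair j π)) :=
  MulEquiv.ofBijective
    ({ toFun := fun s => lamEquiv j π (j.j s)
       map_mul' := fun s t => by
        rw [← Con.coe_mul, ← map_mul, munn_lamEquiv_eq_iff, map_mul, j.q_j, j.q_j, j.q_j] } :
      S →ₙ* MunnQuotient (GN (isCartanPair j π)))
    ⟨fun s t h => by
      have := (munn_lamEquiv_eq_iff j π).1 h
      rwa [j.q_j, j.q_j] at this, fun x => by
      induction x using Con.induction_on with
      | H v =>
        refine ⟨X.q ((lamEquiv j π).symm v), ?_⟩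
        have h : (lamEquiv j π (j.j (X.q ((lamEquiv j π).symm v))) :
            MunnQuotient (GN (isCartanPair j π))) = lamEquiv j π ((lamEquiv j π).symm v) := by
          rw [munn_lamEquiv_eq_iff, j.q_j]
        rw [MulEquiv.apply_symm_apply] at h
        exact h⟩

theorem munnEquiv_apply (s : S) : munnEquiv j π s = (lamEquiv j π (j.j s)) := rfl

/-- The extension for the constructed Cartan pair is equivalent to the given one. -/
theorem extEquiv_of_isExtensionOf
    {Y : Extension (MunnQuotient (GN (isCartanPair j π))) (GN (isCartanPair j π))}
    (hY : IsExtensionOf (isCartanPair j π) Y) : ExtEquiv X Y := by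
  obtain ⟨hq, Φ, hΦ, hι⟩ := hY
  refine ⟨munnEquiv j π, lamEquiv j π, fun g => ?_, fun p => ?_⟩
  · rw [hq, munnEquiv_apply, munn_lamEquiv_eq_iff, j.q_j]
  · obtain ⟨hc, -⟩ := exists_charAlg_equiv (isCartanPair j π)
    let ψ : CharAlg S →⋆ₐ[ℂ] Opr π :=
      (repOf Φ).comp (ContinuousMap.compStarAlgHom' ℂ ℂ (characterMap (munnEquiv j π)))
    have hψ : ∀ f, ψ f = diagRep π.toHom f := fun f =>
      mem_of_chi (LinearMap.eqLocus (ψ.toAlgHom.toLinearMap)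
          ((diagRep π.toHom).toAlgHom.toLinearMap))
        (isClosed_eq (map_continuous ψ) (map_continuous (diagRep π.toHom))) (fun e => by
          have he : IsIdempotentElem (lamEquiv j π (j.j e)) := by
            rw [IsIdempotentElem, ← map_mul, (j_idem j e.2).eq]
          change (Φ (chi ⟨((lamEquiv j π (j.j e) : GN (isCartanPair j π)) :
            MunnQuotient (GN (isCartanPair j π))), idem_mk ⟨_, he⟩⟩) : Opr π) = diagRep π.toHom (chi e)
          rw [hΦ ⟨_, he⟩, diagRep_chi j]; rfl) f
    apply Subtype.ext
    rw [hι, coe_lamEquiv, lam_ι]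
    exact hψ p

end pair

section orderSection
variable {S G : Type*} [MonoidWithZero S] [IsCartanInverseMonoid S]
  [Semigroup G] [IsInverseSemigroup G] (X : Extension S G)

theorem dag_mul_self_eq_ι (g : G) : dag g * g = X.ι (chiP (dom (X.q g))) := by
  refine q_injOn X (idem_dag_mul g) ?_ ?_
  · rw [IsIdempotentElem, ← map_mul]
    exact congrArg _ (Subtype.ext (chi_mul_self _))
  · rw [X.q_ι_chiP, map_mul, map_dag]; rfl

theorem mul_ι_one (g : G) : g * X.ι 1 = g := by
  conv_lhs => rw [← mul_dag_mul g, mul_assoc g, dag_mul_self_eq_ι X, mul_assoc, ← map_mul, mul_one,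
    ← dag_mul_self_eq_ι]
  rw [← mul_assoc, mul_dag_mul]

theorem ι_one_mul (g : G) : X.ι 1 * g = g := by
  have h := mul_ι_one X (dag g)
  have h1 := congrArg dag h
  rw [dag_mul, dag_dag, dag_idem] at h1
  · exact h1
  · rw [IsIdempotentElem, ← map_mul, mul_one]

theorem q_ι_one : X.q (X.ι 1) = 1 := by
  have h : (1 : partialIsometries S) = chiP ⟨1, mul_one 1⟩ :=
    Subtype.ext (chi_one (⟨1, mul_one 1⟩ : Idem S) rfl).symm
  rw [h, X.q_ι_chiP]

/-- The zero of the partial isometries. -/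
noncomputable def zeroP (S : Type*) [MonoidWithZero S] : partialIsometries S :=
  ⟨0, by change (0 : CharAlg S) * star 0 * 0 = 0; rw [mul_zero]⟩

theorem mul_ι_zero (g : G) : g * X.ι (zeroP S) = X.ι (zeroP S) := by
  have h0 : zeroP S = chiP ⟨0, zero_mul 0⟩ := Subtype.ext (chi_zero _ rfl).symm
  have hz : ∀ p : partialIsometries S, p * zeroP S = zeroP S := fun p => Subtype.ext (mul_zero _)
  obtain ⟨p, hp⟩ := (X.isIdempotentElem_q_iff (g * X.ι (zeroP S))).1 (by
    rw [map_mul, h0, X.q_ι_chiP, mul_zero]; exact zero_mul 0)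
  calc g * X.ι (zeroP S) = g * X.ι (zeroP S) * X.ι (zeroP S) := by
        rw [mul_assoc, ← map_mul, hz]
    _ = X.ι (zeroP S) := by rw [← hp, ← map_mul, hz]

theorem mul_ι_dom (g : G) : g * X.ι (chiP (dom (X.q g))) = g := by
  rw [← dag_mul_self_eq_ι, ← mul_assoc, mul_dag_mul]

/-- `e` is the supremum of the family `E`. -/
def IsSup {ι : Type*} (E : ι → Idem S) (e : Idem S) : Prop :=
  (∀ i, (e * E i : S) = E i) ∧ ∀ y : Idem S, (e * y : S) = y → (∀ i, (y * E i : S) = 0) → (y : S) = 0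

variable {X}

theorem IsSup.eq_zero (X : Extension S G) {ι : Type*} {E : ι → Idem S} {e : Idem S} (h : IsSup E e)
    {f : CharAlg S} (hf : f * chi e = f) (h' : ∀ i, f * chi (E i) = 0) : f = 0 := by
  by_contra hne
  obtain ⟨y, ⟨ρ, hρ⟩, hy⟩ := exists_idem_ne_zero X hne
  have h1 : (e * y : S) = y := by
    have : chi (idemMul e y) = chi y := by
      rw [← chi_mul e y _ rfl]
      ext τ
      rw [ContinuousMap.mul_apply]
      by_cases hτ : τ y = true
      · have h2 := congrArg (fun k : CharAlg S => k τ) hf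
        simp only [ContinuousMap.mul_apply] at h2
        rw [mul_left_cancel₀ (hy τ hτ) (h2.trans (mul_one _).symm), one_mul]
      · rw [chi_apply y, if_neg hτ, mul_zero]
    exact congrArg Subtype.val (chi_injective X this)
  have h2 : (y : S) = 0 := h.2 y h1 fun i => by
    have : chi (idemMul y (E i)) = chi (⟨0, zero_mul 0⟩ : Idem S) := by
      rw [← chi_mul y (E i) _ rfl, chi_zero (⟨0, zero_mul 0⟩ : Idem S) rfl]
      ext τ
      rw [ContinuousMap.mul_apply, ContinuousMap.zero_apply]
      by_cases hτ : τ y = true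
      · have h2 := congrArg (fun k : CharAlg S => k τ) (h' i)
        simp only [ContinuousMap.mul_apply, ContinuousMap.zero_apply] at h2
        rw [(mul_eq_zero.1 h2).resolve_left (hy τ hτ), mul_zero]
      · rw [chi_apply y, if_neg hτ, zero_mul]
    exact congrArg Subtype.val (chi_injective X this)
  have := ρ.2.1 y h2
  rw [show ρ.1 y = true from hρ] at this
  exact Bool.noConfusion this

theorem eq_of_mul_ι_eq {ι : Type*} {E : ι → Idem S} {g g' : G} (hq : X.q g = X.q g')
    (h : IsSup E (dom (X.q g'))) (h' : ∀ i, g * X.ι (chiP (E i)) = g' * X.ι (chiP (E i))) :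
    g = g' := by
  obtain ⟨p, hp⟩ := (X.isIdempotentElem_q_iff (dag g' * g)).1 (by
    rw [map_mul, map_dag, hq]; exact idem_dag_mul _)
  have h0 : (p : CharAlg S) * chi (dom (X.q g')) - chi (dom (X.q g')) = 0 := by
    refine h.eq_zero X ?_ fun i => ?_
    · rw [sub_mul, mul_assoc, chi_mul_self]
    · have h1 : X.ι p * X.ι (chiP (E i)) = X.ι (chiP (dom (X.q g'))) * X.ι (chiP (E i)) := by
        rw [hp, mul_assoc, h', ← mul_assoc, dag_mul_self_eq_ι X]
      rw [← map_mul, ← map_mul] at h1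
      have h2 : (p : CharAlg S) * chi (E i) = chi (dom (X.q g')) * chi (E i) :=
        congrArg Subtype.val (X.ι_injective h1)
      have h3 : chi (dom (X.q g')) * chi (E i) = chi (E i) := chi_mul _ _ _ (h.1 i).symm
      rw [sub_mul, mul_assoc, h3, h2, h3, sub_self]
  have h4 : p * chiP (dom (X.q g')) = chiP (dom (X.q g')) := Subtype.ext (sub_eq_zero.1 h0)
  have h5 : g' * dag g' = g * dag g := q_injOn X (idem_mul_dag _) (idem_mul_dag _) (by
    rw [map_mul, map_mul, map_dag, map_dag, hq])
  calc g = g' * (dag g' * g) := by rw [← mul_assoc, h5, mul_dag_mul]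
    _ = g' * (dag g' * g * X.ι (chiP (dom (X.q g')))) := by
        rw [← hq, mul_assoc (dag g'), mul_ι_dom]
    _ = g' := by rw [← hp, ← map_mul, h4, mul_ι_dom]

theorem exists_glue {ι : Type*} {E : ι → Idem S} (hdisj : ∀ i k, i ≠ k → (E i * E k : S) = 0)
    {t : S} (hE : IsSup E (dom t)) (ℓ : ι → G) (hℓ : ∀ i, X.q (ℓ i) * (E i : S) = t * E i) :
    ∃ g : G, X.q g = t ∧ ∀ i, g * X.ι (chiP (E i)) = ℓ i * X.ι (chiP (E i)) := by
  obtain ⟨g₀, hg₀⟩ := X.q_surjective t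
  have hdom : ∀ i, dom (t * (E i : S)) = E i := fun i => Subtype.ext (by
    change dag (t * (E i : S)) * (t * E i) = E i
    rw [dag_mul, dag_idem (E i).2]
    calc (E i : S) * dag t * (t * E i) = E i * (dom t * E i) := by
          change _ = (E i : S) * (dag t * t * E i)
          simp only [mul_assoc]
      _ = E i := by rw [hE.1, (E i).2.eq])
  have hp : ∀ i, ∃ p : partialIsometries S,
      ℓ i * X.ι (chiP (E i)) = g₀ * X.ι (chiP (E i)) * X.ι p := fun i =>
    exists_lam_eq_mul (by rw [map_mul, map_mul, X.q_ι_chiP, hg₀, hℓ])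
  choose p hp using hp
  have hmod : ∀ i, star (p i : CharAlg S) * p i * chi (E i) = chi (E i) := fun i => by
    have h1 : dag (ℓ i * X.ι (chiP (E i))) * (ℓ i * X.ι (chiP (E i))) = X.ι (chiP (E i)) := by
      rw [dag_mul_self_eq_ι X, map_mul, X.q_ι_chiP, hℓ, hdom]
    have h2 : dag (g₀ * X.ι (chiP (E i))) * (g₀ * X.ι (chiP (E i))) = X.ι (chiP (E i)) := by
      rw [dag_mul_self_eq_ι X, map_mul, X.q_ι_chiP, hg₀, hdom]
    rw [hp, dag_mul, mul_assoc, ← mul_assoc (dag (g₀ * _)), h2, ← ι_star, ← map_mul,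
      ← map_mul] at h1
    have h3 : star (p i : CharAlg S) * (chi (E i) * p i) = chi (E i) :=
      congrArg Subtype.val (X.ι_injective h1)
    rw [mul_assoc, mul_comm _ (chi (E i)), h3]
  have hnorm : ∀ (i) (ρ : Character S), ‖(p i : CharAlg S) ρ‖ ≤ 1 := fun i ρ => by
    have h1 : (p i : CharAlg S) * star (p i : CharAlg S) * p i = p i := (p i).2
    have h2 : (p i : CharAlg S) ρ * star ((p i : CharAlg S) ρ) * (p i : CharAlg S) ρ =
      (p i : CharAlg S) ρ := congrArg (fun k : CharAlg S => k ρ) h1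
    have h3 := congrArg norm h2
    rw [norm_mul, norm_mul, norm_star] at h3
    have := norm_nonneg ((p i : CharAlg S) ρ)
    nlinarith [sq_nonneg (‖(p i : CharAlg S) ρ‖ - 1)]
  let c : ι → C(Character S, ℝ) := fun i => rePart (chi (E i))
  have hc : ∀ i ρ, c i ρ = if ρ (E i) then 1 else 0 := fun i ρ => by
    change (chi (E i) ρ).re = _
    rw [chi_apply]; split_ifs <;> rfl
  have hcc : ∀ i, c i * c i = c i := fun i => by
    ext ρ; rw [ContinuousMap.mul_apply, hc]; split_ifs <;> norm_num
  have hck : ∀ i k, i ≠ k → c i * c k = 0 := fun i k hik => by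
    ext ρ
    have h1 := ρ.2.2.2.1 (E i) (E k) ⟨0, zero_mul 0⟩ (hdisj i k hik).symm
    rw [ρ.2.1 _ rfl] at h1
    rw [ContinuousMap.mul_apply, hc, hc, ContinuousMap.zero_apply]
    change (if ρ.1 (E i) = true then (1 : ℝ) else 0) * (if ρ.1 (E k) = true then 1 else 0) = 0
    revert h1
    cases ρ.1 (E i) <;> cases ρ.1 (E k) <;> simp
  have patch : ∀ f : ι → C(Character S, ℝ), (∀ i ρ, |f i ρ| ≤ 1) →
      ∃ g : C(Character S, ℝ), ∀ i, g * c i = f i * c i := fun f hf => by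
    obtain ⟨g, -, hg⟩ := exists_patch c f zero_le_one hcc hf fun i k => by
      by_cases hik : i = k
      · rw [hik]
      · rw [hck i k hik, mul_zero, mul_zero]
    exact ⟨g, hg⟩
  obtain ⟨a, ha⟩ := patch (fun i => rePart (p i : CharAlg S)) fun i ρ =>
    (Complex.abs_re_le_norm _).trans (hnorm i ρ)
  obtain ⟨b, hb⟩ := patch (fun i => imPart (p i : CharAlg S)) fun i ρ =>
    (Complex.abs_im_le_norm _).trans (hnorm i ρ)
  let r : CharAlg S := complexify a + Complex.I • complexify b
  have hcE : ∀ i, complexify (c i) = chi (E i) := fun i => by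
    ext ρ
    rw [complexify_apply, hc, chi_apply]; split_ifs <;> simp
  have hr : ∀ i, r * chi (E i) = p i * chi (E i) := fun i => by
    rw [← hcE, add_mul, smul_mul_assoc, ← complexify_mul, ← complexify_mul, ha, hb, complexify_mul,
      complexify_mul, ← smul_mul_assoc, ← add_mul, complexify_re_add_im]
  have hunit : star r * r * chi (dom t) = chi (dom t) := by
    rw [← sub_eq_zero]
    refine hE.eq_zero X ?_ fun i => ?_
    · rw [sub_mul, mul_assoc, chi_mul_self]
    · have h3 : chi (dom t) * chi (E i) = chi (E i) := chi_mul _ _ _ (hE.1 i).symm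
      have h4 : star r * chi (E i) = star (p i : CharAlg S) * chi (E i) := by
        have := congrArg star (hr i)
        simpa only [star_mul', star_chi] using this
      rw [sub_mul, mul_assoc, h3, mul_assoc, hr, mul_left_comm, h4, ← mul_assoc, mul_comm (p i : CharAlg S),
        hmod, sub_self]
  let r' : partialIsometries S := ⟨r * chi (dom t), by
    change r * chi (dom t) * star (r * chi (dom t)) * (r * chi (dom t)) = r * chi (dom t)
    rw [star_mul', star_chi]
    calc r * chi (dom t) * (star r * chi (dom t)) * (r * chi (dom t))
        = (star r * r * chi (dom t)) * (chi (dom t) * chi (dom t)) * r := by ring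
      _ = _ := by rw [hunit, chi_mul_self, chi_mul_self, mul_comm]⟩
  have hqr : X.q (X.ι r') = dom t := by
    have hx : IsIdempotentElem (X.q (X.ι r')) := (X.isIdempotentElem_q_iff _).2 ⟨r', rfl⟩
    have h1 : dag (X.ι r') * X.ι r' = X.ι (chiP (dom t)) := by
      rw [← ι_star, ← map_mul]
      refine congrArg _ (Subtype.ext ?_)
      change star (r * chi (dom t)) * (r * chi (dom t)) = chi (dom t)
      rw [star_mul', star_chi]
      calc star r * chi (dom t) * (r * chi (dom t))
          = star r * r * chi (dom t) * chi (dom t) := by ring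
        _ = _ := by rw [hunit, chi_mul_self]
    have h2 := congrArg X.q h1
    rwa [map_mul, map_dag, dag_idem hx, hx.eq, X.q_ι_chiP] at h2
  refine ⟨g₀ * X.ι r', by rw [map_mul, hg₀, hqr, mul_dom], fun i => ?_⟩
  rw [hp, mul_assoc, mul_assoc, ← map_mul, ← map_mul]
  congr 2
  apply Subtype.ext
  change r * chi (dom t) * chi (E i) = chi (E i) * p i
  have h3 : chi (dom t) * chi (E i) = chi (E i) := chi_mul _ _ _ (hE.1 i).symm
  rw [mul_assoc, h3, hr, mul_comm]

variable (X)

/-- Every extension has an order preserving section. -/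
theorem exists_orderSection : Nonempty (OrderSection X) := by
  classical
  obtain ⟨C, h1C, -, hCp, hmax⟩ := exists_maximal_pairwise
    (fun s t : S => (fixIdem s t : S) = 0) Set.univ {1} (Set.subset_univ _)
    (Set.pairwise_singleton _ _)
  have hone : (1 : S) ∈ C := h1C rfl
  let E : S → C → Idem S := fun t s => fixIdem (s : S) t
  have hdisj : ∀ t i k, i ≠ k → (E t i * E t k : S) = 0 := fun t i k hik => by
    have h1 := fixIdem_trans (i : S) t k
    rw [hCp i.2 k.2 (fun h => hik (Subtype.ext h)), zero_mul, fixIdem_comm t] at h1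
    exact h1
  have hfix : ∀ s t : S, (dom t * fixIdem s t : S) = fixIdem s t := fun s t => by
    rw [fixIdem_comm]
    have h1 := fixIdem_mul_idem t s (dom t)
    rw [mul_dom] at h1
    rw [idem_comm (dom t).2 (fixIdem t s).2, ← h1]
  have hself : ∀ t : S, fixIdem t t = dom t := fun t => Subtype.ext
    (natLE_antisymm (fixIdem_isMeet t t).1 ((fixIdem_isMeet t t).2.2 _
      ⟨dag t * t, idem_dag_mul t, (idem_dag_mul t).eq.symm⟩ (natLE_one (idem_dag_mul t))))
  have hsup : ∀ t, IsSup (E t) (dom t) := fun t => by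
    refine ⟨fun i => hfix _ _, fun y hy hyE => ?_⟩
    have h1 : t * (y : S) ∈ C := hmax _ (Set.mem_univ _) fun c hc _ => by
      have h2 : (fixIdem (t * y) c : S) = 0 := by
        rw [fixIdem_mul_idem, fixIdem_comm, idem_comm (fixIdem c t).2 y.2]
        exact hyE ⟨c, hc⟩
      exact ⟨h2, by rw [fixIdem_comm]; exact h2⟩
    have h3 := hyE ⟨_, h1⟩
    change (y * fixIdem (t * y) t : S) = 0 at h3
    rwa [fixIdem_mul_idem, hself, hy, y.2.eq] at h3
  choose ℓ₀ hℓ₀ using X.q_surjective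
  let ℓ : S → G := fun s => if s = 1 then X.ι 1 else ℓ₀ s
  have hℓ : ∀ s, X.q (ℓ s) = s := fun s => by
    change X.q (if s = 1 then X.ι 1 else ℓ₀ s) = s
    split_ifs with h
    · rw [q_ι_one, h]
    · exact hℓ₀ s
  have hglue : ∀ t, ∃ g : G, X.q g = t ∧
      ∀ i : C, g * X.ι (chiP (E t i)) = ℓ i * X.ι (chiP (E t i)) := fun t =>
    exists_glue (hdisj t) (hsup t) (fun i : C => ℓ i) fun i => by
      rw [hℓ]; exact mul_fixIdem _ _
  choose J hJq hJ using hglue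
  have huniq : ∀ t g, X.q g = t →
      (∀ i : C, g * X.ι (chiP (E t i)) = ℓ i * X.ι (chiP (E t i))) → J t = g := fun t g hq h =>
    eq_of_mul_ι_eq (E := E t) ((hJq t).trans hq.symm) (by rw [hq]; exact hsup t)
      fun i => (hJ t i).trans (h i).symm
  have hJ1 : J 1 = X.ι 1 := huniq 1 _ (q_ι_one X) fun i => by
    by_cases hi : (i : S) = 1
    · change _ = (if (i : S) = 1 then X.ι 1 else ℓ₀ i) * _
      rw [if_pos hi]
    · have h1 : (E 1 i : S) = 0 := hCp i.2 hone hi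
      have h2 : chiP (E 1 i) = zeroP S := Subtype.ext (chi_zero _ h1)
      rw [h2, mul_ι_zero, mul_ι_zero]
  refine ⟨⟨J, hJq, fun g => ?_, fun s t hst => ?_⟩⟩
  · rw [hJ1]
    exact ⟨ι_one_mul X g, mul_ι_one X g⟩
  · obtain ⟨e, he, rfl⟩ := hst
    refine ⟨X.ι (chiP ⟨e, he⟩), ?_, huniq _ _ ?_ fun i => ?_⟩
    · rw [IsIdempotentElem, ← map_mul]
      exact congrArg _ (Subtype.ext (chi_mul_self _))
    · rw [map_mul, hJq, X.q_ι_chiP]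
    · have h1 : chiP (E (t * e) i) = chiP (E t i) * chiP ⟨e, he⟩ := Subtype.ext (by
        refine (chi_mul _ _ _ ?_).symm
        change (fixIdem (i : S) (t * e) : S) = fixIdem (i : S) t * e
        rw [fixIdem_comm, fixIdem_comm _ t]
        exact fixIdem_mul_idem t i ⟨e, he⟩)
      have h2 : chiP ⟨e, he⟩ * (chiP (E t i) * chiP ⟨e, he⟩) = chiP (E t i) * chiP ⟨e, he⟩ := by
        apply Subtype.ext
        change chi _ * (chi _ * chi _) = chi _ * chi _
        rw [mul_left_comm, chi_mul_self]
      rw [h1, mul_assoc, ← map_mul, h2, map_mul, ← mul_assoc, hJ, mul_assoc]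

end orderSection

section gns
variable {X : Type*} [TopologicalSpace X]

/-- The complex linear extension of a real functional. -/
noncomputable def cxFun (μ : C(X, ℝ) →ₗ[ℝ] ℝ) : C(X, ℂ) →ₗ[ℂ] ℂ where
  toFun f := μ (rePart f) + Complex.I * μ (imPart f)
  map_add' f g := by
    have h1 : rePart (f + g) = rePart f + rePart g := rfl
    have h2 : imPart (f + g) = imPart f + imPart g := rfl
    rw [h1, h2, map_add, map_add]; push_cast; ring
  map_smul' c f := by
    have h1 : rePart (c • f) = c.re • rePart f - c.im • imPart f := by
      ext x; exact Complex.mul_re _ _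
    have h2 : imPart (c • f) = c.re • imPart f + c.im • rePart f := by
      ext x; exact Complex.mul_im _ _
    rw [h1, h2, map_sub, map_add, map_smul, map_smul, map_smul, map_smul]
    simp only [smul_eq_mul, RingHom.id_apply]
    conv_rhs => rw [← Complex.re_add_im c]
    push_cast
    linear_combination (-(μ (imPart f) : ℂ) * c.im) * Complex.I_sq

theorem cxFun_complexify (μ : C(X, ℝ) →ₗ[ℝ] ℝ) (f : C(X, ℝ)) : cxFun μ (complexify f) = μ f := by
  have h1 : rePart (complexify f) = f := by ext; rfl
  have h2 : imPart (complexify f) = 0 := by ext; rfl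
  change (μ (rePart (complexify f)) : ℂ) + Complex.I * μ (imPart (complexify f)) = _
  rw [h1, h2, map_zero, Complex.ofReal_zero, mul_zero, add_zero]

theorem cxFun_star (μ : C(X, ℝ) →ₗ[ℝ] ℝ) (f : C(X, ℂ)) :
    cxFun μ (star f) = (starRingEnd ℂ) (cxFun μ f) := by
  have h1 : rePart (star f) = rePart f := by ext; rfl
  have h2 : imPart (star f) = -imPart f := by ext; rfl
  change (μ (rePart (star f)) : ℂ) + Complex.I * μ (imPart (star f)) =
    (starRingEnd ℂ) (μ (rePart f) + Complex.I * μ (imPart f))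
  rw [h1, h2, map_neg, map_add, map_mul, Complex.conj_ofReal, Complex.conj_ofReal, Complex.conj_I]
  push_cast; ring

/-- The function `|f|²`. -/
noncomputable def normSq (f : C(X, ℂ)) : C(X, ℝ) := ⟨fun x => ‖f x‖ ^ 2, by fun_prop⟩

theorem star_mul_eq_normSq (f : C(X, ℂ)) : star f * f = complexify (normSq f) := by
  ext x
  change (starRingEnd ℂ) (f x) * f x = ((‖f x‖ ^ 2 : ℝ) : ℂ)
  rw [Complex.conj_mul']; push_cast; rfl

/-- Positive normal functionals on `C(X)`. -/
def NormalFunctional (X : Type*) [TopologicalSpace X] : Type _ :=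
  {μ : C(X, ℝ) →ₗ[ℝ] ℝ // (∀ g, 0 ≤ g → 0 ≤ μ g) ∧
    ∀ (F : Set C(X, ℝ)) (g : C(X, ℝ)), F.Nonempty → DirectedOn (· ≤ ·) F → IsLUB F g →
      IsLUB (μ '' F) (μ g)}

/-- The vector space of finitely supported families of functions, indexed by the positive normal
functionals. -/
def PreGNS (X : Type*) [TopologicalSpace X] : Type _ := NormalFunctional X →₀ C(X, ℂ)

noncomputable instance : AddCommGroup (PreGNS X) :=
  inferInstanceAs (AddCommGroup (NormalFunctional X →₀ C(X, ℂ)))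

noncomputable instance : Module ℂ (PreGNS X) :=
  inferInstanceAs (Module ℂ (NormalFunctional X →₀ C(X, ℂ)))

/-- The component of a family. -/
noncomputable def PreGNS.comp (x : PreGNS X) (μ : NormalFunctional X) : C(X, ℂ) :=
  DFunLike.coe (F := NormalFunctional X →₀ C(X, ℂ)) x μ

/-- The support of a family. -/
noncomputable def PreGNS.supp (x : PreGNS X) : Finset (NormalFunctional X) :=
  Finsupp.support (M := C(X, ℂ)) x

theorem PreGNS.ext {x y : PreGNS X} (h : ∀ μ, x.comp μ = y.comp μ) : x = y := Finsupp.ext h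

theorem PreGNS.comp_add (x y : PreGNS X) (μ : NormalFunctional X) :
    (x + y).comp μ = x.comp μ + y.comp μ := rfl

theorem PreGNS.comp_smul (c : ℂ) (x : PreGNS X) (μ : NormalFunctional X) :
    (c • x).comp μ = c • x.comp μ := rfl

theorem PreGNS.mem_supp {x : PreGNS X} {μ : NormalFunctional X} : μ ∈ x.supp ↔ x.comp μ ≠ 0 :=
  Finsupp.mem_support_iff

/-- The form `∑ φ(a_φ^* b_φ)`. -/
noncomputable def gnsInner (x y : PreGNS X) : ℂ :=
  ∑ μ ∈ x.supp, cxFun μ.1 (star (x.comp μ) * y.comp μ)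

theorem gnsInner_eq_sum (x y : PreGNS X) (A : Finset (NormalFunctional X))
    (hA : ∀ μ, x.comp μ ≠ 0 → μ ∈ A) :
    gnsInner x y = ∑ μ ∈ A, cxFun μ.1 (star (x.comp μ) * y.comp μ) := by
  refine Finset.sum_subset (fun μ hμ => hA μ (PreGNS.mem_supp.1 hμ)) fun μ _ hμ => ?_
  rw [PreGNS.mem_supp, not_not] at hμ
  rw [hμ, star_zero, zero_mul, map_zero]

noncomputable instance gnsCore : PreInnerProductSpace.Core ℂ (PreGNS X) where
  inner x y := gnsInner x y
  conj_inner_symm x y := by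
    classical
    change (starRingEnd ℂ) (gnsInner y x) = gnsInner x y
    rw [gnsInner_eq_sum x y (x.supp ∪ y.supp)
        fun μ hμ => Finset.mem_union_left _ (PreGNS.mem_supp.2 hμ),
      gnsInner_eq_sum y x (x.supp ∪ y.supp)
        fun μ hμ => Finset.mem_union_right _ (PreGNS.mem_supp.2 hμ), map_sum]
    refine Finset.sum_congr rfl fun μ _ => ?_
    rw [← cxFun_star, star_mul, star_star]
  add_left x y z := by
    classical
    change gnsInner (x + y) z = gnsInner x z + gnsInner y z
    rw [gnsInner_eq_sum (x + y) z (x.supp ∪ y.supp) fun μ hμ => ?_,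
      gnsInner_eq_sum x z (x.supp ∪ y.supp)
        fun μ hμ => Finset.mem_union_left _ (PreGNS.mem_supp.2 hμ),
      gnsInner_eq_sum y z (x.supp ∪ y.supp)
        fun μ hμ => Finset.mem_union_right _ (PreGNS.mem_supp.2 hμ),
      ← Finset.sum_add_distrib]
    · refine Finset.sum_congr rfl fun μ _ => ?_
      rw [PreGNS.comp_add, star_add, add_mul, map_add]
    · rw [Finset.mem_union, PreGNS.mem_supp, PreGNS.mem_supp]
      by_contra! h
      exact hμ (by rw [PreGNS.comp_add, h.1, h.2, add_zero])
  smul_left x y c := by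
    change gnsInner (c • x) y = (starRingEnd ℂ) c * gnsInner x y
    rw [gnsInner_eq_sum (c • x) y x.supp fun μ hμ => PreGNS.mem_supp.2 fun h =>
        hμ (by rw [PreGNS.comp_smul, h]; exact smul_zero (A := C(X, ℂ)) c),
      gnsInner, Finset.mul_sum]
    refine Finset.sum_congr rfl fun μ _ => ?_
    rw [PreGNS.comp_smul, star_smul, smul_mul_assoc, map_smul]; rfl
  re_inner_nonneg x := by
    change 0 ≤ (gnsInner x x).re
    rw [gnsInner, Complex.re_sum]
    refine Finset.sum_nonneg fun μ _ => ?_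
    rw [star_mul_eq_normSq, cxFun_complexify, Complex.ofReal_re]
    exact μ.2.1 _ fun ρ => sq_nonneg _

noncomputable instance : SeminormedAddCommGroup (PreGNS X) :=
  InnerProductSpace.Core.toSeminormedAddCommGroup (𝕜 := ℂ)

noncomputable instance : InnerProductSpace ℂ (PreGNS X) := .ofCore _

theorem inner_preGNS (x y : PreGNS X) : inner ℂ x y = gnsInner x y := rfl

/-- Multiplication by a function. -/
noncomputable def gnsMul (f : C(X, ℂ)) : PreGNS X →ₗ[ℂ] PreGNS X :=
  Finsupp.mapRange.linearMap (LinearMap.mulLeft ℂ f)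

theorem gnsMul_apply (f : C(X, ℂ)) (x : PreGNS X) (μ : NormalFunctional X) :
    (gnsMul f x).comp μ = f * x.comp μ := rfl

theorem gnsMul_mul (f g : C(X, ℂ)) (x : PreGNS X) : gnsMul (f * g) x = gnsMul f (gnsMul g x) :=
  PreGNS.ext fun μ => by rw [gnsMul_apply, gnsMul_apply, gnsMul_apply, mul_assoc]

theorem gnsMul_add (f g : C(X, ℂ)) (x : PreGNS X) : gnsMul (f + g) x = gnsMul f x + gnsMul g x :=
  PreGNS.ext fun μ => by
    rw [gnsMul_apply, PreGNS.comp_add, gnsMul_apply, gnsMul_apply, add_mul]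

theorem gnsMul_smul_one (c : ℂ) (x : PreGNS X) : gnsMul (c • (1 : C(X, ℂ))) x = c • x :=
  PreGNS.ext fun μ => by rw [gnsMul_apply, PreGNS.comp_smul, smul_mul_assoc, one_mul]

theorem inner_gnsMul_right (f : C(X, ℂ)) (x y : PreGNS X) :
    inner ℂ x (gnsMul f y) = inner ℂ (gnsMul (star f) x) y := by
  rw [inner_preGNS, inner_preGNS, gnsInner,
    gnsInner_eq_sum (gnsMul (star f) x) y x.supp fun μ hμ => PreGNS.mem_supp.2 fun h =>
      hμ (by rw [gnsMul_apply, h, mul_zero])]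
  refine Finset.sum_congr rfl fun μ _ => ?_
  rw [gnsMul_apply, gnsMul_apply, star_mul, star_star]
  congr 1; ring

variable [CompactSpace X]

theorem norm_gnsMul_le (f : C(X, ℂ)) (x : PreGNS X) : ‖gnsMul f x‖ ≤ ‖f‖ * ‖x‖ := by
  let g : C(X, ℂ) := complexify ⟨fun ρ => √(‖f‖ ^ 2 - ‖f ρ‖ ^ 2), by fun_prop⟩
  have hfg : star f * f + star g * g = ((‖f‖ ^ 2 : ℝ) : ℂ) • (1 : C(X, ℂ)) := by
    rw [star_mul_eq_normSq, star_mul_eq_normSq, ← complexify_add, ← complexify_one,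
      ← complexify_smul]
    congr 1
    ext ρ
    have h1 : (0 : ℝ) ≤ ‖f‖ ^ 2 - ‖f ρ‖ ^ 2 := by
      have := f.norm_coe_le_norm ρ
      have := norm_nonneg (f ρ)
      nlinarith
    change ‖f ρ‖ ^ 2 + ‖((√(‖f‖ ^ 2 - ‖f ρ‖ ^ 2) : ℝ) : ℂ)‖ ^ 2 = ‖f‖ ^ 2 * 1
    rw [Complex.norm_real, Real.norm_eq_abs, sq_abs, Real.sq_sqrt h1]
    ring
  have h : inner ℂ x (gnsMul (star f * f + star g * g) x) =
      inner ℂ (gnsMul f x) (gnsMul f x) + inner ℂ (gnsMul g x) (gnsMul g x) := by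
    rw [gnsMul_add, inner_add_right, gnsMul_mul, gnsMul_mul, inner_gnsMul_right (star f),
      inner_gnsMul_right (star g), star_star, star_star]
  rw [hfg, gnsMul_smul_one, inner_smul_right] at h
  have h' := congrArg Complex.re h
  rw [Complex.re_ofReal_mul, Complex.add_re] at h'
  have e1 := inner_self_eq_norm_sq (𝕜 := ℂ) x
  have e2 := inner_self_eq_norm_sq (𝕜 := ℂ) (gnsMul f x)
  have e3 := inner_self_eq_norm_sq (𝕜 := ℂ) (gnsMul g x)
  simp only [RCLike.re_to_complex] at e1 e2 e3
  rw [e1, e2, e3] at h'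
  refine abs_le_of_sq_le_sq' ?_ (by positivity) |>.2
  rw [mul_pow, h']
  exact le_add_of_nonneg_right (sq_nonneg _)

/-- Multiplication by a function on the completion. -/
noncomputable def gnsOpr (f : C(X, ℂ)) :
    UniformSpace.Completion (PreGNS X) →L[ℂ] UniformSpace.Completion (PreGNS X) :=
  ((gnsMul f).mkContinuous ‖f‖ (norm_gnsMul_le f)).completion

theorem gnsOpr_coe (f : C(X, ℂ)) (x : PreGNS X) :
    gnsOpr f (x : UniformSpace.Completion (PreGNS X)) = (gnsMul f x : PreGNS X) := by
  unfold gnsOpr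
  rw [ContinuousLinearMap.completion_apply_coe, LinearMap.mkContinuous_apply]

theorem gns_ext {S T : UniformSpace.Completion (PreGNS X) →L[ℂ] UniformSpace.Completion (PreGNS X)}
    (h : ∀ x : PreGNS X, S x = T x) : S = T :=
  ContinuousLinearMap.ext fun z => UniformSpace.Completion.induction_on z
    (isClosed_eq S.continuous T.continuous) h

variable (X) in
/-- The direct sum of the representations given by the positive normal functionals. -/
noncomputable def gnsRep : C(X, ℂ) →⋆ₐ[ℂ]
    (UniformSpace.Completion (PreGNS X) →L[ℂ] UniformSpace.Completion (PreGNS X)) where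
  toFun := gnsOpr
  map_one' := gns_ext fun x => by
    rw [gnsOpr_coe, ← one_smul ℂ (1 : C(X, ℂ)), gnsMul_smul_one, one_smul]; rfl
  map_mul' f g := gns_ext fun x => by
    rw [mul_apply_eq_comp, gnsOpr_coe, gnsOpr_coe, gnsOpr_coe, gnsMul_mul]
  map_zero' := gns_ext fun x => by
    rw [gnsOpr_coe, ← zero_smul ℂ (1 : C(X, ℂ)), gnsMul_smul_one, zero_smul]; rfl
  map_add' f g := gns_ext fun x => by
    rw [add_apply, gnsOpr_coe, gnsOpr_coe, gnsOpr_coe, gnsMul_add, UniformSpace.Completion.coe_add]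
  commutes' c := gns_ext fun x => by
    rw [Algebra.algebraMap_eq_smul_one, Algebra.algebraMap_eq_smul_one, gnsOpr_coe,
      gnsMul_smul_one, UniformSpace.Completion.coe_smul]; rfl
  map_star' f := by
    refine gns_ext fun x => ext_inner_left ℂ fun v => UniformSpace.Completion.induction_on v
      (isClosed_eq (by fun_prop) (by fun_prop)) fun y => ?_
    rw [inner_star_right, gnsOpr_coe, gnsOpr_coe, UniformSpace.Completion.inner_coe,
      UniformSpace.Completion.inner_coe, inner_gnsMul_right, star_star]

theorem gnsRep_coe (f : C(X, ℂ)) (x : PreGNS X) :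
    gnsRep X f (x : UniformSpace.Completion (PreGNS X)) = (gnsMul f x : PreGNS X) := gnsOpr_coe f x

theorem re_inner_gnsMul (x : PreGNS X) (f : C(X, ℝ)) :
    (inner ℂ x (gnsMul (complexify f) x)).re =
      ∑ μ ∈ x.supp, μ.1 (normSq (x.comp μ) * f) := by
  rw [inner_preGNS, gnsInner, Complex.re_sum]
  refine Finset.sum_congr rfl fun μ _ => ?_
  rw [gnsMul_apply, mul_left_comm, star_mul_eq_normSq, mul_comm, ← complexify_mul, cxFun_complexify,
    Complex.ofReal_re]

theorem exists_lt_of_normal (μ : NormalFunctional X) {F : Set C(X, ℝ)} {f : C(X, ℝ)}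
    (hne : F.Nonempty) (hd : DirectedOn (· ≤ ·) F) (hf : IsLUB F f) {ε : ℝ} (hε : 0 < ε) :
    ∃ y ∈ F, ∀ z ∈ F, y ≤ z → μ.1 (f - z) < ε := by
  have h := μ.2.2 F f hne hd hf
  by_contra! hcon
  have h1 : μ.1 f ≤ μ.1 f - ε := h.2 (by
    rintro _ ⟨y, hy, rfl⟩
    obtain ⟨z, hz, hyz, h2⟩ := hcon y hy
    have h3 := μ.2.1 (z - y) (sub_nonneg.2 hyz)
    rw [map_sub] at h2 h3
    linarith)
  linarith

theorem exists_sum_lt {F : Set C(X, ℝ)} {f : C(X, ℝ)} (hne : F.Nonempty)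
    (hd : DirectedOn (· ≤ ·) F) (hf : IsLUB F f) (c : NormalFunctional X → ℝ)
    (A : Finset (NormalFunctional X)) : (∀ μ, 0 ≤ c μ) → ∀ {ε : ℝ}, 0 < ε →
    ∃ y ∈ F, ∀ z ∈ F, y ≤ z → ∑ μ ∈ A, c μ * μ.1 (f - z) < ε := by
  classical
  intro hc
  induction A using Finset.induction_on with
  | empty => intro ε hε; obtain ⟨y, hy⟩ := hne; exact ⟨y, hy, fun z _ _ => by simpa using hε⟩
  | insert μ A hμ ih =>
    intro ε hε
    obtain ⟨y, hy, h1⟩ := ih (half_pos hε)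
    have hδ : 0 < ε / 2 / (c μ + 1) := div_pos (half_pos hε) (by linarith [hc μ])
    obtain ⟨y', hy', h2⟩ := exists_lt_of_normal μ hne hd hf hδ
    obtain ⟨w, hw, h3, h4⟩ := hd y hy y' hy'
    refine ⟨w, hw, fun z hz hwz => ?_⟩
    rw [Finset.sum_insert hμ]
    have h5 := h1 z hz (h3.trans hwz)
    have h6 := h2 z hz (h4.trans hwz)
    have h7 := μ.2.1 (f - z) (sub_nonneg.2 (hf.1 hz))
    rw [lt_div_iff₀ (by linarith [hc μ])] at h6
    nlinarith [hc μ]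

theorem gnsRep_isNormalHom : IsNormalHom (gnsRep X) := by
  intro F f hne hd hf
  have hmono : ∀ {y z : C(X, ℝ)}, y ≤ z →
    gnsRep X (complexify y) ≤ gnsRep X (complexify z) := fun h => map_complexify_mono _ h
  have hd' : DirectedOn (· ≤ ·) ((fun g => gnsRep X (complexify g)) '' F) := by
    rintro _ ⟨y, hy, rfl⟩ _ ⟨z, hz, rfl⟩
    obtain ⟨w, hw, h1, h2⟩ := hd y hy z hz
    exact ⟨_, ⟨w, hw, rfl⟩, hmono h1, hmono h2⟩
  obtain ⟨T, hT, -⟩ := exists_wTendsto_of_directed (hne.image _) hd' (z := gnsRep X (complexify f))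
    (by rintro _ ⟨y, hy, rfl⟩; exact hmono (hf.1 hy))
  have hle : T ≤ gnsRep X (complexify f) :=
    hT.2 (by rintro _ ⟨y, hy, rfl⟩; exact hmono (hf.1 hy))
  have h0 : 0 ≤ gnsRep X (complexify f) - T := sub_nonneg.2 hle
  have key : gnsRep X (complexify f) - T = 0 := gns_ext fun x => by
    rw [zero_apply]
    refine apply_eq_zero_of_re_inner h0 (le_antisymm ?_ ?_)
    · refine le_of_forall_pos_lt_add fun ε hε => ?_
      rw [zero_add]
      obtain ⟨y, hy, h2⟩ := exists_sum_lt hne hd hf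
        (fun μ => ‖x.comp μ‖ ^ 2) x.supp
        (fun μ => sq_nonneg _) hε
      refine lt_of_le_of_lt ?_ (h2 y hy le_rfl)
      have h3 : gnsRep X (complexify f) - T ≤ gnsRep X (complexify f) - gnsRep X (complexify y) :=
        sub_le_sub_left (hT.1 ⟨y, hy, rfl⟩) _
      have h4 := (Complex.le_def.1 (le_iff_inner.1 h3 x)).1
      rw [sub_apply, inner_sub_right, Complex.sub_re, Complex.zero_re, sub_nonneg] at h4
      refine h4.trans ?_
      rw [← map_sub, ← complexify_sub, gnsRep_coe, UniformSpace.Completion.inner_coe,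
        re_inner_gnsMul]
      refine Finset.sum_le_sum fun μ _ => ?_
      have h7 := μ.2.1 (‖x.comp μ‖ ^ 2 • (f - y) - normSq (x.comp μ) * (f - y)) fun ρ => by
        change 0 ≤ ‖x.comp μ‖ ^ 2 * (f ρ - y ρ) - ‖x.comp μ ρ‖ ^ 2 * (f ρ - y ρ)
        have h5 : y ρ ≤ f ρ := hf.1 hy ρ
        have h6 := (x.comp μ).norm_coe_le_norm ρ
        rw [← sub_mul]
        refine mul_nonneg (sub_nonneg.2 ?_) (sub_nonneg.2 h5)
        gcongr
      rwa [map_sub, map_smul, smul_eq_mul, sub_nonneg] at h7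
    · have := (Complex.le_def.1 (le_iff_inner.1 h0 x)).1
      rwa [sub_zero] at this
  rw [sub_eq_zero] at key
  rwa [key]

theorem gnsRep_injective (hX : IsHyperstonean X) : Function.Injective (gnsRep X) := by
  rw [injective_iff_map_eq_zero]
  intro f hf
  by_contra hne
  have h1 : normSq f ≠ 0 := fun h => hne (by
    ext ρ
    have := congrArg (fun k : C(X, ℝ) => k ρ) h
    change ‖f ρ‖ ^ 2 = 0 at this
    rw [sq_eq_zero_iff, norm_eq_zero] at this
    rw [this]; rfl)
  obtain ⟨μ, hμ, hn, hμf⟩ := hX.2.2.2 (normSq f) (fun ρ => sq_nonneg _) h1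
  let ν₀ : NormalFunctional X := ⟨μ, hμ, hn⟩
  let x : PreGNS X := Finsupp.single ν₀ 1
  have h2 : gnsRep X (star f * f) (x : UniformSpace.Completion (PreGNS X)) = 0 := by
    rw [map_mul, hf, mul_zero]; rfl
  have h3 := congrArg (fun z => inner ℂ (x : UniformSpace.Completion (PreGNS X)) z) h2
  simp only [inner_zero_right] at h3
  rw [gnsRep_coe, UniformSpace.Completion.inner_coe, inner_preGNS] at h3
  have h4 : gnsInner x (gnsMul (star f * f) x) = cxFun μ (star f * f) := by
    have hx : x.comp ν₀ = 1 := Finsupp.single_eq_same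
    rw [gnsInner_eq_sum x _ ({ν₀} : Finset (NormalFunctional X)) fun ν hν => ?_]
    · refine (Finset.sum_singleton _ _).trans ?_
      rw [gnsMul_apply, hx, star_one, one_mul, mul_one]
    · rw [Finset.mem_singleton]
      by_contra h
      exact hν (Finsupp.single_eq_of_ne h)
  rw [h4, star_mul_eq_normSq, cxFun_complexify, Complex.ofReal_eq_zero] at h3
  exact hμf h3

end gns

/-- Faithful normal representations exist. -/
theorem exists_faithfulNormalRep (S : Type*) [MonoidWithZero S] [IsCartanInverseMonoid S] :
    Nonempty (FaithfulNormalRep S (UniformSpace.Completion (PreGNS (Character S)))) :=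
  ⟨⟨gnsRep (Character S), gnsRep_injective IsCartanInverseMonoid.hyperstonean, gnsRep_isNormalHom⟩⟩

/-- The extension for a Cartan pair. -/
noncomputable def CartanPair.extension (P : CartanPair.{u}) :
    Extension (MunnQuotient (GN P.isCartanPair)) (GN P.isCartanPair) :=
  (exists_isExtensionOf P.isCartanPair).choose

theorem CartanPair.isExtensionOf (P : CartanPair.{u}) : IsExtensionOf P.isCartanPair P.extension :=
  (exists_isExtensionOf P.isCartanPair).choose_spec

/-- The extension for a Cartan pair, as a bundled extension. -/
noncomputable def CartanPair.toCartanExtension (P : CartanPair.{u}) : CartanExtension.{u} :=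
  haveI := munn_cartan P.isCartanPair
  CartanExtension.mk (MunnQuotient (GN P.isCartanPair)) (GN P.isCartanPair) P.extension

/-- The extension for a Cartan pair, on isomorphism classes. -/
noncomputable def extensionClass :
    Quotient cartanPairSetoid.{u} → Quotient cartanExtensionSetoid.{u} :=
  Quotient.map CartanPair.toCartanExtension fun P Q h =>
    extEquiv_of_cartanPairIso P.isExtensionOf Q.isExtensionOf h

theorem extensionClass_injective : Function.Injective extensionClass.{u} := by
  rintro ⟨P⟩ ⟨Q⟩ h
  exact Quotient.sound (cartanPairIso_of_extEquiv P.isExtensionOf Q.isExtensionOf (Quotient.exact h))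

theorem extensionClass_mk (𝒳 : CartanExtension.{u}) (j : OrderSection 𝒳.X) {H : Type u}
    [NormedAddCommGroup H] [InnerProductSpace ℂ H] [CompleteSpace H] (π : FaithfulNormalRep 𝒳.S H) :
    extensionClass ⟦CartanPair.mk (InteriorTensor π.toHom) (algM j π) (algD j π)
      (isCartanPair j π)⟧ = ⟦𝒳⟧ :=
  Quotient.sound (extEquiv_of_isExtensionOf j π (CartanPair.isExtensionOf
    (CartanPair.mk (InteriorTensor π.toHom) (algM j π) (algD j π) (isCartanPair j π)))).symm

theorem extensionClass_surjective : Function.Surjective extensionClass.{u} := by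
  rintro ⟨𝒳⟩
  obtain ⟨j⟩ := exists_orderSection 𝒳.X
  obtain ⟨π⟩ := exists_faithfulNormalRep 𝒳.S
  exact ⟨_, extensionClass_mk 𝒳 j π⟩

end CartanExt

theorem theorem5p11 :
    (∀ {S G H : Type*} [MonoidWithZero S] [IsCartanInverseMonoid S]
      [Semigroup G] [IsInverseSemigroup G]
      [NormedAddCommGroup H] [InnerProductSpace ℂ H] [CompleteSpace H]
      (X : Extension S G) (j : OrderSection X) (π : FaithfulNormalRep S H),
      ∃ h : IsCartanPair (algM j π) (algD j π),
        Set.range (lam j π.toHom) = {v | IsGroupoidNormalizer (algM j π) (algD j π) v} ∧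
        IsCartanInverseMonoid (MunnQuotient (GN h)) ∧
        ∃ Y : Extension (MunnQuotient (GN h)) (GN h), IsExtensionOf h Y ∧ ExtEquiv X Y) ∧
    (∀ {S₁ G₁ H₁ S₂ G₂ H₂ : Type*}
      [MonoidWithZero S₁] [IsCartanInverseMonoid S₁] [Semigroup G₁] [IsInverseSemigroup G₁]
      [NormedAddCommGroup H₁] [InnerProductSpace ℂ H₁] [CompleteSpace H₁]
      [MonoidWithZero S₂] [IsCartanInverseMonoid S₂] [Semigroup G₂] [IsInverseSemigroup G₂]
      [NormedAddCommGroup H₂] [InnerProductSpace ℂ H₂] [CompleteSpace H₂]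
      (X₁ : Extension S₁ G₁) (j₁ : OrderSection X₁) (π₁ : FaithfulNormalRep S₁ H₁)
      (X₂ : Extension S₂ G₂) (j₂ : OrderSection X₂) (π₂ : FaithfulNormalRep S₂ H₂),
      ExtEquiv X₁ X₂ → CartanPairIso (algM j₁ π₁) (algD j₁ π₁) (algM j₂ π₂) (algD j₂ π₂)) ∧
    ∃ Φ : Quotient cartanPairSetoid.{u} ≃ Quotient cartanExtensionSetoid.{u},
      (∀ P : CartanPair.{u},
        ∃ (_ : IsCartanInverseMonoid (MunnQuotient (GN P.isCartanPair)))
          (Y : Extension (MunnQuotient (GN P.isCartanPair)) (GN P.isCartanPair)),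
          IsExtensionOf P.isCartanPair Y ∧
          Φ ⟦P⟧ =
            ⟦CartanExtension.mk (MunnQuotient (GN P.isCartanPair)) (GN P.isCartanPair) Y⟧) ∧
      (∀ (𝒳 : CartanExtension.{u}) (j : OrderSection 𝒳.X) (H : Type u)
        [NormedAddCommGroup H] [InnerProductSpace ℂ H] [CompleteSpace H]
        (π : FaithfulNormalRep 𝒳.S H),
        ∃ h : IsCartanPair (algM j π) (algD j π),
          Φ.symm ⟦𝒳⟧ =
            ⟦CartanPair.mk (InteriorTensor π.toHom) (algM j π) (algD j π) h⟧) ∧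
      (∀ 𝒳 : CartanExtension.{u}, Nonempty (OrderSection 𝒳.X) ∧
        ∃ (H : Type u) (_ : NormedAddCommGroup H) (_ : InnerProductSpace ℂ H)
          (_ : CompleteSpace H), Nonempty (FaithfulNormalRep 𝒳.S H)) := by
  refine ⟨?_, ?_, Equiv.ofBijective _ ⟨extensionClass_injective, extensionClass_surjective⟩,
    ?_, ?_, ?_⟩
  · intro S G H _ _ _ _ _ _ _ X j π
    obtain ⟨Y, hY⟩ := exists_isExtensionOf (isCartanPair j π)
    exact ⟨isCartanPair j π, range_lam j π, munn_cartan _, Y, hY, extEquiv_of_isExtensionOf j π hY⟩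
  · intro S₁ G₁ H₁ S₂ G₂ H₂ _ _ _ _ _ _ _ _ _ _ _ _ _ _ X₁ j₁ π₁ X₂ j₂ π₂ h
    obtain ⟨Y₁, hY₁⟩ := exists_isExtensionOf (isCartanPair j₁ π₁)
    obtain ⟨Y₂, hY₂⟩ := exists_isExtensionOf (isCartanPair j₂ π₂)
    exact cartanPairIso_of_extEquiv hY₁ hY₂ ((extEquiv_of_isExtensionOf j₁ π₁ hY₁).symm.trans
      (h.trans (extEquiv_of_isExtensionOf j₂ π₂ hY₂)))
  · exact fun P => ⟨munn_cartan _, P.extension, P.isExtensionOf, rfl⟩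
  · intro 𝒳 j H _ _ _ π
    refine ⟨isCartanPair j π, ?_⟩
    rw [Equiv.symm_apply_eq]
    exact (extensionClass_mk 𝒳 j π).symm
  · exact fun 𝒳 => ⟨exists_orderSection 𝒳.X,
      _, inferInstance, inferInstance, inferInstance, exists_faithfulNormalRep 𝒳.S⟩
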